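/- **Setting.** Fix $M\ge 0$ and reals $u_0,v_1$ (with $u_0<v_1$ if $M=0$). On the region $u\le u_0$, $v\ge v_1$ of the exterior of the Schwarzschild spacetime of mass $M$ (Minkowski if $M=0$) use double null coordinates, so that the area radius $r=r(u,v)>2M$ is given by $r+2M\log(\tfrac{r}{2M}-1)=v-u$ (and $r=v-u$ if $M=0$); put $\Omega^2=1-\tfrac{2M}{r}$ and $r_0=r_0(u)=r(u,v_1)$. Let $\underline\alpha$ be a smooth field of symmetric trace-free 2-tensors on the spheres $S_{u,v}$, written in orthonormal frames (so that $\nabla_u,\nabla_v$ act on components), solving the Teukolsky equation $$\nabla_u\Big(\frac{r^4}{\Omega^4}\nabla_v(r\Omega^2\underline\alpha)\Big)=r^3(\Delta-2)\underline\alpha-6Mr^2\underline\alpha ,$$ where $\Delta$ is the (rough) Laplacian of the unit sphere. Let $\underline\psi=\frac{r^2}{\Omega^2}\nabla_v(r\Omega^2\underline\alpha)$, $\underline\Psi=\frac{r^2}{\Omega^2}\nabla_v\underline\psi$, and let $T_\ell$ ($\ell\ge2$) be the projection of a symmetric trace-free tensor $T$ on $S^2$ to the span of the electric and magnetic tensor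 spherical harmonics of degree $\ell$. The incoming radiation along $\mathcal I^-$ is $P=P(v)$ if for every $v\ge v_1$, $\nabla_v\underline\Psi\to P$ in $L^2([v_1,v]\times S^2)$ as $u\to-\infty$; there is no incoming radiation on $v\ge v_1$ if $P=0$. We say that $\underline\alpha$ *describes the exterior of a compactly supported gravitational perturbation along $\mathcal I^-$*, with coefficients $\mathscr E_{\ell,p}$ and $\overline{\mathscr A}_\ell$ (tensors on $S^2$, $\ell,p\ge2$), if there is no incoming radiation on $v\ge v_1$, if along the cone $v=v_1$, for all $\ell\ge2$ and $N\ge2$, $$r\underline\alpha_\ell=\sum_{p=2}^N\mathscr E_{\ell,p}\,r_0^{-2-p}+O(r_0^{-3-N})\qquad(u\le u_0),$$ and if $\lim_{u\to-\infty}\underline\Psi_\ell|_{v=v_1}=2\,\overline{\mathscr A}_\ell$ for all $\ell\ge 2$. For real $x$ let $x!=\Gamma(x+1)$, and for integers $0\le n\le j\le \ell-s$ let $$S_{\ell,p,j,n,s}=(-1)^{\ell-s+n}\,\frac{(s+p)!\,(\ell-s)!\,(2\ell-j+n)!}{n!\,(\ell+s)!\,(\ell+p)!}\binom{\ell-p}{j-n},$$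 where $\binom{x}{k}=x(x-1)\cdots(x-k+1)/k!$. All constants implied by $O(\cdot)$ below may depend on the solution, on $\ell$ and on $N$, and the bounds are uniform in $u\le u_0$ and on $S^2$. **Theorem.** 1. *(Minkowski.)* Let $M=0$ and let $\underline\alpha$ describe the exterior of a compactly supported gravitational perturbation, with coefficients $\mathscr E_{\ell,p}$, $\overline{\mathscr A}_\ell$. For every $\ell\ge2$ and $u\le u_0$ the limit $\lim_{v\to\infty}r\underline\alpha_\ell$ exists, and for every $N\ge2$ $$\lim_{v\to\infty}r\underline\alpha_\ell=\sum_{p=2}^N\mathscr E_{\ell,p}\,S_{\ell,p,\ell+2,0,-2}\,r_0^{-2-p}+O(r_0^{-3-N}).$$ In particular it decays like $r_0^{-3-\ell}$: $$\lim_{v\to\infty}r\underline\alpha_\ell=\mathscr E_{\ell,\ell+1}\,S_{\ell,\ell+1,\ell+2,0,-2}\,r_0^{-3-\ell}+O(r_0^{-4-\ell}).$$ 2. *(Vanishing of the constants.)* For integers $\ell,p\ge2$: $S_{\ell,p,\ell+2,0,-2}=0$ if and only if $p\le\ell$. 3. *(The coefficients are generically nonvanishing.)* For $M=0$, all $u_0<v_1$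 and all $\ell,p\ge2$ there is a solution $\underline\alpha$ as in 1. with $\mathscr E_{\ell,p}\ne0$. 4. *(Positive mass.)* Let $M>0$ and let $\underline\alpha$ describe the exterior of a compactly supported gravitational perturbation, with coefficients $\mathscr E_{\ell,p}$, $\overline{\mathscr A}_\ell$. For every $\ell\ge2$ and $u\le u_0$ the limit $\lim_{v\to\infty}r\underline\alpha_\ell$ exists, and $$\lim_{v\to\infty}r\underline\alpha_\ell=(-1)^{\ell+1}\frac{(\ell-2)!}{(\ell+2)!}\,4M\,\overline{\mathscr A}_\ell\,r_0^{-3}+O(r_0^{-4}).$$ 5. *(Compactly supported radiation.)* Let $M\ge0$ and $v_1\le v_2$. Suppose that the solution $\underline\alpha$ on $u\le u_0$, $v\ge v_1$ has trivial data on the cone $v=v_1$ ($\underline\alpha=0$ along the cone, and $\underline\psi=\underline\Psi=0$ on the sphere $u=u_0$, $v=v_1$) and arises from smooth incoming radiation $P$ along $\mathcal I^-$ with $P(v)=0$ for $v\ge v_2$. Then $\underline\alpha$, on $u\le u_0$, $v\ge v_2$, describes the exterior of a compactly supported gravitational perturbation (with $v_1$ replaced by $v_2$ in the definition) for some coefficients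 $\mathscr E_{\ell,p}$ and with $\overline{\mathscr A}_\ell=\frac12\int_{v_1}^{v_2}P_\ell(v)\,dv$; so 1. and 4. apply to it. -/

import Mathlib

open Set Filter Topology MeasureTheory
open scoped ContDiff

noncomputable section

namespace TeukolskyScattering

/-! ### Tensor fields on the unit sphere

A covariant `k`-tensor field on the unit sphere of Euclidean 3-space is represented by its
Cartesian components (tensors which vanish on the normal direction).  Only the values at unit
vectors matter. -/

abbrev E3 := EuclideanSpace ℝ (Fin 3)

abbrev SphereTensor (k : ℕ) := E3 → (Fin k → Fin 3) → ℝ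

/-- The components of the orthogonal projection onto the tangent space at the unit vector `x`. -/
def tangentProj (x : E3) (i j : Fin 3) : ℝ := (if i = j then 1 else 0) - x i * x j

/-- The Levi-Civita covariant derivative of the round unit sphere (tangential projection of the
flat derivative); the new index is the first one. -/
def covDeriv {k : ℕ} (T : SphereTensor k) : SphereTensor (k + 1) := fun x I =>
  ∑ J : Fin (k + 1) → Fin 3, (∏ a, tangentProj x (I a) (J a)) *
    fderiv ℝ (fun y : E3 => T (‖y‖⁻¹ • y) (Fin.tail J)) x (EuclideanSpace.single (J 0) 1)

/-- The (rough) Laplacian of the unit sphere on covariant tensors. -/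
def sphereLaplacian {k : ℕ} (T : SphereTensor k) : SphereTensor k := fun x I =>
  ∑ i : Fin 3, covDeriv (covDeriv T) x (Fin.cons i (Fin.cons i I))

/-- The Levi-Civita symbol on three indices. -/
def leviCivita (i j k : Fin 3) : ℝ :=
  Matrix.det (Matrix.of ![Pi.single i (1 : ℝ), Pi.single j 1, Pi.single k 1])

/-- The Hodge dual `(⋆ξ)_A = ε_{AB} ξ^B` on the unit sphere, oriented by the outward normal. -/
def hodge (ξ : SphereTensor 1) : SphereTensor 1 := fun x I =>
  ∑ j : Fin 3, (∑ k : Fin 3, leviCivita k (I 0) j * x k) * ξ x ![j]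

/-- The operator `(f, g) ↦ -∇f + ⋆∇g`, the adjoint of `β ↦ (div β, curl β)`. -/
def adjD1 (f g : SphereTensor 0) : SphereTensor 1 :=
  fun x I => -covDeriv f x I + hodge (covDeriv g) x I

/-- The symmetric trace-free part of a tangential 2-tensor. -/
def stfPart (T : SphereTensor 2) : SphereTensor 2 := fun x I =>
  (T x ![I 0, I 1] + T x ![I 1, I 0]) / 2
    - tangentProj x (I 0) (I 1) * (∑ i : Fin 3, T x ![i, i]) / 2

/-- The operator `β ↦ -(∇β)_stf`, the adjoint of the divergence on stf 2-tensors. -/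
def adjD2 (β : SphereTensor 1) : SphereTensor 2 := fun x I => -stfPart (covDeriv β) x I

/-- Symmetric trace-free (stf) tangential 2-tensor fields on the unit sphere. -/
def IsStf (T : SphereTensor 2) : Prop :=
  ∀ x : E3, ‖x‖ = 1 → (∀ i j, T x ![i, j] = T x ![j, i]) ∧
    (∀ j, ∑ i : Fin 3, x i * T x ![i, j] = 0) ∧ ∑ i : Fin 3, T x ![i, i] = 0

/-- The surface measure of the unit sphere. -/
def sphereMeasure : Measure (Metric.sphere (0 : E3) 1) := (volume : Measure E3).toSphere

/-- The `L²` inner product of tensor fields on the unit sphere. -/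
def l2Inner {k : ℕ} (S T : SphereTensor k) : ℝ :=
  ∫ x : Metric.sphere (0 : E3) 1, ∑ I : Fin k → Fin 3, S x I * T x I ∂sphereMeasure

/-! ### Spherical harmonics -/

/-- The usual real `L²`-normalised spherical harmonics `Y_{ℓ,m}`, `-ℓ ≤ m ≤ ℓ`.  With
`x₂ = cos θ` and `x₀ + i x₁ = sin θ e^{iφ}`, the associated Legendre function is written as
`sin^|m| θ` times a derivative of the Rodrigues polynomial. -/
def realSphHarm (ℓ : ℕ) (m : ℤ) : SphereTensor 0 := fun x _ =>
  Real.sqrt ((if m = 0 then 1 else 2) * ((2 * ℓ + 1) / (4 * Real.pi))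
      * ((ℓ - m.natAbs).factorial / (ℓ + m.natAbs).factorial)) / (2 ^ ℓ * ℓ.factorial)
    * (Polynomial.derivative^[ℓ + m.natAbs]
        (((Polynomial.X : Polynomial ℝ) ^ 2 - 1) ^ ℓ)).eval (x 2)
    * (if 0 ≤ m then ((⟨x 0, x 1⟩ : ℂ) ^ m.natAbs).re else ((⟨x 0, x 1⟩ : ℂ) ^ m.natAbs).im)

/-- The normalisation factor of the stf 2-tensor harmonics of degree `ℓ`. -/
def harmNorm (ℓ : ℕ) : ℝ :=
  (Real.sqrt ((ℓ : ℝ) * (ℓ + 1)))⁻¹ * (Real.sqrt (((ℓ : ℝ) - 1) * (ℓ + 2) / 2))⁻¹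

/-- The electric stf 2-tensor harmonics. -/
def harmE (ℓ : ℕ) (m : ℤ) : SphereTensor 2 := harmNorm ℓ • adjD2 (adjD1 (realSphHarm ℓ m) 0)

/-- The magnetic stf 2-tensor harmonics. -/
def harmH (ℓ : ℕ) (m : ℤ) : SphereTensor 2 := harmNorm ℓ • adjD2 (adjD1 0 (realSphHarm ℓ m))

/-- The projection `T_ℓ` of an stf 2-tensor field to angular frequency `ℓ`. -/
def angularMode (ℓ : ℕ) (T : SphereTensor 2) : SphereTensor 2 :=
  ∑ m ∈ Finset.Icc (-(ℓ : ℤ)) ℓ,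
    (l2Inner T (harmE ℓ m) • harmE ℓ m + l2Inner T (harmH ℓ m) • harmH ℓ m)

/-! ### Schwarzschild in double null coordinates -/

/-- `r_* = r + 2M log (r / 2M - 1)`, and `r_* = r` if `M = 0`. -/
def tortoise (M r : ℝ) : ℝ := r + 2 * M * Real.log (r / (2 * M) - 1)

/-- The area radius `r(u, v) > 2M`, defined by `r_* = v - u`. -/
def areaRadius (M u v : ℝ) : ℝ := Function.invFunOn (tortoise M) (Ioi (2 * M)) (v - u)

/-- `Ω² = 1 - 2M / r`. -/
def lapseSq (M u v : ℝ) : ℝ := 1 - 2 * M / areaRadius M u v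

/-- A family of 2-tensor fields on the spheres `S_{u,v}`, given by its components in orthonormal
frames, so that `∇_u`, `∇_v` are the partial derivatives of the components. -/
abbrev Field := ℝ → ℝ → SphereTensor 2

/-- `∇_u` on the region `u ≤ u₀` (one-sided at `u = u₀`). -/
def nablaU (u₀ : ℝ) (F : Field) : Field := fun u v x I =>
  derivWithin (fun u' => F u' v x I) (Iic u₀) u

/-- `∇_v` on the region `v ≥ v₁` (one-sided at `v = v₁`). -/
def nablaV (v₁ : ℝ) (F : Field) : Field := fun u v x I =>
  derivWithin (fun v' => F u v' x I) (Ici v₁) v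

/-- `r Ω² α̲`. -/
def weighted (M : ℝ) (α : Field) : Field := fun u v x I =>
  areaRadius M u v * lapseSq M u v * α u v x I

/-- `(r² / Ω²) ∇_v`. -/
def scaledNablaV (M v₁ : ℝ) (F : Field) : Field := fun u v x I =>
  areaRadius M u v ^ 2 / lapseSq M u v * nablaV v₁ F u v x I

/-- `ψ̲ = (r² / Ω²) ∇_v (r Ω² α̲)`. -/
def psiBar (M v₁ : ℝ) (α : Field) : Field := scaledNablaV M v₁ (weighted M α)

/-- `Ψ̲ = ((r² / Ω²) ∇_v)² (r Ω² α̲)`. -/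
def PsiBar (M v₁ : ℝ) (α : Field) : Field := scaledNablaV M v₁ (psiBar M v₁ α)

/-- `α` is a smooth stf solution, on the region `u ≤ u₀`, `v ≥ v₁`, of the Teukolsky equation
`∇_u ((r⁴ / Ω⁴) ∇_v (r Ω² α̲)) = r³ (Δ - 2) α̲ - 6 M r² α̲`, where `Δ` is the Laplacian of the
unit sphere. -/
structure IsTeukolskySolution (M u₀ v₁ : ℝ) (α : Field) : Prop where
  smooth : ContDiffOn ℝ ∞ (fun p : ℝ × ℝ × E3 => α p.1 p.2.1 (‖p.2.2‖⁻¹ • p.2.2))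
    (Iic u₀ ×ˢ Ici v₁ ×ˢ {0}ᶜ)
  stf : ∀ u ≤ u₀, ∀ v ≥ v₁, IsStf (α u v)
  teukolsky : ∀ u ≤ u₀, ∀ v ≥ v₁, ∀ x : E3, ‖x‖ = 1 → ∀ I : Fin 2 → Fin 3,
    nablaU u₀ (fun u v x I => areaRadius M u v ^ 4 / lapseSq M u v ^ 2
        * nablaV v₁ (weighted M α) u v x I) u v x I
      = areaRadius M u v ^ 3 * (sphereLaplacian (α u v) x I - 2 * α u v x I)
        - 6 * M * areaRadius M u v ^ 2 * α u v x I

/-- The incoming radiation of `α` along past null infinity is `P`: for all `v ≥ v₁`,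
`∇_v Ψ̲ → P` in `L²([v₁, v] × S²)` as `u → -∞`. -/
def HasIncomingRadiation (M v₁ : ℝ) (α : Field) (P : ℝ → SphereTensor 2) : Prop :=
  ∀ v ≥ v₁, Tendsto (fun u => ∫ v' in v₁..v,
      l2Inner (nablaV v₁ (PsiBar M v₁ α) u v' - P v') (nablaV v₁ (PsiBar M v₁ α) u v' - P v'))
    atBot (𝓝 0)

/-- `α` is a scattering solution on `u ≤ u₀`, `v ≥ v₁` without incoming radiation whose seed data
describe the exterior of a compactly supported gravitational perturbation: along the cone
`v = v₁`, with `r₀(u) = r(u, v₁)`, each angular mode of `r α̲` has the asymptotic expansion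
`∑_{p ≥ 2} E_p r₀^{-2-p}`, and each angular mode of `Ψ̲` has a limit `2 A` at `u = -∞`. -/
structure DescribesExterior (M u₀ v₁ : ℝ) (α : Field) (E : ℕ → ℕ → SphereTensor 2)
    (A : ℕ → SphereTensor 2) : Prop where
  solution : IsTeukolskySolution M u₀ v₁ α
  noIncoming : HasIncomingRadiation M v₁ α 0
  expansion : ∀ ℓ : ℕ, 2 ≤ ℓ → ∀ N : ℕ, 2 ≤ N → ∃ C : ℝ, ∀ u ≤ u₀, ∀ x : E3, ‖x‖ = 1 →
    ‖areaRadius M u v₁ • angularMode ℓ (α u v₁) x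
        - ∑ p ∈ Finset.Icc 2 N, areaRadius M u v₁ ^ (-2 - (p : ℤ)) • E ℓ p x‖
      ≤ C * areaRadius M u v₁ ^ (-3 - (N : ℤ))
  limit : ∀ ℓ : ℕ, 2 ≤ ℓ → ∀ x : E3, ‖x‖ = 1 →
    Tendsto (fun u => angularMode ℓ (PsiBar M v₁ α u v₁) x) atBot (𝓝 ((2 : ℝ) • A ℓ x))

/-- `α` is a scattering solution on `u ≤ u₀`, `v ≥ v₁` with trivial data on the cone `v = v₁`
(for `α̲` along the cone, and for its first two transversal derivatives on the sphere `u = u₀`),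
arising from smooth incoming radiation `P` along past null infinity which vanishes for
`v ≥ v₂`. -/
structure ArisesFromCompactRadiation (M u₀ v₁ v₂ : ℝ) (α : Field) (P : ℝ → SphereTensor 2) :
    Prop where
  solution : IsTeukolskySolution M u₀ v₁ α
  trivial : ∀ u ≤ u₀, ∀ x : E3, ‖x‖ = 1 → α u v₁ x = 0
  trivial_psi : ∀ x : E3, ‖x‖ = 1 → psiBar M v₁ α u₀ v₁ x = 0
  trivial_Psi : ∀ x : E3, ‖x‖ = 1 → PsiBar M v₁ α u₀ v₁ x = 0
  smooth : ContDiffOn ℝ ∞ (fun p : ℝ × E3 => P p.1 (‖p.2‖⁻¹ • p.2)) (Ici v₁ ×ˢ {0}ᶜ)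
  support : ∀ v ≥ v₂, ∀ x : E3, ‖x‖ = 1 → P v x = 0
  radiation : HasIncomingRadiation M v₁ α P

/-! ### The constants in the expansion -/

/-- `x ! = Γ(x + 1)`. -/
def fact (x : ℝ) : ℝ := Real.Gamma (x + 1)

/-- The generalised binomial coefficient `x (x - 1) ⋯ (x - k + 1) / k!`. -/
def binom (x : ℝ) (k : ℕ) : ℝ := (∏ i ∈ Finset.range k, (x - i)) / k.factorial

/-- The constants `S_{ℓ,p,j,n,s}` for `n ≤ j ≤ ℓ - s`; the last factor is
`binom (ℓ - p) (ℓ - p - j + n) = binom (ℓ - p) (j - n)`. -/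
def coeffS (ℓ : ℕ) (p : ℝ) (j n : ℕ) (s : ℤ) : ℝ :=
  (-1) ^ ((ℓ : ℤ) - s + n) * fact (s + p) * fact (ℓ - s) * fact (2 * ℓ - j + n)
    / (n.factorial * fact (ℓ + s) * fact (ℓ + p)) * binom (ℓ - p) (j - n)

end TeukolskyScattering

end

/-!
The radiation field along future null infinity of a solution of the Teukolsky equation which has no
incoming radiation from past null infinity.

*Reduction to scalar modes.* The tensor harmonics of degree `ℓ` are restrictions of expressions in
solid harmonics (`isSolidHarmonic_legendre`), hence smooth eigentensors of the Laplacian of the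
sphere (`isTensorHarmonic_harm`), and this Laplacian is symmetric
(`integral_mul_flatLaplacian_comm`). So the `L²` product of a solution with a tensor harmonic, or
with the kernel of the projection to degree `ℓ`, satisfies a system of ordinary differential
equations in `u` and in `v` for `f = r Ω² α̲` and its weighted `v`-derivatives `ψ` and `Ψ`
(`IsMode`, `IsTeukolskySolution.isMode`), in which `Ψ` solves the Regge-Wheeler equation. The
tensors of degree `ℓ` form a finite-dimensional space and are determined by their values at
finitely many points, so estimates of the modes are uniform on the sphere (`exists_interpolated`,
`exists_norm_le_of_interpolation`).

*Energy.* For the Regge-Wheeler equation with a small source, the energy identity with an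
exponential weight bounds the flux through an outgoing cone by data on the initial incoming cone,
because the flux from past null infinity vanishes (`IsWave.flux_le`). Data of size `r₀⁻ᵐ` for `Ψ`
then contribute only `O(r₀⁻ᵐ⁻²)` to the radiation field (`IsWave.exists_tendsto_integral`).

*The leading profile.* Near spacelike infinity the equation is invariant under scaling up to powers
of `M / r`, and `Ψ` is close to `H(y) + r₀⁻¹ G(y)` with `y = 1 - r₀ / r`. Here `H` is `2 A` times a
shifted Legendre polynomial, and `G` solves an inhomogeneous equation with a source proportional to
`M H`, with a logarithmic term at `y = 1` (`exists_isProfile`). Two integrations in `v` recover `f`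
from `Ψ`. The contribution of `H` to the radiation field is the integral of `(1 - y) H` over `[0,
1]`, which vanishes for `ℓ ≥ 2`; that of `G` follows from the value `G(1)`, which is determined by
a conserved Wronskian of `G` and a solution of the adjoint equation. This gives the coefficient of
`r₀⁻³` for positive mass (`IsMode.exists_radiation_field`), which is zero on Minkowski space.

*Minkowski space.* The exact solutions with data `r₀⁻²⁻ᵖ` are `r₀⁻²⁻ᵖ q(1 - r₀ / r)` with a
hypergeometric polynomial `q` (`IsRadius.isMode_scatPoly`). The Chu-Vandermonde identity evaluates
`q(1)` as a product which is equal to `S_{ℓ,p,ℓ+2,0,-2}` (`eval_one_hypPoly`, `coeffS_eq`) and has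
a zero factor exactly when `p ≤ ℓ`. Subtracting these solutions from a given one leaves data of
high order, to which the preceding estimate applies (`IsMode.exists_radiation_expansion`). The same
solutions show that no coefficient `E_{ℓ,p}` has to vanish (`exists_describesExterior`).

*Compactly supported radiation.* With trivial data on `v = v₁`, the limit of `Ψ` at past null
infinity is the integral of the incoming radiation. Expressing `ψ` and `f` as integrals of `Ψ` in
`v`, and integrating the equation for `∂_u Ψ` from `u = -∞`, one gains a power of `1 / r(u, v₂)` in
each step and obtains a full asymptotic expansion (`IsMode.exists_expansion_of_trivial`).
-/

namespace TeukolskyScattering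

open Polynomial
open Finset (sum_congr mul_sum sum_add_distrib sum_mul sum_sub_distrib sum_ite_eq sum_comm
  sum_insert sum_eq_zero sum_singleton sum_neg_distrib sum_le_sum sum_smul abs_sum_le_sum_abs
  prod_congr prod_div_distrib)
open intervalIntegral (integral_mono_on integral_congr)

/-! ### The area radius -/

theorem hasDerivAt_tortoise {M r : ℝ} (hM : 0 ≤ M) (hr : 2 * M < r) :
    HasDerivAt (tortoise M) (1 - 2 * M / r)⁻¹ r := by
  unfold tortoise
  rcases hM.eq_or_lt with rfl | hM
  · simpa using hasDerivAt_id' r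
  · have h1 : r / (2 * M) - 1 ≠ 0 := by
      have : 1 < r / (2 * M) := by rw [lt_div_iff₀ (by positivity)]; linarith
      linarith
    have h2 := (hasDerivAt_id' r).add
      (((((hasDerivAt_id' r).div_const (2 * M)).sub_const 1).log h1).const_mul (2 * M))
    refine h2.congr_deriv ?_
    have : r - 2 * M ≠ 0 := by linarith
    have hr0 : r ≠ 0 := by linarith
    rw [show r / (2 * M) - 1 = (r - 2 * M) / (2 * M) by field_simp,
      show 1 - 2 * M / r = (r - 2 * M) / r by field_simp]
    field_simp
    ring

theorem lapse_pos {M r : ℝ} (hM : 0 ≤ M) (hr : 2 * M < r) : 0 < 1 - 2 * M / r := by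
  have : 2 * M / r < 1 := by rw [div_lt_one (by linarith)]; exact hr
  linarith

theorem strictMonoOn_tortoise {M : ℝ} (hM : 0 ≤ M) : StrictMonoOn (tortoise M) (Ioi (2 * M)) := by
  apply strictMonoOn_of_deriv_pos (convex_Ioi _)
  · intro r hr
    exact (hasDerivAt_tortoise hM hr).continuousAt.continuousWithinAt
  · intro r hr
    rw [interior_Ioi] at hr
    rw [(hasDerivAt_tortoise hM hr).deriv]
    exact inv_pos.2 (lapse_pos hM hr)

theorem exists_tortoise_eq {M t : ℝ} (hM : 0 ≤ M) (ht : M = 0 → 0 < t) :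
    ∃ r ∈ Ioi (2 * M), tortoise M r = t := by
  rcases hM.eq_or_lt with rfl | hM
  · exact ⟨t, by simpa using ht rfl, by simp [tortoise]⟩
  · have hcont : ContinuousOn (tortoise M) (Ioi (2 * M)) := fun r hr =>
      (hasDerivAt_tortoise hM.le hr).continuousAt.continuousWithinAt
    have htop : Tendsto (tortoise M) atTop atTop := by
      apply tendsto_atTop_mono' _ _ tendsto_id
      filter_upwards [eventually_ge_atTop (4 * M)] with r hr
      have : 1 ≤ r / (2 * M) - 1 := by
        have : 2 ≤ r / (2 * M) := by rw [le_div_iff₀ (by positivity)]; linarith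
        linarith
      have := Real.log_nonneg this
      simp only [tortoise, id]
      nlinarith
    have hbot : Tendsto (tortoise M) (𝓝[>] (2 * M)) atBot := by
      have h1 : Tendsto (fun r => r / (2 * M) - 1) (𝓝[>] (2 * M)) (𝓝[>] 0) := by
        apply tendsto_nhdsWithin_of_tendsto_nhds_of_eventually_within
        · have : Tendsto (fun r => r / (2 * M) - 1) (𝓝 (2 * M)) (𝓝 (2 * M / (2 * M) - 1)) :=
            Continuous.tendsto (by fun_prop) _
          rw [div_self (by positivity), sub_self] at this
          exact this.mono_left nhdsWithin_le_nhds
        · filter_upwards [self_mem_nhdsWithin] with r hr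
          have : 1 < r / (2 * M) := by
            rw [lt_div_iff₀ (by positivity)]; linarith [show 2 * M < r from hr]
          simp; exact this
      have h2 := (Real.tendsto_log_nhdsGT_zero.comp h1).const_mul_atBot (show 0 < 2 * M by positivity)
      have h3 : Tendsto (fun r : ℝ => r) (𝓝[>] (2 * M)) (𝓝 (2 * M)) := nhdsWithin_le_nhds
      exact h3.add_atBot h2
    have := (isPreconnected_Ioi (a := 2 * M)).intermediate_value_Iii
      (l₁ := 𝓝[>] (2 * M)) (l₂ := atTop)
      (le_principal_iff.2 self_mem_nhdsWithin) (le_principal_iff.2 (Ioi_mem_atTop _)) hcont hbot htop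
    obtain ⟨r, hr, h⟩ := this (mem_univ t)
    exact ⟨r, hr, h⟩

/-- The area radius as a function of `t = v - u`. -/
noncomputable def radius (M t : ℝ) : ℝ := Function.invFunOn (tortoise M) (Ioi (2 * M)) t

theorem areaRadius_eq (M u v : ℝ) : areaRadius M u v = radius M (v - u) := rfl

theorem radius_gt {M t : ℝ} (hM : 0 ≤ M) (ht : M = 0 → 0 < t) : 2 * M < radius M t :=
  Function.invFunOn_mem (exists_tortoise_eq hM ht)

theorem tortoise_radius {M t : ℝ} (hM : 0 ≤ M) (ht : M = 0 → 0 < t) :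
    tortoise M (radius M t) = t :=
  Function.invFunOn_eq (exists_tortoise_eq hM ht)

theorem radius_tortoise {M r : ℝ} (hM : 0 ≤ M) (hr : 2 * M < r) : radius M (tortoise M r) = r := by
  have ht : M = 0 → 0 < tortoise M r := by rintro rfl; simpa [tortoise] using hr
  exact (strictMonoOn_tortoise hM).injOn (radius_gt hM ht) hr (tortoise_radius hM ht)

theorem radius_zero {t : ℝ} (ht : 0 < t) : radius 0 t = t := by
  have := tortoise_radius (M := 0) le_rfl (fun _ => ht)
  simpa [tortoise] using this

theorem isOpen_radiusDomain (M : ℝ) : IsOpen {t : ℝ | M = 0 → 0 < t} := by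
  by_cases h : M = 0
  · simpa [h] using isOpen_lt continuous_const continuous_id
  · simp [h]

theorem hasDerivAt_radius {M t : ℝ} (hM : 0 ≤ M) (ht : M = 0 → 0 < t) :
    HasDerivAt (radius M) (1 - 2 * M / radius M t) t := by
  have hgt := radius_gt hM ht
  have hmono : StrictMonoOn (radius M) {t : ℝ | M = 0 → 0 < t} := by
    intro a ha b hb hab
    by_contra! h
    have := (strictMonoOn_tortoise hM).monotoneOn (radius_gt hM hb) (radius_gt hM ha) h
    rw [tortoise_radius hM ha, tortoise_radius hM hb] at this
    linarith
  have hcont : ContinuousAt (radius M) t := by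
    apply hmono.continuousAt_of_image_mem_nhds ((isOpen_radiusDomain M).mem_nhds ht)
    apply mem_of_superset (Ioi_mem_nhds hgt)
    intro r hr
    refine ⟨tortoise M r, ?_, radius_tortoise hM hr⟩
    rintro rfl
    simpa [tortoise] using hr
  have := (hasDerivAt_tortoise hM hgt).of_local_left_inverse hcont
    (inv_ne_zero (lapse_pos hM hgt).ne') ?_
  · simpa using this
  · filter_upwards [(isOpen_radiusDomain M).mem_nhds ht] with s hs
    exact tortoise_radius hM hs

theorem contDiffOn_radius {M : ℝ} (hM : 0 ≤ M) :
    ContDiffOn ℝ ∞ (radius M) {t : ℝ | M = 0 → 0 < t} := by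
  rw [contDiffOn_infty]
  intro n
  induction n with
  | zero =>
    exact contDiffOn_zero.2 fun t ht => (hasDerivAt_radius hM ht).continuousAt.continuousWithinAt
  | succ n ih =>
    push_cast
    rw [contDiffOn_succ_iff_deriv_of_isOpen (isOpen_radiusDomain M)]
    refine ⟨fun t ht => (hasDerivAt_radius hM ht).differentiableAt.differentiableWithinAt,
      by simp, ?_⟩
    have : ContDiffOn ℝ n (fun t => 1 - 2 * M / radius M t) {t : ℝ | M = 0 → 0 < t} :=
      contDiffOn_const.sub (contDiffOn_const.div ih fun t ht => by
        have := radius_gt hM ht; linarith)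
    exact this.congr fun t ht => (hasDerivAt_radius hM ht).deriv

/-- The properties of the area radius, as a function of `v - u ≥ t₀`, on which the scalar
analysis rests. -/
structure IsRadius (M t₀ : ℝ) (R : ℝ → ℝ) : Prop where
  nonneg : 0 ≤ M
  gt : ∀ t ≥ t₀, 2 * M < R t
  deriv : ∀ t ≥ t₀, HasDerivAt R (1 - 2 * M / R t) t
  tendsto : Tendsto R atTop atTop

theorem isRadius_radius {M t₀ : ℝ} (hM : 0 ≤ M) (ht : M = 0 → 0 < t₀) :
    IsRadius M t₀ (radius M) where
  nonneg := hM
  gt t h := radius_gt hM fun h0 => lt_of_lt_of_le (ht h0) h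
  deriv t h := hasDerivAt_radius hM fun h0 => lt_of_lt_of_le (ht h0) h
  tendsto := by
    rw [tendsto_atTop_atTop]
    intro b
    refine ⟨max (tortoise M (max b (2 * M + 1))) 1, fun t h => ?_⟩
    by_contra! hlt
    have h0 : M = 0 → 0 < t := fun _ => lt_of_lt_of_le one_pos ((le_max_right _ _).trans h)
    have h1 := radius_gt hM h0
    have h2 := strictMonoOn_tortoise hM h1
      (show max b (2 * M + 1) ∈ Ioi (2 * M) from
        lt_of_lt_of_le (by linarith) (le_max_right b (2 * M + 1)))
      (hlt.trans_le (le_max_left _ _))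
    rw [tortoise_radius hM h0] at h2
    linarith [(le_max_left _ _).trans h]

namespace IsRadius

variable {M t₀ : ℝ} {R : ℝ → ℝ}

theorem pos (h : IsRadius M t₀ R) {t : ℝ} (ht : t₀ ≤ t) : 0 < R t := by
  have := h.gt t ht; have := h.nonneg; linarith

theorem lapse_pos (h : IsRadius M t₀ R) {t : ℝ} (ht : t₀ ≤ t) : 0 < 1 - 2 * M / R t :=
  TeukolskyScattering.lapse_pos h.nonneg (h.gt t ht)

theorem continuousOn (h : IsRadius M t₀ R) : ContinuousOn R (Ici t₀) :=
  fun t ht => (h.deriv t ht).continuousAt.continuousWithinAt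

theorem monotoneOn (h : IsRadius M t₀ R) : MonotoneOn R (Ici t₀) := by
  apply monotoneOn_of_deriv_nonneg (convex_Ici _) h.continuousOn
  · intro t ht
    rw [interior_Ici] at ht
    exact (h.deriv t ht.le).differentiableAt.differentiableWithinAt
  · intro t ht
    rw [interior_Ici] at ht
    rw [(h.deriv t ht.le).deriv]
    exact (h.lapse_pos ht.le).le

theorem lapse_mono (h : IsRadius M t₀ R) {t t' : ℝ} (ht : t₀ ≤ t) (htt' : t ≤ t') :
    1 - 2 * M / R t ≤ 1 - 2 * M / R t' := by
  have h1 := h.monotoneOn ht (ht.trans htt') htt'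
  have h2 := h.pos ht
  have := div_le_div_of_nonneg_left (show 0 ≤ 2 * M by linarith [h.nonneg]) h2 h1
  linarith

theorem lapse_le_one (h : IsRadius M t₀ R) {t : ℝ} (ht : t₀ ≤ t) : 1 - 2 * M / R t ≤ 1 := by
  have := div_nonneg (show 0 ≤ 2 * M by linarith [h.nonneg]) (h.pos ht).le
  linarith

/-- The reciprocal radius `ρ = 1 / r` satisfies `ρ' = -Ω² ρ²`. -/
theorem hasDerivAt_inv (h : IsRadius M t₀ R) {t : ℝ} (ht : t₀ ≤ t) :
    HasDerivAt (fun t => (R t)⁻¹) (-((1 - 2 * M * (R t)⁻¹) * (R t)⁻¹ ^ 2)) t := by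
  have h0 := (h.pos ht).ne'
  refine ((h.deriv t ht).fun_inv h0).congr_deriv ?_
  field_simp

theorem tendsto_inv (h : IsRadius M t₀ R) : Tendsto (fun t => (R t)⁻¹) atTop (𝓝 0) :=
  tendsto_inv_atTop_zero.comp h.tendsto

theorem mono (h : IsRadius M t₀ R) {t₁ : ℝ} (ht : t₀ ≤ t₁) : IsRadius M t₁ R :=
  ⟨h.nonneg, fun t h' => h.gt t (ht.trans h'), fun t h' => h.deriv t (ht.trans h'), h.tendsto⟩

end IsRadius

/-! ### The weighted energy estimate -/

theorem intervalIntegrable_of_continuousOn_Ici {f : ℝ → ℝ} {a b : ℝ} (h : ContinuousOn f (Ici a))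
    (hab : a ≤ b) : IntervalIntegrable f volume a b :=
  (h.mono Icc_subset_Ici_self).intervalIntegrable_of_Icc hab

theorem integral_eq_sub_of_hasDerivWithinAt_Icc {f f' : ℝ → ℝ} {a b : ℝ} (hab : a ≤ b)
    (hf : ∀ x ∈ Icc a b, HasDerivWithinAt f (f' x) (Icc a b) x)
    (hc : ContinuousOn f' (Icc a b)) : ∫ x in a..b, f' x = f b - f a := by
  apply intervalIntegral.integral_eq_sub_of_hasDerivAt_of_le hab
  · exact fun x hx => (hf x hx).continuousWithinAt
  · exact fun x hx => (hf x (Ioo_subset_Icc_self hx)).hasDerivAt (Icc_mem_nhds hx.1 hx.2)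
  · exact hc.intervalIntegrable_of_Icc hab

/-- Green's formula on a rectangle, for fields with only one continuous partial derivative
each. -/
theorem rectangle_green {X Y A B : ℝ → ℝ → ℝ} {a b c d : ℝ} (hab : a ≤ b) (hcd : c ≤ d)
    (hX : ∀ u ∈ Icc a b, ∀ v ∈ Icc c d, HasDerivWithinAt (X u) (A u v) (Icc c d) v)
    (hY : ∀ u ∈ Icc a b, ∀ v ∈ Icc c d,
      HasDerivWithinAt (fun u' => Y u' v) (B u v) (Icc a b) u)
    (hXc : ContinuousOn (Function.uncurry X) (Icc a b ×ˢ Icc c d))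
    (hYc : ContinuousOn (Function.uncurry Y) (Icc a b ×ˢ Icc c d))
    (hA : ContinuousOn (Function.uncurry A) (Icc a b ×ˢ Icc c d))
    (hB : ContinuousOn (Function.uncurry B) (Icc a b ×ˢ Icc c d)) :
    (∫ u in a..b, X u d) - (∫ u in a..b, X u c) + (∫ v in c..d, Y b v) - (∫ v in c..d, Y a v)
      = ∫ u in a..b, ∫ v in c..d, (A u v + B u v) := by
  have slice_v : ∀ {Z : ℝ → ℝ → ℝ}, ContinuousOn (Function.uncurry Z) (Icc a b ×ˢ Icc c d) →
      ∀ u ∈ Icc a b, ContinuousOn (Z u) (Icc c d) := fun hZ u hu =>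
    hZ.comp (f := fun v => (u, v)) (by fun_prop) fun v hv => ⟨hu, hv⟩
  have slice_u : ∀ {Z : ℝ → ℝ → ℝ}, ContinuousOn (Function.uncurry Z) (Icc a b ×ˢ Icc c d) →
      ∀ v ∈ Icc c d, ContinuousOn (fun u => Z u v) (Icc a b) := fun hZ v hv =>
    hZ.comp (f := fun u => (u, v)) (by fun_prop) fun u hu => ⟨hu, hv⟩
  have hint : ∀ {Z : ℝ → ℝ → ℝ}, ContinuousOn (Function.uncurry Z) (Icc a b ×ˢ Icc c d) →
      IntegrableOn (Function.uncurry Z) (Set.uIoc a b ×ˢ Set.uIoc c d) := fun hZ => by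
    rw [uIoc_of_le hab, uIoc_of_le hcd]
    exact (hZ.integrableOn_compact (isCompact_Icc.prod isCompact_Icc)).mono_set
      (prod_mono Ioc_subset_Icc_self Ioc_subset_Icc_self)
  have inner_cont : ∀ {Z : ℝ → ℝ → ℝ}, ContinuousOn (Function.uncurry Z) (Icc a b ×ˢ Icc c d) →
      IntervalIntegrable (fun u => ∫ v in c..d, Z u v) volume a b := fun {Z} hZ => by
    have h := hint hZ
    rw [IntegrableOn, Measure.volume_eq_prod, ← Measure.prod_restrict] at h
    have h2 := h.integral_prod_left
    rw [intervalIntegrable_iff]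
    simp_rw [intervalIntegral.integral_of_le hcd]
    rw [uIoc_of_le hcd] at h2
    exact h2
  have e1 : ∫ u in a..b, ∫ v in c..d, A u v = (∫ u in a..b, X u d) - ∫ u in a..b, X u c := by
    rw [← intervalIntegral.integral_sub
      ((slice_u hXc d ⟨hcd, le_rfl⟩).intervalIntegrable_of_Icc hab)
      ((slice_u hXc c ⟨le_rfl, hcd⟩).intervalIntegrable_of_Icc hab)]
    apply integral_congr
    intro u hu
    rw [uIcc_of_le hab] at hu
    exact integral_eq_sub_of_hasDerivWithinAt_Icc hcd (hX u hu) (slice_v hA u hu)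
  have e2 : ∫ u in a..b, ∫ v in c..d, B u v = (∫ v in c..d, Y b v) - ∫ v in c..d, Y a v := by
    rw [intervalIntegral_intervalIntegral_swap (hint hB), ← intervalIntegral.integral_sub
      ((slice_v hYc b ⟨hab, le_rfl⟩).intervalIntegrable_of_Icc hcd)
      ((slice_v hYc a ⟨le_rfl, hab⟩).intervalIntegrable_of_Icc hcd)]
    apply integral_congr
    intro v hv
    rw [uIcc_of_le hcd] at hv
    exact integral_eq_sub_of_hasDerivWithinAt_Icc hab (fun u hu => hY u hu v hv)
      (slice_u hB v hv)
  have e3 : ∫ u in a..b, ∫ v in c..d, (A u v + B u v)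
      = (∫ u in a..b, ∫ v in c..d, A u v) + ∫ u in a..b, ∫ v in c..d, B u v := by
    rw [← intervalIntegral.integral_add (inner_cont hA) (inner_cont hB)]
    apply integral_congr
    intro u hu
    rw [uIcc_of_le hab] at hu
    exact intervalIntegral.integral_add ((slice_v hA u hu).intervalIntegrable_of_Icc hcd)
      ((slice_v hB u hu).intervalIntegrable_of_Icc hcd)
  rw [e3, e1, e2]
  ring

theorem sq_intervalIntegral_le {g : ℝ → ℝ} {a b : ℝ} (hab : a ≤ b)
    (hg : ContinuousOn g (Icc a b)) :
    (∫ x in a..b, g x) ^ 2 ≤ (b - a) * ∫ x in a..b, g x ^ 2 := by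
  rcases hab.eq_or_lt with rfl | hlt
  · simp
  have hi : IntervalIntegrable g volume a b := hg.intervalIntegrable_of_Icc hab
  have hi2 : IntervalIntegrable (fun x => g x ^ 2) volume a b :=
    (hg.pow 2).intervalIntegrable_of_Icc hab
  set I := ∫ x in a..b, g x with hI
  have h0 : 0 ≤ ∫ x in a..b, ((b - a) * g x - I) ^ 2 :=
    intervalIntegral.integral_nonneg hab fun x _ => sq_nonneg _
  have h1 : ∫ x in a..b, ((b - a) * g x - I) ^ 2
      = (b - a) ^ 2 * (∫ x in a..b, g x ^ 2) - 2 * (b - a) * I * I + (b - a) * I ^ 2 := by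
    have : ∀ x, ((b - a) * g x - I) ^ 2
        = (b - a) ^ 2 * g x ^ 2 - 2 * (b - a) * I * g x + I ^ 2 := fun x => by ring
    simp_rw [this]
    rw [intervalIntegral.integral_add ((hi2.const_mul _).sub (hi.const_mul _)) (by simp),
      intervalIntegral.integral_sub (hi2.const_mul _) (hi.const_mul _),
      intervalIntegral.integral_const_mul, intervalIntegral.integral_const_mul,
      intervalIntegral.integral_const, ← hI]
    simp
  rw [h1] at h0
  have hpos : 0 < b - a := sub_pos.2 hlt
  have : 0 ≤ (b - a) * ((b - a) * (∫ x in a..b, g x ^ 2) - I ^ 2) := by nlinarith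
  have := nonneg_of_mul_nonneg_right this hpos
  linarith

/-- The Regge-Wheeler potential, in terms of `ρ = 1 / r`, with `lam = ℓ (ℓ + 1)`. -/
def potential (M lam ρ : ℝ) : ℝ := (1 - 2 * M * ρ) * ρ ^ 2 * (lam - 6 * M * ρ)

/-- The derivative of `potential` along `-Ω² ρ² ∂_ρ`. -/
def potentialDeriv (M lam ρ : ℝ) : ℝ :=
  -((1 - 2 * M * ρ) * ρ ^ 2) *
    (-(2 * M) * ρ ^ 2 * (lam - 6 * M * ρ) + (1 - 2 * M * ρ) * (2 * ρ) * (lam - 6 * M * ρ)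
      + (1 - 2 * M * ρ) * ρ ^ 2 * (-(6 * M)))

theorem hasDerivAt_potential (M lam : ℝ) {ρ : ℝ → ℝ} {t : ℝ}
    (h : HasDerivAt ρ (-((1 - 2 * M * ρ t) * ρ t ^ 2)) t) :
    HasDerivAt (fun t => potential M lam (ρ t)) (potentialDeriv M lam (ρ t)) t := by
  unfold potential
  have h1 := ((h.const_mul (2 * M)).const_sub 1)
  have h2 := ((h.const_mul (6 * M)).const_sub lam)
  refine ((h1.mul (h.fun_pow 2)).mul h2).congr_deriv ?_
  simp only [potentialDeriv, Pi.mul_apply]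
  ring

theorem IsRadius.inv_pos {M t₀ : ℝ} {R : ℝ → ℝ} (hR : IsRadius M t₀ R) {t : ℝ} (ht : t₀ ≤ t) :
    0 < (R t)⁻¹ := _root_.inv_pos.2 (hR.pos ht)

theorem IsRadius.inv_anti {M t₀ : ℝ} {R : ℝ → ℝ} (hR : IsRadius M t₀ R) {t t' : ℝ}
    (ht : t₀ ≤ t) (htt' : t ≤ t') : (R t')⁻¹ ≤ (R t)⁻¹ :=
  inv_anti₀ (hR.pos ht) (hR.monotoneOn ht (ht.trans htt') htt')

theorem IsRadius.lapse_inv_pos {M t₀ : ℝ} {R : ℝ → ℝ} (hR : IsRadius M t₀ R) {t : ℝ}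
    (ht : t₀ ≤ t) : 0 < 1 - 2 * M * (R t)⁻¹ := by
  simpa [div_eq_mul_inv] using hR.lapse_pos ht

theorem IsRadius.lapse_inv_le {M t₀ : ℝ} {R : ℝ → ℝ} (hR : IsRadius M t₀ R) {t : ℝ}
    (ht : t₀ ≤ t) : 1 - 2 * M * (R t)⁻¹ ≤ 1 := by
  simpa [div_eq_mul_inv] using hR.lapse_le_one ht

theorem IsRadius.lapse_inv_mono {M t₀ : ℝ} {R : ℝ → ℝ} (hR : IsRadius M t₀ R) {t t' : ℝ}
    (ht : t₀ ≤ t) (htt' : t ≤ t') : 1 - 2 * M * (R t)⁻¹ ≤ 1 - 2 * M * (R t')⁻¹ := by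
  simpa [div_eq_mul_inv] using hR.lapse_mono ht htt'

theorem le_potential {M lam ρ : ℝ} (hlam : 6 ≤ lam) (hρ : 0 ≤ 1 - 2 * M * ρ) :
    (1 - 2 * M * ρ) * ρ ^ 2 ≤ potential M lam ρ := by
  unfold potential
  have : 0 ≤ (1 - 2 * M * ρ) * ρ ^ 2 := by positivity
  nlinarith

theorem potential_le {M lam ρ : ℝ} (hM : 0 ≤ M) (hlam : 6 ≤ lam) (hρ : 0 ≤ ρ)
    (hρ' : 0 ≤ 1 - 2 * M * ρ) : potential M lam ρ ≤ lam * ρ ^ 2 := by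
  unfold potential
  have h1 : (1 - 2 * M * ρ) * ρ ^ 2 ≤ ρ ^ 2 := by
    have : 0 ≤ M * ρ := by positivity
    nlinarith [sq_nonneg ρ]
  have h2 : 0 ≤ lam - 6 * M * ρ := by nlinarith
  have h3 : lam - 6 * M * ρ ≤ lam := by nlinarith [mul_nonneg hM hρ]
  calc _ ≤ ρ ^ 2 * lam := mul_le_mul h1 h3 h2 (sq_nonneg _)
    _ = _ := by ring

theorem continuous_potential (M lam : ℝ) : Continuous (potential M lam) := by
  unfold potential; fun_prop

theorem continuous_potentialDeriv (M lam : ℝ) : Continuous (potentialDeriv M lam) := by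
  unfold potentialDeriv; fun_prop

/-- A solution of the inhomogeneous Regge-Wheeler equation `∂_u ∂_v e = - V e + F` on the region
`u ≤ u₀`, `v ≥ v₁`, given together with its first derivatives. -/
structure IsWave (M lam u₀ v₁ : ℝ) (R : ℝ → ℝ) (e eu ev F : ℝ → ℝ → ℝ) : Prop where
  deriv_u : ∀ u ≤ u₀, ∀ v ≥ v₁, HasDerivWithinAt (fun u' => e u' v) (eu u v) (Iic u₀) u
  deriv_v : ∀ u ≤ u₀, ∀ v ≥ v₁, HasDerivWithinAt (fun v' => e u v') (ev u v) (Ici v₁) v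
  deriv_uv : ∀ u ≤ u₀, ∀ v ≥ v₁, HasDerivWithinAt (fun v' => eu u v')
    (-potential M lam (R (v - u))⁻¹ * e u v + F u v) (Ici v₁) v
  deriv_vu : ∀ u ≤ u₀, ∀ v ≥ v₁, HasDerivWithinAt (fun u' => ev u' v)
    (-potential M lam (R (v - u))⁻¹ * e u v + F u v) (Iic u₀) u
  cont : ContinuousOn (Function.uncurry e) (Iic u₀ ×ˢ Ici v₁)
  cont_u : ContinuousOn (Function.uncurry eu) (Iic u₀ ×ˢ Ici v₁)
  cont_v : ContinuousOn (Function.uncurry ev) (Iic u₀ ×ˢ Ici v₁)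
  cont_F : ContinuousOn (Function.uncurry F) (Iic u₀ ×ˢ Ici v₁)

section
variable {M lam u₀ v₁ : ℝ} {R : ℝ → ℝ} (hR : IsRadius M (v₁ - u₀) R)
include hR

theorem IsRadius.hasDerivAt_inv_v {u v : ℝ} (hu : u ≤ u₀) (hv : v₁ ≤ v) :
    HasDerivAt (fun v' => (R (v' - u))⁻¹)
      (-((1 - 2 * M * (R (v - u))⁻¹) * (R (v - u))⁻¹ ^ 2)) v := by
  have h := hR.hasDerivAt_inv (t := v - u) (by linarith)
  refine (h.comp v ((hasDerivAt_id' v).sub_const u)).congr_deriv ?_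
  ring

theorem IsRadius.hasDerivAt_inv_u {u v : ℝ} (hu : u ≤ u₀) (hv : v₁ ≤ v) :
    HasDerivAt (fun u' => (R (v - u'))⁻¹)
      ((1 - 2 * M * (R (v - u))⁻¹) * (R (v - u))⁻¹ ^ 2) u := by
  have h := hR.hasDerivAt_inv (t := v - u) (by linarith)
  refine (h.comp u ((hasDerivAt_id' u).const_sub v)).congr_deriv ?_
  ring

theorem IsRadius.continuousOn_inv_v {u : ℝ} (hu : u ≤ u₀) :
    ContinuousOn (fun v => (R (v - u))⁻¹) (Ici v₁) := fun _ hv =>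
  (hR.hasDerivAt_inv_v hu hv).continuousAt.continuousWithinAt

theorem IsRadius.continuousOn_inv :
    ContinuousOn (fun p : ℝ × ℝ => (R (p.2 - p.1))⁻¹) (Iic u₀ ×ˢ Ici v₁) := by
  have h : ContinuousOn (fun t => (R t)⁻¹) (Ici (v₁ - u₀)) :=
    fun t ht => (hR.hasDerivAt_inv ht).continuousAt.continuousWithinAt
  refine h.comp (f := fun p : ℝ × ℝ => p.2 - p.1) (by fun_prop) fun p hp => ?_
  have := hp.1; have := hp.2
  simp only [mem_Iic, mem_Ici] at *
  linarith

/-- The integral of `Ω² ρ^(k+2)` along an outgoing cone. -/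
theorem IsRadius.integral_v_le (k : ℕ) {u V : ℝ} (hu : u ≤ u₀) (hV : v₁ ≤ V) :
    ∫ v in v₁..V, (1 - 2 * M * (R (v - u))⁻¹) * (R (v - u))⁻¹ ^ (k + 2)
      ≤ (R (v₁ - u))⁻¹ ^ (k + 1) := by
  have hc := (hR.continuousOn_inv_v hu).mono (Icc_subset_Ici_self (a := V))
  have h := integral_eq_sub_of_hasDerivWithinAt_Icc (a := v₁) (b := V)
    (f := fun v => -(R (v - u))⁻¹ ^ (k + 1) / (k + 1))
    (f' := fun v => (1 - 2 * M * (R (v - u))⁻¹) * (R (v - u))⁻¹ ^ (k + 2)) hV ?_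
    (by fun_prop)
  · rw [h]
    have h1 : 0 < (R (v₁ - u))⁻¹ := hR.inv_pos (by linarith)
    have h2 : 0 < (R (V - u))⁻¹ := hR.inv_pos (by linarith)
    have h4 : (R (V - u))⁻¹ ^ (k + 1) ≤ (R (v₁ - u))⁻¹ ^ (k + 1) :=
      pow_le_pow_left₀ h2.le (hR.inv_anti (by linarith) (by linarith)) _
    rw [neg_div, neg_div, sub_neg_eq_add, neg_add_eq_sub, ← sub_div,
      div_le_iff₀ (by positivity)]
    have h3 := pow_pos h1 (k + 1)
    have h5 := pow_pos h2 (k + 1)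
    nlinarith [mul_nonneg h3.le (Nat.cast_nonneg (α := ℝ) k)]
  · intro v hv
    refine ((((hR.hasDerivAt_inv_v hu hv.1).fun_pow (k + 1)).fun_neg).div_const
      (k + 1 : ℝ)).hasDerivWithinAt.congr_deriv ?_
    have : (k + 1 : ℝ) ≠ 0 := by positivity
    rw [Nat.add_sub_cancel]
    push_cast
    generalize (R _)⁻¹ = x
    field_simp
    ring

/-- The integral of `Ω² ρ^(k+2)` along an ingoing cone. -/
theorem IsRadius.integral_u_le (k : ℕ) {U u v : ℝ} (hU : U ≤ u) (hu : u ≤ u₀) (hv : v₁ ≤ v) :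
    ∫ u' in U..u, (1 - 2 * M * (R (v - u'))⁻¹) * (R (v - u'))⁻¹ ^ (k + 2)
      ≤ (R (v - u))⁻¹ ^ (k + 1) := by
  have hc : ContinuousOn (fun u' => (R (v - u'))⁻¹) (Icc U u) := fun u' hu' =>
    (hR.hasDerivAt_inv_u (hu'.2.trans hu) hv).continuousAt.continuousWithinAt
  have h := integral_eq_sub_of_hasDerivWithinAt_Icc (a := U) (b := u)
    (f := fun u' => (R (v - u'))⁻¹ ^ (k + 1) / (k + 1))
    (f' := fun u' => (1 - 2 * M * (R (v - u'))⁻¹) * (R (v - u'))⁻¹ ^ (k + 2)) hU ?_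
    (by fun_prop)
  · rw [h]
    have h1 : 0 < (R (v - u))⁻¹ := hR.inv_pos (by linarith)
    have h2 : 0 < (R (v - U))⁻¹ := hR.inv_pos (by linarith)
    rw [← sub_div, div_le_iff₀ (by positivity)]
    have h3 := pow_pos h1 (k + 1)
    have h5 := pow_pos h2 (k + 1)
    nlinarith [mul_nonneg h3.le (Nat.cast_nonneg (α := ℝ) k)]
  · intro u' hu'
    refine (((hR.hasDerivAt_inv_u (hu'.2.trans hu) hv).fun_pow (k + 1)).div_const
      (k + 1 : ℝ)).hasDerivWithinAt.congr_deriv ?_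
    have : (k + 1 : ℝ) ≠ 0 := by positivity
    rw [Nat.add_sub_cancel]
    push_cast
    generalize (R _)⁻¹ = x
    field_simp
    ring

end

/-- The pointwise inequality behind the energy estimate: the source terms are absorbed by the
derivative of the weight. -/
theorem two_mul_mul_le_of_weight {F a w K : ℝ} (hw : 0 < w) (h : F ^ 2 ≤ w * K) :
    2 * F * a ≤ K + w * a ^ 2 := by
  have h1 : 0 ≤ (F - w * a) ^ 2 := sq_nonneg _
  have h2 : w * (2 * F * a) ≤ w * (K + w * a ^ 2) := by nlinarith
  exact le_of_mul_le_mul_left h2 hw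

/-- The bulk term of the weighted energy identity is bounded by the product of a function of `v` and
a function of `u`.  Here `a`, `b`, `c` are the reciprocals of `r(u, v)`, `r(u', v₁)`, `r(u', v)`,
and `la`, `lb`, `lc` are the corresponding lapses. -/
theorem weighted_source_le {c₀ σ a b c la lb lc CF F x y e W κ : ℝ} {m : ℕ} (hc0 : 0 < c₀)
    (hσ0 : 0 < σ) (p1 : 0 < a) (p2 : 0 < b) (p3 : 0 < c) (q1 : c ≤ a) (q2 : c ≤ b) (l1 : c₀ ≤ la)
    (l2 : c₀ ≤ lb) (l4 : 0 < lc) (l3 : lc ≤ 1) (hF : |F| ≤ CF * (lc * c ^ 2) * b ^ m)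
    (hW : 0 ≤ W) (hκ : 0 < κ) (hκ1 : κ ≤ Real.exp 1) :
    κ * (2 * F * x - σ * (la * a ^ 2) * (x ^ 2 + W * e ^ 2)
        + (2 * F * y - σ * (lb * b ^ 2) * (y ^ 2 + W * e ^ 2)))
      ≤ Real.exp 1 * (2 * (CF ^ 2 * c₀⁻¹ ^ 3 * σ⁻¹)) * (la * a ^ 2 * (lb * b ^ (2 * m))) := by
  have hla : 0 < la := hc0.trans_le l1
  have hlb : 0 < lb := hc0.trans_le l2
  have hσ1 : σ⁻¹ * σ = 1 := inv_mul_cancel₀ hσ0.ne'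
  set Q := CF ^ 2 * c₀⁻¹ ^ 3 * σ⁻¹ * (la * a ^ 2 * (lb * b ^ (2 * m))) with hQ
  have hFsq : F ^ 2 ≤ CF ^ 2 * (c ^ 4 * b ^ (2 * m)) := by
    calc F ^ 2 = |F| ^ 2 := (sq_abs _).symm
      _ ≤ (CF * (lc * c ^ 2) * b ^ m) ^ 2 := pow_le_pow_left₀ (abs_nonneg _) hF 2
      _ = lc ^ 2 * (CF ^ 2 * (c ^ 4 * b ^ (2 * m))) := by ring
      _ ≤ 1 * (CF ^ 2 * (c ^ 4 * b ^ (2 * m))) := by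
          have : lc ^ 2 ≤ 1 := pow_le_one₀ l4.le l3
          gcongr
      _ = _ := one_mul _
  have key : ∀ {a b : ℝ}, c₀ ≤ a → c₀ ≤ b → 1 ≤ c₀⁻¹ ^ 3 * (a * a * b) := fun {a b} ha hb => by
    have ha0 : 0 < a := hc0.trans_le ha
    have h1 : c₀ * c₀ * c₀ ≤ a * a * b := by gcongr
    calc (1 : ℝ) = c₀⁻¹ ^ 3 * (c₀ * c₀ * c₀) := by field_simp
      _ ≤ _ := by gcongr
  have b1 : F ^ 2 ≤ σ * (la * a ^ 2) * Q := by
    refine hFsq.trans ?_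
    calc _ ≤ CF ^ 2 * (a ^ 4 * b ^ (2 * m)) * 1 := by rw [mul_one]; gcongr
      _ ≤ CF ^ 2 * (a ^ 4 * b ^ (2 * m)) * (c₀⁻¹ ^ 3 * (la * la * lb)) := by
          gcongr; exact key l1 l2
      _ = σ * (la * a ^ 2) * Q := by
          rw [hQ]
          linear_combination -(CF ^ 2 * (a ^ 4 * b ^ (2 * m)) * (c₀⁻¹ ^ 3 * (la * la * lb))) * hσ1
  have b2 : F ^ 2 ≤ σ * (lb * b ^ 2) * Q := by
    refine hFsq.trans ?_
    calc _ ≤ CF ^ 2 * (a ^ 2 * b ^ 2 * b ^ (2 * m)) * 1 := by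
          rw [mul_one, show c ^ 4 = c ^ 2 * c ^ 2 by ring]
          gcongr
      _ ≤ CF ^ 2 * (a ^ 2 * b ^ 2 * b ^ (2 * m)) * (c₀⁻¹ ^ 3 * (lb * lb * la)) := by
          gcongr; exact key l2 l1
      _ = σ * (lb * b ^ 2) * Q := by
          rw [hQ]
          linear_combination -(CF ^ 2 * (a ^ 2 * b ^ 2 * b ^ (2 * m))
            * (c₀⁻¹ ^ 3 * (lb * lb * la))) * hσ1
  have hw₁ : 0 < σ * (la * a ^ 2) := by positivity
  have hw₂ : 0 < σ * (lb * b ^ 2) := by positivity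
  have t1 := two_mul_mul_le_of_weight (a := x) hw₁ b1
  have t2 := two_mul_mul_le_of_weight (a := y) hw₂ b2
  have hWe : 0 ≤ W * e ^ 2 := by positivity
  have hQ0 : 0 ≤ Q := by positivity
  calc _ ≤ κ * (2 * Q) := by
        have := mul_nonneg hw₁.le hWe
        have := mul_nonneg hw₂.le hWe
        apply mul_le_mul_of_nonneg_left _ hκ.le
        linarith
    _ ≤ Real.exp 1 * (2 * Q) := by gcongr
    _ = _ := by rw [hQ]; ring

/-- The weighted energy inequality on a rectangle, before the initial data are bounded. -/
theorem IsWave.energy_rectangle {M lam u₀ v₁ : ℝ} {R : ℝ → ℝ} (hR : IsRadius M (v₁ - u₀) R)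
    (hlam : 6 ≤ lam) {e eu ev F : ℝ → ℝ → ℝ} (h : IsWave M lam u₀ v₁ R e eu ev F) {m : ℕ}
    (hm : 1 ≤ m) {CF : ℝ}
    (hF : ∀ u ≤ u₀, ∀ v ≥ v₁, |F u v| ≤ CF * ((1 - 2 * M * (R (v - u))⁻¹) * (R (v - u))⁻¹ ^ 2)
      * (R (v₁ - u))⁻¹ ^ m) {U u V : ℝ} (hU : U ≤ u) (hu : u ≤ u₀) (hV : v₁ ≤ V) :
    ∫ v in v₁..V, (ev u v ^ 2 + potential M lam (R (v - u))⁻¹ * e u v ^ 2)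
      ≤ Real.exp 2 * ((∫ u' in U..u, (eu u' v₁ ^ 2
            + potential M lam (R (v₁ - u'))⁻¹ * e u' v₁ ^ 2))
          + (∫ v in v₁..V, (ev U v ^ 2 + potential M lam (R (v - U))⁻¹ * e U v ^ 2))
          + 2 * CF ^ 2 * (1 - 2 * M * (R (v₁ - u₀))⁻¹)⁻¹ ^ 3 * (R (v₁ - u))⁻¹ ^ (2 * m + 1)) := by
  set c₀ := 1 - 2 * M * (R (v₁ - u₀))⁻¹ with hc₀
  have hc0 : 0 < c₀ := hR.lapse_inv_pos le_rfl
  set σ := R (v₁ - u) with hσ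
  have hσ0 : 0 < σ := hR.pos (by linarith)
  -- a weight which decreases in both variables, so that its derivatives absorb the source; on the
  -- scale `σ` of the final cone it stays between `e⁻¹` and `e`
  set κ : ℝ → ℝ → ℝ := fun u' v => Real.exp (σ * (R (v - u))⁻¹ - σ * (R (v₁ - u'))⁻¹) with hκ
  set w₁ : ℝ → ℝ := fun v => σ * ((1 - 2 * M * (R (v - u))⁻¹) * (R (v - u))⁻¹ ^ 2) with hw₁
  set w₂ : ℝ → ℝ := fun u' => σ * ((1 - 2 * M * (R (v₁ - u'))⁻¹) * (R (v₁ - u'))⁻¹ ^ 2) with hw₂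
  set J₁ : ℝ → ℝ → ℝ := fun u' v => eu u' v ^ 2 + potential M lam (R (v - u'))⁻¹ * e u' v ^ 2
    with hJ₁
  set J₂ : ℝ → ℝ → ℝ := fun u' v => ev u' v ^ 2 + potential M lam (R (v - u'))⁻¹ * e u' v ^ 2
    with hJ₂
  -- the derivatives of the weighted densities; in `A + B` the potential survives only in `J₁`, `J₂`
  set A : ℝ → ℝ → ℝ := fun u' v => κ u' v * (-w₁ v * J₁ u' v
    + (2 * eu u' v * (-potential M lam (R (v - u'))⁻¹ * e u' v + F u' v)
      + potentialDeriv M lam (R (v - u'))⁻¹ * e u' v ^ 2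
      + 2 * potential M lam (R (v - u'))⁻¹ * e u' v * ev u' v)) with hA
  set B : ℝ → ℝ → ℝ := fun u' v => κ u' v * (-w₂ u' * J₂ u' v
    + (2 * ev u' v * (-potential M lam (R (v - u'))⁻¹ * e u' v + F u' v)
      - potentialDeriv M lam (R (v - u'))⁻¹ * e u' v ^ 2
      + 2 * potential M lam (R (v - u'))⁻¹ * e u' v * eu u' v)) with hB
  set S : Set (ℝ × ℝ) := Icc U u ×ˢ Icc v₁ V
  have hsub : S ⊆ Iic u₀ ×ˢ Ici v₁ := fun p hp => ⟨hp.1.2.trans hu, hp.2.1⟩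
  have ce : ContinuousOn (fun p : ℝ × ℝ => e p.1 p.2) S := h.cont.mono hsub
  have ceu : ContinuousOn (fun p : ℝ × ℝ => eu p.1 p.2) S := h.cont_u.mono hsub
  have cev : ContinuousOn (fun p : ℝ × ℝ => ev p.1 p.2) S := h.cont_v.mono hsub
  have cF : ContinuousOn (fun p : ℝ × ℝ => F p.1 p.2) S := h.cont_F.mono hsub
  have cρ : ContinuousOn (fun p : ℝ × ℝ => (R (p.2 - p.1))⁻¹) S := hR.continuousOn_inv.mono hsub
  have cρu : ContinuousOn (fun p : ℝ × ℝ => (R (p.2 - u))⁻¹) S :=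
    hR.continuousOn_inv.comp (f := fun p : ℝ × ℝ => (u, p.2)) (by fun_prop)
      fun p hp => ⟨hu, hp.2.1⟩
  have cρv : ContinuousOn (fun p : ℝ × ℝ => (R (v₁ - p.1))⁻¹) S :=
    hR.continuousOn_inv.comp (f := fun p : ℝ × ℝ => (p.1, v₁)) (by fun_prop)
      fun p hp => ⟨hp.1.2.trans hu, le_refl v₁⟩
  have cV : ContinuousOn (fun p : ℝ × ℝ => potential M lam (R (p.2 - p.1))⁻¹) S :=
    (continuous_potential M lam).comp_continuousOn cρ
  have cV' : ContinuousOn (fun p : ℝ × ℝ => potentialDeriv M lam (R (p.2 - p.1))⁻¹) S :=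
    (continuous_potentialDeriv M lam).comp_continuousOn cρ
  have cκ : ContinuousOn (fun p : ℝ × ℝ => κ p.1 p.2) S := by
    simp only [hκ]; fun_prop
  have cw₁ : ContinuousOn (fun p : ℝ × ℝ => w₁ p.2) S := by simp only [hw₁]; fun_prop
  have cw₂ : ContinuousOn (fun p : ℝ × ℝ => w₂ p.1) S := by simp only [hw₂]; fun_prop
  have cJ₁ : ContinuousOn (fun p : ℝ × ℝ => J₁ p.1 p.2) S := by simp only [hJ₁]; fun_prop
  have cJ₂ : ContinuousOn (fun p : ℝ × ℝ => J₂ p.1 p.2) S := by simp only [hJ₂]; fun_prop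
  have cA : ContinuousOn (Function.uncurry A) S := by
    exact cκ.mul ((cw₁.neg.mul cJ₁).add ((((continuousOn_const.mul ceu).mul
      ((cV.neg.mul ce).add cF)).add (cV'.mul (ce.pow 2))).add
      (((continuousOn_const.mul cV).mul ce).mul cev)))
  have cB : ContinuousOn (Function.uncurry B) S := by
    exact cκ.mul ((cw₂.neg.mul cJ₂).add ((((continuousOn_const.mul cev).mul
      ((cV.neg.mul ce).add cF)).sub (cV'.mul (ce.pow 2))).add
      (((continuousOn_const.mul cV).mul ce).mul ceu)))
  have dA : ∀ u' ∈ Icc U u, ∀ v ∈ Icc v₁ V,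
      HasDerivWithinAt (fun v => κ u' v * J₁ u' v) (A u' v) (Icc v₁ V) v := by
    intro u' hu' v hv
    have hu'0 := hu'.2.trans hu
    have d1 := (((hR.hasDerivAt_inv_v hu hv.1).const_mul σ).sub_const
      (σ * (R (v₁ - u'))⁻¹)).exp.hasDerivWithinAt (s := Icc v₁ V)
    have d2 := (h.deriv_uv u' hu'0 v hv.1).mono (show Icc v₁ V ⊆ Ici v₁ from fun x hx => hx.1)
    have d3 := (h.deriv_v u' hu'0 v hv.1).mono (show Icc v₁ V ⊆ Ici v₁ from fun x hx => hx.1)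
    have d4 := (hasDerivAt_potential M lam (ρ := fun v => (R (v - u'))⁻¹)
      (hR.hasDerivAt_inv_v hu'0 hv.1)).hasDerivWithinAt (s := Icc v₁ V)
    refine (d1.mul ((d2.fun_pow 2).add (d4.mul (d3.fun_pow 2)))).congr_deriv ?_
    simp only [hA, hκ, hw₁, hJ₁, Pi.add_apply, Pi.mul_apply]
    ring
  have dB : ∀ u' ∈ Icc U u, ∀ v ∈ Icc v₁ V,
      HasDerivWithinAt (fun u' => κ u' v * J₂ u' v) (B u' v) (Icc U u) u' := by
    intro u' hu' v hv
    have hu'0 := hu'.2.trans hu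
    have hsub' : Icc U u ⊆ Iic u₀ := fun x hx => hx.2.trans hu
    have d1 := (((hR.hasDerivAt_inv_u hu'0 le_rfl).const_mul σ).const_sub
      (σ * (R (v - u))⁻¹)).exp.hasDerivWithinAt (s := Icc U u)
    have d2 := (h.deriv_vu u' hu'0 v hv.1).mono hsub'
    have d3 := (h.deriv_u u' hu'0 v hv.1).mono hsub'
    have d4 := ((hasDerivAt_potential M lam (ρ := fun t => (R t)⁻¹)
      (hR.hasDerivAt_inv (t := v - u') (by linarith [hv.1]))).comp u'
        ((hasDerivAt_id' u').const_sub v)).hasDerivWithinAt (s := Icc U u)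
    refine (d1.mul ((d2.fun_pow 2).add (d4.mul (d3.fun_pow 2)))).congr_deriv ?_
    simp only [hB, hκ, hw₂, hJ₂, Pi.add_apply, Pi.mul_apply, Function.comp]
    ring
  have green := rectangle_green (X := fun u' v => κ u' v * J₁ u' v)
    (Y := fun u' v => κ u' v * J₂ u' v) hU hV dA dB (cκ.mul cJ₁) (cκ.mul cJ₂) cA cB
  -- bounds for the weight
  have hκle : ∀ u' ∈ Icc U u, ∀ v ∈ Icc v₁ V, κ u' v ≤ Real.exp 1 := by
    intro u' hu' v hv
    apply Real.exp_le_exp.2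
    have h1 : (R (v - u))⁻¹ ≤ σ⁻¹ := hR.inv_anti (by linarith) (by linarith [hv.1])
    have h2 : 0 < (R (v₁ - u'))⁻¹ := hR.inv_pos (by linarith [hu'.2])
    have h3 : σ * (R (v - u))⁻¹ ≤ 1 := by
      calc _ ≤ σ * σ⁻¹ := by gcongr
        _ = 1 := mul_inv_cancel₀ hσ0.ne'
    nlinarith
  have hκge : ∀ v ∈ Icc v₁ V, Real.exp (-1) ≤ κ u v := by
    intro v hv
    apply Real.exp_le_exp.2
    have h2 : 0 < (R (v - u))⁻¹ := hR.inv_pos (by linarith [hv.1])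
    have h3 : σ * (R (v₁ - u))⁻¹ = 1 := mul_inv_cancel₀ hσ0.ne'
    nlinarith
  have hV0 : ∀ u' ∈ Icc U u, ∀ v ∈ Icc v₁ V, 0 ≤ potential M lam (R (v - u'))⁻¹ :=
    fun u' hu' v hv => by
      have h1 := hR.lapse_inv_pos (t := v - u') (by linarith [hu'.2, hv.1])
      exact le_trans (by positivity) (le_potential hlam h1.le)
  have hJ₁0 : ∀ u' ∈ Icc U u, ∀ v ∈ Icc v₁ V, 0 ≤ J₁ u' v := fun u' hu' v hv =>
    add_nonneg (sq_nonneg _) (mul_nonneg (hV0 u' hu' v hv) (sq_nonneg _))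
  have hJ₂0 : ∀ u' ∈ Icc U u, ∀ v ∈ Icc v₁ V, 0 ≤ J₂ u' v := fun u' hu' v hv =>
    add_nonneg (sq_nonneg _) (mul_nonneg (hV0 u' hu' v hv) (sq_nonneg _))
  -- the source is bounded by a product of a function of `v` and a function of `u`
  set D : ℝ := 2 * (CF ^ 2 * c₀⁻¹ ^ 3 * σ⁻¹) with hD
  set av : ℝ → ℝ := fun v => (1 - 2 * M * (R (v - u))⁻¹) * (R (v - u))⁻¹ ^ 2 with hav
  set bu : ℝ → ℝ := fun u' => (1 - 2 * M * (R (v₁ - u'))⁻¹) * (R (v₁ - u'))⁻¹ ^ (2 * m) with hbu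
  have hsource : ∀ u' ∈ Icc U u, ∀ v ∈ Icc v₁ V,
      A u' v + B u' v ≤ Real.exp 1 * D * (av v * bu u') := by
    intro u' hu' v hv
    have hu'0 := hu'.2.trans hu
    have hF' := hF u' hu'0 v hv.1
    have p1 : 0 < (R (v - u))⁻¹ := hR.inv_pos (by linarith [hv.1])
    have p2 : 0 < (R (v₁ - u'))⁻¹ := hR.inv_pos (by linarith)
    have p3 : 0 < (R (v - u'))⁻¹ := hR.inv_pos (by linarith [hv.1])
    have q1 : (R (v - u'))⁻¹ ≤ (R (v - u))⁻¹ := hR.inv_anti (by linarith [hv.1]) (by linarith [hu'.2])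
    have q2 : (R (v - u'))⁻¹ ≤ (R (v₁ - u'))⁻¹ := hR.inv_anti (by linarith [hv.1]) (by linarith [hv.1])
    have l1 : c₀ ≤ 1 - 2 * M * (R (v - u))⁻¹ := hR.lapse_inv_mono le_rfl (by linarith [hv.1])
    have l2 : c₀ ≤ 1 - 2 * M * (R (v₁ - u'))⁻¹ := hR.lapse_inv_mono le_rfl (by linarith [hv.1])
    have l3 : 1 - 2 * M * (R (v - u'))⁻¹ ≤ 1 := hR.lapse_inv_le (by linarith [hv.1])
    have l4 : 0 < 1 - 2 * M * (R (v - u'))⁻¹ := hR.lapse_inv_pos (by linarith [hv.1])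
    have hpt := weighted_source_le (x := eu u' v) (y := ev u' v) (e := e u' v) hc0 hσ0 p1 p2 p3 q1
      q2 l1 l2 l4 l3 hF' (hV0 u' hu' v hv) (Real.exp_pos _) (hκle u' hu' v hv)
    calc A u' v + B u' v = κ u' v * (2 * F u' v * eu u' v - w₁ v * J₁ u' v
          + (2 * F u' v * ev u' v - w₂ u' * J₂ u' v)) := by
          simp only [hA, hB]; ring
      _ ≤ _ := hpt
  have slice_v : ∀ {Z : ℝ × ℝ → ℝ}, ContinuousOn Z S →
      ∀ u' ∈ Icc U u, IntervalIntegrable (fun v => Z (u', v)) volume v₁ V := fun hZ u' hu' =>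
    (hZ.comp (f := fun v => (u', v)) (by fun_prop)
      fun v hv => ⟨hu', hv⟩).intervalIntegrable_of_Icc hV
  have slice_u : ∀ {Z : ℝ × ℝ → ℝ}, ContinuousOn Z S →
      ∀ v ∈ Icc v₁ V, IntervalIntegrable (fun u' => Z (u', v)) volume U u := fun hZ v hv =>
    (hZ.comp (f := fun u' => (u', v)) (by fun_prop)
      fun u' hu' => ⟨hu', hv⟩).intervalIntegrable_of_Icc hU
  have hle : ∫ u' in U..u, ∫ v in v₁..V, (A u' v + B u' v)
      ≤ ∫ u' in U..u, ∫ v in v₁..V, Real.exp 1 * D * (av v * bu u') := by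
    have cAB : ContinuousOn (fun p : ℝ × ℝ => A p.1 p.2 + B p.1 p.2) S := cA.add cB
    have cav : ContinuousOn (fun p : ℝ × ℝ => Real.exp 1 * D * (av p.2 * bu p.1)) S := by
      simp only [hav, hbu]; fun_prop
    have outer : ∀ {Z : ℝ × ℝ → ℝ}, ContinuousOn Z S →
        IntervalIntegrable (fun u' => ∫ v in v₁..V, Z (u', v)) volume U u := fun {Z} hZ => by
      have hi : IntegrableOn Z (Ioc U u ×ˢ Ioc v₁ V) :=
        (hZ.integrableOn_compact (isCompact_Icc.prod isCompact_Icc)).mono_set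
          (prod_mono Ioc_subset_Icc_self Ioc_subset_Icc_self)
      rw [IntegrableOn, Measure.volume_eq_prod, ← Measure.prod_restrict] at hi
      rw [intervalIntegrable_iff, uIoc_of_le hU]
      simp_rw [intervalIntegral.integral_of_le hV]
      exact hi.integral_prod_left
    refine integral_mono_on hU (outer cAB) (outer cav) fun u' hu' => ?_
    exact integral_mono_on hV (slice_v cAB u' hu') (slice_v cav u' hu')
      fun v hv => hsource u' hu' v hv
  have hprod : ∫ u' in U..u, ∫ v in v₁..V, Real.exp 1 * D * (av v * bu u')
      ≤ Real.exp 1 * (2 * CF ^ 2 * c₀⁻¹ ^ 3 * σ⁻¹ ^ (2 * m + 1)) := by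
    have e1 : ∫ u' in U..u, ∫ v in v₁..V, Real.exp 1 * D * (av v * bu u')
        = Real.exp 1 * D * ((∫ v in v₁..V, av v) * ∫ u' in U..u, bu u') := by
      simp_rw [intervalIntegral.integral_const_mul, intervalIntegral.integral_mul_const]
      rw [intervalIntegral.integral_const_mul]
    rw [e1]
    have h1 := hR.integral_v_le 0 hu hV
    obtain ⟨j, hj⟩ : ∃ j, 2 * m = j + 2 := ⟨2 * m - 2, by omega⟩
    have h2 := hR.integral_u_le j hU hu (le_refl v₁)
    rw [← hj] at h2
    have h3 : 0 ≤ ∫ u' in U..u, bu u' := intervalIntegral.integral_nonneg hU fun u' hu' => by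
      have := hR.lapse_inv_pos (t := v₁ - u') (by linarith [hu'.2])
      have := hR.inv_pos (t := v₁ - u') (by linarith [hu'.2])
      simp only [hbu]; positivity
    calc _ ≤ Real.exp 1 * D * (σ⁻¹ ^ (0 + 1) * σ⁻¹ ^ (j + 1)) := by
          gcongr
      _ = _ := by
          rw [show 2 * m + 1 = j + 3 by omega]
          simp only [hD]; ring
  -- conclusion
  have g1 : ∫ u' in U..u, κ u' V * J₁ u' V ≥ 0 := intervalIntegral.integral_nonneg hU
    fun u' hu' => mul_nonneg (Real.exp_pos _).le (hJ₁0 u' hu' V ⟨hV, le_rfl⟩)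
  have g2 : ∫ u' in U..u, κ u' v₁ * J₁ u' v₁ ≤ Real.exp 1 * ∫ u' in U..u, J₁ u' v₁ := by
    rw [← intervalIntegral.integral_const_mul]
    refine integral_mono_on hU (slice_u (cκ.mul cJ₁) v₁ ⟨le_rfl, hV⟩)
      ((slice_u cJ₁ v₁ ⟨le_rfl, hV⟩).const_mul _) fun u' hu' => ?_
    exact mul_le_mul_of_nonneg_right (hκle u' hu' v₁ ⟨le_rfl, hV⟩) (hJ₁0 u' hu' v₁ ⟨le_rfl, hV⟩)
  have g3 : ∫ v in v₁..V, κ U v * J₂ U v ≤ Real.exp 1 * ∫ v in v₁..V, J₂ U v := by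
    rw [← intervalIntegral.integral_const_mul]
    refine integral_mono_on hV (slice_v (cκ.mul cJ₂) U ⟨le_rfl, hU⟩)
      ((slice_v cJ₂ U ⟨le_rfl, hU⟩).const_mul _) fun v hv => ?_
    exact mul_le_mul_of_nonneg_right (hκle U ⟨le_rfl, hU⟩ v hv) (hJ₂0 U ⟨le_rfl, hU⟩ v hv)
  have g4 : Real.exp (-1) * ∫ v in v₁..V, J₂ u v ≤ ∫ v in v₁..V, κ u v * J₂ u v := by
    rw [← intervalIntegral.integral_const_mul]
    refine integral_mono_on hV ((slice_v cJ₂ u ⟨hU, le_rfl⟩).const_mul _)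
      (slice_v (cκ.mul cJ₂) u ⟨hU, le_rfl⟩) fun v hv => ?_
    exact mul_le_mul_of_nonneg_right (hκge v hv) (hJ₂0 u ⟨hU, le_rfl⟩ v hv)
  have hfin : Real.exp (-1) * ∫ v in v₁..V, J₂ u v
      ≤ Real.exp 1 * ((∫ u' in U..u, J₁ u' v₁) + (∫ v in v₁..V, J₂ U v)
        + 2 * CF ^ 2 * c₀⁻¹ ^ 3 * σ⁻¹ ^ (2 * m + 1)) := by
    have := hle.trans hprod
    rw [← green] at this
    linarith
  have hexp : Real.exp 1 * Real.exp (-1) = 1 := by rw [← Real.exp_add]; simp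
  have hexp2 : Real.exp 1 * Real.exp 1 = Real.exp 2 := by rw [← Real.exp_add]; norm_num
  calc ∫ v in v₁..V, J₂ u v = Real.exp 1 * (Real.exp (-1) * ∫ v in v₁..V, J₂ u v) := by
        rw [← mul_assoc, hexp, one_mul]
    _ ≤ Real.exp 1 * (Real.exp 1 * ((∫ u' in U..u, J₁ u' v₁) + (∫ v in v₁..V, J₂ U v)
        + 2 * CF ^ 2 * c₀⁻¹ ^ 3 * σ⁻¹ ^ (2 * m + 1))) := by gcongr
    _ = _ := by rw [← mul_assoc, hexp2]

theorem IsWave.continuousOn_v {M lam u₀ v₁ : ℝ} {R : ℝ → ℝ} {e eu ev F : ℝ → ℝ → ℝ}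
    (h : IsWave M lam u₀ v₁ R e eu ev F)
    {u : ℝ} (hu : u ≤ u₀) : ContinuousOn (e u) (Ici v₁) ∧ ContinuousOn (ev u) (Ici v₁) :=
  ⟨h.cont.comp (f := fun v => (u, v)) (by fun_prop) fun _ hv => ⟨hu, hv⟩,
    h.cont_v.comp (f := fun v => (u, v)) (by fun_prop) fun _ hv => ⟨hu, hv⟩⟩

section
variable {M lam u₀ v₁ : ℝ} {R : ℝ → ℝ} (hR : IsRadius M (v₁ - u₀) R)
include hR

theorem IsRadius.tendsto_inv_atBot (v : ℝ) : Tendsto (fun u => (R (v - u))⁻¹) atBot (𝓝 0) :=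
  hR.tendsto_inv.comp (tendsto_atTop_add_const_left _ _ tendsto_neg_atBot_atTop)

theorem IsRadius.tendsto_inv_atTop (u : ℝ) : Tendsto (fun v => (R (v - u))⁻¹) atTop (𝓝 0) :=
  hR.tendsto_inv.comp (tendsto_atTop_add_const_right _ (-u) tendsto_id)

/-- Square integrals along incoming rays are insensitive to perturbations of size `r₀⁻¹`. -/
theorem IsRadius.tendsto_integral_sq_of_sub {χ e : ℝ → ℝ → ℝ} {K V : ℝ} (hV : v₁ ≤ V)
    (hχ : ContinuousOn (Function.uncurry χ) (Iic u₀ ×ˢ Ici v₁))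
    (he : ContinuousOn (Function.uncurry e) (Iic u₀ ×ˢ Ici v₁))
    (hK : ∀ u ≤ u₀, ∀ v ≥ v₁, |χ u v - e u v| ≤ K * (R (v₁ - u))⁻¹)
    (h : Tendsto (fun u => ∫ v in v₁..V, χ u v ^ 2) atBot (𝓝 0)) :
    Tendsto (fun u => ∫ v in v₁..V, e u v ^ 2) atBot (𝓝 0) := by
  have hlim : Tendsto (fun U => 2 * (∫ v in v₁..V, χ U v ^ 2)
      + 2 * (K * (R (v₁ - U))⁻¹) ^ 2 * (V - v₁)) atBot (𝓝 0) := by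
    have := (h.const_mul 2).add
      (((((hR.tendsto_inv_atBot v₁).const_mul K).pow 2).const_mul 2).mul_const (V - v₁))
    simpa using this
  refine tendsto_of_tendsto_of_tendsto_of_le_of_le' tendsto_const_nhds hlim ?_ ?_
  · exact Eventually.of_forall fun U =>
      intervalIntegral.integral_nonneg hV fun v _ => sq_nonneg _
  · filter_upwards [eventually_le_atBot u₀] with U hU
    have cχ : ContinuousOn (χ U) (Icc v₁ V) :=
      hχ.comp (f := fun v => (U, v)) (by fun_prop) fun _ hv => ⟨hU, hv.1⟩
    have ce : ContinuousOn (e U) (Icc v₁ V) :=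
      he.comp (f := fun v => (U, v)) (by fun_prop) fun _ hv => ⟨hU, hv.1⟩
    have i1 : IntervalIntegrable (fun v => 2 * χ U v ^ 2) volume v₁ V :=
      (continuousOn_const.mul (cχ.pow 2)).intervalIntegrable_of_Icc hV
    calc ∫ v in v₁..V, e U v ^ 2
        ≤ ∫ v in v₁..V, (2 * χ U v ^ 2 + 2 * (K * (R (v₁ - U))⁻¹) ^ 2) := by
          refine integral_mono_on hV
            ((ce.pow 2).intervalIntegrable_of_Icc hV) (i1.add intervalIntegrable_const)
            fun v hv => ?_
          have e5 := sq_le_sq.2 ((hK U hU v hv.1).trans (le_abs_self _))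
          nlinarith [sq_nonneg (χ U v + (χ U v - e U v))]
      _ = _ := by
          rw [intervalIntegral.integral_add i1 intervalIntegrable_const]
          simp only [intervalIntegral.integral_const_mul, intervalIntegral.integral_const,
            smul_eq_mul]
          ring

/-- Without incoming radiation the energy on a cone `u = U` vanishes as `U → -∞`. -/
theorem IsWave.tendsto_energy (hlam : 6 ≤ lam) {e eu ev F : ℝ → ℝ → ℝ}
    (h : IsWave M lam u₀ v₁ R e eu ev F)
    (h0 : Tendsto (fun U => e U v₁) atBot (𝓝 0)) {V : ℝ} (hV : v₁ ≤ V)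
    (hin : Tendsto (fun U => ∫ v in v₁..V, ev U v ^ 2) atBot (𝓝 0)) :
    Tendsto (fun U => ∫ v in v₁..V, (ev U v ^ 2 + potential M lam (R (v - U))⁻¹ * e U v ^ 2))
      atBot (𝓝 0) := by
  have hlim : Tendsto (fun U => (∫ v in v₁..V, ev U v ^ 2)
      + lam * (R (v₁ - U))⁻¹ ^ 2 * (2 * e U v₁ ^ 2 + 2 * (V - v₁) * ∫ v in v₁..V, ev U v ^ 2)
        * (V - v₁)) atBot (𝓝 0) := by
    have := hin.add ((((hR.tendsto_inv_atBot v₁).pow 2).const_mul lam).mul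
      (((h0.pow 2).const_mul 2).add (hin.const_mul (2 * (V - v₁)))) |>.mul_const (V - v₁))
    simpa using this
  refine tendsto_of_tendsto_of_tendsto_of_le_of_le' tendsto_const_nhds hlim ?_ ?_
  · filter_upwards [eventually_le_atBot u₀] with U hU
    refine intervalIntegral.integral_nonneg hV fun v hv => ?_
    have h1 := hR.lapse_inv_pos (t := v - U) (by linarith [hv.1])
    have h3 : 0 ≤ potential M lam (R (v - U))⁻¹ := le_trans (by positivity) (le_potential hlam h1.le)
    positivity
  · filter_upwards [eventually_le_atBot u₀] with U hU
    obtain ⟨ce, cev⟩ := h.continuousOn_v hU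
    have hsub : Icc v₁ V ⊆ Ici v₁ := fun _ hx => hx.1
    have ce' := ce.mono hsub
    have cev' := cev.mono hsub
    have cρ : ContinuousOn (fun v => potential M lam (R (v - U))⁻¹) (Icc v₁ V) :=
      (continuous_potential M lam).comp_continuousOn ((hR.continuousOn_inv_v hU).mono hsub)
    have i1 : IntervalIntegrable (fun v => ev U v ^ 2) volume v₁ V :=
      (cev'.pow 2).intervalIntegrable_of_Icc hV
    have i2 : IntervalIntegrable (fun v => potential M lam (R (v - U))⁻¹ * e U v ^ 2)
      volume v₁ V := (cρ.mul (ce'.pow 2)).intervalIntegrable_of_Icc hV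
    rw [intervalIntegral.integral_add i1 i2]
    gcongr
    set I := ∫ v in v₁..V, ev U v ^ 2
    have hbound : ∀ v ∈ Icc v₁ V, potential M lam (R (v - U))⁻¹ * e U v ^ 2
        ≤ lam * (R (v₁ - U))⁻¹ ^ 2 * (2 * e U v₁ ^ 2 + 2 * (V - v₁) * I) := by
      intro v hv
      have h1 := hR.lapse_inv_pos (t := v - U) (by linarith [hv.1])
      have p := hR.inv_pos (t := v - U) (by linarith [hv.1])
      have q : (R (v - U))⁻¹ ≤ (R (v₁ - U))⁻¹ := hR.inv_anti (by linarith) (by linarith [hv.1])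
      have h2 : potential M lam (R (v - U))⁻¹ ≤ lam * (R (v₁ - U))⁻¹ ^ 2 :=
        (potential_le hR.nonneg hlam p.le h1.le).trans (by gcongr)
      have h3 : ∫ x in v₁..v, ev U x = e U v - e U v₁ :=
        integral_eq_sub_of_hasDerivWithinAt_Icc hv.1
          (fun x hx => (h.deriv_v U hU x hx.1).mono fun _ hy => hy.1)
          (cev.mono fun _ hy => hy.1)
      have h4 := sq_intervalIntegral_le hv.1 (cev'.mono (Icc_subset_Icc_right hv.2))
      rw [h3] at h4
      have h5 : ∫ x in v₁..v, ev U x ^ 2 ≤ I := by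
        apply intervalIntegral.integral_mono_interval le_rfl hv.1 hv.2
        · exact Eventually.of_forall fun x => sq_nonneg _
        · exact (cev'.pow 2).intervalIntegrable_of_Icc hV
      have h6 : 0 ≤ ∫ x in v₁..v, ev U x ^ 2 :=
        intervalIntegral.integral_nonneg hv.1 fun x _ => sq_nonneg _
      have h7 : (v - v₁) * (∫ x in v₁..v, ev U x ^ 2) ≤ (V - v₁) * I :=
        mul_le_mul (by linarith [hv.2]) h5 h6 (by linarith)
      have h8 : e U v ^ 2 ≤ 2 * e U v₁ ^ 2 + 2 * (V - v₁) * I := by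
        nlinarith [sq_nonneg (e U v - 2 * e U v₁)]
      exact mul_le_mul h2 h8 (sq_nonneg _) (by positivity)
    calc _ ≤ ∫ v in v₁..V, lam * (R (v₁ - U))⁻¹ ^ 2 * (2 * e U v₁ ^ 2 + 2 * (V - v₁) * I) :=
          integral_mono_on hV ((cρ.mul (ce'.pow 2)).intervalIntegrable_of_Icc hV)
            (by simp) hbound
      _ = _ := by rw [intervalIntegral.integral_const, smul_eq_mul]; ring

/-- The energy estimate: with data of size `r₀^(-m)` on the initial cone, without incoming
radiation and with a source of size `Ω² r^(-2) r₀^(-m)`, the flux through outgoing cones is of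
size `r₀^(-2m-1)`. -/
theorem IsWave.flux_le (hlam : 6 ≤ lam) {e eu ev F : ℝ → ℝ → ℝ}
    (h : IsWave M lam u₀ v₁ R e eu ev F) {m : ℕ} (hm : 1 ≤ m) {CF Ce : ℝ}
    (hF : ∀ u ≤ u₀, ∀ v ≥ v₁, |F u v| ≤ CF * ((1 - 2 * M * (R (v - u))⁻¹) * (R (v - u))⁻¹ ^ 2)
      * (R (v₁ - u))⁻¹ ^ m)
    (he : ∀ u ≤ u₀, |e u v₁| ≤ Ce * (R (v₁ - u))⁻¹ ^ m)
    (heu : ∀ u ≤ u₀, |eu u v₁| ≤ Ce * (R (v₁ - u))⁻¹ ^ (m + 1))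
    (hin : ∀ V ≥ v₁, Tendsto (fun U => ∫ v in v₁..V, ev U v ^ 2) atBot (𝓝 0)) :
    ∃ K, ∀ u ≤ u₀, ∀ V ≥ v₁,
      ∫ v in v₁..V, (1 - 2 * M * (R (v - u))⁻¹) * (R (v - u))⁻¹ ^ 2 * e u v ^ 2
        ≤ K * (R (v₁ - u))⁻¹ ^ (2 * m + 1) := by
  set c₀ := 1 - 2 * M * (R (v₁ - u₀))⁻¹
  have hc0 : 0 < c₀ := hR.lapse_inv_pos le_rfl
  have h0 : Tendsto (fun U => e U v₁) atBot (𝓝 0) := by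
    have h1 : Tendsto (fun U => Ce * (R (v₁ - U))⁻¹ ^ m) atBot (𝓝 0) := by
      simpa [show m ≠ 0 by omega] using ((hR.tendsto_inv_atBot v₁).pow m).const_mul Ce
    refine squeeze_zero_norm' ?_ h1
    filter_upwards [eventually_le_atBot u₀] with U hU using he U hU
  set D := (1 + lam) * Ce ^ 2 * c₀⁻¹ with hD
  refine ⟨Real.exp 2 * (D + 2 * CF ^ 2 * c₀⁻¹ ^ 3), fun u hu V hV => ?_⟩
  have hsub : Icc v₁ V ⊆ Ici v₁ := fun _ hx => hx.1
  have hflux : ∀ U ≤ u, ∫ v in v₁..V, (ev u v ^ 2 + potential M lam (R (v - u))⁻¹ * e u v ^ 2)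
      ≤ Real.exp 2 * (D * (R (v₁ - u))⁻¹ ^ (2 * m + 1)
          + (∫ v in v₁..V, (ev U v ^ 2 + potential M lam (R (v - U))⁻¹ * e U v ^ 2))
          + 2 * CF ^ 2 * c₀⁻¹ ^ 3 * (R (v₁ - u))⁻¹ ^ (2 * m + 1)) := by
    intro U hU
    refine (h.energy_rectangle hR hlam hm hF hU hu hV).trans ?_
    gcongr
    have hsub' : Icc U u ⊆ Iic u₀ := fun _ hx => hx.2.trans hu
    have cρ : ContinuousOn (fun u' => (R (v₁ - u'))⁻¹) (Icc U u) := fun u' hu' =>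
      (hR.hasDerivAt_inv_u (hu'.2.trans hu) le_rfl).continuousAt.continuousWithinAt
    have ce : ContinuousOn (fun u' => e u' v₁) (Icc U u) :=
      h.cont.comp (f := fun u' => (u', v₁)) (by fun_prop) fun _ hx => ⟨hsub' hx, le_refl v₁⟩
    have ceu : ContinuousOn (fun u' => eu u' v₁) (Icc U u) :=
      h.cont_u.comp (f := fun u' => (u', v₁)) (by fun_prop) fun _ hx => ⟨hsub' hx, le_refl v₁⟩
    have cV : ContinuousOn (fun u' => potential M lam (R (v₁ - u'))⁻¹) (Icc U u) :=
      (continuous_potential M lam).comp_continuousOn cρ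
    have hb : ∀ u' ∈ Icc U u, eu u' v₁ ^ 2 + potential M lam (R (v₁ - u'))⁻¹ * e u' v₁ ^ 2
        ≤ D * ((1 - 2 * M * (R (v₁ - u'))⁻¹) * (R (v₁ - u'))⁻¹ ^ (2 * m + 2)) := by
      intro u' hu'
      have hu'0 := hsub' hu'
      have p := hR.inv_pos (t := v₁ - u') (by linarith [show u' ≤ u₀ from hu'0])
      have l := hR.lapse_inv_mono (t' := v₁ - u') le_rfl (by linarith [show u' ≤ u₀ from hu'0])
      have h1 : eu u' v₁ ^ 2 ≤ (Ce * (R (v₁ - u'))⁻¹ ^ (m + 1)) ^ 2 := by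
        rw [← sq_abs]; exact pow_le_pow_left₀ (abs_nonneg _) (heu u' hu'0) 2
      have h2 : e u' v₁ ^ 2 ≤ (Ce * (R (v₁ - u'))⁻¹ ^ m) ^ 2 := by
        rw [← sq_abs]; exact pow_le_pow_left₀ (abs_nonneg _) (he u' hu'0) 2
      have h3 := potential_le hR.nonneg hlam p.le (hc0.trans_le l).le
      have h4 : potential M lam (R (v₁ - u'))⁻¹ * e u' v₁ ^ 2
          ≤ lam * (R (v₁ - u'))⁻¹ ^ 2 * (Ce * (R (v₁ - u'))⁻¹ ^ m) ^ 2 :=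
        mul_le_mul h3 h2 (sq_nonneg _) (by positivity)
      calc _ ≤ (Ce * (R (v₁ - u'))⁻¹ ^ (m + 1)) ^ 2
            + lam * (R (v₁ - u'))⁻¹ ^ 2 * (Ce * (R (v₁ - u'))⁻¹ ^ m) ^ 2 := add_le_add h1 h4
        _ = (1 + lam) * Ce ^ 2 * (c₀⁻¹ * c₀) * (R (v₁ - u'))⁻¹ ^ (2 * m + 2) := by
            rw [inv_mul_cancel₀ hc0.ne']; ring
        _ ≤ (1 + lam) * Ce ^ 2 * (c₀⁻¹ * (1 - 2 * M * (R (v₁ - u'))⁻¹))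
              * (R (v₁ - u'))⁻¹ ^ (2 * m + 2) := by gcongr
        _ = _ := by rw [hD]; ring
    calc _ ≤ ∫ u' in U..u, D * ((1 - 2 * M * (R (v₁ - u'))⁻¹) * (R (v₁ - u'))⁻¹ ^ (2 * m + 2)) := by
          refine integral_mono_on hU
            (((ceu.pow 2).add (cV.mul (ce.pow 2))).intervalIntegrable_of_Icc hU) ?_ hb
          exact ContinuousOn.intervalIntegrable_of_Icc hU (by fun_prop)
      _ ≤ _ := by
          rw [intervalIntegral.integral_const_mul]
          have := hR.integral_u_le (2 * m) hU hu (le_refl v₁)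
          gcongr
  have hlim := ge_of_tendsto ((((tendsto_const_nhds (x := D * (R (v₁ - u))⁻¹ ^ (2 * m + 1))).add
    (h.tendsto_energy hR hlam h0 hV (hin V hV))).add
    (tendsto_const_nhds (x := 2 * CF ^ 2 * c₀⁻¹ ^ 3 * (R (v₁ - u))⁻¹ ^ (2 * m + 1)))).const_mul
      (Real.exp 2)) ((eventually_le_atBot u).mono hflux)
  obtain ⟨ce, cev⟩ := h.continuousOn_v hu
  have cρ := (hR.continuousOn_inv_v hu).mono hsub
  have cV : ContinuousOn (fun v => potential M lam (R (v - u))⁻¹) (Icc v₁ V) :=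
    (continuous_potential M lam).comp_continuousOn cρ
  have ce' := ce.mono hsub
  have cev' := cev.mono hsub
  calc _ ≤ ∫ v in v₁..V, (ev u v ^ 2 + potential M lam (R (v - u))⁻¹ * e u v ^ 2) := by
        refine integral_mono_on hV
          (ContinuousOn.intervalIntegrable_of_Icc hV (by fun_prop))
          (((cev'.pow 2).add (cV.mul (ce'.pow 2))).intervalIntegrable_of_Icc hV) fun v hv => ?_
        have h1 := hR.lapse_inv_pos (t := v - u) (by linarith [hv.1])
        have h2 := le_potential (M := M) (ρ := (R (v - u))⁻¹) hlam h1.le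
        nlinarith [sq_nonneg (ev u v), mul_le_mul_of_nonneg_right h2 (sq_nonneg (e u v))]
    _ ≤ _ := hlim
    _ = _ := by ring

/-- The contribution of the error to the radiation field. -/
theorem IsWave.exists_tendsto_integral (hlam : 6 ≤ lam) {e eu ev F : ℝ → ℝ → ℝ}
    (h : IsWave M lam u₀ v₁ R e eu ev F) {m : ℕ} (hm : 1 ≤ m) {CF Ce : ℝ}
    (hF : ∀ u ≤ u₀, ∀ v ≥ v₁, |F u v| ≤ CF * ((1 - 2 * M * (R (v - u))⁻¹) * (R (v - u))⁻¹ ^ 2)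
      * (R (v₁ - u))⁻¹ ^ m)
    (he : ∀ u ≤ u₀, |e u v₁| ≤ Ce * (R (v₁ - u))⁻¹ ^ m)
    (heu : ∀ u ≤ u₀, |eu u v₁| ≤ Ce * (R (v₁ - u))⁻¹ ^ (m + 1))
    (hin : ∀ V ≥ v₁, Tendsto (fun U => ∫ v in v₁..V, ev U v ^ 2) atBot (𝓝 0)) :
    ∃ K, ∀ u ≤ u₀, (∃ l, Tendsto (fun V => ∫ v in v₁..V,
        (1 - 2 * M * (R (v - u))⁻¹) * (R (v - u))⁻¹ ^ 3 * e u v) atTop (𝓝 l)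
          ∧ |l| ≤ K * (R (v₁ - u))⁻¹ ^ (m + 2)) ∧
      ∀ V ≥ v₁, |∫ v in v₁..V, (1 - 2 * M * (R (v - u))⁻¹) * (R (v - u))⁻¹ ^ 2 * e u v| ≤ K := by
  obtain ⟨K, hK⟩ := h.flux_le hR hlam hm hF he heu hin
  set s₀ := (R (v₁ - u₀))⁻¹
  have hK0 : 0 ≤ K := by
    have := hK u₀ le_rfl v₁ le_rfl
    simp only [intervalIntegral.integral_same] at this
    exact nonneg_of_mul_nonneg_left this (pow_pos (hR.inv_pos le_rfl) _)
  refine ⟨K + 1 + (K * s₀ ^ (2 * m + 1) + s₀), fun u hu => ?_⟩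
  set s := (R (v₁ - u))⁻¹ with hs
  set ρ : ℝ → ℝ := fun v => (R (v - u))⁻¹
  set W : ℕ → ℝ → ℝ := fun n v => (1 - 2 * M * ρ v) * ρ v ^ n with hW
  have ce : ContinuousOn (e u) (Ici v₁) := (h.continuousOn_v hu).1
  have cρ : ContinuousOn ρ (Ici v₁) := hR.continuousOn_inv_v hu
  have cW : ∀ n, ContinuousOn (W n) (Ici v₁) := fun n =>
    (continuousOn_const.sub (continuousOn_const.mul cρ)).mul (cρ.pow n)
  have hs0 : 0 < s := hR.inv_pos (by linarith)
  have hss₀ : s ≤ s₀ := hR.inv_anti le_rfl (by linarith)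
  have hint : ∀ V ≥ v₁, ∀ n, IntervalIntegrable (fun v => W n v * e u v) volume v₁ V :=
    fun V hV n => intervalIntegrable_of_continuousOn_Ici ((cW n).mul ce) hV
  have hintsq : ∀ V ≥ v₁, IntervalIntegrable (fun v => W 2 v * e u v ^ 2) volume v₁ V :=
    fun V hV => intervalIntegrable_of_continuousOn_Ici ((cW 2).mul (ce.pow 2)) hV
  have hintW : ∀ V ≥ v₁, ∀ n, IntervalIntegrable (W n) volume v₁ V :=
    fun V hV n => intervalIntegrable_of_continuousOn_Ici (cW n) hV
  have hK : ∀ V ≥ v₁, ∫ v in v₁..V, W 2 v * e u v ^ 2 ≤ K * s ^ (2 * m + 1) := hK u hu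
  have hρ : ∀ v ≥ v₁, 0 < ρ v := fun v hv => hR.inv_pos (by linarith)
  have hpos : ∀ v ≥ v₁, ∀ n, 0 < W n v := fun v hv n =>
    mul_pos (hR.lapse_inv_pos (by linarith)) (pow_pos (hρ v hv) n)
  have habs : ∀ V ≥ v₁, ∫ v in v₁..V, |W 3 v * e u v| ≤ (K + 1) * s ^ (m + 2) := by
    intro V hV
    -- Young's inequality with weight `s ^ j` balances the flux of `e` and the volume of the cone
    obtain ⟨j, rfl⟩ : ∃ j, m = j + 1 := ⟨m - 1, by omega⟩
    have hsj : 0 < s ^ j := pow_pos hs0 j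
    calc _ ≤ ∫ v in v₁..V, ((s ^ j)⁻¹ * (W 2 v * e u v ^ 2) + s ^ j * W 4 v) := by
          refine integral_mono_on hV (hint V hV 3).abs
            (((hintsq V hV).const_mul _).add ((hintW V hV 4).const_mul _)) fun v hv => ?_
          rw [abs_mul, abs_of_pos (hpos v hv.1 3)]
          have h2 : ρ v * |e u v| ≤ (s ^ j)⁻¹ * e u v ^ 2 + s ^ j * ρ v ^ 2 := by
            refine le_of_mul_le_mul_left ?_ hsj
            rw [mul_add, ← mul_assoc (s ^ j) (s ^ j)⁻¹, mul_inv_cancel₀ hsj.ne', one_mul,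
              ← sq_abs (e u v)]
            nlinarith [mul_nonneg hsj.le (mul_nonneg (hρ v hv.1).le (abs_nonneg (e u v))),
              sq_nonneg (|e u v| - s ^ j * ρ v)]
          calc _ = W 2 v * (ρ v * |e u v|) := by simp only [hW]; ring
            _ ≤ W 2 v * ((s ^ j)⁻¹ * e u v ^ 2 + s ^ j * ρ v ^ 2) :=
                mul_le_mul_of_nonneg_left h2 (hpos v hv.1 2).le
            _ = _ := by simp only [hW]; ring
      _ = (s ^ j)⁻¹ * (∫ v in v₁..V, W 2 v * e u v ^ 2) + s ^ j * ∫ v in v₁..V, W 4 v := by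
          rw [intervalIntegral.integral_add ((hintsq V hV).const_mul _)
            ((hintW V hV 4).const_mul _), intervalIntegral.integral_const_mul,
            intervalIntegral.integral_const_mul]
      _ ≤ (s ^ j)⁻¹ * (K * s ^ (2 * (j + 1) + 1)) + s ^ j * s ^ (2 + 1) := by
          have h1 := hK V hV
          have h2 : ∫ v in v₁..V, W 4 v ≤ s ^ (2 + 1) := hR.integral_v_le 2 hu hV
          gcongr
      _ = _ := by
          rw [show s ^ (2 * (j + 1) + 1) = s ^ j * s ^ (j + 1 + 2) by ring]
          field_simp
          ring
  constructor
  · have hI : IntegrableOn (fun v => W 3 v * e u v) (Ioi v₁) := by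
      refine integrableOn_Ioi_of_intervalIntegral_norm_bounded ((K + 1) * s ^ (m + 2)) v₁
        (fun V : ℝ => ?_) tendsto_id ?_
      · rcases le_total v₁ V with hV | hV
        · exact (intervalIntegrable_iff_integrableOn_Ioc_of_le hV).1 (hint V hV 3)
        · simp [Ioc_eq_empty_of_le hV]
      · filter_upwards [eventually_ge_atTop v₁] with V hV using habs V hV
    have ht := intervalIntegral_tendsto_integral_Ioi v₁ hI tendsto_id
    refine ⟨_, ht, ?_⟩
    refine le_of_tendsto ht.abs ?_
    filter_upwards [eventually_ge_atTop v₁] with V hV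
    refine ((intervalIntegral.abs_integral_le_integral_abs hV).trans (habs V hV)).trans ?_
    have : 0 ≤ K * s₀ ^ (2 * m + 1) + s₀ := by
      have := hs0.trans_le hss₀
      positivity
    exact mul_le_mul_of_nonneg_right (by linarith) (by positivity)
  · intro V hV
    refine (intervalIntegral.abs_integral_le_integral_abs hV).trans ?_
    calc _ ≤ ∫ v in v₁..V, (W 2 v * e u v ^ 2 + W 2 v) := by
          refine integral_mono_on hV (hint V hV 2).abs
            ((hintsq V hV).add (hintW V hV 2)) fun v hv => ?_
          have h2 := hpos v hv.1 2
          rw [abs_mul, abs_of_pos h2, ← mul_add_one, ← sq_abs (e u v)]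
          gcongr
          nlinarith [sq_nonneg (|e u v| - 1), abs_nonneg (e u v)]
      _ ≤ K * s ^ (2 * m + 1) + s := by
          rw [intervalIntegral.integral_add (hintsq V hV) (hintW V hV 2)]
          have h2 := hR.integral_v_le 0 hu hV
          rw [zero_add, zero_add, pow_one] at h2
          exact add_le_add (hK V hV) h2
      _ ≤ K * s₀ ^ (2 * m + 1) + s₀ := by gcongr
      _ ≤ _ := by linarith

end

/-! ### Hypergeometric polynomials -/

/-- The Taylor coefficients of the hypergeometric function `₂F₁(-K, b; c; y)`. -/
noncomputable def hypCoeff (K : ℕ) (b c : ℝ) : ℕ → ℝ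
  | 0 => 1
  | n + 1 => hypCoeff K b c n * ((n - K) * (n + b) / ((n + 1) * (n + c)))

/-- The hypergeometric polynomial `₂F₁(-K, b; c; y)`. -/
noncomputable def hypPoly (K : ℕ) (b c : ℝ) : ℝ[X] :=
  ∑ n ∈ Finset.range (K + 1), monomial n (hypCoeff K b c n)

theorem hypCoeff_eq_zero {K : ℕ} (b c : ℝ) {n : ℕ} (h : K < n) : hypCoeff K b c n = 0 := by
  induction n with
  | zero => omega
  | succ n ih =>
    rcases (Nat.lt_succ_iff.1 h).eq_or_lt with rfl | h
    · simp [hypCoeff]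
    · simp [hypCoeff, ih h]

theorem coeff_hypPoly (K : ℕ) (b c : ℝ) (n : ℕ) : (hypPoly K b c).coeff n = hypCoeff K b c n := by
  simp only [hypPoly, finsetSum_coeff, coeff_monomial]
  rw [Finset.sum_ite_eq' (Finset.range (K + 1)) n]
  split_ifs with h
  · rfl
  · rw [hypCoeff_eq_zero]; simpa using h

theorem hypCoeff_succ_mul {K : ℕ} {b c : ℝ} (hc : 0 < c) (n : ℕ) :
    (n + 1) * (n + c) * hypCoeff K b c (n + 1) = (n - K) * (n + b) * hypCoeff K b c n := by
  have h1 : (n + c : ℝ) ≠ 0 := by positivity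
  have h2 : (n + 1 : ℝ) ≠ 0 := by positivity
  simp only [hypCoeff]
  field_simp

theorem hypPoly_ode {K : ℕ} {b c : ℝ} (hc : 0 < c) :
    X * (1 - X) * derivative (derivative (hypPoly K b c))
      + (C c - C (b - K + 1) * X) * derivative (hypPoly K b c) + C (K * b) * hypPoly K b c = 0 := by
  obtain ⟨a, ha⟩ : ∃ a, a = b - K + 1 := ⟨_, rfl⟩
  obtain ⟨d, hd⟩ : ∃ d, d = K * b := ⟨_, rfl⟩
  rw [← ha, ← hd]
  ext n
  have key : ∀ n : ℕ, _ := fun n => hypCoeff_succ_mul (K := K) (b := b) hc n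
  rcases n with _ | _ | n
  · have := key 0
    simp [sub_mul, mul_sub, mul_assoc, coeff_derivative, coeff_hypPoly] at this ⊢
    rw [hd]; linarith
  · have := key 1
    simp [sub_mul, mul_sub, mul_assoc, coeff_derivative, coeff_hypPoly, coeff_X_mul] at this ⊢
    norm_num at this ⊢
    rw [hd, ha]; linarith
  · have := key (n + 2)
    simp [sub_mul, mul_sub, mul_assoc, coeff_derivative, coeff_hypPoly, coeff_X_mul] at this ⊢
    rw [hd, ha]; linarith

theorem eval_zero_hypPoly (K : ℕ) (b c : ℝ) : (hypPoly K b c).eval 0 = 1 := by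
  rw [← coeff_zero_eq_eval_zero, coeff_hypPoly]; rfl

theorem hypCoeff_contiguous {K : ℕ} {b c : ℝ} (hc : 0 < c) (n : ℕ) :
    (n + 1) * hypCoeff (K + 1) b c (n + 1)
      = -((K + 1 : ℕ) * b / c) * hypCoeff K (b + 1) (c + 1) n := by
  induction n with
  | zero => simp [hypCoeff]; field_simp; ring
  | succ n ih =>
    have h1 := hypCoeff_succ_mul (K := K) (b := b + 1) (c := c + 1) (by linarith) n
    have h2 := hypCoeff_succ_mul (K := K + 1) (b := b) (c := c) hc (n + 1)
    have h3 : (n + 1 : ℝ) ≠ 0 := by positivity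
    have h4 : (n + (c + 1) : ℝ) ≠ 0 := by positivity
    push_cast at h2 ih ⊢
    have : (n + 1 : ℝ) * (n + (c + 1)) * ((n + 1 + 1) * hypCoeff (K + 1) b c (n + 1 + 1))
        = (n + 1 : ℝ) * (n + (c + 1)) * (-((K + 1) * b / c) * hypCoeff K (b + 1) (c + 1) (n + 1)) := by
      calc _ = (n + 1 : ℝ) * ((n + 1 + 1) * (n + 1 + c) * hypCoeff (K + 1) b c (n + 1 + 1)) := by ring
        _ = (n + 1 - (K + 1)) * (n + 1 + b) * ((n + 1) * hypCoeff (K + 1) b c (n + 1)) := by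
            rw [h2]; ring
        _ = -((K + 1) * b / c) * ((n - K) * (n + (b + 1)) * hypCoeff K (b + 1) (c + 1) n) := by
            rw [ih]; ring
        _ = _ := by rw [← h1]; ring
    exact mul_left_cancel₀ (mul_ne_zero h3 h4) this

theorem derivative_hypPoly {K : ℕ} {b c : ℝ} (hc : 0 < c) :
    derivative (hypPoly (K + 1) b c)
      = C (-((K + 1 : ℕ) * b / c)) * hypPoly K (b + 1) (c + 1) := by
  ext n
  rw [coeff_derivative, coeff_C_mul, coeff_hypPoly, coeff_hypPoly, mul_comm]
  exact hypCoeff_contiguous hc n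

/-- The Chu-Vandermonde identity. -/
theorem eval_one_hypPoly (K : ℕ) {b c : ℝ} (hb : 0 < b) (hc : 0 < c) :
    (hypPoly K b c).eval 1 = ∏ i ∈ Finset.range K, (c - b + i) / (c + i) := by
  induction K generalizing b c with
  | zero => simp [hypPoly, hypCoeff]
  | succ K ih =>
    have hode := congrArg (eval 1) (hypPoly_ode (K := K + 1) (b := b) hc)
    simp only [eval_add, eval_mul, eval_X, eval_sub,
      eval_one, sub_self, mul_zero, zero_mul, zero_add, eval_C, mul_one,
      eval_zero] at hode
    rw [derivative_hypPoly hc, eval_mul, eval_C,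
      ih (b := b + 1) (c := c + 1) (by linarith) (by linarith)] at hode
    set E := (hypPoly (K + 1) b c).eval 1
    have h1 : ∏ i ∈ Finset.range K, (c + 1 - (b + 1) + i) / (c + 1 + i)
        = (∏ i ∈ Finset.range K, (c - b + i)) / ∏ i ∈ Finset.range K, (c + (i + 1 : ℕ)) := by
      rw [← prod_div_distrib]
      refine prod_congr rfl fun i _ => ?_
      push_cast; ring_nf
    rw [h1] at hode
    rw [prod_div_distrib, Finset.prod_range_succ (fun i => c - b + (i : ℝ)),
      Finset.prod_range_succ' (fun i => c + (i : ℝ))]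
    have hD : ∏ i ∈ Finset.range K, (c + (i + 1 : ℕ)) ≠ 0 :=
      Finset.prod_ne_zero_iff.2 fun i _ => by positivity
    have hK : ((K + 1 : ℕ) * b : ℝ) ≠ 0 := by positivity
    set A := ∏ i ∈ Finset.range K, (c - b + (i : ℝ))
    set D := ∏ i ∈ Finset.range K, (c + (i + 1 : ℕ))
    apply mul_left_cancel₀ hK
    push_cast at hode ⊢
    have : (K + 1 : ℝ) * b * E = (c - b + K) * ((K + 1) * b / c * (A / D)) := by linarith
    rw [this]
    field_simp
    ring

theorem Gamma_add_nat (x : ℝ) (hx : 0 < x) (n : ℕ) :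
    Real.Gamma (x + n) = (∏ i ∈ Finset.range n, (x + i)) * Real.Gamma x := by
  induction n with
  | zero => simp
  | succ n ih =>
    rw [Finset.prod_range_succ, Nat.cast_succ, ← add_assoc, Real.Gamma_add_one (by positivity), ih]
    ring

/-- The constants `S_{ℓ,p,ℓ+2,0,-2}` as a quotient of Pochhammer symbols. -/
theorem coeffS_eq {ℓ p : ℕ} (hℓ : 2 ≤ ℓ) (hp : 2 ≤ p) :
    coeffS ℓ p (ℓ + 2) 0 (-2)
      = ∏ i ∈ Finset.range (ℓ + 2), ((p : ℝ) - ℓ + i) / ((p : ℝ) - 1 + i) := by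
  have hp' : (2 : ℝ) ≤ p := by exact_mod_cast hp
  have hℓ' : (2 : ℝ) ≤ ℓ := by exact_mod_cast hℓ
  have h1 : fact (ℓ + (p : ℝ)) = (∏ i ∈ Finset.range (ℓ + 2), ((p : ℝ) - 1 + i))
      * Real.Gamma (p - 1) := by
    rw [fact, ← Gamma_add_nat _ (by linarith)]
    push_cast; ring_nf
  have h2 : fact (((-2 : ℤ) : ℝ) + p) = Real.Gamma (p - 1) := by
    rw [fact]; push_cast; ring_nf
  have h3 : fact ((ℓ : ℝ) - ((-2 : ℤ) : ℝ)) = (ℓ + 2).factorial := by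
    rw [fact, ← Real.Gamma_nat_eq_factorial]; push_cast; ring_nf
  have h4 : fact (2 * (ℓ : ℝ) - ((ℓ + 2 : ℕ) : ℝ) + ((0 : ℕ) : ℝ)) = Real.Gamma (ℓ - 1) := by
    rw [fact]; push_cast; ring_nf
  have h5 : fact ((ℓ : ℝ) + ((-2 : ℤ) : ℝ)) = Real.Gamma (ℓ - 1) := by
    rw [fact]; push_cast; ring_nf
  have h6 : ∏ i ∈ Finset.range (ℓ + 2), ((ℓ : ℝ) - p - i)
      = (-1) ^ (ℓ + 2) * ∏ i ∈ Finset.range (ℓ + 2), ((p : ℝ) - ℓ + i) := by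
    have : ∀ i : ℕ, ((ℓ : ℝ) - p - i) = (-1) * ((p : ℝ) - ℓ + i) := fun i => by ring
    simp_rw [this]
    rw [Finset.prod_mul_distrib, Finset.prod_const, Finset.card_range]
  rw [coeffS, h1, h2, h3, h4, h5, binom, Nat.sub_zero, h6, prod_div_distrib]
  have hG1 : Real.Gamma (p - 1) ≠ 0 := (Real.Gamma_pos_of_pos (by linarith)).ne'
  have hG2 : Real.Gamma (ℓ - 1) ≠ 0 := (Real.Gamma_pos_of_pos (by linarith)).ne'
  have hF : ((ℓ + 2).factorial : ℝ) ≠ 0 := by positivity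
  have hsign : (-1 : ℝ) ^ ((ℓ : ℤ) - -2 + ((0 : ℕ) : ℤ)) = (-1) ^ (ℓ + 2) := by
    rw [show (ℓ : ℤ) - -2 + ((0 : ℕ) : ℤ) = ((ℓ + 2 : ℕ) : ℤ) by push_cast; ring, zpow_natCast]
  rw [hsign]
  have hsq : ((-1 : ℝ) ^ (ℓ + 2)) * (-1) ^ (ℓ + 2) = 1 := by
    rw [← mul_pow]; simp
  have hD : ∏ i ∈ Finset.range (ℓ + 2), ((p : ℝ) - 1 + i) ≠ 0 :=
    Finset.prod_ne_zero_iff.2 fun i _ => by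
      have : (0 : ℝ) ≤ i := Nat.cast_nonneg i
      linarith
  set A := ∏ i ∈ Finset.range (ℓ + 2), ((p : ℝ) - ℓ + i)
  set D := ∏ i ∈ Finset.range (ℓ + 2), ((p : ℝ) - 1 + i)
  set ε := (-1 : ℝ) ^ (ℓ + 2)
  rw [Nat.factorial_zero]
  field_simp
  push_cast
  linear_combination A * hsq

theorem coeffS_eq_zero_iff {ℓ p : ℕ} (hℓ : 2 ≤ ℓ) (hp : 2 ≤ p) :
    coeffS ℓ p (ℓ + 2) 0 (-2) = 0 ↔ p ≤ ℓ := by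
  rw [coeffS_eq hℓ hp, Finset.prod_eq_zero_iff]
  have hp' : (2 : ℝ) ≤ p := by exact_mod_cast hp
  constructor
  · rintro ⟨i, -, hi⟩
    have h0 : (0 : ℝ) ≤ i := Nat.cast_nonneg i
    have : ((p : ℝ) - 1 + i) ≠ 0 := by linarith
    rw [div_eq_zero_iff, or_iff_left this] at hi
    exact_mod_cast (show (p : ℝ) ≤ ℓ by linarith)
  · intro h
    refine ⟨ℓ - p, Finset.mem_range.2 (by omega), ?_⟩
    push_cast [h]
    simp

/-- The polynomials which describe the solutions on Minkowski space with data `r₀^(-2-p)`. -/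
noncomputable def scatPoly (ℓ p : ℕ) : ℝ[X] := hypPoly (ℓ + 2) (ℓ - 1) (p - 1)

/-- At future null infinity, `r₀ / r = 0`, the exact solutions have the value `S_{ℓ,p,ℓ+2,0,-2}`. -/
theorem eval_one_scatPoly {ℓ p : ℕ} (hℓ : 2 ≤ ℓ) (hp : 2 ≤ p) :
    (scatPoly ℓ p).eval 1 = coeffS ℓ p (ℓ + 2) 0 (-2) := by
  have hp' : (2 : ℝ) ≤ p := by exact_mod_cast hp
  have hℓ' : (2 : ℝ) ≤ ℓ := by exact_mod_cast hℓ
  rw [scatPoly, eval_one_hypPoly _ (by linarith) (by linarith), coeffS_eq hℓ hp]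
  refine prod_congr rfl fun i _ => ?_
  ring_nf

theorem eval_zero_scatPoly (ℓ p : ℕ) : (scatPoly ℓ p).eval 0 = 1 := eval_zero_hypPoly _ _ _

theorem scatPoly_ode {ℓ p : ℕ} (hp : 2 ≤ p) :
    X * (1 - X) * derivative (derivative (scatPoly ℓ p))
      + (C ((p : ℝ) - 1) + 2 * X) * derivative (scatPoly ℓ p)
      + C (((ℓ : ℝ) - 1) * (ℓ + 2)) * scatPoly ℓ p = 0 := by
  have hp' : (2 : ℝ) ≤ p := by exact_mod_cast hp
  have h := hypPoly_ode (K := ℓ + 2) (b := (ℓ : ℝ) - 1) (c := (p : ℝ) - 1) (by linarith)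
  have e1 : (ℓ : ℝ) - 1 - ((ℓ + 2 : ℕ) : ℝ) + 1 = -2 := by push_cast; ring
  have e2 : ((ℓ + 2 : ℕ) : ℝ) * ((ℓ : ℝ) - 1) = ((ℓ : ℝ) - 1) * (ℓ + 2) := by push_cast; ring
  rw [e1, e2] at h
  rw [← h, scatPoly]
  simp only [map_neg, map_ofNat]
  ring

/-! ### Modes of the Teukolsky equation and their approximation near spacelike infinity -/

/-- A mode of angular frequency `ℓ`, `lam = ℓ (ℓ + 1)`, of a solution of the Teukolsky equation:
`f = r Ω² α̲`, `ψ = (r² / Ω²) ∂_v f`, `Ψ = (r² / Ω²) ∂_v ψ` and `χ = ∂_v Ψ`. -/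
structure IsMode (M lam u₀ v₁ : ℝ) (R : ℝ → ℝ) (f ψ Ψ χ : ℝ → ℝ → ℝ) : Prop where
  f_v : ∀ u ≤ u₀, ∀ v ≥ v₁, HasDerivWithinAt (fun v' => f u v')
    ((1 - 2 * M * (R (v - u))⁻¹) * (R (v - u))⁻¹ ^ 2 * ψ u v) (Ici v₁) v
  ψ_v : ∀ u ≤ u₀, ∀ v ≥ v₁, HasDerivWithinAt (fun v' => ψ u v')
    ((1 - 2 * M * (R (v - u))⁻¹) * (R (v - u))⁻¹ ^ 2 * Ψ u v) (Ici v₁) v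
  Ψ_v : ∀ u ≤ u₀, ∀ v ≥ v₁, HasDerivWithinAt (fun v' => Ψ u v') (χ u v) (Ici v₁) v
  ψ_u : ∀ u ≤ u₀, ∀ v ≥ v₁, HasDerivWithinAt (fun u' => ψ u' v)
    ((2 * (R (v - u))⁻¹ - 6 * M * (R (v - u))⁻¹ ^ 2) * ψ u v
      - (lam - 2 + 6 * M * (R (v - u))⁻¹) * f u v) (Iic u₀) u
  Ψ_u : ∀ u ≤ u₀, ∀ v ≥ v₁, HasDerivWithinAt (fun u' => Ψ u' v)
    (-(lam - 6 * M * (R (v - u))⁻¹) * ψ u v + 6 * M * f u v) (Iic u₀) u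
  χ_u : ∀ u ≤ u₀, ∀ v ≥ v₁, HasDerivWithinAt (fun u' => χ u' v)
    (-potential M lam (R (v - u))⁻¹ * Ψ u v) (Iic u₀) u
  cont_f : ContinuousOn (Function.uncurry f) (Iic u₀ ×ˢ Ici v₁)
  cont_ψ : ContinuousOn (Function.uncurry ψ) (Iic u₀ ×ˢ Ici v₁)
  cont_Ψ : ContinuousOn (Function.uncurry Ψ) (Iic u₀ ×ˢ Ici v₁)
  cont_χ : ContinuousOn (Function.uncurry χ) (Iic u₀ ×ˢ Ici v₁)

namespace IsMode

variable {M lam u₀ v₁ : ℝ} {R : ℝ → ℝ} {f ψ Ψ χ f' ψ' Ψ' χ' : ℝ → ℝ → ℝ}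

theorem add (h : IsMode M lam u₀ v₁ R f ψ Ψ χ) (h' : IsMode M lam u₀ v₁ R f' ψ' Ψ' χ') :
    IsMode M lam u₀ v₁ R (fun u v => f u v + f' u v) (fun u v => ψ u v + ψ' u v)
      (fun u v => Ψ u v + Ψ' u v) (fun u v => χ u v + χ' u v) where
  f_v u hu v hv := ((h.f_v u hu v hv).add (h'.f_v u hu v hv)).congr_deriv (by ring)
  ψ_v u hu v hv := ((h.ψ_v u hu v hv).add (h'.ψ_v u hu v hv)).congr_deriv (by ring)
  Ψ_v u hu v hv := (h.Ψ_v u hu v hv).add (h'.Ψ_v u hu v hv)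
  ψ_u u hu v hv := ((h.ψ_u u hu v hv).add (h'.ψ_u u hu v hv)).congr_deriv (by ring)
  Ψ_u u hu v hv := ((h.Ψ_u u hu v hv).add (h'.Ψ_u u hu v hv)).congr_deriv (by ring)
  χ_u u hu v hv := ((h.χ_u u hu v hv).add (h'.χ_u u hu v hv)).congr_deriv (by ring)
  cont_f := h.cont_f.add h'.cont_f
  cont_ψ := h.cont_ψ.add h'.cont_ψ
  cont_Ψ := h.cont_Ψ.add h'.cont_Ψ
  cont_χ := h.cont_χ.add h'.cont_χ

theorem const_mul (h : IsMode M lam u₀ v₁ R f ψ Ψ χ) (c : ℝ) :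
    IsMode M lam u₀ v₁ R (fun u v => c * f u v) (fun u v => c * ψ u v)
      (fun u v => c * Ψ u v) (fun u v => c * χ u v) where
  f_v u hu v hv := ((h.f_v u hu v hv).const_mul c).congr_deriv (by ring)
  ψ_v u hu v hv := ((h.ψ_v u hu v hv).const_mul c).congr_deriv (by ring)
  Ψ_v u hu v hv := (h.Ψ_v u hu v hv).const_mul c
  ψ_u u hu v hv := ((h.ψ_u u hu v hv).const_mul c).congr_deriv (by ring)
  Ψ_u u hu v hv := ((h.Ψ_u u hu v hv).const_mul c).congr_deriv (by ring)
  χ_u u hu v hv := ((h.χ_u u hu v hv).const_mul c).congr_deriv (by ring)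
  cont_f := continuousOn_const.mul h.cont_f
  cont_ψ := continuousOn_const.mul h.cont_ψ
  cont_Ψ := continuousOn_const.mul h.cont_Ψ
  cont_χ := continuousOn_const.mul h.cont_χ

theorem zero : IsMode M lam u₀ v₁ R (fun _ _ => 0) (fun _ _ => 0) (fun _ _ => 0)
    (fun _ _ => 0) where
  f_v u hu v hv := (hasDerivWithinAt_const _ _ _).congr_deriv (by ring)
  ψ_v u hu v hv := (hasDerivWithinAt_const _ _ _).congr_deriv (by ring)
  Ψ_v u hu v hv := hasDerivWithinAt_const _ _ _
  ψ_u u hu v hv := (hasDerivWithinAt_const _ _ _).congr_deriv (by ring)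
  Ψ_u u hu v hv := (hasDerivWithinAt_const _ _ _).congr_deriv (by ring)
  χ_u u hu v hv := (hasDerivWithinAt_const _ _ _).congr_deriv (by ring)
  cont_f := continuousOn_const
  cont_ψ := continuousOn_const
  cont_Ψ := continuousOn_const
  cont_χ := continuousOn_const

theorem sum {ι : Type*} (s : Finset ι) {f ψ Ψ χ : ι → ℝ → ℝ → ℝ}
    (h : ∀ i ∈ s, IsMode M lam u₀ v₁ R (f i) (ψ i) (Ψ i) (χ i)) :
    IsMode M lam u₀ v₁ R (fun u v => ∑ i ∈ s, f i u v) (fun u v => ∑ i ∈ s, ψ i u v)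
      (fun u v => ∑ i ∈ s, Ψ i u v) (fun u v => ∑ i ∈ s, χ i u v) := by
  classical
  induction s using Finset.induction_on with
  | empty => simpa using zero
  | insert a s ha ih =>
    simp only [sum_insert ha]
    exact (h a (Finset.mem_insert_self _ _)).add (ih fun i hi => h i (Finset.mem_insert_of_mem hi))

end IsMode

section
variable {M lam u₀ v₁ : ℝ} {R : ℝ → ℝ} (hR : IsRadius M (v₁ - u₀) R)
include hR

/-- Integration from `u = -∞` of a function whose derivative decays like `r₀^(-k-2)`. -/
theorem IsRadius.exists_limit {h h' : ℝ → ℝ} {C : ℝ} {k : ℕ}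
    (hd : ∀ u ≤ u₀, HasDerivWithinAt h (h' u) (Iic u₀) u)
    (hb : ∀ u ≤ u₀, |h' u| ≤ C * (R (v₁ - u))⁻¹ ^ (k + 2)) :
    ∃ c, Tendsto h atBot (𝓝 c) ∧ ∃ K, ∀ u ≤ u₀, |h u - c| ≤ K * (R (v₁ - u))⁻¹ ^ (k + 1) := by
  set c₀ := 1 - 2 * M * (R (v₁ - u₀))⁻¹
  have hc0 : 0 < c₀ := hR.lapse_inv_pos le_rfl
  have hC : 0 ≤ C := by
    have h1 := (abs_nonneg _).trans (hb u₀ le_rfl)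
    exact nonneg_of_mul_nonneg_left h1 (pow_pos (hR.inv_pos le_rfl) _)
  -- `g` tends to zero, and its derivative dominates that of `h`
  set K := C * c₀⁻¹ with hK
  set g : ℝ → ℝ := fun u => K * (R (v₁ - u))⁻¹ ^ (k + 1) with hg
  have hg' : ∀ u ≤ u₀, HasDerivWithinAt g (K * ((k + 1 : ℕ) * (R (v₁ - u))⁻¹ ^ k
      * ((1 - 2 * M * (R (v₁ - u))⁻¹) * (R (v₁ - u))⁻¹ ^ 2))) (Iic u₀) u := fun u hu =>
    (((hR.hasDerivAt_inv_u hu le_rfl).fun_pow (k + 1)).const_mul K).hasDerivWithinAt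
  have hle : ∀ u ≤ u₀, |h' u| ≤ K * ((k + 1 : ℕ) * (R (v₁ - u))⁻¹ ^ k
      * ((1 - 2 * M * (R (v₁ - u))⁻¹) * (R (v₁ - u))⁻¹ ^ 2)) := by
    intro u hu
    have p := hR.inv_pos (t := v₁ - u) (by linarith)
    have l := hR.lapse_inv_mono (t' := v₁ - u) le_rfl (by linarith)
    calc |h' u| ≤ C * (R (v₁ - u))⁻¹ ^ (k + 2) := hb u hu
      _ = C * (c₀⁻¹ * c₀) * (1 * (R (v₁ - u))⁻¹ ^ (k + 2)) := by
          rw [inv_mul_cancel₀ hc0.ne']; ring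
      _ ≤ C * (c₀⁻¹ * (1 - 2 * M * (R (v₁ - u))⁻¹))
            * ((k + 1 : ℕ) * (R (v₁ - u))⁻¹ ^ (k + 2)) := by
          have : (1 : ℝ) ≤ (k + 1 : ℕ) := by simp
          have : 0 ≤ 1 - 2 * M * (R (v₁ - u))⁻¹ := (hc0.trans_le l).le
          gcongr
      _ = _ := by rw [hK]; ring
  have hint : ∀ u ∈ interior (Iic u₀), u ∈ Iic u₀ := fun _ hu => interior_subset hu
  have hmono : MonotoneOn (fun u => h u + g u) (Iic u₀) := by
    apply monotoneOn_of_hasDerivWithinAt_nonneg (convex_Iic _)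
    · exact fun u hu => ((hd u hu).add (hg' u hu)).continuousWithinAt
    · exact fun u hu => ((hd u (hint u hu)).add (hg' u (hint u hu))).mono interior_subset
    · intro u hu
      have := neg_le_of_abs_le (hle u (hint u hu))
      linarith
  have hanti : AntitoneOn (fun u => h u - g u) (Iic u₀) := by
    apply antitoneOn_of_hasDerivWithinAt_nonpos (convex_Iic _)
    · exact fun u hu => ((hd u hu).sub (hg' u hu)).continuousWithinAt
    · exact fun u hu => ((hd u (hint u hu)).sub (hg' u (hint u hu))).mono interior_subset
    · intro u hu
      have := le_of_abs_le (hle u (hint u hu))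
      linarith
  have hgpos : ∀ u ≤ u₀, 0 ≤ g u := fun u hu => by
    have p := hR.inv_pos (t := v₁ - u) (by linarith)
    simp only [hg, hK]; positivity
  have hg0 : Tendsto g atBot (𝓝 0) := by
    have h1 := ((hR.tendsto_inv_atBot v₁).pow (k + 1)).const_mul K
    rw [zero_pow (by omega), mul_zero] at h1
    exact h1
  have hlim : ∃ c, Tendsto (fun u => h u + g u) atBot (𝓝 c) := by
    have hm : Monotone fun u => h (min u u₀) + g (min u u₀) := fun a b hab =>
      hmono (mem_Iic.2 (min_le_right a u₀))
        (mem_Iic.2 (min_le_right b u₀)) (min_le_min_right _ hab)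
    have hbdd : BddBelow (range fun u => h (min u u₀) + g (min u u₀)) := by
      refine ⟨h u₀ - g u₀, ?_⟩
      rintro _ ⟨u, rfl⟩
      have h1 := hanti (mem_Iic.2 (min_le_right u u₀))
        (mem_Iic.2 (le_refl u₀)) (min_le_right u u₀)
      have h2 := hgpos _ (min_le_right u u₀)
      simp only at h1 ⊢
      linarith
    refine ⟨_, (tendsto_atBot_ciInf hm hbdd).congr' ?_⟩
    filter_upwards [eventually_le_atBot u₀] with u hu
    rw [min_eq_left hu]
  obtain ⟨c, hc⟩ := hlim
  have hc1 : Tendsto h atBot (𝓝 c) := by simpa using hc.sub hg0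
  have hc2 : Tendsto (fun u => h u - g u) atBot (𝓝 c) := by simpa using hc1.sub hg0
  refine ⟨c, hc1, K, fun u hu => ?_⟩
  have h1 : c ≤ h u + g u := le_of_tendsto hc
    ((eventually_le_atBot u).mono fun u' hu' => hmono (mem_Iic.2 (hu'.trans hu)) (mem_Iic.2 hu) hu')
  have h2 : h u - g u ≤ c := ge_of_tendsto hc2
    ((eventually_le_atBot u).mono fun u' hu' => hanti (mem_Iic.2 (hu'.trans hu)) (mem_Iic.2 hu) hu')
  rw [abs_le]
  constructor <;> linarith

end

/-- A profile `H(y) + r₀⁻¹ G(y)`, `y = 1 - r₀ / r`, which solves the Regge-Wheeler equation up to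
an error of relative size `r₀^(-2)`, with data `2 A + k r₀⁻¹` on the initial cone.  `H₁`, `H₂`,
`G₁`, `G₂` are derivatives, and `ΘH`, `ΘG` are primitives of `(1 - y) H` and `(1 - y) G`, whose
limits at `y = 1` determine the radiation field. -/
structure IsProfile (M lam A k κ : ℝ) (H H₁ H₂ G G₁ G₂ ΘH ΘG : ℝ → ℝ) : Prop where
  dH : ∀ y < 1, HasDerivAt H (H₁ y) y
  dH₁ : ∀ y < 1, HasDerivAt H₁ (H₂ y) y
  dG : ∀ y < 1, HasDerivAt G (G₁ y) y
  dG₁ : ∀ y < 1, HasDerivAt G₁ (G₂ y) y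
  cH₂ : ContinuousOn H₂ (Iio 1)
  cG₂ : ContinuousOn G₂ (Iio 1)
  H_zero : H 0 = 2 * A
  G_zero : G 0 = k
  odeH : ∀ y < 1, (1 - y) * y * H₂ y + (2 * (1 - y) - 1) * H₁ y + lam * H y = 0
  odeG : ∀ y < 1, (1 - y) * y * G₂ y + 2 * (1 - y) * G₁ y + lam * G y
    = -M * (2 * H₁ y - 2 * (1 + (1 - y)) * ((1 - y) * y) * H₂ y - 6 * (1 - y) ^ 2 * H₁ y
      - 6 * (1 - y) * H y)
  bound : ∃ K, ∀ y ∈ Ico (0 : ℝ) 1, |H y| ≤ K ∧ |G y| ≤ K ∧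
    |-2 * (1 + (1 - y)) * ((1 - y) * y) * G₂ y - 6 * (1 - y) ^ 2 * G₁ y - 6 * (1 - y) * G y| ≤ K
  bound₁ : ∃ K, ∀ y ∈ Ico (0 : ℝ) 1, |(1 - y) * H₁ y| ≤ K ∧ |(1 - y) * G₁ y| ≤ K
  dΘH : ∀ y < 1, HasDerivAt ΘH ((1 - y) * H y) y
  dΘG : ∀ y < 1, HasDerivAt ΘG ((1 - y) * G y) y
  ΘH_zero : ΘH 0 = 0
  ΘG_zero : ΘG 0 = 0
  ΘH_one : Tendsto ΘH (𝓝[<] 1) (𝓝 0)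
  ΘG_one : Tendsto ΘG (𝓝[<] 1) (𝓝 (κ + k / lam))

section
variable {M lam u₀ v₁ : ℝ} {R : ℝ → ℝ} (hR : IsRadius M (v₁ - u₀) R)
include hR

/-- The difference of `Ψ` and an approximate profile is a wave with small source. -/
theorem IsMode.isWave_sub_profile {f ψ Ψ χ : ℝ → ℝ → ℝ} (h : IsMode M lam u₀ v₁ R f ψ Ψ χ)
    {A k κ : ℝ} {H H₁ H₂ G G₁ G₂ ΘH ΘG : ℝ → ℝ}
    (hp : IsProfile M lam A k κ H H₁ H₂ G G₁ G₂ ΘH ΘG) :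
    ∃ e eu ev F : ℝ → ℝ → ℝ, IsWave M lam u₀ v₁ R e eu ev F ∧
      (∀ u ≤ u₀, ∀ v ≥ v₁, Ψ u v = e u v + (H (1 - (R (v - u))⁻¹ / (R (v₁ - u))⁻¹)
        + (R (v₁ - u))⁻¹ * G (1 - (R (v - u))⁻¹ / (R (v₁ - u))⁻¹))) ∧
      (∀ u ≤ u₀, ∀ v ≥ v₁, ev u v = χ u v
        - (H₁ (1 - (R (v - u))⁻¹ / (R (v₁ - u))⁻¹)
          + (R (v₁ - u))⁻¹ * G₁ (1 - (R (v - u))⁻¹ / (R (v₁ - u))⁻¹))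
          * ((1 - 2 * M * (R (v - u))⁻¹) * (R (v - u))⁻¹ ^ 2 / (R (v₁ - u))⁻¹)) ∧
      (∀ u ≤ u₀, e u v₁ = Ψ u v₁ - (2 * A + (R (v₁ - u))⁻¹ * k)) ∧
      (∀ u ≤ u₀, eu u v₁ = -(lam - 6 * M * (R (v₁ - u))⁻¹) * ψ u v₁ + 6 * M * f u v₁
        - k * ((1 - 2 * M * (R (v₁ - u))⁻¹) * (R (v₁ - u))⁻¹ ^ 2)) ∧
      ∃ K, ∀ u ≤ u₀, ∀ v ≥ v₁, |F u v| ≤ M * K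
        * ((1 - 2 * M * (R (v - u))⁻¹) * (R (v - u))⁻¹ ^ 2) * (R (v₁ - u))⁻¹ ^ 2 := by
  set ρ : ℝ → ℝ → ℝ := fun u v => (R (v - u))⁻¹ with hρ
  set a : ℝ → ℝ := fun u => (R (v₁ - u))⁻¹ with ha
  set y : ℝ → ℝ → ℝ := fun u v => 1 - ρ u v / a u with hy
  set yu : ℝ → ℝ → ℝ := fun u v => ρ u v * (1 - 2 * M * a u)
    - (1 - 2 * M * ρ u v) * ρ u v ^ 2 / a u with hyu
  set B : ℝ → ℝ → ℝ := fun u v => H (y u v) + a u * G (y u v) with hB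
  set Bu : ℝ → ℝ → ℝ := fun u v => (H₁ (y u v) + a u * G₁ (y u v)) * yu u v
    + (1 - 2 * M * a u) * a u ^ 2 * G (y u v) with hBu
  set Bv : ℝ → ℝ → ℝ := fun u v => (H₁ (y u v) + a u * G₁ (y u v))
    * ((1 - 2 * M * ρ u v) * ρ u v ^ 2 / a u) with hBv
  set Buv : ℝ → ℝ → ℝ := fun u v => (1 - 2 * M * ρ u v) * ρ u v ^ 2 / a u *
    ((2 * ρ u v - 6 * M * ρ u v ^ 2) * (H₁ (y u v) + a u * G₁ (y u v))
      + ((H₂ (y u v) + a u * G₂ (y u v)) * yu u v + (1 - 2 * M * a u) * a u ^ 2 * G₁ (y u v))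
      - (H₁ (y u v) + a u * G₁ (y u v)) * ((1 - 2 * M * a u) * a u)) with hBuv
  have a_pos : ∀ u ≤ u₀, 0 < a u := fun u hu => hR.inv_pos (by linarith)
  have ρ_pos : ∀ u ≤ u₀, ∀ v ≥ v₁, 0 < ρ u v := fun u hu v hv => hR.inv_pos (by linarith)
  have y_lt : ∀ u ≤ u₀, ∀ v ≥ v₁, y u v < 1 := fun u hu v hv => by
    have := div_pos (ρ_pos u hu v hv) (a_pos u hu)
    simp only [hy]; linarith
  have y_nonneg : ∀ u ≤ u₀, ∀ v ≥ v₁, 0 ≤ y u v := fun u hu v hv => by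
    have : ρ u v / a u ≤ 1 := by
      rw [div_le_one (a_pos u hu)]
      exact hR.inv_anti (by linarith) (by linarith)
    simp only [hy]; linarith
  have y_v₁ : ∀ u ≤ u₀, y u v₁ = 0 := fun u hu => by
    simp only [hy]; rw [show ρ u v₁ = a u from rfl, div_self (a_pos u hu).ne', sub_self]
  have da : ∀ u ≤ u₀, HasDerivAt a ((1 - 2 * M * a u) * a u ^ 2) u := fun u hu =>
    hR.hasDerivAt_inv_u hu le_rfl
  have dρu : ∀ u ≤ u₀, ∀ v ≥ v₁, HasDerivAt (fun u' => ρ u' v)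
      ((1 - 2 * M * ρ u v) * ρ u v ^ 2) u := fun u hu v hv => hR.hasDerivAt_inv_u hu hv
  have dρv : ∀ u ≤ u₀, ∀ v ≥ v₁, HasDerivAt (fun v' => ρ u v')
      (-((1 - 2 * M * ρ u v) * ρ u v ^ 2)) v := fun u hu v hv => hR.hasDerivAt_inv_v hu hv
  have dyu : ∀ u ≤ u₀, ∀ v ≥ v₁, HasDerivAt (fun u' => y u' v) (yu u v) u := by
    intro u hu v hv
    refine (((dρu u hu v hv).div (da u hu) (a_pos u hu).ne').const_sub 1).congr_deriv ?_
    have := (a_pos u hu).ne'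
    simp only [hyu]
    field_simp
    ring
  have dyv : ∀ u ≤ u₀, ∀ v ≥ v₁, HasDerivAt (fun v' => y u v')
      ((1 - 2 * M * ρ u v) * ρ u v ^ 2 / a u) v := by
    intro u hu v hv
    refine (((dρv u hu v hv).div_const (a u)).const_sub 1).congr_deriv ?_
    ring
  have dBu : ∀ u ≤ u₀, ∀ v ≥ v₁, HasDerivAt (fun u' => B u' v) (Bu u v) u := by
    intro u hu v hv
    have h1 := (hp.dH _ (y_lt u hu v hv)).comp u (dyu u hu v hv)
    have h2 := (hp.dG _ (y_lt u hu v hv)).comp u (dyu u hu v hv)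
    refine (h1.add ((da u hu).mul h2)).congr_deriv ?_
    simp only [hBu, Function.comp]
    ring
  have dBv : ∀ u ≤ u₀, ∀ v ≥ v₁, HasDerivAt (fun v' => B u v') (Bv u v) v := by
    intro u hu v hv
    have h1 := (hp.dH _ (y_lt u hu v hv)).comp v (dyv u hu v hv)
    have h2 := (hp.dG _ (y_lt u hu v hv)).comp v (dyv u hu v hv)
    refine (h1.add (h2.const_mul (a u))).congr_deriv ?_
    simp only [hBv]
    ring
  have dBvu : ∀ u ≤ u₀, ∀ v ≥ v₁, HasDerivAt (fun u' => Bv u' v) (Buv u v) u := by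
    intro u hu v hv
    have h1 := (hp.dH₁ _ (y_lt u hu v hv)).comp u (dyu u hu v hv)
    have h2 := (hp.dG₁ _ (y_lt u hu v hv)).comp u (dyu u hu v hv)
    have h3 := ((((dρu u hu v hv).const_mul (2 * M)).const_sub 1).mul
      ((dρu u hu v hv).fun_pow 2)).div (da u hu) (a_pos u hu).ne'
    refine ((h1.add ((da u hu).mul h2)).mul h3).congr_deriv ?_
    have := (a_pos u hu).ne'
    simp only [hBuv, hyu, Function.comp, Pi.add_apply, Pi.mul_apply, Pi.div_apply]
    field_simp
    ring
  have dBuv : ∀ u ≤ u₀, ∀ v ≥ v₁, HasDerivAt (fun v' => Bu u v') (Buv u v) v := by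
    intro u hu v hv
    have h1 := (hp.dH₁ _ (y_lt u hu v hv)).comp v (dyv u hu v hv)
    have h2 := (hp.dG₁ _ (y_lt u hu v hv)).comp v (dyv u hu v hv)
    have h4 := (hp.dG _ (y_lt u hu v hv)).comp v (dyv u hu v hv)
    have h3 := ((dρv u hu v hv).mul_const (1 - 2 * M * a u)).sub
      (((((dρv u hu v hv).const_mul (2 * M)).const_sub 1).mul
        ((dρv u hu v hv).fun_pow 2)).div_const (a u))
    refine (((h1.add (h2.const_mul (a u))).mul h3).add
      (h4.const_mul ((1 - 2 * M * a u) * a u ^ 2))).congr_deriv ?_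
    have := (a_pos u hu).ne'
    simp only [hBuv, hyu, Function.comp, Pi.add_apply, Pi.mul_apply, Pi.sub_apply]
    field_simp
    ring
  -- the two equations for the profile remove the two leading orders in `a` of the residual
  have residual : ∀ u ≤ u₀, ∀ v ≥ v₁, Buv u v + potential M lam (ρ u v) * B u v
      = M * (-2 * (1 + (1 - y u v)) * ((1 - y u v) * y u v) * G₂ (y u v)
        - 6 * (1 - y u v) ^ 2 * G₁ (y u v) - 6 * (1 - y u v) * G (y u v))
        * ((1 - 2 * M * ρ u v) * ρ u v ^ 2) * a u ^ 2 := by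
    intro u hu v hv
    have h1 := hp.odeH _ (y_lt u hu v hv)
    have h2 := hp.odeG _ (y_lt u hu v hv)
    have hane := (a_pos u hu).ne'
    have hρy : ρ u v = (1 - y u v) * a u := by
      simp only [hy]; field_simp; ring
    have hyu' : yu u v = (1 - y u v) * a u * (1 - 2 * M * a u)
        - (1 - 2 * M * ((1 - y u v) * a u)) * ((1 - y u v) ^ 2 * a u) := by
      simp only [hyu]; rw [hρy]; field_simp
    have hw : (1 - 2 * M * ρ u v) * ρ u v ^ 2 / a u
        = (1 - 2 * M * ((1 - y u v) * a u)) * ((1 - y u v) ^ 2 * a u) := by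
      rw [hρy]; field_simp
    simp only [hBuv, hB, potential]
    rw [hw, hyu', hρy]
    clear_value y a
    generalize y u v = y at *
    generalize a u = a at *
    linear_combination (a ^ 2 * (1 - y) ^ 2 * (1 - 2 * M * (1 - y) * a)) * h1
      + (a ^ 3 * (1 - y) ^ 2 * (1 - 2 * M * (1 - y) * a)) * h2
  set S : Set (ℝ × ℝ) := Iic u₀ ×ˢ Ici v₁
  have cρ : ContinuousOn (fun p : ℝ × ℝ => ρ p.1 p.2) S := hR.continuousOn_inv
  have ca : ContinuousOn (fun p : ℝ × ℝ => a p.1) S :=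
    hR.continuousOn_inv.comp (f := fun p : ℝ × ℝ => (p.1, v₁)) (by fun_prop)
      fun p hp => ⟨hp.1, le_refl v₁⟩
  have ca0 : ∀ p ∈ S, a p.1 ≠ 0 := fun p hp => (a_pos p.1 hp.1).ne'
  have cy : ContinuousOn (fun p : ℝ × ℝ => y p.1 p.2) S := continuousOn_const.sub (cρ.div ca ca0)
  have my : MapsTo (fun p : ℝ × ℝ => y p.1 p.2) S (Iio 1) := fun p hp =>
    y_lt p.1 hp.1 p.2 hp.2
  have comp_y : ∀ {Z : ℝ → ℝ}, ContinuousOn Z (Iio 1) →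
      ContinuousOn (fun p : ℝ × ℝ => Z (y p.1 p.2)) S := fun hZ => hZ.comp cy my
  have cH := comp_y (Z := H) fun t ht => (hp.dH t ht).continuousAt.continuousWithinAt
  have cH₁ := comp_y (Z := H₁) fun t ht => (hp.dH₁ t ht).continuousAt.continuousWithinAt
  have cH₂ := comp_y hp.cH₂
  have cG := comp_y (Z := G) fun t ht => (hp.dG t ht).continuousAt.continuousWithinAt
  have cG₁ := comp_y (Z := G₁) fun t ht => (hp.dG₁ t ht).continuousAt.continuousWithinAt
  have cG₂ := comp_y hp.cG₂
  have cw : ContinuousOn (fun p : ℝ × ℝ => (1 - 2 * M * ρ p.1 p.2) * ρ p.1 p.2 ^ 2 / a p.1) S :=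
    ((continuousOn_const.sub (continuousOn_const.mul cρ)).mul (cρ.pow 2)).div ca ca0
  have cl : ContinuousOn (fun p : ℝ × ℝ => 1 - 2 * M * a p.1) S :=
    continuousOn_const.sub (continuousOn_const.mul ca)
  have cyu : ContinuousOn (fun p : ℝ × ℝ => yu p.1 p.2) S := (cρ.mul cl).sub cw
  have cB : ContinuousOn (fun p : ℝ × ℝ => B p.1 p.2) S := cH.add (ca.mul cG)
  have cH₁G₁ : ContinuousOn (fun p : ℝ × ℝ => H₁ (y p.1 p.2) + a p.1 * G₁ (y p.1 p.2)) S :=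
    cH₁.add (ca.mul cG₁)
  have cBu : ContinuousOn (fun p : ℝ × ℝ => Bu p.1 p.2) S :=
    (cH₁G₁.mul cyu).add ((cl.mul (ca.pow 2)).mul cG)
  have cBv : ContinuousOn (fun p : ℝ × ℝ => Bv p.1 p.2) S := cH₁G₁.mul cw
  have cBuv : ContinuousOn (fun p : ℝ × ℝ => Buv p.1 p.2) S :=
    cw.mul (((((continuousOn_const.mul cρ).sub (continuousOn_const.mul (cρ.pow 2))).mul
      cH₁G₁).add (((cH₂.add (ca.mul cG₂)).mul cyu).add ((cl.mul (ca.pow 2)).mul cG₁))).sub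
      (cH₁G₁.mul (cl.mul ca)))
  have cV : ContinuousOn (fun p : ℝ × ℝ => potential M lam (ρ p.1 p.2)) S :=
    (continuous_potential M lam).comp_continuousOn cρ
  refine ⟨fun u v => Ψ u v - B u v, fun u v => (-(lam - 6 * M * ρ u v) * ψ u v + 6 * M * f u v)
    - Bu u v, fun u v => χ u v - Bv u v,
    fun u v => -(Buv u v + potential M lam (ρ u v) * B u v), ?_, ?_, ?_, ?_, ?_, ?_⟩
  · constructor
    · exact fun u hu v hv => (h.Ψ_u u hu v hv).sub (dBu u hu v hv).hasDerivWithinAt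
    · exact fun u hu v hv => (h.Ψ_v u hu v hv).sub (dBv u hu v hv).hasDerivWithinAt
    · intro u hu v hv
      have d1 := (((dρv u hu v hv).const_mul (6 * M)).const_sub lam).fun_neg.hasDerivWithinAt
        (s := Ici v₁)
      refine (((d1.mul (h.ψ_v u hu v hv)).add ((h.f_v u hu v hv).const_mul (6 * M))).sub
        (dBuv u hu v hv).hasDerivWithinAt).congr_deriv ?_
      change _ = -potential M lam (ρ u v) * (Ψ u v - B u v)
        + -(Buv u v + potential M lam (ρ u v) * B u v)
      simp only [potential, ← show ρ u v = (R (v - u))⁻¹ from rfl]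
      ring
    · intro u hu v hv
      refine ((h.χ_u u hu v hv).sub (dBvu u hu v hv).hasDerivWithinAt).congr_deriv ?_
      change _ = -potential M lam (ρ u v) * (Ψ u v - B u v)
        + -(Buv u v + potential M lam (ρ u v) * B u v)
      simp only [← show ρ u v = (R (v - u))⁻¹ from rfl]
      ring
    · exact h.cont_Ψ.sub cB
    · exact (((continuousOn_const.sub (continuousOn_const.mul cρ)).neg.mul h.cont_ψ).add
        (continuousOn_const.mul h.cont_f)).sub cBu
    · exact h.cont_χ.sub cBv
    · exact (cBuv.add (cV.mul cB)).neg
  · intro u hu v hv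
    simp only [hB, hy, hρ, ha]
    ring
  · intro u hu v hv
    rfl
  · intro u hu
    simp only [hB, y_v₁ u hu, hp.H_zero, hp.G_zero, ha]
  · intro u hu
    have hane := (a_pos u hu).ne'
    have : yu u v₁ = 0 := by
      simp only [hyu]; rw [show ρ u v₁ = a u from rfl]; field_simp; ring
    simp only [hBu, y_v₁ u hu, this, hp.G_zero]
    simp only [ha, hρ]
    ring
  · obtain ⟨K, hK⟩ := hp.bound
    refine ⟨K, fun u hu v hv => ?_⟩
    have h1 := (hK (y u v) ⟨y_nonneg u hu v hv, y_lt u hu v hv⟩).2.2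
    have h2 := hR.lapse_inv_pos (t := v - u) (by linarith)
    have h3 := ρ_pos u hu v hv
    have h4 := a_pos u hu
    have hM := hR.nonneg
    simp only [residual u hu v hv]
    rw [abs_neg, abs_mul, abs_mul, abs_mul, abs_of_nonneg hM, abs_of_pos (a := a u ^ 2) (by positivity),
      abs_of_pos (a := (1 - 2 * M * ρ u v) * ρ u v ^ 2) (mul_pos h2 (by positivity))]
    have : 0 ≤ (1 - 2 * M * ρ u v) * ρ u v ^ 2 := (mul_pos h2 (by positivity)).le
    gcongr

end

/-! ### Radiation fields of modes along future null infinity -/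

section
variable {M lam u₀ v₁ : ℝ} {R : ℝ → ℝ} (hR : IsRadius M (v₁ - u₀) R)
include hR

/-- `f + r⁻¹ ψ` is the quantity whose `v`-derivative decays best. -/
theorem IsMode.add_mul_eq_integral {f ψ Ψ χ : ℝ → ℝ → ℝ} (h : IsMode M lam u₀ v₁ R f ψ Ψ χ)
    {u V : ℝ} (hu : u ≤ u₀) (hV : v₁ ≤ V) :
    f u V + (R (V - u))⁻¹ * ψ u V = f u v₁ + (R (v₁ - u))⁻¹ * ψ u v₁
      + ∫ v in v₁..V, (1 - 2 * M * (R (v - u))⁻¹) * (R (v - u))⁻¹ ^ 3 * Ψ u v := by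
  have cΨ : ContinuousOn (Ψ u) (Ici v₁) :=
    h.cont_Ψ.comp (f := fun v => (u, v)) (by fun_prop) fun _ hv => ⟨hu, hv⟩
  have cρ := hR.continuousOn_inv_v hu
  rw [integral_eq_sub_of_hasDerivWithinAt_Icc (f := fun v => f u v + (R (v - u))⁻¹ * ψ u v)
    (f' := fun v => (1 - 2 * M * (R (v - u))⁻¹) * (R (v - u))⁻¹ ^ 3 * Ψ u v) hV
    ?_ ((((continuousOn_const.sub (continuousOn_const.mul cρ)).mul (cρ.pow 3)).mul cΨ).mono
      fun x hx => hx.1)]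
  · ring
  · intro v hv
    refine (((h.f_v u hu v hv.1).add ((hR.hasDerivAt_inv_v hu hv.1).hasDerivWithinAt.mul
      (h.ψ_v u hu v hv.1))).congr_deriv ?_).mono fun x hx => hx.1
    ring

theorem IsMode.ψ_eq_integral {f ψ Ψ χ : ℝ → ℝ → ℝ} (h : IsMode M lam u₀ v₁ R f ψ Ψ χ)
    {u V : ℝ} (hu : u ≤ u₀) (hV : v₁ ≤ V) :
    ψ u V = ψ u v₁
      + ∫ v in v₁..V, (1 - 2 * M * (R (v - u))⁻¹) * (R (v - u))⁻¹ ^ 2 * Ψ u v := by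
  have cΨ : ContinuousOn (Ψ u) (Ici v₁) :=
    h.cont_Ψ.comp (f := fun v => (u, v)) (by fun_prop) fun _ hv => ⟨hu, hv⟩
  have cρ := hR.continuousOn_inv_v hu
  rw [integral_eq_sub_of_hasDerivWithinAt_Icc (f := fun v => ψ u v)
    (f' := fun v => (1 - 2 * M * (R (v - u))⁻¹) * (R (v - u))⁻¹ ^ 2 * Ψ u v) hV
    (fun v hv => (h.ψ_v u hu v hv.1).mono fun x hx => hx.1)
    ((((continuousOn_const.sub (continuousOn_const.mul cρ)).mul (cρ.pow 2)).mul cΨ).mono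
      fun x hx => hx.1)]
  ring

/-- The first transversal derivative on the initial cone: `ψ / (Ω² ρ²)` converges as
`u → -∞`. -/
theorem IsMode.exists_limit_ψ {f ψ Ψ χ : ℝ → ℝ → ℝ} (h : IsMode M lam u₀ v₁ R f ψ Ψ χ)
    (hlam : 6 ≤ lam) {Cf : ℝ} {k : ℕ}
    (hf : ∀ u ≤ u₀, |f u v₁| ≤ Cf * (R (v₁ - u))⁻¹ ^ (k + 4)) :
    ∃ (g : ℝ → ℝ) (c₁ K : ℝ), 0 ≤ K ∧ ∀ u ≤ u₀,
      ψ u v₁ = (1 - 2 * M * (R (v₁ - u))⁻¹) * (R (v₁ - u))⁻¹ ^ 2 * g u ∧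
      |g u - c₁| ≤ K * (R (v₁ - u))⁻¹ ^ (k + 1) ∧ |g u| ≤ K := by
  set c₀ := 1 - 2 * M * (R (v₁ - u₀))⁻¹
  have hc0 : 0 < c₀ := hR.lapse_inv_pos le_rfl
  have hM := hR.nonneg
  set w : ℝ → ℝ := fun u => (1 - 2 * M * (R (v₁ - u))⁻¹) * (R (v₁ - u))⁻¹ ^ 2 with hw
  have wpos : ∀ u ≤ u₀, 0 < w u := fun u hu =>
    mul_pos (hR.lapse_inv_pos (by linarith)) (pow_pos (hR.inv_pos (by linarith)) 2)
  have hCf : 0 ≤ Cf := nonneg_of_mul_nonneg_left ((abs_nonneg _).trans (hf u₀ le_rfl))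
    (pow_pos (hR.inv_pos le_rfl) _)
  have hdw : ∀ u ≤ u₀, HasDerivAt w
      ((2 * (R (v₁ - u))⁻¹ - 6 * M * (R (v₁ - u))⁻¹ ^ 2) * w u) u := by
    intro u hu
    have h1 := hR.hasDerivAt_inv_u hu (le_refl v₁)
    refine (((h1.const_mul (2 * M)).const_sub 1).mul (h1.fun_pow 2)).congr_deriv ?_
    simp only [hw]
    ring
  have hd : ∀ u ≤ u₀, HasDerivWithinAt (fun u => ψ u v₁ / w u)
      (-((lam - 2 + 6 * M * (R (v₁ - u))⁻¹) * f u v₁ / w u)) (Iic u₀) u := by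
    intro u hu
    refine ((h.ψ_u u hu v₁ le_rfl).div (hdw u hu).hasDerivWithinAt (wpos u hu).ne').congr_deriv ?_
    have := (wpos u hu).ne'
    field_simp
    ring
  have hle : ∀ u ≤ u₀, |-((lam - 2 + 6 * M * (R (v₁ - u))⁻¹) * f u v₁ / w u)|
      ≤ ((lam - 2 + 6 * M * (R (v₁ - u₀))⁻¹) * Cf * c₀⁻¹) * (R (v₁ - u))⁻¹ ^ (k + 2) := by
    intro u hu
    have l := hR.lapse_inv_mono (t' := v₁ - u) le_rfl (by linarith)
    have p := hR.inv_pos (t := v₁ - u) (by linarith)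
    have p' := hR.inv_anti (t := v₁ - u₀) (t' := v₁ - u) le_rfl (by linarith)
    rw [abs_neg, abs_div, abs_of_pos (wpos u hu), abs_mul,
      abs_of_nonneg (a := lam - 2 + 6 * M * (R (v₁ - u))⁻¹)
        (add_nonneg (by linarith) (by positivity)), div_le_iff₀ (wpos u hu)]
    have hlam' : 0 ≤ lam - 2 + 6 * M * (R (v₁ - u))⁻¹ := add_nonneg (by linarith) (by positivity)
    calc (lam - 2 + 6 * M * (R (v₁ - u))⁻¹) * |f u v₁|
        ≤ (lam - 2 + 6 * M * (R (v₁ - u₀))⁻¹) * (Cf * (R (v₁ - u))⁻¹ ^ (k + 4)) := by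
          have := hf u hu
          gcongr
          exact add_nonneg (by linarith) (mul_nonneg (by positivity) (p.le.trans p'))
      _ = (lam - 2 + 6 * M * (R (v₁ - u₀))⁻¹) * Cf * (c₀⁻¹ * c₀) * (R (v₁ - u))⁻¹ ^ (k + 2)
            * (R (v₁ - u))⁻¹ ^ 2 := by
          rw [inv_mul_cancel₀ hc0.ne']; ring
      _ ≤ (lam - 2 + 6 * M * (R (v₁ - u₀))⁻¹) * Cf * (c₀⁻¹ * (1 - 2 * M * (R (v₁ - u))⁻¹))
            * (R (v₁ - u))⁻¹ ^ (k + 2) * (R (v₁ - u))⁻¹ ^ 2 := by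
          have : 0 ≤ lam - 2 + 6 * M * (R (v₁ - u₀))⁻¹ :=
            add_nonneg (by linarith) (mul_nonneg (by positivity) (p.le.trans p'))
          gcongr
      _ = _ := by simp only [hw]; ring
  obtain ⟨c₁, -, K, hK⟩ := hR.exists_limit hd hle
  have hK0 : 0 ≤ K := nonneg_of_mul_nonneg_left ((abs_nonneg _).trans (hK u₀ le_rfl))
    (pow_pos (hR.inv_pos le_rfl) _)
  refine ⟨fun u => ψ u v₁ / w u, c₁, K + (K * (R (v₁ - u₀))⁻¹ ^ (k + 1) + |c₁|), ?_,
    fun u hu => ⟨?_, ?_, ?_⟩⟩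
  · have := hR.inv_pos (le_refl (v₁ - u₀)); positivity
  · have := (wpos u hu).ne'
    change _ = w u * _
    field_simp
  · refine (hK u hu).trans ?_
    have p := hR.inv_pos (t := v₁ - u) (by linarith)
    have p0 := hR.inv_pos (le_refl (v₁ - u₀))
    have : 0 ≤ K * (R (v₁ - u₀))⁻¹ ^ (k + 1) + |c₁| := by positivity
    gcongr
    linarith
  · have h1 := hK u hu
    have p := hR.inv_pos (t := v₁ - u) (by linarith)
    have p' := hR.inv_anti (t := v₁ - u₀) (t' := v₁ - u) le_rfl (by linarith)
    have h2 : K * (R (v₁ - u))⁻¹ ^ (k + 1) ≤ K * (R (v₁ - u₀))⁻¹ ^ (k + 1) := by gcongr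
    have h3 : |ψ u v₁ / w u| ≤ |ψ u v₁ / w u - c₁| + |c₁| := by
      simpa using abs_add_le (ψ u v₁ / w u - c₁) c₁
    linarith

/-- The leading behaviour of the radiation field along future null infinity of a mode without
incoming radiation.  The subleading profile is exact on Minkowski space only, so that data of higher
order (`k > 0`) give a smaller error only there. -/
theorem IsMode.exists_radiation_field {f ψ Ψ χ : ℝ → ℝ → ℝ}
    (h : IsMode M lam u₀ v₁ R f ψ Ψ χ) (hlam : 6 ≤ lam) {A κ Cf : ℝ} {k : ℕ}
    (hMk : M = 0 ∨ k = 0)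
    (hf : ∀ u ≤ u₀, |f u v₁| ≤ Cf * (R (v₁ - u))⁻¹ ^ (k + 4))
    (hΨ : Tendsto (fun u => Ψ u v₁) atBot (𝓝 (2 * A)))
    (hχ : ∀ V ≥ v₁, Tendsto (fun u => ∫ v in v₁..V, χ u v ^ 2) atBot (𝓝 0))
    (hprof : ∀ k', ∃ H H₁ H₂ G G₁ G₂ ΘH ΘG, IsProfile M lam A k' κ H H₁ H₂ G G₁ G₂ ΘH ΘG) :
    ∃ (L : ℝ → ℝ) (K : ℝ), ∀ u ≤ u₀, Tendsto (fun v => f u v) atTop (𝓝 (L u)) ∧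
      |L u - κ * (R (v₁ - u))⁻¹ ^ 3| ≤ K * (R (v₁ - u))⁻¹ ^ (k + 4) := by
  have hM := hR.nonneg
  obtain ⟨g, c₁, Kg, hKg0, hg⟩ := h.exists_limit_ψ hR hlam hf
  -- the subleading datum of `Ψ` on the initial cone is forced by `∂_u Ψ = -lam c₁ r₀⁻² + O(r₀⁻³)`
  obtain ⟨H, H₁, H₂, G, G₁, G₂, ΘH, ΘG, hp⟩ := hprof (-lam * c₁)
  obtain ⟨e, eu, ev, F, hw, hΨe, hev, he0, heu0, KF, hF⟩ := h.isWave_sub_profile hR hp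
  set a₀ := (R (v₁ - u₀))⁻¹
  have a₀pos : 0 < a₀ := hR.inv_pos le_rfl
  have hCf : 0 ≤ Cf := nonneg_of_mul_nonneg_left ((abs_nonneg _).trans (hf u₀ le_rfl))
    (pow_pos (hR.inv_pos le_rfl) _)
  have ap : ∀ u ≤ u₀, 0 < (R (v₁ - u))⁻¹ := fun u hu => hR.inv_pos (by linarith)
  have ale : ∀ u ≤ u₀, (R (v₁ - u))⁻¹ ≤ a₀ := fun u hu =>
    hR.inv_anti (t := v₁ - u₀) (t' := v₁ - u) le_rfl (by linarith)
  have hF' : ∀ u ≤ u₀, ∀ v ≥ v₁, |F u v| ≤ M * KF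
      * ((1 - 2 * M * (R (v - u))⁻¹) * (R (v - u))⁻¹ ^ 2) * (R (v₁ - u))⁻¹ ^ (k + 2) := by
    rcases hMk with h0 | h0
    · intro u hu v hv
      refine (hF u hu v hv).trans (le_of_eq ?_)
      rw [h0]; ring
    · subst h0; exact hF
  -- the transversal derivative of the difference on the initial cone
  have heu : ∀ u ≤ u₀, |eu u v₁| ≤ (lam * Kg + 6 * M * Kg + 6 * M * Cf * a₀)
      * (R (v₁ - u))⁻¹ ^ (k + 2 + 1) := by
    intro u hu
    obtain ⟨h1, h2, h3⟩ := hg u hu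
    rw [heu0 u hu, h1]
    have h4 := hf u hu
    have p := ap u hu
    have l0 := hR.lapse_inv_pos (t := v₁ - u) (by linarith)
    have l1 := hR.lapse_inv_le (t := v₁ - u) (by linarith)
    have hale := ale u hu
    generalize (R (v₁ - u))⁻¹ = a at *
    have e1 : -(lam - 6 * M * a) * ((1 - 2 * M * a) * a ^ 2 * g u) + 6 * M * f u v₁
        - -lam * c₁ * ((1 - 2 * M * a) * a ^ 2)
      = (1 - 2 * M * a) * (-(lam * a ^ 2) * (g u - c₁)) + (1 - 2 * M * a) * (6 * M * a ^ 3 * g u)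
        + 6 * M * f u v₁ := by ring
    rw [e1]
    have b1 : |(1 - 2 * M * a) * (-(lam * a ^ 2) * (g u - c₁))| ≤ lam * Kg * a ^ (k + 2 + 1) := by
      rw [abs_mul, abs_mul, abs_neg, abs_of_pos l0, abs_of_nonneg (a := lam * a ^ 2) (by positivity)]
      calc _ ≤ 1 * (lam * a ^ 2 * (Kg * a ^ (k + 1))) := by gcongr
        _ = _ := by ring
    have b2 : |(1 - 2 * M * a) * (6 * M * a ^ 3 * g u)| ≤ 6 * M * Kg * a ^ (k + 2 + 1) := by
      rw [abs_mul, abs_mul, abs_of_pos l0, abs_of_nonneg (a := 6 * M * a ^ 3) (by positivity)]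
      calc _ ≤ 1 * (6 * M * a ^ 3 * Kg) := by gcongr
        _ = _ := by
          rcases hMk with h0 | h0
          · rw [h0]; ring
          · rw [h0]; ring
    have b3 : |6 * M * f u v₁| ≤ 6 * M * Cf * a₀ * a ^ (k + 2 + 1) := by
      rw [abs_mul, abs_of_nonneg (a := 6 * M) (by positivity)]
      calc _ ≤ 6 * M * (Cf * a ^ (k + 4)) := by gcongr
        _ = 6 * M * Cf * a * a ^ (k + 2 + 1) := by ring
        _ ≤ _ := by gcongr
    refine (abs_add_three _ _ _).trans ?_
    linarith
  -- the difference itself on the initial cone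
  obtain ⟨ce, hce, Ke, hKe⟩ := hR.exists_limit (k := k + 1)
    (fun u hu => hw.deriv_u u hu v₁ le_rfl) (by simpa only [add_assoc] using heu)
  have hce0 : ce = 0 := by
    refine tendsto_nhds_unique hce ?_
    have h1 := hΨ.sub ((hR.tendsto_inv_atBot v₁).mul_const (-lam * c₁) |>.const_add (2 * A))
    rw [zero_mul, add_zero, sub_self] at h1
    refine h1.congr' ?_
    filter_upwards [eventually_le_atBot u₀] with u hu
    rw [he0 u hu]
  have he : ∀ u ≤ u₀, |e u v₁| ≤ Ke * (R (v₁ - u))⁻¹ ^ (k + 2) := fun u hu => by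
    simpa [hce0] using hKe u hu
  have hin : ∀ V ≥ v₁, Tendsto (fun U => ∫ v in v₁..V, ev U v ^ 2) atBot (𝓝 0) := by
    intro V hV
    obtain ⟨K₁, hK₁⟩ := hp.bound₁
    refine hR.tendsto_integral_sq_of_sub (K := K₁ + a₀ * K₁) hV h.cont_χ hw.cont_v
      (fun u hu v hv => ?_) (hχ V hV)
    rw [hev u hu v hv, sub_sub_cancel]
    have p := ap u hu
    have q : 0 < (R (v - u))⁻¹ := hR.inv_pos (by linarith)
    have l0 := hR.lapse_inv_pos (t := v - u) (by linarith)
    have l1 := hR.lapse_inv_le (t := v - u) (by linarith)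
    have hale := ale u hu
    have q' : (R (v - u))⁻¹ ≤ (R (v₁ - u))⁻¹ := hR.inv_anti (by linarith) (by linarith)
    set y := 1 - (R (v - u))⁻¹ / (R (v₁ - u))⁻¹ with hy
    have hy1 : (R (v - u))⁻¹ = (1 - y) * (R (v₁ - u))⁻¹ := by
      rw [hy, sub_sub_cancel, div_mul_cancel₀ _ p.ne']
    obtain ⟨k1, k2⟩ := hK₁ y ⟨sub_nonneg.2 ((div_le_one p).2 q'), sub_lt_self _ (div_pos q p)⟩
    generalize (R (v₁ - u))⁻¹ = a at *
    generalize (R (v - u))⁻¹ = b at *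
    have hK₁0 : 0 ≤ K₁ := (abs_nonneg _).trans k1
    have e1 : (H₁ y + a * G₁ y) * ((1 - 2 * M * b) * b ^ 2 / a)
        = ((1 - y) * H₁ y + a * ((1 - y) * G₁ y)) * ((1 - 2 * M * b) * b) := by
      have : b ^ 2 / a = (1 - y) * b := by
        rw [div_eq_iff p.ne']; linear_combination b * hy1
      rw [mul_div_assoc, this]; ring
    rw [e1, abs_mul, abs_of_pos (mul_pos l0 q)]
    have e3 : |(1 - y) * H₁ y + a * ((1 - y) * G₁ y)| ≤ K₁ + a₀ * K₁ := by
      refine (abs_add_le _ _).trans ?_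
      rw [abs_mul a, abs_of_pos p]
      gcongr
    have e4 : (1 - 2 * M * b) * b ≤ a := by nlinarith
    gcongr
  set Ce := max (lam * Kg + 6 * M * Kg + 6 * M * Cf * a₀) Ke
  obtain ⟨K, hK⟩ := hw.exists_tendsto_integral hR hlam (m := k + 2) (by omega) hF' (Ce := Ce)
    (fun u hu => (he u hu).trans (by have := ap u hu; gcongr; exact le_max_right _ _))
    (fun u hu => (heu u hu).trans (by have := ap u hu; gcongr; exact le_max_left _ _)) hin
  choose! l hl hl' using fun u hu => (hK u hu).1
  refine ⟨fun u => f u v₁ + (R (v₁ - u))⁻¹ * ψ u v₁ + (l u + ((R (v₁ - u))⁻¹ ^ 2 * 0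
    + (R (v₁ - u))⁻¹ ^ 3 * (κ + -lam * c₁ / lam))), Cf + Kg + 2 * M * Kg + K, fun u hu => ⟨?_, ?_⟩⟩
  · have p := ap u hu
    set a := (R (v₁ - u))⁻¹
    set ρ : ℝ → ℝ := fun v => (R (v - u))⁻¹
    set W : ℕ → ℝ → ℝ := fun n v => (1 - 2 * M * ρ v) * ρ v ^ n with hW
    set y : ℝ → ℝ := fun v => 1 - ρ v / a with hy
    set Q : ℝ → ℝ := fun v => H (y v) + a * G (y v) with hQ
    have ρpos : ∀ v ≥ v₁, 0 < ρ v := fun v hv => hR.inv_pos (by linarith)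
    have cρ : ContinuousOn ρ (Ici v₁) := hR.continuousOn_inv_v hu
    have cW : ∀ n, ContinuousOn (W n) (Ici v₁) := fun n =>
      (continuousOn_const.sub (continuousOn_const.mul cρ)).mul (cρ.pow n)
    have ce := (hw.continuousOn_v hu).1
    have hyI : ∀ v ≥ v₁, y v ∈ Ico (0 : ℝ) 1 := fun v hv =>
      ⟨sub_nonneg.2 ((div_le_one p).2 (hR.inv_anti (by linarith) (by linarith))),
        sub_lt_self _ (div_pos (ρpos v hv) p)⟩
    have dy : ∀ v ≥ v₁, HasDerivAt y (W 2 v / a) v := fun v hv =>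
      (((hR.hasDerivAt_inv_v hu hv).div_const a).const_sub 1).congr_deriv (by
        rw [neg_div, neg_neg])
    have cQ : ContinuousOn Q (Ici v₁) := fun v hv =>
      (((hp.dH _ (hyI v hv).2).comp v (dy v hv)).add (((hp.dG _ (hyI v hv).2).comp v
        (dy v hv)).const_mul a)).continuousAt.continuousWithinAt
    have split : ∀ n : ℕ, ∀ V ≥ v₁, ∫ v in v₁..V, W n v * Ψ u v
        = (∫ v in v₁..V, W n v * e u v) + ∫ v in v₁..V, W n v * Q v := by
      intro n V hV
      have i : ∀ {g : ℝ → ℝ}, ContinuousOn g (Ici v₁) →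
          IntervalIntegrable (fun v => W n v * g v) volume v₁ V := fun hg =>
        intervalIntegrable_of_continuousOn_Ici ((cW n).mul hg) hV
      rw [← intervalIntegral.integral_add (i ce) (i cQ)]
      refine integral_congr fun v hv => ?_
      rw [uIcc_of_le hV] at hv
      exact (congrArg (W n v * ·) (hΨe u hu v hv.1)).trans (mul_add _ _ _)
    -- the contribution of the profile
    have hΘ : ∀ V ≥ v₁, ∫ v in v₁..V, W 3 v * Q v = a ^ 2 * ΘH (y V) + a ^ 3 * ΘG (y V) := by
      intro V hV
      rw [integral_eq_sub_of_hasDerivWithinAt_Icc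
        (f := fun v => a ^ 2 * ΘH (y v) + a ^ 3 * ΘG (y v)) (f' := fun v => W 3 v * Q v) hV ?_
        (((cW 3).mul cQ).mono fun x hx => hx.1)]
      · have : y v₁ = 0 := sub_eq_zero.2 (div_self p.ne').symm
        simp [this, hp.ΘH_zero, hp.ΘG_zero]
      · intro v hv
        have d1 := (hp.dΘH _ (hyI v hv.1).2).comp v (dy v hv.1)
        have d2 := (hp.dΘG _ (hyI v hv.1).2).comp v (dy v hv.1)
        refine ((d1.const_mul (a ^ 2)).add (d2.const_mul (a ^ 3))).hasDerivWithinAt.congr_deriv ?_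
        simp only [hW, hQ]
        have hρy : ρ v = (1 - y v) * a := by simp only [hy]; field_simp; ring
        generalize y v = z at *
        rw [hρy]
        field_simp
    have hρ0 : Tendsto ρ atTop (𝓝 0) := hR.tendsto_inv_atTop u
    have hy1 : Tendsto y atTop (𝓝[<] 1) := tendsto_nhdsWithin_iff.2
      ⟨by simpa using (hρ0.div_const a).const_sub 1,
        (eventually_ge_atTop v₁).mono fun v hv => (hyI v hv).2⟩
    -- `ψ` is bounded along the outgoing cone
    obtain ⟨KB, hKB⟩ := hp.bound
    have hKB0 := (abs_nonneg _).trans (hKB 0 (by simp)).1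
    have hψ : ∀ V ≥ v₁, |ψ u V| ≤ |ψ u v₁| + (K + (KB + a₀ * KB) * a) := by
      intro V hV
      have h0 : ψ u V = ψ u v₁ + ∫ v in v₁..V, W 2 v * Ψ u v := h.ψ_eq_integral hR hu hV
      rw [h0, split 2 V hV]
      refine (abs_add_le _ _).trans (add_le_add le_rfl ((abs_add_le _ _).trans
        (add_le_add ((hK u hu).2 V hV) ?_)))
      refine (intervalIntegral.abs_integral_le_integral_abs hV).trans ?_
      calc _ ≤ ∫ v in v₁..V, (KB + a₀ * KB) * W 2 v := by
            refine integral_mono_on hV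
              (intervalIntegrable_of_continuousOn_Ici ((cW 2).mul cQ) hV).abs
              (intervalIntegrable_of_continuousOn_Ici (continuousOn_const.mul (cW 2)) hV)
              fun v hv => ?_
            obtain ⟨b1, b2, -⟩ := hKB _ (hyI v hv.1)
            have hale := ale u hu
            have hW2 : 0 < W 2 v :=
              mul_pos (hR.lapse_inv_pos (by linarith [hv.1])) (pow_pos (ρpos v hv.1) 2)
            rw [abs_mul, abs_of_pos hW2, mul_comm]
            refine mul_le_mul_of_nonneg_right ((abs_add_le _ _).trans (add_le_add b1 ?_)) hW2.le
            rw [abs_mul, abs_of_pos p]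
            gcongr
        _ = (KB + a₀ * KB) * ∫ v in v₁..V, W 2 v := intervalIntegral.integral_const_mul _ _
        _ ≤ _ := by
            have h1 := hR.integral_v_le 0 hu hV
            rw [zero_add, pow_one] at h1
            exact mul_le_mul_of_nonneg_left h1 (by positivity)
    have hρψ : Tendsto (fun V => ρ V * ψ u V) atTop (𝓝 0) := by
      refine squeeze_zero_norm' (a := fun V => ρ V * (|ψ u v₁| + (K + (KB + a₀ * KB) * a))) ?_
        (by simpa using hρ0.mul_const _)
      filter_upwards [eventually_ge_atTop v₁] with V hV
      have q := ρpos V hV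
      rw [Real.norm_eq_abs, abs_mul, abs_of_pos q]
      exact mul_le_mul_of_nonneg_left (hψ V hV) q.le
    have lim := (((hl u hu).add (((hp.ΘH_one.comp hy1).const_mul (a ^ 2)).add
      ((hp.ΘG_one.comp hy1).const_mul (a ^ 3)))).const_add (f u v₁ + a * ψ u v₁)).sub hρψ
    rw [sub_zero] at lim
    refine lim.congr' ?_
    filter_upwards [eventually_ge_atTop v₁] with V hV
    have h1 : f u V + ρ V * ψ u V = f u v₁ + a * ψ u v₁ + ∫ v in v₁..V, W 3 v * Ψ u v :=
      h.add_mul_eq_integral hR hu hV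
    rw [split 3 V hV, hΘ V hV, ← add_assoc] at h1
    exact sub_eq_iff_eq_add.2 ((add_assoc _ _ _).symm.trans h1.symm)
  · obtain ⟨h1, h2, h3⟩ := hg u hu
    beta_reduce
    rw [h1]
    have h4 := hf u hu
    have h5 := hl' u hu
    have p := ap u hu
    generalize (R (v₁ - u))⁻¹ = a at *
    -- the contributions of `c₁` from the initial cone and from the profile cancel
    have e1 : f u v₁ + a * ((1 - 2 * M * a) * a ^ 2 * g u) + (l u + (a ^ 2 * 0
        + a ^ 3 * (κ + -lam * c₁ / lam))) - κ * a ^ 3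
        = f u v₁ + a ^ 3 * (g u - c₁) + (-(2 * M * a ^ 4 * g u)) + l u := by
      have : -lam * c₁ / lam = -c₁ := by field_simp
      rw [this]; ring
    rw [e1]
    have b1 : |a ^ 3 * (g u - c₁)| ≤ Kg * a ^ (k + 4) := by
      rw [abs_mul, abs_of_pos (a := a ^ 3) (by positivity)]
      calc _ ≤ a ^ 3 * (Kg * a ^ (k + 1)) := by gcongr
        _ = _ := by ring
    have b2 : |-(2 * M * a ^ 4 * g u)| ≤ 2 * M * Kg * a ^ (k + 4) := by
      rw [abs_neg, abs_mul, abs_of_nonneg (a := 2 * M * a ^ 4) (by positivity)]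
      calc _ ≤ 2 * M * a ^ 4 * Kg := by gcongr
        _ = _ := by
          rcases hMk with h0 | h0
          · rw [h0]; ring
          · rw [h0]; ring
    have h5' : |l u| ≤ K * a ^ (k + 4) := h5
    calc _ ≤ |f u v₁ + a ^ 3 * (g u - c₁) + (-(2 * M * a ^ 4 * g u))| + |l u| := abs_add_le _ _
      _ ≤ (|f u v₁| + |a ^ 3 * (g u - c₁)| + |-(2 * M * a ^ 4 * g u)|) + |l u| := by
          gcongr; exact abs_add_three _ _ _
      _ ≤ _ := by linarith

end

/-! ### Existence of the profile near spacelike infinity -/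

section

/-- The operator `y (1 - y) ∂² + 2 (1 - y) ∂ + lam` governing the subleading profile. -/
noncomputable def profileOp (lam : ℝ) (f : ℝ[X]) : ℝ[X] :=
  X * (1 - X) * derivative (derivative f) + 2 * (1 - X) * derivative f + C lam * f

theorem coeff_profileOp (lam : ℝ) (f : ℝ[X]) (n : ℕ) : (profileOp lam f).coeff n
    = (lam - n * (n + 1)) * f.coeff n + (n + 1) * (n + 2) * f.coeff (n + 1) := by
  have e : profileOp lam f = X * derivative (derivative f) - X * (X * derivative (derivative f))
      + C 2 * derivative f - C 2 * (X * derivative f) + C lam * f := by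
    simp only [profileOp, map_ofNat]; ring
  rw [e]
  rcases n with _ | _ | n
  · simp [coeff_derivative]
    ring
  · simp [coeff_X_mul, coeff_derivative]
    ring
  · simp only [coeff_add, coeff_sub, coeff_C_mul, coeff_X_mul, coeff_derivative]
    push_cast
    ring

theorem profileOp_add (lam : ℝ) (f g : ℝ[X]) :
    profileOp lam (f + g) = profileOp lam f + profileOp lam g := by
  simp only [profileOp, derivative_add]; ring

theorem legendre_sub_ne_zero {ℓ n : ℕ} (h : n ≠ ℓ) : ((ℓ : ℝ) * (ℓ + 1) - n * (n + 1)) ≠ 0 := by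
  have : ((ℓ : ℝ) * (ℓ + 1) - n * (n + 1)) = (ℓ - n) * (ℓ + n + 1) := by ring
  rw [this]
  have h1 : (ℓ : ℝ) - n ≠ 0 := sub_ne_zero.2 (by exact_mod_cast h.symm)
  have h2 : (ℓ : ℝ) + n + 1 ≠ 0 := by positivity
  exact mul_ne_zero h1 h2

theorem exists_profileOp_eq_of_degree_lt {ℓ : ℕ} (n : ℕ) (hn : n ≤ ℓ) (Q : ℝ[X])
    (hQ : ∀ m ≥ n, Q.coeff m = 0) : ∃ f, profileOp (ℓ * (ℓ + 1)) f = Q := by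
  induction n generalizing Q with
  | zero => exact ⟨0, by ext m; simp [coeff_profileOp, hQ m (Nat.zero_le _)]⟩
  | succ n ih =>
    have h0 := legendre_sub_ne_zero (ℓ := ℓ) (n := n) (by omega)
    set f₀ := monomial n (Q.coeff n / ((ℓ : ℝ) * (ℓ + 1) - n * (n + 1))) with hf₀
    obtain ⟨f, hf⟩ := ih (by omega) (Q - profileOp (ℓ * (ℓ + 1)) f₀) fun m hm => by
      rw [coeff_sub, coeff_profileOp, hf₀, coeff_monomial, coeff_monomial]
      rcases hm.eq_or_lt with rfl | hm
      · simp [mul_div_cancel₀ _ h0]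
      · simp [hQ m hm, hm.ne, show n ≠ m + 1 by omega]
    exact ⟨f₀ + f, by rw [profileOp_add, hf]; ring⟩

/-- The cokernel of `profileOp` in degree at most `ℓ + 1` is spanned by any polynomial of degree
`ℓ`. -/
theorem exists_profileOp_eq_add {ℓ : ℕ} (Q W : ℝ[X]) (hQ : ∀ m ≥ ℓ + 2, Q.coeff m = 0)
    (hW : ∀ m ≥ ℓ + 1, W.coeff m = 0) (hW0 : W.coeff ℓ ≠ 0) :
    ∃ (f : ℝ[X]) (c : ℝ), profileOp (ℓ * (ℓ + 1)) f = Q + C c * W := by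
  have h0 := legendre_sub_ne_zero (ℓ := ℓ) (n := ℓ + 1) (by omega)
  set f₀ := monomial (ℓ + 1) (Q.coeff (ℓ + 1) / ((ℓ : ℝ) * (ℓ + 1) - (ℓ + 1 : ℕ) * ((ℓ + 1 : ℕ) + 1)))
    with hf₀
  set Q' := Q - profileOp (ℓ * (ℓ + 1)) f₀ with hQ'
  obtain ⟨f, hf⟩ := exists_profileOp_eq_of_degree_lt ℓ le_rfl (Q' + C (-(Q'.coeff ℓ / W.coeff ℓ)) * W)
    fun m hm => by
      rw [coeff_add, coeff_C_mul]
      rcases hm.eq_or_lt with rfl | hm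
      · field_simp; ring
      · rw [hW m hm, mul_zero, add_zero, hQ', coeff_sub, coeff_profileOp, hf₀, coeff_monomial,
          coeff_monomial]
        rcases (show ℓ + 1 ≤ m from hm).eq_or_lt with rfl | hm
        · simp only [if_true, show ¬ ℓ + 1 = ℓ + 1 + 1 by omega, if_false, mul_zero, add_zero]
          rw [mul_div_cancel₀ _ h0, sub_self]
        · simp [hQ m hm, show ¬ ℓ + 1 = m by omega, show ¬ ℓ = m by omega]
  exact ⟨f₀ + f, _, by rw [profileOp_add, hf, hQ']; ring⟩

end

/-- The shifted Legendre polynomial, normalised to be `1` at `0`. -/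
noncomputable def shiftedLegendre (ℓ : ℕ) : ℝ[X] := hypPoly ℓ (ℓ + 1) 1

theorem eval_one_shiftedLegendre (ℓ : ℕ) : (shiftedLegendre ℓ).eval 1 = (-1) ^ ℓ := by
  rw [shiftedLegendre, eval_one_hypPoly _ (by positivity) one_pos]
  have h1 : ∀ n : ℕ, ∏ i ∈ Finset.range n, (1 + (i : ℝ)) = n.factorial := fun n => by
    rw [← Finset.prod_range_add_one_eq_factorial]; push_cast
    exact prod_congr rfl fun i _ => add_comm _ _
  have h2 : ∏ i ∈ Finset.range ℓ, (1 - ((ℓ : ℝ) + 1) + i) = (-1) ^ ℓ * ℓ.factorial := by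
    have h3 : (-1 : ℝ) ^ ℓ = ∏ _i ∈ Finset.range ℓ, (-1 : ℝ) := by simp
    rw [← h1, ← Finset.prod_range_reflect (fun i : ℕ => (1 + (i : ℝ))), h3,
      ← Finset.prod_mul_distrib]
    refine prod_congr rfl fun i hi => ?_
    have : i + 1 ≤ ℓ := Finset.mem_range.1 hi
    rw [show ℓ - 1 - i = ℓ - (i + 1) by omega, Nat.cast_sub this]
    push_cast; ring
  rw [prod_div_distrib, h1, h2, mul_div_assoc, div_self (by positivity), mul_one]

theorem coeff_shiftedLegendre_ne_zero (ℓ : ℕ) : (shiftedLegendre ℓ).coeff ℓ ≠ 0 := by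
  rw [shiftedLegendre, coeff_hypPoly]
  have : ∀ n ≤ ℓ, hypCoeff ℓ (ℓ + 1) 1 n ≠ 0 := by
    intro n hn
    induction n with
    | zero => simp [hypCoeff]
    | succ n ih =>
      have h1 : (n : ℝ) - ℓ ≠ 0 := sub_ne_zero.2 (by exact_mod_cast (by omega : n ≠ ℓ))
      have h2 : (n : ℝ) + (ℓ + 1) ≠ 0 := by positivity
      have h3 : (n : ℝ) + 1 ≠ 0 := by positivity
      simp only [hypCoeff]
      exact mul_ne_zero (ih (by omega)) (div_ne_zero (mul_ne_zero h1 h2) (mul_ne_zero h3 h3))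
  exact this ℓ le_rfl

theorem coeff_shiftedLegendre_eq_zero {ℓ n : ℕ} (h : ℓ < n) : (shiftedLegendre ℓ).coeff n = 0 := by
  rw [shiftedLegendre, coeff_hypPoly, hypCoeff_eq_zero _ _ h]

section

theorem shiftedLegendre_ode (ℓ : ℕ) :
    X * (1 - X) * derivative (derivative (shiftedLegendre ℓ))
      + (1 - 2 * X) * derivative (shiftedLegendre ℓ)
      + C ((ℓ : ℝ) * (ℓ + 1)) * shiftedLegendre ℓ = 0 := by
  have h := hypPoly_ode (K := ℓ) (b := (ℓ : ℝ) + 1) (c := 1) one_pos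
  rw [show (ℓ : ℝ) + 1 - ℓ + 1 = 2 by ring] at h
  rw [map_ofNat, C_1] at h
  exact h

/-- The source of the subleading profile, its degree, and the degree of the resonant term. -/
theorem exists_profile_polynomial (ℓ : ℕ) (hℓ : 2 ≤ ℓ) (a : ℝ) :
    ∃ (f : ℝ[X]) (c : ℝ), profileOp (ℓ * (ℓ + 1)) f
      = C a * (2 * X * (1 - X) * derivative (shiftedLegendre ℓ)
          + (C (2 * ((ℓ : ℝ) * (ℓ + 1))) * (2 - X) - 6 * (1 - X)) * shiftedLegendre ℓ)
        + C c * (2 * X * derivative ((1 - X) * derivative (shiftedLegendre ℓ))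
          + X * derivative (shiftedLegendre ℓ)
          + 2 * ((1 - X) * derivative (shiftedLegendre ℓ))) := by
  have hz := fun m (hm : m ≥ ℓ + 1) => coeff_shiftedLegendre_eq_zero (ℓ := ℓ) (n := m) hm
  have hne := coeff_shiftedLegendre_ne_zero ℓ
  generalize shiftedLegendre ℓ = P at *
  have e : 2 * X * derivative ((1 - X) * derivative P) + X * derivative P
        + 2 * ((1 - X) * derivative P)
      = C 2 * (X * derivative (derivative P)) - C 2 * (X * derivative (X * derivative P))
        - X * derivative P + C 2 * derivative P := by
    simp only [map_ofNat, sub_mul, one_mul, derivative_sub]; ring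
  apply exists_profileOp_eq_add
  · intro m hm
    obtain ⟨n, rfl⟩ : ∃ n, m = n + 2 := ⟨m - 2, by omega⟩
    have e : C a * (2 * X * (1 - X) * derivative P
          + (C (2 * ((ℓ : ℝ) * (ℓ + 1))) * (2 - X) - 6 * (1 - X)) * P)
        = C (2 * a) * (X * derivative P) - C (2 * a) * (X * (X * derivative P))
          + C (a * (4 * ((ℓ : ℝ) * (ℓ + 1)) - 6)) * P
          - C (a * (2 * ((ℓ : ℝ) * (ℓ + 1)) - 6)) * (X * P) := by
      simp only [map_mul, map_sub, map_ofNat]; ring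
    rw [e]
    simp only [coeff_add, coeff_sub, coeff_C_mul, coeff_X_mul, coeff_derivative]
    rw [hz (n + 1 + 1) (by omega), hz (n + 1) (by omega)]
    ring
  · intro m hm
    obtain ⟨n, rfl⟩ : ∃ n, m = n + 1 := ⟨m - 1, by omega⟩
    rw [e]
    simp only [coeff_add, coeff_sub, coeff_C_mul, coeff_X_mul, coeff_derivative]
    rw [hz (n + 1 + 1) (by omega), hz (n + 1) (by omega)]
    ring
  · obtain ⟨n, rfl⟩ : ∃ n, ℓ = n + 1 := ⟨ℓ - 1, by omega⟩
    rw [e]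
    simp only [coeff_add, coeff_sub, coeff_C_mul, coeff_X_mul, coeff_derivative]
    rw [hz (n + 1 + 1) (by omega)]
    have : (-(2 * (n : ℝ) + 3) * (n + 1)) * P.coeff (n + 1) ≠ 0 :=
      mul_ne_zero (mul_ne_zero (neg_ne_zero.2 (by positivity)) (by positivity)) hne
    convert this using 1
    push_cast
    ring

end

/-- Profiles exist for all data `A`, `k`; the contribution `κ` to the radiation field depends on
`A` and on the mass only. -/
theorem exists_isProfile (M A k : ℝ) {ℓ : ℕ} (hℓ : 2 ≤ ℓ) :
    ∃ H H₁ H₂ G G₁ G₂ ΘH ΘG, IsProfile M (ℓ * (ℓ + 1)) A k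
      ((-1) ^ (ℓ + 1) * (4 * M * A) / (((ℓ : ℝ) * (ℓ + 1) - 2) * (ℓ * (ℓ + 1))))
      H H₁ H₂ G G₁ G₂ ΘH ΘG := by
  have hℓ' : (2 : ℝ) ≤ ℓ := by exact_mod_cast hℓ
  obtain ⟨f, c, hf⟩ := exists_profile_polynomial ℓ hℓ (-(2 * M * A))
  obtain ⟨lam, hlam⟩ : ∃ lam, lam = (ℓ : ℝ) * (ℓ + 1) := ⟨_, rfl⟩
  have hlam6 : 6 ≤ lam := by rw [hlam]; nlinarith
  have hlam0 : lam ≠ 0 := by linarith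
  have hlam2 : lam - 2 ≠ 0 := by linarith
  have hode := shiftedLegendre_ode ℓ
  rw [← hlam] at hf hode ⊢
  set p := shiftedLegendre ℓ
  set P : ℝ → ℝ := fun y => p.eval y
  set P₁ : ℝ → ℝ := fun y => p.derivative.eval y
  set P₂ : ℝ → ℝ := fun y => p.derivative.derivative.eval y
  set P₃ : ℝ → ℝ := fun y => p.derivative.derivative.derivative.eval y
  set f₀ : ℝ → ℝ := fun y => f.eval y
  set f₁ : ℝ → ℝ := fun y => f.derivative.eval y
  set f₂ : ℝ → ℝ := fun y => f.derivative.derivative.eval y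
  have dP : ∀ y, HasDerivAt P (P₁ y) y := fun y => p.hasDerivAt y
  have dP₁ : ∀ y, HasDerivAt P₁ (P₂ y) y := fun y => p.derivative.hasDerivAt y
  have dP₂ : ∀ y, HasDerivAt P₂ (P₃ y) y := fun y => p.derivative.derivative.hasDerivAt y
  have df : ∀ y, HasDerivAt f₀ (f₁ y) y := fun y => f.hasDerivAt y
  have df₁ : ∀ y, HasDerivAt f₁ (f₂ y) y := fun y => f.derivative.hasDerivAt y
  have cP : Continuous P := p.continuous
  have cP₁ : Continuous P₁ := p.derivative.continuous
  have cP₂ : Continuous P₂ := p.derivative.derivative.continuous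
  have cP₃ : Continuous P₃ := p.derivative.derivative.derivative.continuous
  have cf : Continuous f₀ := f.continuous
  have cf₁ : Continuous f₁ := f.derivative.continuous
  have cf₂ : Continuous f₂ := f.derivative.derivative.continuous
  have odeP : ∀ y, (1 - y) * y * P₂ y + (1 - 2 * y) * P₁ y + lam * P y = 0 := fun y => by
    have := congrArg (eval y) hode
    simp at this
    linear_combination this
  -- the derivative of the equation for `P`
  have odeP₁ : ∀ y, (1 - y) * y * P₃ y + 2 * (1 - 2 * y) * P₂ y + (lam - 2) * P₁ y = 0 := fun y => by
    have := congrArg (fun q => eval y (derivative q)) hode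
    simp at this
    linear_combination this
  set S : ℝ → ℝ := fun y => 2 * y * (1 - y) * P₁ y + (2 * lam * (2 - y) - 6 * (1 - y)) * P y with hS
  have odef : ∀ y, (1 - y) * y * f₂ y + 2 * (1 - y) * f₁ y + lam * f₀ y
      = -(2 * M * A) * S y
        + c * (2 * y * ((1 - y) * P₂ y - P₁ y) + y * P₁ y + 2 * ((1 - y) * P₁ y)) := fun y => by
    have := congrArg (eval y) hf
    simp [profileOp] at this
    simp only [hS]
    linear_combination this
  have P0 : P 0 = 1 := eval_zero_hypPoly _ _ _
  have P1 : P 1 = (-1) ^ ℓ := eval_one_shiftedLegendre ℓ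
  have P₁0 : P₁ 0 = -lam := by linear_combination odeP 0 - lam * P0
  have P₁1 : P₁ 1 = lam * P 1 := by linear_combination -odeP 1
  have P1sq : P 1 * P 1 = 1 := by rw [P1, ← mul_pow]; simp
  -- the resonant part of the source needs a logarithm; the coefficient `κ'` of the homogeneous
  -- solution `(1 - y) P'` is fixed by the data
  set κ' := -(k - f₀ 0) / lam with hκ'
  set G : ℝ → ℝ := fun y => f₀ y + c * ((1 - y) * P₁ y) * Real.log (1 - y)
    + κ' * ((1 - y) * P₁ y) with hG
  set G₁ : ℝ → ℝ := fun y => f₁ y + c * (((1 - y) * P₂ y - P₁ y) * Real.log (1 - y) - P₁ y)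
    + κ' * ((1 - y) * P₂ y - P₁ y) with hG₁
  set G₂ : ℝ → ℝ := fun y => f₂ y + c * (((1 - y) * P₃ y - 2 * P₂ y) * Real.log (1 - y)
    - ((1 - y) * P₂ y - P₁ y) / (1 - y) - P₂ y) + κ' * ((1 - y) * P₃ y - 2 * P₂ y) with hG₂
  have dz : ∀ y : ℝ, HasDerivAt (fun y : ℝ => 1 - y) (-1) y := fun y => (hasDerivAt_id' y).const_sub 1
  have dlog : ∀ y < (1 : ℝ), HasDerivAt (fun y : ℝ => Real.log (1 - y)) (-(1 - y)⁻¹) y := by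
    intro y hy
    refine ((dz y).log (by linarith)).congr_deriv ?_
    ring
  have db : ∀ y, HasDerivAt (fun y => (1 - y) * P₁ y) ((1 - y) * P₂ y - P₁ y) y := fun y =>
    ((dz y).mul (dP₁ y)).congr_deriv (by ring)
  have db₁ : ∀ y, HasDerivAt (fun y => (1 - y) * P₂ y - P₁ y) ((1 - y) * P₃ y - 2 * P₂ y) y :=
    fun y => (((dz y).mul (dP₂ y)).sub (dP₁ y)).congr_deriv (by ring)
  have dG : ∀ y < 1, HasDerivAt G (G₁ y) y := by
    intro y hy
    have : 1 - y ≠ 0 := by linarith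
    refine (((df y).add (((db y).const_mul c).mul (dlog y hy))).add
      ((db y).const_mul κ')).congr_deriv ?_
    simp only [hG₁]
    field_simp
    ring
  have dG₁ : ∀ y < 1, HasDerivAt G₁ (G₂ y) y := by
    intro y hy
    have : 1 - y ≠ 0 := by linarith
    refine (((df₁ y).add ((((db₁ y).mul (dlog y hy)).sub (dP₁ y)).const_mul c)).add
      ((db₁ y).const_mul κ')).congr_deriv ?_
    simp only [hG₂]
    field_simp
    ring
  have odeG : ∀ y < 1, (1 - y) * y * G₂ y + 2 * (1 - y) * G₁ y + lam * G y
      = -(2 * M * A) * S y := by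
    intro y hy
    have : 1 - y ≠ 0 := by linarith
    have e : (1 - y) * (((1 - y) * P₂ y - P₁ y) / (1 - y)) = (1 - y) * P₂ y - P₁ y := by
      field_simp
    simp only [hG, hG₁, hG₂]
    linear_combination odef y + (c * (1 - y) * Real.log (1 - y) + κ' * (1 - y)) * odeP₁ y
      - c * y * e
  have hG0 : G 0 = k := by
    simp only [hG, P₁0, hκ', sub_zero, Real.log_one]
    field_simp
    ring
  -- continuous extensions to `y = 1`
  set N : ℝ → ℝ := fun y => (1 - y) * Real.log (1 - y) with hN
  have cN : Continuous N := Real.continuous_mul_log.comp (continuous_const.sub continuous_id)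
  set Gc : ℝ → ℝ := fun y => f₀ y + c * P₁ y * N y + κ' * ((1 - y) * P₁ y) with hGc
  set Gc₁ : ℝ → ℝ := fun y => (1 - y) * f₁ y
    + c * (((1 - y) * P₂ y - P₁ y) * N y - (1 - y) * P₁ y)
    + κ' * (1 - y) * ((1 - y) * P₂ y - P₁ y) with hGc₁
  set Gc₂ : ℝ → ℝ := fun y => (1 - y) * f₂ y + c * (((1 - y) * P₃ y - 2 * P₂ y) * N y
    - ((1 - y) * P₂ y - P₁ y) - (1 - y) * P₂ y) + κ' * (1 - y) * ((1 - y) * P₃ y - 2 * P₂ y)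
    with hGc₂
  have eGc : ∀ y, G y = Gc y := fun y => by simp only [hG, hGc, hN]; ring
  have eGc₁ : ∀ y, (1 - y) * G₁ y = Gc₁ y := fun y => by simp only [hG₁, hGc₁, hN]; ring
  have eGc₂ : ∀ y < 1, (1 - y) * G₂ y = Gc₂ y := fun y hy => by
    have : 1 - y ≠ 0 := by linarith
    simp only [hG₂, hGc₂, hN]; field_simp
  have cGc : Continuous Gc := by simp only [hGc]; fun_prop
  have cGc₁ : Continuous Gc₁ := by simp only [hGc₁]; fun_prop
  have cGc₂ : Continuous Gc₂ := by simp only [hGc₂]; fun_prop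
  have Gc₁1 : Gc₁ 1 = 0 := by simp [hGc₁, hN]
  have tendsto_one : ∀ {Z : ℝ → ℝ}, Continuous Z → Tendsto Z (𝓝[<] 1) (𝓝 (Z 1)) := fun hZ =>
    hZ.continuousAt.tendsto.mono_left nhdsWithin_le_nhds
  have bdd : ∀ {Z : ℝ → ℝ}, Continuous Z → ∃ K, ∀ y ∈ Ico (0 : ℝ) 1, |Z y| ≤ K := fun hZ => by
    obtain ⟨K, hK⟩ := isCompact_Icc.exists_bound_of_continuousOn (s := Icc (0 : ℝ) 1)
      hZ.continuousOn
    exact ⟨K, fun y hy => hK y ⟨hy.1, hy.2.le⟩⟩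
  -- explicit primitives, vanishing at both ends, of `P`, `(1 - y) P` and of the source
  set q : ℝ → ℝ := fun y => (1 - y) * y * P₁ y with hq
  have dy : ∀ y : ℝ, HasDerivAt (fun y : ℝ => y) 1 y := hasDerivAt_id'
  have dq : ∀ y, HasDerivAt q (-lam * P y) y := fun y => by
    refine ((((dz y).mul (dy y)).mul (dP₁ y))).congr_deriv ?_
    simp only [Pi.mul_apply]
    linear_combination odeP y
  have dzyP : ∀ y, HasDerivAt (fun y => (1 - y) * y * P y) ((1 - 2 * y) * P y + q y) y := fun y => by
    refine ((((dz y).mul (dy y)).mul (dP y))).congr_deriv ?_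
    simp only [hq, Pi.mul_apply]; ring
  set p₁ : ℝ → ℝ := fun y => (-((1 - y) * q y + (1 - y) * y * P y) + q y / lam) / (lam - 2) with hp₁
  have dp₁ : ∀ y, HasDerivAt p₁ ((1 - y) * P y) y := fun y => by
    refine ((((dz y).mul (dq y)).add (dzyP y)).fun_neg.add ((dq y).div_const lam)).div_const
      (lam - 2) |>.congr_deriv ?_
    field_simp
    ring
  set σ₀ : ℝ → ℝ := fun y => 2 * ((1 - y) * y * P y - 2 * p₁ y - q y / lam)
    - 2 * q y + (2 * lam - 6) * p₁ y with hσ₀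
  have dσ₀ : ∀ y, HasDerivAt σ₀ (S y) y := fun y => by
    refine (((((dzyP y).sub ((dp₁ y).const_mul 2)).sub ((dq y).div_const lam)).const_mul 2).sub
      ((dq y).const_mul 2) |>.add ((dp₁ y).const_mul (2 * lam - 6))).congr_deriv ?_
    simp only [hq, hS]
    field_simp
    ring
  set σ₁ : ℝ → ℝ := fun y => 2 * ((1 - y) * ((1 - y) * y * P y)) + (4 + 2 * lam) * p₁ y
    + 2 * (-((1 - y) ^ 2 * q y + 2 * ((1 - y) * ((1 - y) * y * P y))) - 4 * p₁ y) with hσ₁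
  have dσ₁ : ∀ y, HasDerivAt σ₁ ((1 - y) * S y) y := fun y => by
    have d1 := ((dz y).mul (dzyP y))
    refine (((d1.const_mul 2).add ((dp₁ y).const_mul (4 + 2 * lam))).add
      ((((((dz y).fun_pow 2).mul (dq y)).add (d1.const_mul 2)).fun_neg.sub
        ((dp₁ y).const_mul 4)).const_mul 2)).congr_deriv ?_
    simp only [hq, hS]
    ring
  -- the value `G 1`, from the adjoint equation
  set U : ℝ → ℝ := fun y => q y ^ 2 / lam + (1 - y) * y * P y ^ 2 with hU
  set W : ℝ → ℝ := fun y => (2 * lam * (2 - y) - 6 * (1 - y)) * y with hW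
  set J : ℝ → ℝ := fun y => 2 * (y * P y * q y) - (1 - y) * y * P y ^ 2 + U y - lam * U y
    + W y * P y ^ 2 / 2 - (lam - 3) * U y with hJ
  have dzyP2 : ∀ y, HasDerivAt (fun y => (1 - y) * y * P y ^ 2)
      ((1 - 2 * y) * P y ^ 2 + 2 * P y * q y) y := fun y => by
    refine ((((dz y).mul (dy y)).mul ((dP y).fun_pow 2))).congr_deriv ?_
    simp only [hq, Pi.mul_apply]; ring
  have dU : ∀ y, HasDerivAt U ((1 - 2 * y) * P y ^ 2) y := fun y => by
    refine ((((dq y).fun_pow 2).div_const lam).add (dzyP2 y)).congr_deriv ?_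
    field_simp
    ring
  have dW : ∀ y, HasDerivAt W (2 * lam + (2 * lam - 6) * (1 - 2 * y)) y := fun y => by
    refine ((((((dy y).const_sub 2).const_mul (2 * lam)).sub ((dz y).const_mul 6))).mul
      (dy y)).congr_deriv ?_
    simp only [Pi.sub_apply]
    ring
  have dJ : ∀ y, HasDerivAt J (y * P₁ y * S y) y := fun y => by
    refine (((((((((dy y).mul (dP y)).mul (dq y)).const_mul 2).sub (dzyP2 y)).add (dU y)).sub
      ((dU y).const_mul lam)).add (((dW y).mul ((dP y).fun_pow 2)).div_const 2)).sub
      ((dU y).const_mul (lam - 3))).congr_deriv ?_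
    simp only [hq, hW, hS, Pi.mul_apply]
    ring
  -- testing the equation for `G` with `y P'`, which solves the adjoint equation, gives a constant
  set I : ℝ → ℝ := fun y => (1 - y) * y * (y * P₁ y) * G₁ y
    + (y * P₁ y - (1 - y) * y * (P₁ y + y * P₂ y)) * G y + 2 * M * A * J y with hI
  have dI : ∀ y < 1, HasDerivAt I 0 y := fun y hy => by
    have d1 := (dy y).mul (dP₁ y)
    have d2 := (dz y).mul (dy y)
    refine ((((d2.mul d1).mul (dG₁ y hy)).add
      ((d1.sub (d2.mul ((dP₁ y).add ((dy y).mul (dP₂ y))))).mul (dG y hy))).add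
      ((dJ y).const_mul (2 * M * A))).congr_deriv ?_
    simp only [Pi.mul_apply, Pi.add_apply, Pi.sub_apply]
    linear_combination (y * P₁ y) * odeG y hy - (y * G y) * odeP₁ y
  have hI0 : ∀ y ∈ Ico (0 : ℝ) 1, I y = 0 := fun y hy => by
    have h1 := constant_of_has_deriv_right_zero (f := I) (a := 0) (b := y)
      (fun x hx => (dI x (hx.2.trans_lt hy.2)).continuousAt.continuousWithinAt)
      (fun x hx => (dI x (hx.2.trans hy.2)).hasDerivWithinAt) y ⟨hy.1, le_rfl⟩
    rw [h1]
    simp [hI, hJ, hU, hW, hq]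
  have cJ : Continuous J := continuous_iff_continuousAt.2 fun y => (dJ y).continuousAt
  have hG1 : P₁ 1 * Gc 1 + 2 * M * A * lam = 0 := by
    have h1 := tendsto_one (Z := fun y => y * (y * P₁ y) * Gc₁ y
      + (y * P₁ y - (1 - y) * y * (P₁ y + y * P₂ y)) * Gc y + 2 * M * A * J y) (by fun_prop)
    have h2 : J 1 = lam := by
      simp only [hJ, hU, hW, hq]
      linear_combination lam * P1sq
    have h3 := tendsto_nhds_unique (h1.congr' (f₂ := fun _ => (0 : ℝ)) ?_) tendsto_const_nhds
    · rw [h2, Gc₁1] at h3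
      linear_combination h3
    · filter_upwards [Ioo_mem_nhdsLT (show (0 : ℝ) < 1 by norm_num)] with y hy
      rw [← hI0 y ⟨hy.1.le, hy.2⟩, ← eGc₁, ← eGc]
      simp only [hI]; ring
  have hG1' : Gc 1 = (-1) ^ (ℓ + 1) * (2 * M * A) := by
    have h1 : lam * (P 1 * Gc 1 + 2 * M * A) = 0 := by rw [P₁1] at hG1; linear_combination hG1
    have h2 := (mul_eq_zero.1 h1).resolve_left hlam0
    rw [pow_succ, ← P1]
    linear_combination P 1 * h2 - Gc 1 * P1sq
  set ΘG : ℝ → ℝ := fun y => (-(2 * M * A) * σ₁ y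
    - 2 / lam * (-(2 * M * A) * σ₀ y - ((1 - y) * y * G₁ y + G y) + k)
    - ((1 - y) * ((1 - y) * y * G₁ y) + (1 - y) * G y + (1 - y) * y * G y) + k) / (lam - 2) with hΘG
  refine ⟨fun y => 2 * A * P y, fun y => 2 * A * P₁ y, fun y => 2 * A * P₂ y, G, G₁, G₂,
    fun y => 2 * A * p₁ y, ΘG, ?_⟩
  constructor
  · exact fun y _ => (dP y).const_mul _
  · exact fun y _ => (dP₁ y).const_mul _
  · exact dG
  · exact dG₁
  · exact (continuous_const.mul cP₂).continuousOn
  · have : ContinuousOn (fun y => Gc₂ y / (1 - y)) (Iio 1) :=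
      cGc₂.continuousOn.div (by fun_prop) fun y hy => sub_ne_zero.2 (ne_of_gt hy)
    refine this.congr fun y hy => ?_
    change _ = Gc₂ y / (1 - y)
    rw [← eGc₂ y hy, mul_div_cancel_left₀ _ (sub_ne_zero.2 (ne_of_gt hy))]
  · simp only [P0, mul_one]
  · exact hG0
  · intro y _
    linear_combination 2 * A * odeP y
  · intro y hy
    simp only [hS] at odeG
    linear_combination odeG y hy + (-4 * M * A * (2 - y)) * odeP y
  · obtain ⟨K₁, hK₁⟩ := bdd (continuous_const.mul cP : Continuous fun y => 2 * A * P y)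
    obtain ⟨K₂, hK₂⟩ := bdd cGc
    obtain ⟨K₃, hK₃⟩ := bdd (Z := fun y => -2 * (1 + (1 - y)) * y * Gc₂ y - 6 * (1 - y) * Gc₁ y
      - 6 * (1 - y) * Gc y) (by fun_prop)
    refine ⟨max K₁ (max K₂ K₃), fun y hy => ⟨(hK₁ y hy).trans (le_max_left _ _), ?_, ?_⟩⟩
    · rw [eGc]; exact (hK₂ y hy).trans ((le_max_left _ _).trans (le_max_right _ _))
    · refine le_trans (le_of_eq ?_) ((hK₃ y hy).trans ((le_max_right _ _).trans (le_max_right _ _)))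
      rw [← eGc, ← eGc₁, ← eGc₂ y hy.2]
      ring_nf
  · obtain ⟨K₁, hK₁⟩ := bdd (Z := fun y => (1 - y) * (2 * A * P₁ y)) (by fun_prop)
    obtain ⟨K₂, hK₂⟩ := bdd cGc₁
    refine ⟨max K₁ K₂, fun y hy => ⟨(hK₁ y hy).trans (le_max_left _ _), ?_⟩⟩
    rw [eGc₁]; exact (hK₂ y hy).trans (le_max_right _ _)
  · intro y _
    exact ((dp₁ y).const_mul (2 * A)).congr_deriv (by ring)
  · intro y hy
    have d2 := (dz y).mul (dy y)
    have d3 := d2.mul (dG₁ y hy)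
    have d4 := (dz y).mul (dG y hy)
    refine ((((((dσ₁ y).const_mul (-(2 * M * A))).sub (((((dσ₀ y).const_mul (-(2 * M * A))).sub
      (d3.add (dG y hy))).add_const k).const_mul (2 / lam))).sub
      ((((dz y).mul d3).add d4).add (d2.mul (dG y hy)))).add_const k).div_const
      (lam - 2)).congr_deriv ?_
    simp only [Pi.mul_apply]
    have h := odeG y hy
    rw [div_eq_iff hlam2]
    have e1 : 2 / lam * lam = 2 := by field_simp
    linear_combination (-(1 - y) + 2 / lam) * h + (-G y) * e1
  · simp [hp₁, hq]
  · simp only [hΘG, hσ₁, hσ₀, hp₁, hq, hG0]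
    field_simp
    ring
  · have : Tendsto (fun y => 2 * A * p₁ y) (𝓝[<] 1) (𝓝 (2 * A * p₁ 1)) :=
      tendsto_one (continuous_const.mul (continuous_iff_continuousAt.2 fun y =>
        (dp₁ y).continuousAt))
    simpa [hp₁, hq] using this
  · have cσ₀ : Continuous σ₀ := continuous_iff_continuousAt.2 fun y => (dσ₀ y).continuousAt
    have cσ₁ : Continuous σ₁ := continuous_iff_continuousAt.2 fun y => (dσ₁ y).continuousAt
    have h1 := tendsto_one (Z := fun y => (-(2 * M * A) * σ₁ y
      - 2 / lam * (-(2 * M * A) * σ₀ y - (y * Gc₁ y + Gc y) + k)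
      - ((1 - y) * (y * Gc₁ y) + (1 - y) * Gc y + (1 - y) * y * Gc y) + k) / (lam - 2))
      (by fun_prop)
    refine (h1.congr fun y => ?_).trans (le_of_eq ?_)
    · simp only [hΘG, ← eGc, ← eGc₁]
      ring
    congr 1
    rw [Gc₁1, hG1']
    simp only [hσ₁, hσ₀, hp₁, hq]
    field_simp
    ring

/-! ### Exact modes on Minkowski space -/

section

theorem eval_scatPoly_ode {ℓ p : ℕ} (hp : 2 ≤ p) (y : ℝ) :
    y * (1 - y) * (derivative (derivative (scatPoly ℓ p))).eval y
      + ((p : ℝ) - 1 + 2 * y) * (derivative (scatPoly ℓ p)).eval y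
      + ((ℓ : ℝ) * (ℓ + 1) - 2) * (scatPoly ℓ p).eval y = 0 := by
  have := congrArg (eval y) (scatPoly_ode (ℓ := ℓ) hp)
  simp at this
  linear_combination this

theorem eval_scatPoly_ode₁ {ℓ p : ℕ} (hp : 2 ≤ p) (y : ℝ) :
    y * (1 - y) * (derivative (derivative (derivative (scatPoly ℓ p)))).eval y
      + (p : ℝ) * (derivative (derivative (scatPoly ℓ p))).eval y
      + ((ℓ : ℝ) * (ℓ + 1)) * (derivative (scatPoly ℓ p)).eval y = 0 := by
  have := congrArg (fun q => eval y (derivative q)) (scatPoly_ode (ℓ := ℓ) hp)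
  simp at this
  linear_combination this

theorem eval_scatPoly_ode₂ {ℓ p : ℕ} (hp : 2 ≤ p) (y : ℝ) :
    y * (1 - y) * (derivative (derivative (derivative (derivative (scatPoly ℓ p))))).eval y
      + (p + 1 - 2 * y) * (derivative (derivative (derivative (scatPoly ℓ p)))).eval y
      + ((ℓ : ℝ) * (ℓ + 1)) * (derivative (derivative (scatPoly ℓ p))).eval y = 0 := by
  have := congrArg (fun q => eval y (derivative (derivative q)))
    (scatPoly_ode (ℓ := ℓ) hp)
  simp at this
  linear_combination this

end

section
variable {u₀ v₁ : ℝ} {R : ℝ → ℝ} (hR : IsRadius 0 (v₁ - u₀) R)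
include hR

/-- The exact solution with data `r₀^(-2-p)` on Minkowski space. -/
theorem IsRadius.isMode_scatPoly (ℓ : ℕ) {p : ℕ} (hp : 2 ≤ p) :
    IsMode 0 (ℓ * (ℓ + 1)) u₀ v₁ R
      (fun u v => (R (v₁ - u))⁻¹ ^ (p + 2)
        * (scatPoly ℓ p).eval (1 - (R (v - u))⁻¹ / (R (v₁ - u))⁻¹))
      (fun u v => (R (v₁ - u))⁻¹ ^ (p + 1)
        * (derivative (scatPoly ℓ p)).eval (1 - (R (v - u))⁻¹ / (R (v₁ - u))⁻¹))
      (fun u v => (R (v₁ - u))⁻¹ ^ p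
        * (derivative (derivative (scatPoly ℓ p))).eval (1 - (R (v - u))⁻¹ / (R (v₁ - u))⁻¹))
      (fun u v => (R (v₁ - u))⁻¹ ^ (p - 1) * (R (v - u))⁻¹ ^ 2
        * (derivative (derivative (derivative (scatPoly ℓ p)))).eval
          (1 - (R (v - u))⁻¹ / (R (v₁ - u))⁻¹)) := by
  obtain ⟨n, rfl⟩ : ∃ n, p = n + 1 := ⟨p - 1, by omega⟩
  have ode := eval_scatPoly_ode (ℓ := ℓ) hp
  have ode₁ := eval_scatPoly_ode₁ (ℓ := ℓ) hp
  have ode₂ := eval_scatPoly_ode₂ (ℓ := ℓ) hp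
  generalize scatPoly ℓ (n + 1) = g at *
  rw [Nat.add_sub_cancel]
  push_cast at ode ode₁ ode₂
  have a_pos : ∀ u ≤ u₀, 0 < (R (v₁ - u))⁻¹ := fun u hu => hR.inv_pos (by linarith)
  have hb : ∀ u ≤ u₀, ∀ v,
      (R (v - u))⁻¹ = (1 - (1 - (R (v - u))⁻¹ / (R (v₁ - u))⁻¹)) * (R (v₁ - u))⁻¹ := fun u hu v => by
    rw [sub_sub_cancel, div_mul_cancel₀ _ (a_pos u hu).ne']
  have da : ∀ u ≤ u₀, HasDerivAt (fun u => (R (v₁ - u))⁻¹) ((R (v₁ - u))⁻¹ ^ 2) u := fun u hu =>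
    (hR.hasDerivAt_inv_u hu le_rfl).congr_deriv (by ring)
  have dyu : ∀ u ≤ u₀, ∀ v ≥ v₁, HasDerivAt (fun u => 1 - (R (v - u))⁻¹ / (R (v₁ - u))⁻¹)
      ((R (v₁ - u))⁻¹ * ((1 - (1 - (R (v - u))⁻¹ / (R (v₁ - u))⁻¹))
        * (1 - (R (v - u))⁻¹ / (R (v₁ - u))⁻¹))) u := by
    intro u hu v hv
    refine (((hR.hasDerivAt_inv_u hu hv).div (da u hu) (a_pos u hu).ne').const_sub 1).congr_deriv ?_
    have := a_pos u hu
    generalize (R (v₁ - u))⁻¹ = a at *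
    generalize (R (v - u))⁻¹ = b at *
    field_simp
    ring
  have dyv : ∀ u ≤ u₀, ∀ v ≥ v₁, HasDerivAt (fun v => 1 - (R (v - u))⁻¹ / (R (v₁ - u))⁻¹)
      ((R (v - u))⁻¹ ^ 2 / (R (v₁ - u))⁻¹) v := by
    intro u hu v hv
    refine (((hR.hasDerivAt_inv_v hu hv).div_const _).const_sub 1).congr_deriv ?_
    ring
  have cρ := hR.continuousOn_inv
  have ca : ContinuousOn (fun p : ℝ × ℝ => (R (v₁ - p.1))⁻¹) (Iic u₀ ×ˢ Ici v₁) :=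
    hR.continuousOn_inv.comp (f := fun p : ℝ × ℝ => (p.1, v₁)) (by fun_prop)
      fun p hp => ⟨hp.1, le_refl v₁⟩
  have cg : ∀ q : ℝ[X], ContinuousOn (fun p : ℝ × ℝ =>
      q.eval (1 - (R (p.2 - p.1))⁻¹ / (R (v₁ - p.1))⁻¹)) (Iic u₀ ×ˢ Ici v₁) := fun q =>
    q.continuous.comp_continuousOn
      (continuousOn_const.sub (cρ.div ca fun p hp => (a_pos p.1 hp.1).ne'))
  constructor
  · intro u hu v hv
    refine (((g.hasDerivAt _).comp v (dyv u hu v hv)).const_mul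
      ((R (v₁ - u))⁻¹ ^ (n + 1 + 2))).hasDerivWithinAt.congr_deriv ?_
    have := a_pos u hu
    generalize (R (v₁ - u))⁻¹ = a at *
    field_simp
    ring
  · intro u hu v hv
    refine (((g.derivative.hasDerivAt _).comp v (dyv u hu v hv)).const_mul
      ((R (v₁ - u))⁻¹ ^ (n + 1 + 1))).hasDerivWithinAt.congr_deriv ?_
    have := a_pos u hu
    generalize (R (v₁ - u))⁻¹ = a at *
    field_simp
    ring
  · intro u hu v hv
    refine (((g.derivative.derivative.hasDerivAt _).comp v (dyv u hu v hv)).const_mul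
      ((R (v₁ - u))⁻¹ ^ (n + 1))).hasDerivWithinAt.congr_deriv ?_
    have := a_pos u hu
    generalize (R (v₁ - u))⁻¹ = a at *
    field_simp
    ring
  · intro u hu v hv
    refine (((da u hu).fun_pow (n + 1 + 1)).mul
      ((g.derivative.hasDerivAt _).comp u (dyu u hu v hv))).hasDerivWithinAt.congr_deriv ?_
    have hb := hb u hu v
    simp only [Function.comp]
    generalize 1 - (R (v - u))⁻¹ / (R (v₁ - u))⁻¹ = y at *
    rw [hb]
    generalize (R (v₁ - u))⁻¹ = a at *
    simp only [Nat.add_sub_cancel]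
    push_cast
    linear_combination a ^ (n + 3) * ode y
  · intro u hu v hv
    refine (((da u hu).fun_pow (n + 1)).mul
      ((g.derivative.derivative.hasDerivAt _).comp u (dyu u hu v hv))).hasDerivWithinAt.congr_deriv ?_
    have hb := hb u hu v
    simp only [Function.comp]
    generalize 1 - (R (v - u))⁻¹ / (R (v₁ - u))⁻¹ = y at *
    generalize (R (v₁ - u))⁻¹ = a at *
    simp only [Nat.add_sub_cancel]
    push_cast
    linear_combination a ^ (n + 2) * ode₁ y
  · intro u hu v hv
    refine ((((da u hu).fun_pow n).mul ((hR.hasDerivAt_inv_u hu hv).fun_pow 2)).mul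
      ((g.derivative.derivative.derivative.hasDerivAt _).comp u
        (dyu u hu v hv))).hasDerivWithinAt.congr_deriv ?_
    have hb := hb u hu v
    simp only [Function.comp, Pi.mul_apply, potential]
    generalize 1 - (R (v - u))⁻¹ / (R (v₁ - u))⁻¹ = y at *
    rw [hb]
    generalize (R (v₁ - u))⁻¹ = a at *
    rcases n with _ | n
    · omega
    · simp only [Nat.add_sub_cancel]
      push_cast at *
      linear_combination a ^ (n + 4) * (1 - y) ^ 2 * ode₂ y
  · exact (ca.pow _).mul (cg _)
  · exact (ca.pow _).mul (cg _)
  · exact (ca.pow _).mul (cg _)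
  · exact ((ca.pow _).mul (cρ.pow _)).mul (cg _)

/-- The `v`-derivative of `Ψ` for the exact solutions is of size `r₀⁻¹`. -/
theorem IsRadius.exists_abs_chi_scatPoly_le (ℓ : ℕ) {p : ℕ} (hp : 2 ≤ p) :
    ∃ K : ℝ, ∀ u ≤ u₀, ∀ v ≥ v₁, |(R (v₁ - u))⁻¹ ^ (p - 1) * (R (v - u))⁻¹ ^ 2
      * (derivative (derivative (derivative
        (scatPoly ℓ p)))).eval (1 - (R (v - u))⁻¹ / (R (v₁ - u))⁻¹)| ≤ K * (R (v₁ - u))⁻¹ := by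
  obtain ⟨B, hB⟩ := (isCompact_Icc (a := (0 : ℝ)) (b := 1)).exists_bound_of_continuousOn
    (Polynomial.continuous (derivative (derivative
      (derivative (scatPoly ℓ p))))).continuousOn
  obtain ⟨q, rfl⟩ : ∃ q, p = q + 1 := ⟨p - 1, by omega⟩
  set a₀ := (R (v₁ - u₀))⁻¹
  refine ⟨a₀ ^ (q + 1) * B, fun u hu v hv => ?_⟩
  have p0 : 0 < (R (v₁ - u))⁻¹ := hR.inv_pos (by linarith)
  have p1 := hR.inv_pos (t := v - u) (by linarith)
  have p2 := hR.inv_anti (t := v₁ - u) (t' := v - u) (by linarith) (by linarith)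
  have p3 : (R (v₁ - u))⁻¹ ≤ a₀ := hR.inv_anti (t := v₁ - u₀) (t' := v₁ - u) le_rfl (by linarith)
  have h3 := hB (1 - (R (v - u))⁻¹ / (R (v₁ - u))⁻¹)
    ⟨by linarith [(div_le_one p0).2 p2], by linarith [div_pos p1 p0]⟩
  rw [Nat.add_sub_cancel, abs_mul, abs_of_pos (a := _ * _) (by positivity)]
  calc (R (v₁ - u))⁻¹ ^ q * (R (v - u))⁻¹ ^ 2 * |_|
      ≤ a₀ ^ q * (a₀ * (R (v₁ - u))⁻¹) * B := by
        have : 0 ≤ a₀ := p0.le.trans p3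
        rw [sq]
        have p4 := p2.trans p3
        gcongr
        exact h3
    _ = _ := by ring

/-- On Minkowski space, an expansion of a mode without incoming radiation in powers of `r₀⁻¹` on
the initial cone gives an expansion of its radiation field. -/
theorem IsMode.exists_radiation_expansion {ℓ : ℕ} (hℓ : 2 ≤ ℓ) {f ψ Ψ χ : ℝ → ℝ → ℝ}
    (h : IsMode 0 (ℓ * (ℓ + 1)) u₀ v₁ R f ψ Ψ χ) {A : ℝ} {E : ℕ → ℝ}
    (hf : ∀ N : ℕ, 2 ≤ N → ∃ C, ∀ u ≤ u₀,
      |f u v₁ - ∑ p ∈ Finset.Icc 2 N, (R (v₁ - u))⁻¹ ^ (p + 2) * E p| ≤ C * (R (v₁ - u))⁻¹ ^ (N + 3))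
    (hΨ : Tendsto (fun u => Ψ u v₁) atBot (𝓝 (2 * A)))
    (hχ : ∀ V ≥ v₁, Tendsto (fun u => ∫ v in v₁..V, χ u v ^ 2) atBot (𝓝 0)) :
    ∃ L : ℝ → ℝ, (∀ u ≤ u₀, Tendsto (fun v => f u v) atTop (𝓝 (L u))) ∧
      ∀ N : ℕ, 2 ≤ N → ∃ C, ∀ u ≤ u₀,
        |L u - ∑ p ∈ Finset.Icc 2 N, coeffS ℓ p (ℓ + 2) 0 (-2) * (R (v₁ - u))⁻¹ ^ (p + 2) * E p|
          ≤ C * (R (v₁ - u))⁻¹ ^ (N + 3) := by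
  have hℓ' : (2 : ℝ) ≤ ℓ := by exact_mod_cast hℓ
  have hlam : (6 : ℝ) ≤ ℓ * (ℓ + 1) := by nlinarith
  have key : ∀ N : ℕ, 2 ≤ N → ∃ (L : ℝ → ℝ) (C : ℝ), ∀ u ≤ u₀,
      Tendsto (fun v => f u v) atTop (𝓝 (L u)) ∧
      |L u - ∑ p ∈ Finset.Icc 2 N, coeffS ℓ p (ℓ + 2) 0 (-2) * (R (v₁ - u))⁻¹ ^ (p + 2) * E p|
          ≤ C * (R (v₁ - u))⁻¹ ^ (N + 3) := by
    intro N hN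
    obtain ⟨C, hC⟩ := hf N hN
    have hm := IsMode.sum (Finset.Icc 2 N) fun p hp =>
      (hR.isMode_scatPoly ℓ (Finset.mem_Icc.1 hp).1).const_mul (-E p)
    have hs := h.add hm
    have ap : ∀ u ≤ u₀, 0 < (R (v₁ - u))⁻¹ := fun u hu => hR.inv_pos (by linarith)
    have hLK : ∃ (L : ℝ → ℝ) (K : ℝ), ∀ u ≤ u₀, Tendsto (fun v => f u v
          + ∑ p ∈ Finset.Icc 2 N, -E p * ((R (v₁ - u))⁻¹ ^ (p + 2)
            * (scatPoly ℓ p).eval (1 - (R (v - u))⁻¹ / (R (v₁ - u))⁻¹))) atTop (𝓝 (L u)) ∧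
        |L u - 0 * (R (v₁ - u))⁻¹ ^ 3| ≤ K * (R (v₁ - u))⁻¹ ^ (N - 1 + 4) := by
      refine hs.exists_radiation_field hR hlam (A := A) (Cf := C) (Or.inl rfl) ?_ ?_ ?_ ?_
      · intro u hu
        rw [show N - 1 + 4 = N + 3 by omega]
        refine le_trans (le_of_eq ?_) (hC u hu)
        congr 1
        simp only [div_self (ap u hu).ne', sub_self, eval_zero_scatPoly, neg_mul,
          sum_neg_distrib, mul_one, ← sub_eq_add_neg]
        congr 1
        exact sum_congr rfl fun p _ => mul_comm _ _
      · have h2 : Tendsto (fun u => ∑ p ∈ Finset.Icc 2 N, -E p * ((R (v₁ - u))⁻¹ ^ p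
            * (derivative (derivative (scatPoly ℓ p))).eval 0)) atBot
            (𝓝 (∑ p ∈ Finset.Icc 2 N, 0)) := by
          refine tendsto_finsetSum _ fun p hp => ?_
          have h3 := (((hR.tendsto_inv_atBot v₁).pow p).mul_const ((derivative
            (derivative (scatPoly ℓ p))).eval 0)).const_mul (-E p)
          rw [zero_pow (by have := (Finset.mem_Icc.1 hp).1; omega), zero_mul, mul_zero] at h3
          exact h3
        rw [Finset.sum_const_zero] at h2
        have h3 := hΨ.add h2
        rw [add_zero] at h3
        refine h3.congr' ?_
        filter_upwards [eventually_le_atBot u₀] with u hu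
        simp only [div_self (ap u hu).ne', sub_self]
      · intro V hV
        have hb : ∀ p : ℕ, ∃ K, 2 ≤ p → ∀ u ≤ u₀, ∀ v ≥ v₁, _ ≤ K * (R (v₁ - u))⁻¹ := fun p => by
          by_cases hp : 2 ≤ p
          · obtain ⟨K, hK⟩ := hR.exists_abs_chi_scatPoly_le ℓ hp
            exact ⟨K, fun _ => hK⟩
          · exact ⟨0, fun h => (hp h).elim⟩
        choose B hB using hb
        refine hR.tendsto_integral_sq_of_sub (K := ∑ p ∈ Finset.Icc 2 N, |E p| * B p)
          hV h.cont_χ hs.cont_χ (fun u hu v hv => ?_) (hχ V hV)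
        rw [sub_add_cancel_left, abs_neg, sum_mul]
        refine (abs_sum_le_sum_abs _ _).trans (sum_le_sum fun p hp => ?_)
        rw [abs_mul, abs_neg, mul_assoc |E p|]
        exact mul_le_mul_of_nonneg_left (hB p (Finset.mem_Icc.1 hp).1 u hu v hv) (abs_nonneg _)
      · intro k'
        have := exists_isProfile 0 A k' hℓ
        simpa using this
    obtain ⟨L, K, hL⟩ := hLK
    refine ⟨fun u => L u + ∑ p ∈ Finset.Icc 2 N,
      coeffS ℓ p (ℓ + 2) 0 (-2) * (R (v₁ - u))⁻¹ ^ (p + 2) * E p, K, fun u hu => ⟨?_, ?_⟩⟩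
    · have hy1 : Tendsto (fun V => 1 - (R (V - u))⁻¹ / (R (v₁ - u))⁻¹) atTop (𝓝 1) := by
        simpa using ((hR.tendsto_inv_atTop u).div_const ((R (v₁ - u))⁻¹)).const_sub 1
      have h2 : Tendsto (fun v => ∑ p ∈ Finset.Icc 2 N, E p * ((R (v₁ - u))⁻¹ ^ (p + 2)
          * (scatPoly ℓ p).eval (1 - (R (v - u))⁻¹ / (R (v₁ - u))⁻¹))) atTop
          (𝓝 (∑ p ∈ Finset.Icc 2 N,
            coeffS ℓ p (ℓ + 2) 0 (-2) * (R (v₁ - u))⁻¹ ^ (p + 2) * E p)) := by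
        refine tendsto_finsetSum _ fun p hp => ?_
        have h3 := ((((scatPoly ℓ p).continuous.tendsto 1).comp hy1).const_mul
          ((R (v₁ - u))⁻¹ ^ (p + 2))).const_mul (E p)
        rw [eval_one_scatPoly hℓ (Finset.mem_Icc.1 hp).1] at h3
        refine h3.trans (le_of_eq ?_)
        congr 1; ring
      refine ((hL u hu).1.add h2).congr fun v => ?_
      simp only [neg_mul, sum_neg_distrib]
      ring
    · have h1 := (hL u hu).2
      rw [show N - 1 + 4 = N + 3 by omega] at h1
      rw [add_sub_cancel_right]
      simpa using h1
  obtain ⟨L, C, hL⟩ := key 2 le_rfl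
  refine ⟨L, fun u hu => (hL u hu).1, fun N hN => ?_⟩
  obtain ⟨L', C', hL'⟩ := key N hN
  refine ⟨C', fun u hu => ?_⟩
  rw [tendsto_nhds_unique (hL u hu).1 (hL' u hu).1]
  exact (hL' u hu).2

end

/-! ### Expansions produced by compactly supported incoming radiation -/

/-- `F u v` has a Taylor-type expansion with `N` terms in powers of `τ u`, uniformly in
`v ∈ [v₁, v₂]`, with coefficients that are continuous functions of `v`. -/
def HasExpansion (u₀ v₁ v₂ : ℝ) (τ : ℝ → ℝ) : ℕ → (ℝ → ℝ → ℝ) → Prop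
  | 0, F => (∃ C, ∀ u ≤ u₀, ∀ v ∈ Icc v₁ v₂, |F u v| ≤ C) ∧
      ∀ u ≤ u₀, ContinuousOn (F u) (Icc v₁ v₂)
  | N + 1, F => ∃ (a : ℝ → ℝ) (F' : ℝ → ℝ → ℝ), ContinuousOn a (Icc v₁ v₂) ∧
      HasExpansion u₀ v₁ v₂ τ N F' ∧ ∀ u ≤ u₀, ∀ v ∈ Icc v₁ v₂, F u v = a v + τ u * F' u v

namespace HasExpansion

variable {u₀ v₁ v₂ : ℝ} {τ : ℝ → ℝ} {N : ℕ} {F G : ℝ → ℝ → ℝ}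

theorem congr (h : HasExpansion u₀ v₁ v₂ τ N F)
    (hFG : ∀ u ≤ u₀, ∀ v ∈ Icc v₁ v₂, G u v = F u v) : HasExpansion u₀ v₁ v₂ τ N G := by
  rcases N with _ | N
  · obtain ⟨⟨C, hC⟩, hc⟩ := h
    exact ⟨⟨C, fun u hu v hv => by rw [hFG u hu v hv]; exact hC u hu v hv⟩,
      fun u hu => (hc u hu).congr fun v hv => hFG u hu v hv⟩
  · obtain ⟨a, F', ha, hF', h⟩ := h
    exact ⟨a, F', ha, hF', fun u hu v hv => by rw [hFG u hu v hv, h u hu v hv]⟩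

theorem of_fun {a : ℝ → ℝ} (ha : ContinuousOn a (Icc v₁ v₂)) :
    HasExpansion u₀ v₁ v₂ τ N (fun _ v => a v) := by
  induction N generalizing a with
  | zero =>
    obtain ⟨C, hC⟩ := isCompact_Icc.exists_bound_of_continuousOn ha
    exact ⟨⟨C, fun _ _ v hv => hC v hv⟩, fun _ _ => ha⟩
  | succ N ih => exact ⟨a, fun _ _ => 0, ha, ih continuousOn_const, fun u _ v _ => by ring⟩

theorem add (hF : HasExpansion u₀ v₁ v₂ τ N F) (hG : HasExpansion u₀ v₁ v₂ τ N G) :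
    HasExpansion u₀ v₁ v₂ τ N (fun u v => F u v + G u v) := by
  induction N generalizing F G with
  | zero =>
    obtain ⟨⟨C, hC⟩, hc⟩ := hF
    obtain ⟨⟨D, hD⟩, hd⟩ := hG
    exact ⟨⟨C + D, fun u hu v hv => (abs_add_le _ _).trans (add_le_add (hC u hu v hv) (hD u hu v hv))⟩,
      fun u hu => (hc u hu).add (hd u hu)⟩
  | succ N ih =>
    obtain ⟨a, F', ha, hF', h⟩ := hF
    obtain ⟨b, G', hb, hG', h'⟩ := hG
    exact ⟨fun v => a v + b v, _, ha.add hb, ih hF' hG', fun u hu v hv => by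
      beta_reduce; rw [h u hu v hv, h' u hu v hv]; ring⟩

theorem bounded (hτ : ∃ T, ∀ u ≤ u₀, |τ u| ≤ T) (hF : HasExpansion u₀ v₁ v₂ τ N F) :
    HasExpansion u₀ v₁ v₂ τ 0 F := by
  induction N generalizing F with
  | zero => exact hF
  | succ N ih =>
    obtain ⟨a, F', ha, hF', h⟩ := hF
    obtain ⟨⟨C, hC⟩, hc⟩ := ih hF'
    obtain ⟨T, hT⟩ := hτ
    obtain ⟨D, hD⟩ := isCompact_Icc.exists_bound_of_continuousOn ha
    refine ⟨⟨D + T * C, fun u hu v hv => ?_⟩, fun u hu =>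
      (ha.add (continuousOn_const.mul (hc u hu))).congr fun v hv => h u hu v hv⟩
    rw [h u hu v hv]
    refine (abs_add_le _ _).trans (add_le_add (hD v hv) ?_)
    rw [abs_mul]
    exact mul_le_mul (hT u hu) (hC u hu v hv) (abs_nonneg _) ((abs_nonneg _).trans (hT u hu))

theorem mul_succ (hF : HasExpansion u₀ v₁ v₂ τ N F) :
    HasExpansion u₀ v₁ v₂ τ (N + 1) (fun u v => τ u * F u v) :=
  ⟨fun _ => 0, F, continuousOn_const, hF, fun _ _ _ _ => by ring⟩

theorem of_succ (hτ : ∃ T, ∀ u ≤ u₀, |τ u| ≤ T) (hF : HasExpansion u₀ v₁ v₂ τ (N + 1) F) :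
    HasExpansion u₀ v₁ v₂ τ N F := by
  induction N generalizing F with
  | zero => exact hF.bounded hτ
  | succ N ih =>
    obtain ⟨a, F', ha, hF', h⟩ := hF
    exact ⟨a, F', ha, ih hF', h⟩

theorem mul_tau (hτ : ∃ T, ∀ u ≤ u₀, |τ u| ≤ T) (hF : HasExpansion u₀ v₁ v₂ τ N F) :
    HasExpansion u₀ v₁ v₂ τ N (fun u v => τ u * F u v) := hF.mul_succ.of_succ hτ

theorem mul (hτ : ∃ T, ∀ u ≤ u₀, |τ u| ≤ T) (hF : HasExpansion u₀ v₁ v₂ τ N F)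
    (hG : HasExpansion u₀ v₁ v₂ τ N G) : HasExpansion u₀ v₁ v₂ τ N (fun u v => F u v * G u v) := by
  induction N generalizing F G with
  | zero =>
    obtain ⟨⟨C, hC⟩, hc⟩ := hF
    obtain ⟨⟨D, hD⟩, hd⟩ := hG
    refine ⟨⟨C * D, fun u hu v hv => ?_⟩, fun u hu => (hc u hu).mul (hd u hu)⟩
    rw [abs_mul]
    exact mul_le_mul (hC u hu v hv) (hD u hu v hv) (abs_nonneg _)
      ((abs_nonneg _).trans (hC u hu v hv))
  | succ N ih =>
    obtain ⟨a, F', ha, hF', h⟩ := hF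
    obtain ⟨b, G', hb, hG', h'⟩ := hG
    exact ⟨fun v => a v * b v, _, ha.mul hb,
      ((ih (of_fun ha) hG').add (ih (of_fun hb) hF')).add ((ih hF' hG').mul_tau hτ),
      fun u hu v hv => by
        beta_reduce; rw [h u hu v hv, h' u hu v hv]; ring⟩

theorem const_mul (hτ : ∃ T, ∀ u ≤ u₀, |τ u| ≤ T) (c : ℝ) (hF : HasExpansion u₀ v₁ v₂ τ N F) :
    HasExpansion u₀ v₁ v₂ τ N (fun u v => c * F u v) :=
  (of_fun continuousOn_const).mul hτ hF

theorem integral (hv : v₁ ≤ v₂) (hF : HasExpansion u₀ v₁ v₂ τ N F)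
    (hτ : ∃ T, ∀ u ≤ u₀, |τ u| ≤ T) :
    HasExpansion u₀ v₁ v₂ τ N (fun u v => ∫ v' in v₁..v, F u v') := by
  have cint : ∀ {a : ℝ → ℝ}, ContinuousOn a (Icc v₁ v₂) →
      ContinuousOn (fun v => ∫ v' in v₁..v, a v') (Icc v₁ v₂) := fun {a} ha => by
    have := intervalIntegral.continuousOn_primitive_interval (μ := volume) (f := a) (a := v₁)
      (b := v₂) (by rw [uIcc_of_le hv]; exact ha.integrableOn_Icc)
    rwa [uIcc_of_le hv] at this
  induction N generalizing F with
  | zero =>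
    obtain ⟨⟨C, hC⟩, hc⟩ := hF
    refine ⟨⟨C * (v₂ - v₁), fun u hu v hv' => ?_⟩, fun u hu => cint (hc u hu)⟩
    have h0 : 0 ≤ C := (abs_nonneg _).trans (hC u hu v₁ ⟨le_rfl, hv⟩)
    have := intervalIntegral.norm_integral_le_of_norm_le_const (f := F u) (a := v₁) (b := v)
      (C := C) fun x hx => by
        rw [uIoc_of_le hv'.1] at hx
        exact hC u hu x ⟨hx.1.le, hx.2.trans hv'.2⟩
    rw [Real.norm_eq_abs, abs_of_nonneg (sub_nonneg.2 hv'.1)] at this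
    exact this.trans (by have := hv'.2; gcongr)
  | succ N ih =>
    obtain ⟨a, F', ha, hF', h⟩ := hF
    refine ⟨_, _, cint ha, ih hF', fun u hu v hv' => ?_⟩
    have hc := (hF'.bounded hτ).2 u hu
    have sub : Icc v₁ v ⊆ Icc v₁ v₂ := Icc_subset_Icc_right hv'.2
    have i1 : IntervalIntegrable a volume v₁ v := (ha.mono sub).intervalIntegrable_of_Icc hv'.1
    have i2 : IntervalIntegrable (fun v' => τ u * F' u v') volume v₁ v :=
      (continuousOn_const.mul (hc.mono sub)).intervalIntegrable_of_Icc hv'.1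
    rw [← intervalIntegral.integral_const_mul, ← intervalIntegral.integral_add i1 i2]
    refine integral_congr fun x hx => ?_
    rw [uIcc_of_le hv'.1] at hx
    exact h u hu x (sub hx)

/-- Solutions of `θ = a + τ F θ` have expansions. -/
theorem of_eq_add_mul (hτ : ∃ T, ∀ u ≤ u₀, |τ u| ≤ T) {θ : ℝ → ℝ → ℝ} {a : ℝ → ℝ}
    (ha : ContinuousOn a (Icc v₁ v₂)) (hθ : HasExpansion u₀ v₁ v₂ τ 0 θ)
    (hF : HasExpansion u₀ v₁ v₂ τ N F)
    (h : ∀ u ≤ u₀, ∀ v ∈ Icc v₁ v₂, θ u v = a v + τ u * (F u v * θ u v)) :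
    HasExpansion u₀ v₁ v₂ τ N θ := by
  induction N with
  | zero => exact hθ
  | succ N ih =>
    have hF' := hF.of_succ hτ
    exact ⟨a, _, ha, hF'.mul hτ (ih hF'), h⟩

end HasExpansion

section
variable {M u₀ v₁ v₂ : ℝ} {R : ℝ → ℝ} (hR : IsRadius M (v₁ - u₀) R) (hv : v₁ ≤ v₂)
include hR hv

theorem IsRadius.tau_bounded : ∃ T, ∀ u ≤ u₀, |(R (v₂ - u))⁻¹| ≤ T := by
  refine ⟨(R (v₂ - u₀))⁻¹, fun u hu => ?_⟩
  rw [abs_of_pos (hR.inv_pos (by linarith))]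
  exact hR.inv_anti (by linarith) (by linarith)

theorem IsRadius.hasExpansion_lapse_inv (N : ℕ) :
    HasExpansion u₀ v₁ v₂ (fun u => (R (v₂ - u))⁻¹) N
      (fun u _ => (1 - 2 * M * (R (v₂ - u))⁻¹)⁻¹) := by
  refine HasExpansion.of_eq_add_mul (a := fun _ => 1) (F := fun _ _ => 2 * M)
    (hR.tau_bounded hv) continuousOn_const ?_ (HasExpansion.of_fun continuousOn_const) ?_
  · refine ⟨⟨(1 - 2 * M * (R (v₂ - u₀))⁻¹)⁻¹, fun u hu v _ => ?_⟩, fun _ _ => continuousOn_const⟩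
    have h1 := hR.lapse_inv_pos (t := v₂ - u₀) (by linarith)
    have h2 := hR.lapse_inv_mono (t := v₂ - u₀) (t' := v₂ - u) (by linarith) (by linarith)
    rw [abs_of_pos (_root_.inv_pos.2 (h1.trans_le h2))]
    exact inv_anti₀ h1 h2
  · intro u hu v _
    have h1 := (hR.lapse_inv_pos (t := v₂ - u) (by linarith)).ne'
    generalize (R (v₂ - u))⁻¹ = a at *
    field_simp
    ring

/-- Integration from `u = -∞` in the variable `τ = 1 / r(u, v₂)`. -/
theorem IsRadius.hasExpansion_of_deriv {N k : ℕ} {F Φ : ℝ → ℝ → ℝ}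
    (hF : HasExpansion u₀ v₁ v₂ (fun u => (R (v₂ - u))⁻¹) N F)
    (hΦ : ∀ u ≤ u₀, ∀ v ∈ Icc v₁ v₂, HasDerivWithinAt (fun u' => Φ u' v)
      ((1 - 2 * M * (R (v₂ - u))⁻¹) * (R (v₂ - u))⁻¹ ^ 2 * ((R (v₂ - u))⁻¹ ^ k * F u v)) (Iic u₀) u)
    (hc : ∀ u ≤ u₀, ContinuousOn (Φ u) (Icc v₁ v₂))
    (h0 : ∀ v ∈ Icc v₁ v₂, Tendsto (fun u => Φ u v) atBot (𝓝 0)) :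
    HasExpansion u₀ v₁ v₂ (fun u => (R (v₂ - u))⁻¹) N
      (fun u v => Φ u v / (R (v₂ - u))⁻¹ ^ (k + 1)) := by
  have τpos : ∀ u ≤ u₀, 0 < (R (v₂ - u))⁻¹ := fun u hu => hR.inv_pos (by linarith)
  induction N generalizing k F Φ with
  | zero =>
    obtain ⟨⟨C, hC⟩, -⟩ := hF
    refine ⟨?_, fun u hu => (hc u hu).div_const _⟩
    have hR₂ : IsRadius M (v₂ - u₀) R := hR.mono (by linarith)
    have hb : ∀ v ∈ Icc v₁ v₂, ∀ u ≤ u₀, |Φ u v| ≤ C * (R (v₂ - u))⁻¹ ^ (k + 1) := by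
      intro v hv' u hu
      have hC0 : 0 ≤ C := (abs_nonneg _).trans (hC u hu v hv')
      -- compare `Φ` with the antiderivative `C τ^(k+1) / (k + 1)` of its bound
      set g : ℝ → ℝ := fun u => C * (R (v₂ - u))⁻¹ ^ (k + 1) / (k + 1)
      have dg : ∀ u ≤ u₀, HasDerivWithinAt g (C * ((1 - 2 * M * (R (v₂ - u))⁻¹)
          * (R (v₂ - u))⁻¹ ^ 2 * (R (v₂ - u))⁻¹ ^ k)) (Iic u₀) u := fun u hu => by
        refine ((((hR.hasDerivAt_inv_u hu hv).fun_pow (k + 1)).const_mul C).div_const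
          ((k : ℝ) + 1)).hasDerivWithinAt.congr_deriv ?_
        simp only [Nat.add_sub_cancel]
        push_cast
        field_simp
      have hle : ∀ u ≤ u₀, |(1 - 2 * M * (R (v₂ - u))⁻¹) * (R (v₂ - u))⁻¹ ^ 2
          * ((R (v₂ - u))⁻¹ ^ k * F u v)| ≤ C * ((1 - 2 * M * (R (v₂ - u))⁻¹)
          * (R (v₂ - u))⁻¹ ^ 2 * (R (v₂ - u))⁻¹ ^ k) := fun u hu => by
        have l := hR.lapse_inv_pos (t := v₂ - u) (by linarith)
        have p := τpos u hu
        have := hC u hu v hv'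
        rw [← mul_assoc, abs_mul, abs_of_pos (a := _ * _) (by positivity), mul_comm]
        gcongr
      have hmono : MonotoneOn (fun u => g u + Φ u v) (Iic u₀) := by
        apply monotoneOn_of_hasDerivWithinAt_nonneg (convex_Iic _)
        · exact fun u hu => ((dg u hu).add (hΦ u hu v hv')).continuousWithinAt
        · exact fun u hu => ((dg u (show u ∈ Iic u₀ from interior_subset hu)).add
            (hΦ u (show u ∈ Iic u₀ from interior_subset hu) v hv')).mono interior_subset
        · intro u hu
          have := neg_le_of_abs_le (hle u (show u ∈ Iic u₀ from interior_subset hu))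
          linarith
      have hmono' : MonotoneOn (fun u => g u - Φ u v) (Iic u₀) := by
        apply monotoneOn_of_hasDerivWithinAt_nonneg (convex_Iic _)
        · exact fun u hu => ((dg u hu).sub (hΦ u hu v hv')).continuousWithinAt
        · exact fun u hu => ((dg u (show u ∈ Iic u₀ from interior_subset hu)).sub
            (hΦ u (show u ∈ Iic u₀ from interior_subset hu) v hv')).mono interior_subset
        · intro u hu
          have := le_of_abs_le (hle u (show u ∈ Iic u₀ from interior_subset hu))
          linarith
      have g0 : Tendsto g atBot (𝓝 0) := by
        have h1 := (((hR₂.tendsto_inv_atBot v₂).pow (k + 1)).const_mul C).div_const ((k : ℝ) + 1)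
        rw [zero_pow (by omega), mul_zero, zero_div] at h1
        exact h1
      have l1 : Tendsto (fun u => g u + Φ u v) atBot (𝓝 0) := by simpa using g0.add (h0 v hv')
      have l2 : Tendsto (fun u => g u - Φ u v) atBot (𝓝 0) := by simpa using g0.sub (h0 v hv')
      have i1 : 0 ≤ g u + Φ u v := le_of_tendsto l1 ((eventually_le_atBot u).mono fun u' hu' =>
        hmono (show u' ∈ Iic u₀ from hu'.trans hu) (show u ∈ Iic u₀ from hu) hu')
      have i2 : 0 ≤ g u - Φ u v := le_of_tendsto l2 ((eventually_le_atBot u).mono fun u' hu' =>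
        hmono' (show u' ∈ Iic u₀ from hu'.trans hu) (show u ∈ Iic u₀ from hu) hu')
      have p := τpos u hu
      have i3 : g u ≤ C * (R (v₂ - u))⁻¹ ^ (k + 1) :=
        div_le_self (by positivity) (by linarith [(Nat.cast_nonneg k : (0 : ℝ) ≤ k)])
      rw [abs_le]
      constructor <;> linarith
    refine ⟨C, fun u hu v hv' => ?_⟩
    rw [abs_div, abs_of_pos (pow_pos (τpos u hu) (k + 1)), div_le_iff₀ (pow_pos (τpos u hu) _)]
    exact hb v hv' u hu
  | succ N ih =>
    obtain ⟨a, F', ha, hF', h⟩ := hF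
    have key := ih (k := k + 1) (Φ := fun u v => Φ u v - a v / (k + 1) * (R (v₂ - u))⁻¹ ^ (k + 1))
      hF' ?_ ?_ ?_
    · refine ⟨fun v => a v / (k + 1), _, ha.div_const _, key, fun u hu v hv' => ?_⟩
      have p := τpos u hu
      beta_reduce
      generalize (R (v₂ - u))⁻¹ = t at *
      field_simp
      ring
    · intro u hu v hv'
      refine ((hΦ u hu v hv').sub (((hR.hasDerivAt_inv_u hu hv).fun_pow (k + 1)).const_mul
        (a v / (k + 1))).hasDerivWithinAt).congr_deriv ?_
      rw [h u hu v hv']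
      simp only [Nat.add_sub_cancel]
      push_cast
      field_simp
      ring
    · exact fun u hu => (hc u hu).sub ((ha.div_const _).mul continuousOn_const)
    · intro v hv'
      have hR₂ : IsRadius M (v₂ - u₀) R := hR.mono (by linarith)
      have h1 := (h0 v hv').sub (((hR₂.tendsto_inv_atBot v₂).pow (k + 1)).const_mul (a v / (k + 1)))
      rw [zero_pow (by omega), mul_zero, sub_zero] at h1
      exact h1

/-- The ratio `r(u, v₂) / r(u, v)` has an expansion in powers of `1 / r(u, v₂)`. -/
theorem IsRadius.hasExpansion_ratio (N : ℕ) :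
    HasExpansion u₀ v₁ v₂ (fun u => (R (v₂ - u))⁻¹) N
      (fun u v => (R (v - u))⁻¹ / (R (v₂ - u))⁻¹) := by
  have hτ := hR.tau_bounded hv
  have hM := hR.nonneg
  have R_pos : ∀ u ≤ u₀, ∀ v ∈ Icc v₁ v₂, 0 < R (v - u) := fun u hu v hv' =>
    hR.pos (by linarith [hv'.1])
  have R_pos₂ : ∀ u ≤ u₀, 0 < R (v₂ - u) := fun u hu => hR.pos (by linarith)
  have cR : ∀ u ≤ u₀, ContinuousOn (fun v => R (v - u)) (Icc v₁ v₂) := fun u hu =>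
    hR.continuousOn.comp (by fun_prop) fun v hv' => by
      have := hv'.1
      simp only [mem_Ici]; linarith
  -- the difference `r(u, v) - r(u, v₂)` is bounded and tends to `v - v₂`
  have hdiff : ∀ u ≤ u₀, ∀ v ∈ Icc v₁ v₂,
      |R (v - u) - R (v₂ - u) - (v - v₂)| ≤ 2 * M * (R (v₁ - u))⁻¹ * (v₂ - v₁) := by
    intro u hu v hv'
    have h1 := Convex.norm_image_sub_le_of_norm_hasDerivWithin_le (f := fun t => R (t - u) - t)
      (f' := fun t => -(2 * M / R (t - u))) (s := Icc v₁ v₂) (C := 2 * M * (R (v₁ - u))⁻¹)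
      (x := v₂) (y := v) ?_ ?_ (convex_Icc _ _) ⟨hv, le_rfl⟩ hv'
    · have e : R (v - u) - v - (R (v₂ - u) - v₂) = R (v - u) - R (v₂ - u) - (v - v₂) := by ring
      rw [e] at h1
      refine h1.trans ?_
      have p : 0 ≤ (R (v₁ - u))⁻¹ := (hR.inv_pos (by linarith)).le
      have : ‖v - v₂‖ ≤ v₂ - v₁ := by
        rw [Real.norm_eq_abs, abs_le]; constructor <;> linarith [hv'.1, hv'.2]
      gcongr
    · intro t ht
      refine (((hR.deriv (t - u) (by linarith [ht.1])).comp t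
        ((hasDerivAt_id' t).sub_const u)).sub (hasDerivAt_id' t)).hasDerivWithinAt.congr_deriv ?_
      ring
    · intro t ht
      have p : 0 < (R (t - u))⁻¹ := hR.inv_pos (by linarith [ht.1])
      have q := hR.inv_anti (t := v₁ - u) (t' := t - u) (by linarith) (by linarith [ht.1])
      rw [norm_neg, Real.norm_eq_abs, div_eq_mul_inv, abs_of_nonneg (by positivity)]
      gcongr
  set w : ℝ → ℝ → ℝ := fun u v => R (v - u) - R (v₂ - u) with hw
  set θ : ℝ → ℝ → ℝ := fun u v => (R (v - u))⁻¹ / (R (v₂ - u))⁻¹ with hθ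
  have eθ : ∀ u ≤ u₀, ∀ v ∈ Icc v₁ v₂, θ u v = 1 + (R (v₂ - u))⁻¹ * (-1 * w u v * θ u v) := by
    intro u hu v hv'
    have h1 := R_pos u hu v hv'
    have h2 := R_pos₂ u hu
    simp only [hθ, hw]
    field_simp
    ring
  have w0 : HasExpansion u₀ v₁ v₂ (fun u => (R (v₂ - u))⁻¹) 0 w := by
    refine ⟨⟨2 * M * (R (v₁ - u₀))⁻¹ * (v₂ - v₁) + (v₂ - v₁), fun u hu v hv' => ?_⟩,
      fun u hu => (cR u hu).sub continuousOn_const⟩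
    have h1 := hdiff u hu v hv'
    have q := hR.inv_anti (t := v₁ - u₀) (t' := v₁ - u) (by linarith) (by linarith)
    have h2 : 2 * M * (R (v₁ - u))⁻¹ * (v₂ - v₁) ≤ 2 * M * (R (v₁ - u₀))⁻¹ * (v₂ - v₁) := by
      have : 0 ≤ v₂ - v₁ := by linarith
      gcongr
    rw [abs_le] at h1 ⊢
    simp only [hw]
    constructor <;> linarith [hv'.1, hv'.2]
  have θ0 : HasExpansion u₀ v₁ v₂ (fun u => (R (v₂ - u))⁻¹) 0 θ := by
    obtain ⟨⟨C, hC⟩, -⟩ := w0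
    refine ⟨⟨1 + C * (R (v₁ - u₀))⁻¹, fun u hu v hv' => ?_⟩, fun u hu =>
      ((cR u hu).inv₀ fun v hv' => (R_pos u hu v hv').ne').div_const _⟩
    have h1 := R_pos u hu v hv'
    have h2 := R_pos₂ u hu
    have e : θ u v = 1 + (-w u v) * (R (v - u))⁻¹ := by
      simp only [hθ, hw]; field_simp; ring
    have q := hR.inv_anti (t := v₁ - u₀) (t' := v - u) (by linarith) (by linarith [hv'.1])
    have hC0 := (abs_nonneg _).trans (hC u hu v hv')
    rw [e]
    refine (abs_add_le _ _).trans (add_le_add (by simp) ?_)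
    rw [abs_mul, abs_neg, abs_of_pos (_root_.inv_pos.2 h1)]
    exact mul_le_mul (hC u hu v hv') q (_root_.inv_pos.2 h1).le hC0
  have θN : ∀ N, HasExpansion u₀ v₁ v₂ (fun u => (R (v₂ - u))⁻¹) N w →
      HasExpansion u₀ v₁ v₂ (fun u => (R (v₂ - u))⁻¹) N θ := fun N h =>
    HasExpansion.of_eq_add_mul hτ (a := fun _ => 1) continuousOn_const θ0 (h.const_mul hτ (-1)) eθ
  refine θN N ?_
  induction N with
  | zero => exact w0
  | succ N ih =>
    have h1 := hR.hasExpansion_of_deriv hv (k := 0) (Φ := fun u v => w u v - (v - v₂))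
      (((ih.mul hτ (θN N ih)).mul hτ (hR.hasExpansion_lapse_inv hv N)).const_mul hτ (-(2 * M)))
      ?_ ?_ ?_
    · refine ⟨fun v => v - v₂, _, by fun_prop, h1, fun u hu v hv' => ?_⟩
      rw [zero_add, pow_one, mul_div_cancel₀ _ (inv_ne_zero (R_pos₂ u hu).ne')]
      ring
    · intro u hu v hv'
      have d1 := (hR.deriv (v - u) (by linarith [hv'.1])).comp u ((hasDerivAt_id' u).const_sub v)
      have d2 := (hR.deriv (v₂ - u) (by linarith)).comp u ((hasDerivAt_id' u).const_sub v₂)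
      refine ((d1.sub d2).sub_const _).hasDerivWithinAt.congr_deriv ?_
      have p1 := R_pos u hu v hv'
      have p2 := R_pos₂ u hu
      have p3 := hR.lapse_inv_pos (t := v₂ - u) (by linarith)
      simp only [hw, hθ]
      rw [pow_zero, one_mul]
      have e : ∀ l x y : ℝ, l ≠ 0 → l * x * (-(2 * M) * (y * l⁻¹)) = -(2 * M) * (x * y) := by
        intro l x y hl; field_simp
      rw [e _ _ _ p3.ne']
      field_simp
      ring
    · exact fun u hu => ((cR u hu).sub continuousOn_const).sub (by fun_prop)
    · intro v hv'
      refine squeeze_zero_norm' (a := fun u => 2 * M * (R (v₁ - u))⁻¹ * (v₂ - v₁)) ?_ ?_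
      · filter_upwards [eventually_le_atBot u₀] with u hu
        exact hdiff u hu v hv'
      · simpa using ((hR.tendsto_inv_atBot v₁).const_mul (2 * M)).mul_const (v₂ - v₁)

end

/-- A function with expansions of every order in powers of `τ → 0` has a single asymptotic
series. -/
theorem exists_asymptotic_series {u₀ v₂ v₁ : ℝ} (hv : v₁ ≤ v₂) {τ : ℝ → ℝ}
    (hτ : ∀ u ≤ u₀, 0 < τ u) (hτb : ∃ T, ∀ u ≤ u₀, |τ u| ≤ T) (hτ0 : Tendsto τ atBot (𝓝 0))
    {F : ℝ → ℝ → ℝ} (hF : ∀ N, HasExpansion u₀ v₁ v₂ τ N F) :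
    ∃ a : ℕ → ℝ, ∀ N, ∃ C, ∀ u ≤ u₀,
      |F u v₂ - ∑ n ∈ Finset.range N, a n * τ u ^ n| ≤ C * τ u ^ N := by
  have mem : v₂ ∈ Icc v₁ v₂ := ⟨hv, le_rfl⟩
  -- peel off one coefficient; the remainder is unique, hence has expansions of every order
  have step : ∀ F : {F : ℝ → ℝ → ℝ // ∀ N, HasExpansion u₀ v₁ v₂ τ N F},
      ∃ (a : ℝ) (F' : {F : ℝ → ℝ → ℝ // ∀ N, HasExpansion u₀ v₁ v₂ τ N F}),
        ∀ u ≤ u₀, F.1 u v₂ = a + τ u * F'.1 u v₂ := by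
    rintro ⟨F, hF⟩
    choose a G ha hG h using fun N => hF (N + 1)
    have lim : ∀ N, ∀ v ∈ Icc v₁ v₂, Tendsto (fun u => F u v) atBot (𝓝 (a N v)) := by
      intro N v hv'
      obtain ⟨⟨C, hC⟩, -⟩ := (hG N).bounded hτb
      have h1 : Tendsto (fun u => τ u * G N u v) atBot (𝓝 0) := by
        refine squeeze_zero_norm' (a := fun u => τ u * C) ?_ (by simpa using hτ0.mul_const C)
        filter_upwards [eventually_le_atBot u₀] with u hu
        rw [Real.norm_eq_abs, abs_mul, abs_of_pos (hτ u hu)]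
        exact mul_le_mul_of_nonneg_left (hC u hu v hv') (hτ u hu).le
      have h2 := h1.const_add (a N v)
      rw [add_zero] at h2
      refine h2.congr' ?_
      filter_upwards [eventually_le_atBot u₀] with u hu
      rw [h N u hu v hv']
    refine ⟨a 0 v₂, ⟨G 0, fun N => (hG N).congr fun u hu v hv' => ?_⟩, fun u hu => h 0 u hu v₂ mem⟩
    have h1 := h 0 u hu v hv'
    have h2 := h N u hu v hv'
    rw [tendsto_nhds_unique (lim 0 v hv') (lim N v hv')] at h1
    have := (hτ u hu).ne'
    have h3 : τ u * (G 0 u v - G N u v) = 0 := by linarith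
    rcases mul_eq_zero.1 h3 with h4 | h4
    · exact absurd h4 this
    · linarith
  choose a next hnext using step
  set seq : ℕ → {F : ℝ → ℝ → ℝ // ∀ N, HasExpansion u₀ v₁ v₂ τ N F} := fun n =>
    next^[n] ⟨F, hF⟩ with hseq
  have hsum : ∀ N, ∀ u ≤ u₀, F u v₂
      = (∑ n ∈ Finset.range N, a (seq n) * τ u ^ n) + τ u ^ N * (seq N).1 u v₂ := by
    intro N u hu
    induction N with
    | zero => simp [hseq]
    | succ N ih =>
      have e : seq (N + 1) = next (seq N) := by
        simp only [hseq, Function.iterate_succ_apply']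
      rw [ih, Finset.sum_range_succ, hnext (seq N) u hu, e]
      ring
  refine ⟨fun n => a (seq n), fun N => ?_⟩
  obtain ⟨⟨C, hC⟩, -⟩ := (seq N).2 0
  refine ⟨C, fun u hu => ?_⟩
  rw [hsum N u hu, add_sub_cancel_left, abs_mul, abs_of_pos (pow_pos (hτ u hu) N), mul_comm]
  exact mul_le_mul_of_nonneg_right (hC u hu v₂ mem) (pow_pos (hτ u hu) N).le

/-- Compactly supported incoming radiation produces a full asymptotic expansion along later
incoming cones. -/
theorem IsMode.exists_expansion_of_trivial {M lam u₀ v₁ v₂ : ℝ} {R : ℝ → ℝ}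
    (hR : IsRadius M (v₁ - u₀) R) (hv : v₁ ≤ v₂) {f ψ Ψ χ : ℝ → ℝ → ℝ}
    (h : IsMode M lam u₀ v₁ R f ψ Ψ χ) (hf : ∀ u ≤ u₀, f u v₁ = 0) (hψ : ψ u₀ v₁ = 0)
    (hΨ : Ψ u₀ v₁ = 0) {P : ℝ → ℝ} (hP : ContinuousOn P (Ici v₁))
    (hin : Tendsto (fun u => ∫ v in v₁..v₂, (χ u v - P v) ^ 2) atBot (𝓝 0)) :
    Tendsto (fun u => Ψ u v₂) atBot (𝓝 (∫ v in v₁..v₂, P v)) ∧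
    ∃ E : ℕ → ℝ, ∀ N : ℕ, 2 ≤ N → ∃ C, ∀ u ≤ u₀,
      |(1 - 2 * M * (R (v₂ - u))⁻¹)⁻¹ * f u v₂
        - ∑ p ∈ Finset.Icc 2 N, (R (v₂ - u))⁻¹ ^ (p + 2) * E p| ≤ C * (R (v₂ - u))⁻¹ ^ (N + 3) := by
  have hτ := hR.tau_bounded hv
  have hR₂ : IsRadius M (v₂ - u₀) R := hR.mono (by linarith)
  have τpos : ∀ u ≤ u₀, 0 < (R (v₂ - u))⁻¹ := fun u hu => hR.inv_pos (by linarith)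
  -- the data on the initial cone vanish
  have hψ0 : ∀ u ≤ u₀, ψ u v₁ = 0 := by
    intro u hu
    have w_pos : ∀ u ≤ u₀, 0 < (1 - 2 * M * (R (v₁ - u))⁻¹) * (R (v₁ - u))⁻¹ ^ 2 := fun u hu =>
      mul_pos (hR.lapse_inv_pos (by linarith)) (pow_pos (hR.inv_pos (by linarith)) 2)
    have hd : ∀ u ≤ u₀, HasDerivWithinAt (fun u => ψ u v₁ /
        ((1 - 2 * M * (R (v₁ - u))⁻¹) * (R (v₁ - u))⁻¹ ^ 2)) 0 (Iic u₀) u := by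
      intro u hu
      have h1 := hR.hasDerivAt_inv_u hu (le_refl v₁)
      have h2 := (((h1.const_mul (2 * M)).const_sub 1).mul (h1.fun_pow 2)).hasDerivWithinAt
        (s := Iic u₀)
      refine ((h.ψ_u u hu v₁ le_rfl).div h2 (w_pos u hu).ne').congr_deriv ?_
      rw [hf u hu]
      simp only [Pi.mul_apply]
      refine div_eq_zero_iff.2 (Or.inl ?_)
      ring
    have hle := Convex.norm_image_sub_le_of_norm_hasDerivWithin_le (C := 0) hd (fun u _ => by simp)
      (convex_Iic u₀) (mem_Iic.2 (le_refl u₀)) (show u ∈ Iic u₀ from hu)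
    rw [zero_mul, norm_le_zero_iff, sub_eq_zero, hψ, zero_div, div_eq_zero_iff] at hle
    exact hle.resolve_right (w_pos u hu).ne'
  have hΨ0 : ∀ u ≤ u₀, Ψ u v₁ = 0 := by
    intro u hu
    have hd : ∀ u ≤ u₀, HasDerivWithinAt (fun u => Ψ u v₁) 0 (Iic u₀) u := fun u hu =>
      (h.Ψ_u u hu v₁ le_rfl).congr_deriv (by rw [hf u hu, hψ0 u hu]; ring)
    have hle := Convex.norm_image_sub_le_of_norm_hasDerivWithin_le (C := 0) hd (fun u _ => by simp)
      (convex_Iic u₀) (mem_Iic.2 (le_refl u₀)) (show u ∈ Iic u₀ from hu)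
    rwa [zero_mul, norm_le_zero_iff, sub_eq_zero, hΨ] at hle
  have cP : ContinuousOn P (Icc v₁ v₂) := hP.mono fun x hx => hx.1
  have cslice : ∀ {g : ℝ → ℝ → ℝ}, ContinuousOn (Function.uncurry g) (Iic u₀ ×ˢ Ici v₁) →
      ∀ u ≤ u₀, ContinuousOn (g u) (Icc v₁ v₂) := fun hg u hu =>
    hg.comp (f := fun v => (u, v)) (by fun_prop) fun _ hv => ⟨hu, hv.1⟩
  have eΨ : ∀ u ≤ u₀, ∀ v ∈ Icc v₁ v₂, Ψ u v - ∫ v' in v₁..v, P v'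
      = ∫ v' in v₁..v, (χ u v' - P v') := by
    intro u hu v hv'
    have sub : Icc v₁ v ⊆ Icc v₁ v₂ := Icc_subset_Icc_right hv'.2
    have h1 := integral_eq_sub_of_hasDerivWithinAt_Icc (f := Ψ u) (f' := χ u) hv'.1
      (fun x hx => (h.Ψ_v u hu x hx.1).mono fun x hx => hx.1) ((cslice h.cont_χ u hu).mono sub)
    rw [hΨ0 u hu, sub_zero] at h1
    rw [← h1, intervalIntegral.integral_sub
      (((cslice h.cont_χ u hu).mono sub).intervalIntegrable_of_Icc hv'.1)
      ((cP.mono sub).intervalIntegrable_of_Icc hv'.1)]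
  -- convergence and boundedness of `Ψ`
  have hb : ∀ u ≤ u₀, ∀ v ∈ Icc v₁ v₂, (Ψ u v - ∫ v' in v₁..v, P v') ^ 2
      ≤ (v₂ - v₁) * ∫ v in v₁..v₂, (χ u v - P v) ^ 2 := by
    intro u hu v hv'
    have sub : Icc v₁ v ⊆ Icc v₁ v₂ := Icc_subset_Icc_right hv'.2
    have cd : ContinuousOn (fun v => χ u v - P v) (Icc v₁ v₂) := (cslice h.cont_χ u hu).sub cP
    rw [eΨ u hu v hv']
    refine (sq_intervalIntegral_le hv'.1 (cd.mono sub)).trans ?_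
    have h1 : ∫ x in v₁..v, (χ u x - P x) ^ 2 ≤ ∫ x in v₁..v₂, (χ u x - P x) ^ 2 :=
      intervalIntegral.integral_mono_interval le_rfl hv'.1 hv'.2
        (Eventually.of_forall fun x => sq_nonneg _) ((cd.pow 2).intervalIntegrable_of_Icc hv)
    have h2 : 0 ≤ ∫ x in v₁..v, (χ u x - P x) ^ 2 :=
      intervalIntegral.integral_nonneg hv'.1 fun x _ => sq_nonneg _
    exact mul_le_mul (by linarith [hv'.2]) h1 h2 (by linarith)
  have hlim : ∀ v ∈ Icc v₁ v₂, Tendsto (fun u => Ψ u v - ∫ v' in v₁..v, P v') atBot (𝓝 0) := by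
    intro v hv'
    have h1 : Tendsto (fun u => (Ψ u v - ∫ v' in v₁..v, P v') ^ 2) atBot (𝓝 0) := by
      have h2 := hin.const_mul (v₂ - v₁)
      rw [mul_zero] at h2
      refine tendsto_of_tendsto_of_tendsto_of_le_of_le' tendsto_const_nhds h2
        (Eventually.of_forall fun u => sq_nonneg _) ?_
      filter_upwards [eventually_le_atBot u₀] with u hu
      exact hb u hu v hv'
    have h2 := h1.sqrt
    rw [Real.sqrt_zero] at h2
    simp only [Real.sqrt_sq_eq_abs] at h2
    exact (tendsto_zero_iff_abs_tendsto_zero _).2 h2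
  have mem₂ : v₂ ∈ Icc v₁ v₂ := ⟨hv, le_rfl⟩
  have mem₁ : v₁ ∈ Icc v₁ v₂ := ⟨le_rfl, hv⟩
  refine ⟨by simpa using (hlim v₂ mem₂).add_const (∫ v' in v₁..v₂, P v'), ?_⟩
  have base : HasExpansion u₀ v₁ v₂ (fun u => (R (v₂ - u))⁻¹) 0 Ψ := by
    refine ⟨?_, cslice h.cont_Ψ⟩
    obtain ⟨U, hU⟩ := (eventually_atBot.1 ((hin.eventually (gt_mem_nhds one_pos)).and
      (eventually_le_atBot u₀)))
    obtain ⟨C₁, hC₁⟩ := (isCompact_Icc (a := U) (b := u₀)).prod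
      (isCompact_Icc (a := v₁) (b := v₂)) |>.exists_bound_of_continuousOn
      (h.cont_Ψ.mono (prod_mono (fun x hx => hx.2) fun x hx => hx.1))
    obtain ⟨C₂, hC₂⟩ := (HasExpansion.integral (N := 0) hv (u₀ := u₀) (HasExpansion.of_fun cP) hτ).1
    refine ⟨max C₁ (C₂ + (1 + (v₂ - v₁))), fun u hu v hv' => ?_⟩
    rcases le_total u U with hle | hle
    · refine le_trans ?_ (le_max_right _ _)
      have h1 := hb u hu v hv'
      have h2 := (hU u hle).1
      have h3 : |Ψ u v - ∫ v' in v₁..v, P v'| ≤ 1 + (v₂ - v₁) := by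
        refine abs_le_of_sq_le_sq ?_ (by linarith)
        have : 0 ≤ v₂ - v₁ := by linarith
        nlinarith
      have h4 := hC₂ u hu v hv'
      have h5 := abs_add_le (∫ v' in v₁..v, P v') (Ψ u v - ∫ v' in v₁..v, P v')
      rw [add_sub_cancel] at h5
      linarith
    · exact (hC₁ (u, v) ⟨⟨hle, hu⟩, hv'⟩).trans (le_max_left _ _)
  -- expansions of `ψ` and `f` in terms of those of `Ψ`
  set θ : ℝ → ℝ → ℝ := fun u v => (R (v - u))⁻¹ / (R (v₂ - u))⁻¹ with hθ
  have eθ : ∀ u ≤ u₀, ∀ v, (R (v - u))⁻¹ = (R (v₂ - u))⁻¹ * θ u v := fun u hu v => by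
    simp only [hθ]; rw [mul_div_cancel₀ _ (τpos u hu).ne']
  have θN : ∀ N, HasExpansion u₀ v₁ v₂ (fun u => (R (v₂ - u))⁻¹) N θ := hR.hasExpansion_ratio hv
  set W : ℝ → ℝ → ℝ := fun u v => (1 + (R (v₂ - u))⁻¹ * (-(2 * M) * θ u v)) * (θ u v * θ u v) with hW
  have WN : ∀ N, HasExpansion u₀ v₁ v₂ (fun u => (R (v₂ - u))⁻¹) N W := fun N =>
    (((HasExpansion.of_fun (a := fun _ => 1) continuousOn_const).add
      (((θN N).const_mul hτ (-(2 * M))).mul_tau hτ))).mul hτ ((θN N).mul hτ (θN N))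
  have eW : ∀ u ≤ u₀, ∀ v, (1 - 2 * M * (R (v - u))⁻¹) * (R (v - u))⁻¹ ^ 2
      = (R (v₂ - u))⁻¹ ^ 2 * W u v := fun u hu v => by
    rw [eθ u hu v]; simp only [hW]; ring
  have eψ : ∀ u ≤ u₀, ∀ v ∈ Icc v₁ v₂, ψ u v
      = (R (v₂ - u))⁻¹ ^ 2 * ∫ v' in v₁..v, W u v' * Ψ u v' := by
    intro u hu v hv'
    rw [h.ψ_eq_integral hR hu hv'.1, hψ0 u hu, zero_add, ← intervalIntegral.integral_const_mul]
    refine integral_congr fun x _ => ?_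
    simp only [eW u hu x]; ring
  have ef : ∀ u ≤ u₀, ∀ v ∈ Icc v₁ v₂, f u v = (R (v₂ - u))⁻¹ ^ 4 * ∫ v' in v₁..v,
      W u v' * ∫ v'' in v₁..v', W u v'' * Ψ u v'' := by
    intro u hu v hv'
    have sub : Icc v₁ v ⊆ Icc v₁ v₂ := Icc_subset_Icc_right hv'.2
    have cρ : ContinuousOn (fun v => (R (v - u))⁻¹) (Icc v₁ v) := fun x hx =>
      (hR.hasDerivAt_inv_v hu hx.1).continuousAt.continuousWithinAt
    have h1 := integral_eq_sub_of_hasDerivWithinAt_Icc (f := f u)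
      (f' := fun x => (1 - 2 * M * (R (x - u))⁻¹) * (R (x - u))⁻¹ ^ 2 * ψ u x) hv'.1
      (fun x hx => (h.f_v u hu x hx.1).mono fun x hx => hx.1)
      (((continuousOn_const.sub (continuousOn_const.mul cρ)).mul (cρ.pow 2)).mul
        ((cslice h.cont_ψ u hu).mono sub))
    rw [hf u hu, sub_zero] at h1
    rw [← h1, ← intervalIntegral.integral_const_mul]
    refine integral_congr fun x hx => ?_
    rw [uIcc_of_le hv'.1] at hx
    simp only [eW u hu x, eψ u hu x (sub hx)]; ring
  have ψN : ∀ {N}, HasExpansion u₀ v₁ v₂ (fun u => (R (v₂ - u))⁻¹) N Ψ →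
      HasExpansion u₀ v₁ v₂ (fun u => (R (v₂ - u))⁻¹) N
        (fun u v => ∫ v' in v₁..v, W u v' * Ψ u v') := fun hN =>
    ((WN _).mul hτ hN).integral hv hτ
  have fN : ∀ {N}, HasExpansion u₀ v₁ v₂ (fun u => (R (v₂ - u))⁻¹) N Ψ →
      HasExpansion u₀ v₁ v₂ (fun u => (R (v₂ - u))⁻¹) N
        (fun u v => ∫ v' in v₁..v, W u v' * ∫ v'' in v₁..v', W u v'' * Ψ u v'') := fun hN =>
    ((WN _).mul hτ (ψN hN)).integral hv hτ
  -- integrating the equation for `∂_u Ψ` from `u = -∞` gains one power of `τ`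
  have all : ∀ N, HasExpansion u₀ v₁ v₂ (fun u => (R (v₂ - u))⁻¹) N Ψ := by
    intro N
    induction N with
    | zero => exact base
    | succ N ih =>
      have src := (((HasExpansion.of_fun (a := fun _ => -lam) continuousOn_const).add
          (((θN N).const_mul hτ (6 * M)).mul_tau hτ)).mul hτ (ψN ih)).add
        (((((fN ih).const_mul hτ (6 * M)).mul_tau hτ)).mul_tau hτ)
      have key := hR.hasExpansion_of_deriv hv (k := 0)
        (Φ := fun u v => Ψ u v - ∫ v' in v₁..v, P v')
        (src.mul hτ (hR.hasExpansion_lapse_inv hv N)) ?_ ?_ hlim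
      · refine ⟨fun v => ∫ v' in v₁..v, P v', _, ?_, key, fun u hu v _ => ?_⟩
        · exact (HasExpansion.integral (N := 0) hv (u₀ := u₀) (HasExpansion.of_fun cP) hτ).2 u₀ le_rfl
        · have := (τpos u hu).ne'
          rw [zero_add, pow_one, mul_div_cancel₀ _ this]
          ring
      · intro u hu v hv'
        refine ((h.Ψ_u u hu v hv'.1).sub_const _).congr_deriv ?_
        have p3 := (hR.lapse_inv_pos (t := v₂ - u) (by linarith)).ne'
        rw [eψ u hu v hv', ef u hu v hv', eθ u hu v, pow_zero, one_mul]
        have e : ∀ l x y : ℝ, l ≠ 0 → l * x * (y * l⁻¹) = x * y := by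
          intro l x y hl; field_simp
        rw [e _ _ _ p3]
        ring
      · exact fun u hu => (cslice h.cont_Ψ u hu).sub
          ((HasExpansion.integral (N := 0) hv (u₀ := u₀) (HasExpansion.of_fun cP) hτ).2 u₀ le_rfl)
  obtain ⟨a, ha⟩ := exists_asymptotic_series hv τpos hτ (hR₂.tendsto_inv_atBot v₂)
    fun N => (hR.hasExpansion_lapse_inv hv N).mul hτ (fN (all N))
  refine ⟨fun p => a (p - 2), fun N hN => ?_⟩
  obtain ⟨C, hC⟩ := ha (N - 1)
  refine ⟨C, fun u hu => ?_⟩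
  have p := τpos u hu
  have e1 : ∑ p ∈ Finset.Icc 2 N, (R (v₂ - u))⁻¹ ^ (p + 2) * a (p - 2)
      = (R (v₂ - u))⁻¹ ^ 4 * ∑ n ∈ Finset.range (N - 1), a n * (R (v₂ - u))⁻¹ ^ n := by
    rw [show Finset.Icc 2 N = Finset.Ico 2 (N + 1) from rfl, Finset.sum_Ico_eq_sum_range,
      mul_sum]
    refine sum_congr (by congr 1) fun n _ => ?_
    rw [Nat.add_sub_cancel_left]; ring
  rw [e1, ef u hu v₂ mem₂, mul_left_comm, ← mul_sub, abs_mul, abs_of_pos (pow_pos p 4),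
    show N + 3 = N - 1 + 4 by omega, pow_add]
  have := mul_le_mul_of_nonneg_left (hC u hu) (pow_pos p 4).le
  linarith

/-! ### Tensor calculus on the unit sphere -/

/-- The `i`-th coordinate vector of `ℝ³`. -/
noncomputable abbrev coordVec (i : Fin 3) : E3 := EuclideanSpace.single i 1

/-- The orthogonal projection of the `i`-th coordinate vector to the tangent space at `x`. -/
noncomputable def tangentVec (x : E3) (i : Fin 3) : E3 := coordVec i - x i • x

theorem tangentVec_apply (x : E3) (i j : Fin 3) : tangentVec x i j = tangentProj x i j := by
  simp [tangentVec, tangentProj, eq_comm]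

theorem tangentProj_comm (x : E3) (i j : Fin 3) : tangentProj x i j = tangentProj x j i := by
  simp [tangentProj, eq_comm, mul_comm]

theorem sum_sq_eq_one {x : E3} (hx : ‖x‖ = 1) : ∑ i, x i * x i = 1 := by
  have := EuclideanSpace.real_norm_sq_eq x
  rw [hx] at this
  simp only [sq] at this
  linarith

theorem sum_smul_coordVec (w : E3) : ∑ j, w j • coordVec j = w := by
  ext i
  simp [Finset.sum_apply, Pi.single_apply]

theorem sum_tangentProj_smul (x : E3) (i : Fin 3) :
    ∑ j, tangentProj x i j • coordVec j = tangentVec x i := by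
  rw [← sum_smul_coordVec (tangentVec x i)]
  simp only [tangentVec_apply]

/-- Contraction with the tangential projection. -/
theorem sum_tangentProj_mul (x : E3) (i : Fin 3) (A : Fin 3 → ℝ) :
    ∑ j, tangentProj x i j * A j = A i - x i * ∑ j, x j * A j := by
  simp only [tangentProj, sub_mul, sum_sub_distrib, ite_mul, one_mul, zero_mul,
    sum_ite_eq, Finset.mem_univ, if_true, mul_assoc, mul_sum]

theorem inner_tangentVec {x : E3} (hx : ‖x‖ = 1) (i : Fin 3) : inner ℝ x (tangentVec x i) = 0 := by
  have : inner ℝ x x = (1 : ℝ) := by rw [real_inner_self_eq_norm_sq, hx]; norm_num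
  rw [tangentVec, inner_sub_right, inner_smul_right, this, EuclideanSpace.inner_single_right]
  simp

theorem fderiv_tangentVec {x : E3} (g : E3 → ℝ) (i : Fin 3) :
    fderiv ℝ g x (tangentVec x i) = ∑ j, tangentProj x i j * fderiv ℝ g x (coordVec j) := by
  rw [← sum_tangentProj_smul, map_sum]
  simp

theorem hasFDerivAt_norm_of_unit {x : E3} (hx : ‖x‖ = 1) :
    HasFDerivAt (fun y : E3 => ‖y‖) (innerSL ℝ x) x := by
  have hx0 : x ≠ 0 := by rintro rfl; simp at hx
  have h1 : DifferentiableAt ℝ (fun y : E3 => ‖y‖) x := (contDiffAt_norm ℝ hx0).differentiableAt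
    (n := 1) (by norm_num)
  have h2 := h1.hasFDerivAt.pow 2
  have h3 := (hasStrictFDerivAt_norm_sq x).hasFDerivAt
  have h4 := h2.unique h3
  refine h1.hasFDerivAt.congr_fderiv ?_
  ext v
  have h5 := DFunLike.congr_fun h4 v
  simp [hx] at h5
  simp [h5]

theorem hasFDerivAt_normalize {x : E3} (hx : ‖x‖ = 1) :
    HasFDerivAt (fun y : E3 => ‖y‖⁻¹ • y)
      (ContinuousLinearMap.id ℝ E3 - (innerSL ℝ x).smulRight x) x := by
  have h1 := ((hasDerivAt_inv (by rw [hx]; norm_num)).comp_hasFDerivAt x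
    (hasFDerivAt_norm_of_unit hx)).smul (hasFDerivAt_id x)
  refine h1.congr_fderiv ?_
  ext v
  simp [hx, sub_eq_add_neg]

/-- Tangential derivatives at a unit vector depend only on the values on the unit sphere. -/
theorem fderiv_normalize_eq {x w : E3} (hx : ‖x‖ = 1) (hw : inner ℝ x w = 0) {T g : E3 → ℝ}
    (hT : ∀ y : E3, ‖y‖ = 1 → T y = g y) (hg : DifferentiableAt ℝ g x) :
    fderiv ℝ (fun y => T (‖y‖⁻¹ • y)) x w = fderiv ℝ g x w := by
  have hx0 : x ≠ 0 := by rintro rfl; simp at hx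
  have e1 : (fun y => T (‖y‖⁻¹ • y)) =ᶠ[𝓝 x] fun y => g (‖y‖⁻¹ • y) := by
    filter_upwards [isOpen_ne.mem_nhds hx0] with y hy
    refine hT _ ?_
    rw [norm_smul, norm_inv, norm_norm, inv_mul_cancel₀ (norm_ne_zero_iff.2 hy)]
  have h1 : (‖x‖⁻¹ • x : E3) = x := by simp [hx]
  have h2 : HasFDerivAt g (fderiv ℝ g x) (‖x‖⁻¹ • x) := by rw [h1]; exact hg.hasFDerivAt
  have h3 : HasFDerivAt (fun y : E3 => g (‖y‖⁻¹ • y)) _ x :=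
    HasFDerivAt.comp (f := fun y : E3 => ‖y‖⁻¹ • y) x h2 (hasFDerivAt_normalize hx)
  rw [e1.fderiv_eq, h3.fderiv]
  simp [hw]

theorem sum_fin_succ_pi {k : ℕ} (h : (Fin (k + 1) → Fin 3) → ℝ) :
    ∑ J, h J = ∑ j, ∑ J : Fin k → Fin 3, h (Fin.cons j J) := by
  rw [← (Fin.consEquiv fun _ => Fin 3).sum_comp, Fintype.sum_prod_type]
  rfl

theorem sum_fin_two_pi (h : (Fin 2 → Fin 3) → ℝ) : ∑ J, h J = ∑ a, ∑ b, h ![a, b] := by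
  simp only [sum_fin_succ_pi, Finset.univ_unique, sum_singleton]
  rfl

theorem sum_fin_one_pi (h : (Fin 1 → Fin 3) → ℝ) : ∑ J, h J = ∑ a, h ![a] := by
  simp only [sum_fin_succ_pi, Finset.univ_unique, sum_singleton]
  rfl

theorem sum_fin_three_pi (h : (Fin 3 → Fin 3) → ℝ) :
    ∑ J, h J = ∑ a, ∑ b, ∑ c, h ![a, b, c] := by
  simp only [sum_fin_succ_pi, Finset.univ_unique, sum_singleton]
  rfl

/-- The covariant derivative, computed with arbitrary extensions of the components. -/
theorem covDeriv_eq {k : ℕ} {T : SphereTensor k} {g : (Fin k → Fin 3) → E3 → ℝ} {x : E3}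
    (hx : ‖x‖ = 1) (hT : ∀ J, ∀ y : E3, ‖y‖ = 1 → T y J = g J y)
    (hg : ∀ J, DifferentiableAt ℝ (g J) x) (I : Fin (k + 1) → Fin 3) :
    covDeriv T x I = ∑ J : Fin k → Fin 3, (∏ a, tangentProj x (I a.succ) (J a))
      * fderiv ℝ (g J) x (tangentVec x (I 0)) := by
  rw [covDeriv, sum_fin_succ_pi, sum_comm]
  refine sum_congr rfl fun J _ => ?_
  rw [← fderiv_normalize_eq hx (inner_tangentVec hx _) (hT J) (hg J), fderiv_tangentVec,
    mul_sum]
  refine sum_congr rfl fun j _ => ?_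
  rw [Fin.prod_univ_succ]
  simp only [Fin.cons_zero, Fin.cons_succ, Fin.tail_cons]
  ring

theorem tangentProj_mul_self {x : E3} (hx : ‖x‖ = 1) (i : Fin 3) :
    ∑ j, tangentProj x i j * x j = 0 := by
  rw [sum_tangentProj_mul, sum_sq_eq_one hx, mul_one, sub_self]

/-- Extensions which are homogeneous of degree zero have no radial derivative. -/
theorem fderiv_comp_normalize_self {T : E3 → ℝ} {y : E3}
    (hD : DifferentiableAt ℝ (fun y : E3 => T (‖y‖⁻¹ • y)) y) :
    fderiv ℝ (fun y : E3 => T (‖y‖⁻¹ • y)) y y = 0 := by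
  set g := fun y : E3 => T (‖y‖⁻¹ • y) with hg
  have h1 : HasDerivAt (fun t : ℝ => g (t • y)) (fderiv ℝ g y y) 1 := by
    have h2 : HasDerivAt (fun t : ℝ => t • y) y 1 := by
      simpa using (hasDerivAt_id (1 : ℝ)).smul_const y
    have h3 : HasFDerivAt g (fderiv ℝ g y) ((1 : ℝ) • y) := by
      rw [one_smul]; exact hD.hasFDerivAt
    exact HasFDerivAt.comp_hasDerivAt (f := fun t : ℝ => t • y) 1 h3 h2
  have h4 : (fun t : ℝ => g (t • y)) =ᶠ[𝓝 1] fun _ => g y := by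
    filter_upwards [lt_mem_nhds (show (0 : ℝ) < 1 by norm_num)] with t ht
    simp only [hg]
    rw [norm_smul, Real.norm_of_nonneg (le_of_lt ht), smul_smul, mul_inv, mul_assoc, mul_comm,
      mul_assoc, mul_inv_cancel₀ (ne_of_gt ht), mul_one]
  exact h1.unique ((hasDerivAt_const 1 _).congr_of_eventuallyEq h4)

/-! ### Solid harmonics -/

/-- Smooth functions on the punctured space. -/
abbrev SmoothOffZero (f : E3 → ℝ) : Prop := ContDiffOn ℝ ∞ f {0}ᶜ

/-- The `i`-th partial derivative. -/
noncomputable def pd (i : Fin 3) (f : E3 → ℝ) (y : E3) : ℝ := fderiv ℝ f y (coordVec i)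

/-- The Laplacian of `ℝ³`. -/
noncomputable def flatLaplacian (f : E3 → ℝ) (y : E3) : ℝ := ∑ i, pd i (pd i f) y

/-- The projection to the unit sphere. -/
noncomputable def normalize (y : E3) : E3 := ‖y‖⁻¹ • y

theorem norm_normalize {y : E3} (hy : y ≠ 0) : ‖normalize y‖ = 1 := by
  rw [normalize, norm_smul, norm_inv, norm_norm, inv_mul_cancel₀ (norm_ne_zero_iff.2 hy)]

theorem normalize_of_unit {x : E3} (hx : ‖x‖ = 1) : normalize x = x := by simp [normalize, hx]

theorem ne_zero_of_unit {x : E3} (hx : ‖x‖ = 1) : x ≠ 0 := by rintro rfl; simp at hx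

theorem normalize_apply (y : E3) (i : Fin 3) : normalize y i = ‖y‖⁻¹ * y i := by simp [normalize]

section Calculus

variable {f g : E3 → ℝ} {i j : Fin 3} {y : E3}

theorem SmoothOffZero.contDiffAt (hf : SmoothOffZero f) (hy : y ≠ 0) : ContDiffAt ℝ ∞ f y :=
  ContDiffOn.contDiffAt hf (isOpen_compl_singleton.mem_nhds hy)

theorem SmoothOffZero.differentiableAt (hf : SmoothOffZero f) (hy : y ≠ 0) :
    DifferentiableAt ℝ f y := (hf.contDiffAt hy).differentiableAt (by norm_num)

theorem smoothOffZero_pd (hf : SmoothOffZero f) (i : Fin 3) : SmoothOffZero (pd i f) :=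
  (hf.fderiv_of_isOpen isOpen_compl_singleton (m := ∞) (by norm_num)).clm_apply contDiffOn_const

theorem smoothOffZero_coord (i : Fin 3) : SmoothOffZero fun y => y i :=
  (EuclideanSpace.proj i : E3 →L[ℝ] ℝ).contDiff.contDiffOn

theorem smoothOffZero_norm : SmoothOffZero fun y => ‖y‖ := fun y hy =>
  (contDiffAt_norm ℝ (show y ≠ 0 from hy)).contDiffWithinAt

theorem pd_congr (h : ∀ y : E3, y ≠ 0 → f y = g y) (hy : y ≠ 0) : pd i f y = pd i g y := by
  have : f =ᶠ[𝓝 y] g := by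
    filter_upwards [isOpen_ne.mem_nhds hy] with z hz using h z hz
  rw [pd, pd, this.fderiv_eq]

theorem flatLaplacian_congr (h : ∀ y : E3, y ≠ 0 → f y = g y) (hy : y ≠ 0) :
    flatLaplacian f y = flatLaplacian g y :=
  sum_congr rfl fun _ _ => pd_congr (fun _ hz => pd_congr h hz) hy

theorem pd_const (c : ℝ) : pd i (fun _ => c) y = 0 := by simp [pd]

theorem pd_coord : pd i (fun y => y j) y = if i = j then 1 else 0 := by
  have h : HasFDerivAt (fun y : E3 => y j) (EuclideanSpace.proj j : E3 →L[ℝ] ℝ) y :=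
    (EuclideanSpace.proj j : E3 →L[ℝ] ℝ).hasFDerivAt
  rw [pd, h.fderiv]
  simp [eq_comm]

theorem pd_add (hf : SmoothOffZero f) (hg : SmoothOffZero g) (hy : y ≠ 0) :
    pd i (fun y => f y + g y) y = pd i f y + pd i g y := by
  simp only [pd]
  rw [fderiv_fun_add (hf.differentiableAt hy) (hg.differentiableAt hy)]
  rfl

theorem pd_mul (hf : SmoothOffZero f) (hg : SmoothOffZero g) (hy : y ≠ 0) :
    pd i (fun y => f y * g y) y = pd i f y * g y + f y * pd i g y := by
  simp only [pd]
  rw [fderiv_fun_mul (hf.differentiableAt hy) (hg.differentiableAt hy)]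
  simp only [add_apply, smul_apply, smul_eq_mul]
  ring

theorem pd_const_mul (c : ℝ) (hf : SmoothOffZero f) (hy : y ≠ 0) :
    pd i (fun y => c * f y) y = c * pd i f y := by
  rw [pd_mul contDiffOn_const hf hy, pd_const, zero_mul, zero_add]

theorem pd_sum {ι : Type*} (s : Finset ι) {F : ι → E3 → ℝ} (hF : ∀ k, SmoothOffZero (F k))
    (hy : y ≠ 0) : pd i (fun y => ∑ k ∈ s, F k y) y = ∑ k ∈ s, pd i (F k) y := by
  simp only [pd]
  rw [fderiv_fun_sum fun k _ => (hF k).differentiableAt hy, sum_apply]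

theorem pd_pd_comm (hf : SmoothOffZero f) (hy : y ≠ 0) : pd i (pd j f) y = pd j (pd i f) y := by
  have h : ∀ k l : Fin 3, pd k (pd l f) y = fderiv ℝ (fderiv ℝ f) y (coordVec k) (coordVec l) := by
    intro k l
    have h1 : DifferentiableAt ℝ (fderiv ℝ f) y :=
      ((hf.contDiffAt hy).fderiv_right (m := ∞) (by norm_num)).differentiableAt (by norm_num)
    have h2 : HasFDerivAt (fun y => fderiv ℝ f y (coordVec l)) _ y :=
      h1.hasFDerivAt.clm_apply (hasFDerivAt_const (coordVec l) y)
    rw [pd, show pd l f = fun y => fderiv ℝ f y (coordVec l) from rfl, h2.fderiv]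
    simp
  rw [h, h]
  exact ((hf.contDiffAt hy).isSymmSndFDerivAt (by
    simpa using WithTop.coe_le_coe.2 (le_top (a := (2 : ℕ∞))))) _ _

theorem pd_norm (hy : y ≠ 0) : pd i (fun y => ‖y‖) y = ‖y‖⁻¹ * y i := by
  have hn : ‖y‖ ≠ 0 := norm_ne_zero_iff.2 hy
  have h1 : pd i (fun y => ‖y‖ * ‖y‖) y = pd i (fun y => ∑ k, y k * y k) y :=
    pd_congr (fun z _ => by
      rw [← sq, EuclideanSpace.real_norm_sq_eq]; simp only [sq]) hy
  rw [pd_mul smoothOffZero_norm smoothOffZero_norm hy,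
    pd_sum _ (fun k => (smoothOffZero_coord k).mul (smoothOffZero_coord k)) hy] at h1
  simp only [pd_mul (smoothOffZero_coord _) (smoothOffZero_coord _) hy, pd_coord, ite_mul, mul_ite,
    one_mul, mul_one, zero_mul, mul_zero, sum_add_distrib, sum_ite_eq,
    Finset.mem_univ, if_true] at h1
  field_simp
  linarith

theorem smoothOffZero_norm_inv : SmoothOffZero fun y => ‖y‖⁻¹ :=
  smoothOffZero_norm.inv fun _ hy => norm_ne_zero_iff.2 hy

theorem pd_norm_inv (hy : y ≠ 0) : pd i (fun y => ‖y‖⁻¹) y = -‖y‖⁻¹ ^ 3 * y i := by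
  have hn : ‖y‖ ≠ 0 := norm_ne_zero_iff.2 hy
  have h1 : pd i (fun y => ‖y‖⁻¹ * ‖y‖) y = pd i (fun _ => 1) y :=
    pd_congr (fun z hz => inv_mul_cancel₀ (norm_ne_zero_iff.2 hz)) hy
  rw [pd_mul smoothOffZero_norm_inv smoothOffZero_norm hy, pd_const, pd_norm hy] at h1
  field_simp at h1 ⊢
  linarith

/-- Smoothness of the extension which is homogeneous of degree zero. -/
theorem smoothOffZero_comp_normalize (hf : SmoothOffZero f) :
    SmoothOffZero fun y => f (normalize y) :=
  hf.comp (smoothOffZero_norm_inv.smul contDiffOn_id) fun _ hy =>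
    ne_zero_of_unit (norm_normalize hy)

theorem flatLaplacian_add (hf : SmoothOffZero f) (hg : SmoothOffZero g) (hy : y ≠ 0) :
    flatLaplacian (fun y => f y + g y) y = flatLaplacian f y + flatLaplacian g y := by
  simp only [flatLaplacian, ← sum_add_distrib]
  refine sum_congr rfl fun i _ => ?_
  rw [pd_congr (fun z hz => pd_add hf hg hz) hy,
    pd_add (smoothOffZero_pd hf i) (smoothOffZero_pd hg i) hy]

theorem flatLaplacian_mul (hf : SmoothOffZero f) (hg : SmoothOffZero g) (hy : y ≠ 0) :
    flatLaplacian (fun y => f y * g y) y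
      = flatLaplacian f y * g y + 2 * ∑ i, pd i f y * pd i g y + f y * flatLaplacian g y := by
  simp only [flatLaplacian, sum_mul, mul_sum, ← sum_add_distrib]
  refine sum_congr rfl fun i _ => ?_
  rw [pd_congr (fun z hz => pd_mul hf hg hz) hy,
    pd_add ((smoothOffZero_pd hf i).mul hg) (hf.mul (smoothOffZero_pd hg i)) hy,
    pd_mul (smoothOffZero_pd hf i) hg hy, pd_mul hf (smoothOffZero_pd hg i) hy]
  ring

theorem flatLaplacian_const_mul (c : ℝ) (hf : SmoothOffZero f) (hy : y ≠ 0) :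
    flatLaplacian (fun y => c * f y) y = c * flatLaplacian f y := by
  simp only [flatLaplacian, mul_sum]
  refine sum_congr rfl fun i _ => ?_
  rw [pd_congr (fun z hz => pd_const_mul c hf hz) hy, pd_const_mul c (smoothOffZero_pd hf i) hy]

theorem flatLaplacian_coord : flatLaplacian (fun y => y j) y = 0 := by
  refine sum_eq_zero fun i _ => ?_
  rw [show pd i (fun y => y j) = fun _ => if i = j then (1 : ℝ) else 0 from
    funext fun _ => pd_coord, pd_const]

end Calculus

/-- Smooth functions on the punctured space which are homogeneous of degree `d`, in the form of
Euler's identity. -/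
structure IsHomogeneousOffZero (d : ℝ) (f : E3 → ℝ) : Prop where
  smooth : SmoothOffZero f
  euler : ∀ y : E3, y ≠ 0 → ∑ k, y k * pd k f y = d * f y

/-- Homogeneous harmonic functions on the punctured space. -/
structure IsSolidHarmonic (d : ℝ) (f : E3 → ℝ) : Prop extends IsHomogeneousOffZero d f where
  harmonic : ∀ y : E3, y ≠ 0 → flatLaplacian f y = 0

namespace IsHomogeneousOffZero

variable {d e : ℝ} {f g : E3 → ℝ}

theorem add (hf : IsHomogeneousOffZero d f) (hg : IsHomogeneousOffZero d g) :
    IsHomogeneousOffZero d fun y => f y + g y where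
  smooth := hf.smooth.add hg.smooth
  euler y hy := by
    simp only [pd_add hf.smooth hg.smooth hy, mul_add, sum_add_distrib, hf.euler y hy,
      hg.euler y hy]

theorem mul (hf : IsHomogeneousOffZero d f) (hg : IsHomogeneousOffZero e g) :
    IsHomogeneousOffZero (d + e) fun y => f y * g y where
  smooth := hf.smooth.mul hg.smooth
  euler y hy := by
    have h1 := hf.euler y hy
    have h2 := hg.euler y hy
    calc _ = (∑ k, y k * pd k f y) * g y + f y * ∑ k, y k * pd k g y := by
          simp only [pd_mul hf.smooth hg.smooth hy, sum_mul, mul_sum,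
            ← sum_add_distrib]
          exact sum_congr rfl fun _ _ => by ring
      _ = _ := by rw [h1, h2]; ring

theorem const (c : ℝ) : IsHomogeneousOffZero 0 fun _ => c :=
  ⟨contDiffOn_const, fun y _ => by simp [pd_const]⟩

theorem coord (i : Fin 3) : IsHomogeneousOffZero 1 fun y => y i :=
  ⟨smoothOffZero_coord i, fun y _ => by simp [pd_coord]⟩

theorem const_mul (c : ℝ) (hf : IsHomogeneousOffZero d f) :
    IsHomogeneousOffZero d fun y => c * f y := by
  simpa using (const c).mul hf

theorem pd (hf : IsHomogeneousOffZero d f) (i : Fin 3) :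
    IsHomogeneousOffZero (d - 1) (pd i f) where
  smooth := smoothOffZero_pd hf.smooth i
  euler y hy := by
    have h1 := pd_congr (i := i) hf.euler hy
    rw [pd_sum _ (fun k => (smoothOffZero_coord k).mul (smoothOffZero_pd hf.smooth k)) hy,
      pd_const_mul d hf.smooth hy] at h1
    simp only [pd_mul (smoothOffZero_coord _) (smoothOffZero_pd hf.smooth _) hy, pd_coord,
      ite_mul, one_mul, zero_mul, sum_add_distrib, sum_ite_eq, Finset.mem_univ,
      if_true, pd_pd_comm (i := i) hf.smooth hy] at h1
    linarith

/-- The first derivatives of the extension which is homogeneous of degree zero. -/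
theorem pd_comp_normalize (hf : IsHomogeneousOffZero d f) (k : Fin 3) {y : E3} (hy : y ≠ 0) :
    TeukolskyScattering.pd k (fun y => f (normalize y)) y = ‖y‖⁻¹
      * (TeukolskyScattering.pd k f (normalize y) - d * (normalize y k * f (normalize y))) := by
  have hn : ‖y‖ ≠ 0 := norm_ne_zero_iff.2 hy
  have h1 : HasFDerivAt (fun y : E3 => ‖y‖⁻¹) (fderiv ℝ (fun y : E3 => ‖y‖⁻¹) y) y :=
    (smoothOffZero_norm_inv.differentiableAt hy).hasFDerivAt
  have h2 : HasFDerivAt normalize _ y := h1.smul (hasFDerivAt_id y)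
  have h3 := (hf.smooth.differentiableAt (ne_zero_of_unit (norm_normalize hy))).hasFDerivAt
  have h4 : HasFDerivAt (fun y => f (normalize y)) _ y := HasFDerivAt.comp (f := normalize) y h3 h2
  have h5 : fderiv ℝ (fun y : E3 => ‖y‖⁻¹) y (coordVec k) = -‖y‖⁻¹ ^ 3 * y k := pd_norm_inv hy
  have h6 : fderiv ℝ f (normalize y) (normalize y) = d * f (normalize y) := by
    conv_lhs => rw [← sum_smul_coordVec (normalize y), map_sum]
    rw [← hf.euler _ (ne_zero_of_unit (norm_normalize hy))]
    simp only [map_smul, smul_eq_mul, sum_smul_coordVec]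
    rfl
  have h7 : fderiv ℝ f (normalize y) y = ‖y‖ * (d * f (normalize y)) := by
    rw [← h6, ← smul_eq_mul, ← map_smul, normalize, smul_smul, mul_inv_cancel₀ hn, one_smul]
  rw [TeukolskyScattering.pd, h4.fderiv]
  simp only [ContinuousLinearMap.comp_apply, add_apply, smul_apply,
    ContinuousLinearMap.smulRight_apply, map_add, map_smul, ContinuousLinearMap.id_apply, h5, h7,
    smul_eq_mul, normalize_apply, TeukolskyScattering.pd]
  field_simp
  ring

/-- The Laplacian of the extension of degree zero of a homogeneous function. -/
theorem flatLaplacian_comp_normalize (hf : IsHomogeneousOffZero d f) {x : E3} (hx : ‖x‖ = 1) :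
    flatLaplacian (fun y => f (normalize y)) x = flatLaplacian f x - d * (d + 1) * f x := by
  have hx0 := ne_zero_of_unit hx
  have hsn : ∀ k, SmoothOffZero fun y => normalize y k := fun k =>
    smoothOffZero_comp_normalize (smoothOffZero_coord k)
  have hsf := smoothOffZero_comp_normalize hf.smooth
  have hsd : ∀ k, SmoothOffZero fun y => TeukolskyScattering.pd k f (normalize y) := fun k =>
    smoothOffZero_comp_normalize (smoothOffZero_pd hf.smooth k)
  have hterm : ∀ k, TeukolskyScattering.pd k (TeukolskyScattering.pd k
      (fun y => f (normalize y))) x = -x k * (TeukolskyScattering.pd k f x - d * (x k * f x))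
      + (TeukolskyScattering.pd k (TeukolskyScattering.pd k f) x
        - (d - 1) * (x k * TeukolskyScattering.pd k f x)
        - d * ((1 - x k * x k) * f x + x k * (TeukolskyScattering.pd k f x - d * (x k * f x)))) := by
    intro k
    rw [pd_congr (fun y hy => hf.pd_comp_normalize k hy) hx0,
      pd_mul smoothOffZero_norm_inv ((hsd k).sub (contDiffOn_const.mul ((hsn k).mul hsf))) hx0,
      pd_norm_inv hx0]
    have h1 : TeukolskyScattering.pd k (fun y => TeukolskyScattering.pd k f (normalize y)
        - d * (normalize y k * f (normalize y))) x
        = TeukolskyScattering.pd k (fun y => TeukolskyScattering.pd k f (normalize y)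
        + (-d) * (normalize y k * f (normalize y))) x := by
      congr 1; ext y; ring
    rw [h1, pd_add (hsd k) (contDiffOn_const.mul ((hsn k).mul hsf)) hx0,
      pd_const_mul _ ((hsn k).mul hsf) hx0, pd_mul (hsn k) hsf hx0,
      hf.pd_comp_normalize k hx0, (hf.pd k).pd_comp_normalize k hx0,
      (coord k).pd_comp_normalize k hx0]
    simp only [normalize_of_unit hx, hx, pd_coord, if_true]
    ring
  have h1 := hf.euler x hx0
  have h2 := sum_sq_eq_one hx
  rw [flatLaplacian, flatLaplacian, sum_congr rfl fun k _ => hterm k]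
  simp only [Fin.sum_univ_three] at h1 h2 ⊢
  linear_combination (-2 * d) * h1 + (d * f x + d ^ 2 * f x + d * f x) * h2

end IsHomogeneousOffZero

namespace IsSolidHarmonic

variable {d : ℝ} {f g : E3 → ℝ}

theorem const_mul (c : ℝ) (hf : IsSolidHarmonic d f) : IsSolidHarmonic d fun y => c * f y where
  toIsHomogeneousOffZero := hf.toIsHomogeneousOffZero.const_mul c
  harmonic y hy := by rw [flatLaplacian_const_mul c hf.smooth hy, hf.harmonic y hy, mul_zero]

theorem add (hf : IsSolidHarmonic d f) (hg : IsSolidHarmonic d g) :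
    IsSolidHarmonic d fun y => f y + g y where
  toIsHomogeneousOffZero := hf.toIsHomogeneousOffZero.add hg.toIsHomogeneousOffZero
  harmonic y hy := by
    rw [flatLaplacian_add hf.smooth hg.smooth hy, hf.harmonic y hy, hg.harmonic y hy, add_zero]

theorem pd (hf : IsSolidHarmonic d f) (i : Fin 3) : IsSolidHarmonic (d - 1) (pd i f) where
  toIsHomogeneousOffZero := hf.toIsHomogeneousOffZero.pd i
  harmonic y hy := by
    have h1 := pd_congr (i := i) hf.harmonic hy
    rw [show flatLaplacian f = fun y => ∑ k, TeukolskyScattering.pd k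
      (TeukolskyScattering.pd k f) y from rfl] at h1
    rw [pd_const, pd_sum _ (fun k => smoothOffZero_pd (smoothOffZero_pd hf.smooth k) k) hy] at h1
    rw [flatLaplacian, ← h1]
    refine sum_congr rfl fun k _ => ?_
    rw [pd_pd_comm (i := i) (smoothOffZero_pd hf.smooth k) hy]
    exact pd_congr (fun z hz => pd_pd_comm hf.smooth hz) hy

end IsSolidHarmonic

theorem sum_mul_self_eq (y : E3) : ∑ i, y i * y i = ‖y‖ ^ 2 := by
  rw [EuclideanSpace.real_norm_sq_eq]; simp only [sq]

section

variable {f : E3 → ℝ} {y : E3}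

theorem smoothOffZero_eval (q : ℝ[X]) (hf : SmoothOffZero f) :
    SmoothOffZero fun y => q.eval (f y) := by
  have : ContDiff ℝ ∞ fun t : ℝ => q.eval t := by
    simpa [coe_aeval_eq_eval] using q.contDiff_aeval (𝕜 := ℝ) ∞
  exact this.comp_contDiffOn hf

theorem pd_eval (q : ℝ[X]) (hf : SmoothOffZero f) (hy : y ≠ 0) (i : Fin 3) :
    pd i (fun y => q.eval (f y)) y = q.derivative.eval (f y) * pd i f y := by
  have h : HasFDerivAt (fun y => q.eval (f y)) _ y :=
    (q.hasDerivAt (f y)).comp_hasFDerivAt y (hf.differentiableAt hy).hasFDerivAt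
  rw [pd, h.fderiv]
  rfl

theorem flatLaplacian_eval (q : ℝ[X]) (hf : SmoothOffZero f) (hy : y ≠ 0) :
    flatLaplacian (fun y => q.eval (f y)) y
      = q.derivative.derivative.eval (f y) * ∑ i, pd i f y * pd i f y
        + q.derivative.eval (f y) * flatLaplacian f y := by
  simp only [flatLaplacian, mul_sum, ← sum_add_distrib]
  refine sum_congr rfl fun i _ => ?_
  rw [pd_congr (fun z hz => pd_eval q hf hz i) hy,
    pd_mul (smoothOffZero_eval _ hf) (smoothOffZero_pd hf i) hy, pd_eval _ hf hy]
  ring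

end

theorem IsHomogeneousOffZero.norm : IsHomogeneousOffZero 1 fun y => ‖y‖ where
  smooth := smoothOffZero_norm
  euler y hy := by
    have hn : ‖y‖ ≠ 0 := norm_ne_zero_iff.2 hy
    have h1 := sum_mul_self_eq y
    simp only [pd_norm hy, Fin.sum_univ_three] at h1 ⊢
    field_simp
    linarith

theorem IsHomogeneousOffZero.pow {d : ℝ} {f : E3 → ℝ} (hf : IsHomogeneousOffZero d f) (k : ℕ) :
    IsHomogeneousOffZero (k * d) fun y => f y ^ k := by
  induction k with
  | zero => simpa using IsHomogeneousOffZero.const 1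
  | succ k ih =>
    have h := ih.mul hf
    simp only [← pow_succ] at h
    rwa [show ((k + 1 : ℕ) : ℝ) * d = k * d + d by push_cast; ring]

theorem pd_norm_pow (k : ℕ) {y : E3} (hy : y ≠ 0) (i : Fin 3) :
    pd i (fun y => ‖y‖ ^ k) y = k * ‖y‖ ^ k * ‖y‖⁻¹ ^ 2 * y i := by
  have h := pd_eval (X ^ k) smoothOffZero_norm hy i
  have hn : ‖y‖ ≠ 0 := norm_ne_zero_iff.2 hy
  simp only [eval_pow, eval_X, pd_norm hy, derivative_X_pow,
    eval_mul, eval_C] at h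
  rw [h]
  rcases k with _ | k
  · simp
  · rw [Nat.add_sub_cancel, pow_succ]; field_simp

theorem flatLaplacian_norm_pow (k : ℕ) {y : E3} (hy : y ≠ 0) :
    flatLaplacian (fun y => ‖y‖ ^ k) y = k * (k + 1) * ‖y‖ ^ k * ‖y‖⁻¹ ^ 2 := by
  have hn : ‖y‖ ≠ 0 := norm_ne_zero_iff.2 hy
  have h0 := sum_mul_self_eq y
  have hA := smoothOffZero_norm.pow k
  have hb := smoothOffZero_norm_inv.pow 2
  have hp : ∀ i, pd i (pd i fun y => ‖y‖ ^ k) y = k * (k - 2) * ‖y‖ ^ k * ‖y‖⁻¹ ^ 4 * (y i * y i)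
      + k * ‖y‖ ^ k * ‖y‖⁻¹ ^ 2 := by
    intro i
    have hb2 : pd i (fun y => ‖y‖⁻¹ ^ 2) y = -2 * ‖y‖⁻¹ ^ 4 * y i := by
      have := pd_eval (i := i) (X ^ 2) smoothOffZero_norm_inv hy
      simp only [eval_pow, eval_X, pd_norm_inv hy,
        derivative_X_pow, eval_mul, eval_C] at this
      rw [this]; norm_num; ring
    rw [pd_congr (fun z hz => pd_norm_pow k hz i) hy,
      pd_mul ((contDiffOn_const.mul hA).mul hb) (smoothOffZero_coord i) hy,
      pd_mul (contDiffOn_const.mul hA) hb hy, pd_const_mul _ hA hy, pd_norm_pow k hy, hb2, pd_coord]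
    simp only [if_true]
    ring
  rw [flatLaplacian, sum_congr rfl fun i _ => hp i, sum_add_distrib,
    ← mul_sum, h0]
  simp only [Finset.sum_const, Finset.card_univ, Fintype.card_fin, nsmul_eq_mul]
  field_simp
  push_cast
  ring

/-- The polynomial `(x₀ + i x₁)ⁿ` consists of a pair of conjugate harmonic functions. -/
theorem re_im_pow_properties (n : ℕ) :
    IsHomogeneousOffZero n (fun y => ((⟨y 0, y 1⟩ : ℂ) ^ n).re) ∧
    IsHomogeneousOffZero n (fun y => ((⟨y 0, y 1⟩ : ℂ) ^ n).im) ∧ ∀ y : E3, y ≠ 0 →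
      pd 0 (fun y => ((⟨y 0, y 1⟩ : ℂ) ^ n).re) y = pd 1 (fun y => ((⟨y 0, y 1⟩ : ℂ) ^ n).im) y ∧
      pd 1 (fun y => ((⟨y 0, y 1⟩ : ℂ) ^ n).re) y = -pd 0 (fun y => ((⟨y 0, y 1⟩ : ℂ) ^ n).im) y ∧
      pd 2 (fun y => ((⟨y 0, y 1⟩ : ℂ) ^ n).re) y = 0 ∧
      pd 2 (fun y => ((⟨y 0, y 1⟩ : ℂ) ^ n).im) y = 0 := by
  induction n with
  | zero =>
    simp only [pow_zero, Complex.one_re, Complex.one_im, pd_const, Nat.cast_zero]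
    exact ⟨.const 1, .const 0, fun y _ => by simp⟩
  | succ n ih =>
    obtain ⟨hc, hs, h⟩ := ih
    have ec : (fun y : E3 => ((⟨y 0, y 1⟩ : ℂ) ^ (n + 1)).re) = fun y =>
        ((⟨y 0, y 1⟩ : ℂ) ^ n).re * y 0 + (-1) * (((⟨y 0, y 1⟩ : ℂ) ^ n).im * y 1) := by
      ext y; rw [pow_succ, Complex.mul_re]; ring
    have es : (fun y : E3 => ((⟨y 0, y 1⟩ : ℂ) ^ (n + 1)).im) = fun y =>
        ((⟨y 0, y 1⟩ : ℂ) ^ n).re * y 1 + ((⟨y 0, y 1⟩ : ℂ) ^ n).im * y 0 := by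
      ext y; rw [pow_succ, Complex.mul_im]
    have h0 := IsHomogeneousOffZero.coord 0
    have h1 := IsHomogeneousOffZero.coord 1
    rw [ec, es]
    refine ⟨?_, ?_, fun y hy => ?_⟩
    · simpa using (hc.mul h0).add ((hs.mul h1).const_mul (-1))
    · simpa using (hc.mul h1).add (hs.mul h0)
    · obtain ⟨e1, e2, e3, e4⟩ := h y hy
      simp only [pd_add (hc.mul h0).smooth ((hs.mul h1).const_mul (-1)).smooth hy,
        pd_add (hc.mul h1).smooth (hs.mul h0).smooth hy, pd_const_mul _ (hs.mul h1).smooth hy,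
        pd_mul hc.smooth h0.smooth hy, pd_mul hc.smooth h1.smooth hy, pd_mul hs.smooth h0.smooth hy,
        pd_mul hs.smooth h1.smooth hy, pd_coord, e1, e2, e3, e4, Fin.isValue, Fin.reduceEq, if_true,
        if_false, zero_ne_one,
        one_ne_zero]
      exact ⟨by ring, by ring, by ring, by ring⟩

theorem isSolidHarmonic_re_im_pow (n : ℕ) :
    (IsSolidHarmonic n fun y => ((⟨y 0, y 1⟩ : ℂ) ^ n).re) ∧
    IsSolidHarmonic n fun y => ((⟨y 0, y 1⟩ : ℂ) ^ n).im := by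
  obtain ⟨hc, hs, h⟩ := re_im_pow_properties n
  refine ⟨⟨hc, fun y hy => ?_⟩, ⟨hs, fun y hy => ?_⟩⟩
  · rw [flatLaplacian, Fin.sum_univ_three, pd_congr (fun z hz => (h z hz).1) hy,
      pd_congr (fun z hz => (h z hz).2.1) hy, pd_congr (fun z hz => (h z hz).2.2.1) hy, pd_const,
      pd_pd_comm hs.smooth hy]
    have := pd_const_mul (i := 1) (-1) (smoothOffZero_pd hs.smooth 0) hy
    simp only [neg_mul, one_mul] at this
    rw [this]
    ring
  · rw [flatLaplacian, Fin.sum_univ_three, ← pd_congr (fun z hz => (h z hz).1) hy,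
      pd_congr (fun z hz => (h z hz).2.2.2) hy, pd_const, pd_pd_comm hc.smooth hy,
      pd_congr (fun z hz => (h z hz).2.1) hy]
    have := pd_const_mul (i := 0) (-1) (smoothOffZero_pd hs.smooth 0) hy
    simp only [neg_mul, one_mul] at this
    rw [this]
    ring

/-- The differential equation of the derivatives of the Rodrigues polynomial. -/
theorem rodrigues_ode (ℓ n : ℕ) :
    (X ^ 2 - 1) * derivative^[n + 2] ((X ^ 2 - 1 : ℝ[X]) ^ ℓ)
      + C (2 * ((n : ℝ) + 1 - ℓ)) * X
        * derivative^[n + 1] ((X ^ 2 - 1 : ℝ[X]) ^ ℓ)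
      + C (((n : ℝ) + 1) * (n - 2 * ℓ))
        * derivative^[n] ((X ^ 2 - 1 : ℝ[X]) ^ ℓ) = 0 := by
  induction n with
  | zero =>
    set w : ℝ[X] := (X ^ 2 - 1) ^ ℓ with hw
    have h1 : (X ^ 2 - 1) * derivative w
        = C (2 * (ℓ : ℝ)) * (X * w) := by
      rw [hw, derivative_pow]
      rcases ℓ with _ | ℓ
      · simp
      · simp only [Nat.add_sub_cancel, pow_succ, derivative_sub,
          derivative_mul, derivative_X, derivative_one, map_mul,
          pow_zero, map_ofNat]
        ring
    have h2 := congrArg derivative h1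
    simp only [derivative_mul, derivative_sub, derivative_X_pow,
      derivative_one, derivative_X, derivative_C] at h2
    simp only [Function.iterate_succ, Function.iterate_zero, Function.comp, id]
    norm_num at h2 ⊢
    linear_combination h2
  | succ n ih =>
    have h2 := congrArg derivative ih
    simp only [derivative_mul, derivative_sub, derivative_X_pow,
      derivative_one, derivative_X, derivative_C,
      derivative_add, ← Function.iterate_succ_apply' derivative,
      derivative_zero] at h2
    have h3 : C (2 : ℝ) = 2 := rfl
    norm_num [h3] at h2 ⊢
    linear_combination h2

/-- A spherical harmonic is the restriction of a solid harmonic: the associated Legendre equation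
is the Laplace equation for `|y|^(ℓ-n) Q(y₂ / |y|) ζ(y₀, y₁)`. -/
theorem isSolidHarmonic_legendre {ℓ n : ℕ} (hn : n ≤ ℓ) {ζ : E3 → ℝ} (hζ : IsSolidHarmonic n ζ)
    (h2 : ∀ y : E3, y ≠ 0 → pd 2 ζ y = 0) :
    IsSolidHarmonic ℓ fun y => ‖y‖ ^ (ℓ - n) * ((derivative^[ℓ + n]
        ((X ^ 2 - 1 : ℝ[X]) ^ ℓ)).eval (y 2 * ‖y‖⁻¹) * ζ y) := by
  set q := derivative^[ℓ + n] ((X ^ 2 - 1 : ℝ[X]) ^ ℓ) with hq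
  have hb : IsHomogeneousOffZero (-1) fun y => ‖y‖⁻¹ := ⟨smoothOffZero_norm_inv, fun y hy => by
    have hn : ‖y‖ ≠ 0 := norm_ne_zero_iff.2 hy
    have h1 := sum_mul_self_eq y
    simp only [pd_norm_inv hy, Fin.sum_univ_three] at h1 ⊢
    field_simp
    linarith⟩
  have ht : IsHomogeneousOffZero 0 fun y => y 2 * ‖y‖⁻¹ := by
    simpa using (IsHomogeneousOffZero.coord 2).mul hb
  have hB : IsHomogeneousOffZero 0 fun y => q.eval (y 2 * ‖y‖⁻¹) :=
    ⟨smoothOffZero_eval q ht.smooth, fun y hy => by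
      have := ht.euler y hy
      simp only [pd_eval q ht.smooth hy, Fin.sum_univ_three] at this ⊢
      linear_combination q.derivative.eval (y 2 * ‖y‖⁻¹) * this⟩
  have hA := IsHomogeneousOffZero.norm.pow (ℓ - n)
  have hBζ := hB.mul hζ.toIsHomogeneousOffZero
  have hcast : ((ℓ - n : ℕ) : ℝ) = ℓ - n := Nat.cast_sub hn
  refine ⟨?_, fun y hy => ?_⟩
  · have := hA.mul hBζ
    rwa [hcast, show ((ℓ : ℝ) - n) * 1 + (0 + n) = ℓ by ring] at this
  have hn0 : ‖y‖ ≠ 0 := norm_ne_zero_iff.2 hy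
  have hy2 := sum_mul_self_eq y
  have e1 : ∑ i, pd i (fun y => ‖y‖ ^ (ℓ - n)) y * pd i (fun y => q.eval (y 2 * ‖y‖⁻¹) * ζ y) y
      = ((ℓ : ℝ) - n) * n * ‖y‖ ^ (ℓ - n) * ‖y‖⁻¹ ^ 2 * (q.eval (y 2 * ‖y‖⁻¹) * ζ y) := by
    have := hBζ.euler y hy
    simp only [pd_norm_pow _ hy, hcast, Fin.sum_univ_three] at this ⊢
    linear_combination ((ℓ : ℝ) - n) * ‖y‖ ^ (ℓ - n) * ‖y‖⁻¹ ^ 2 * this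
  have dt : ∀ i, pd i (fun y => y 2 * ‖y‖⁻¹) y
      = (if i = 2 then 1 else 0) * ‖y‖⁻¹ - y 2 * ‖y‖⁻¹ ^ 3 * y i := by
    intro i
    rw [pd_mul (smoothOffZero_coord 2) smoothOffZero_norm_inv hy, pd_coord, pd_norm_inv hy]
    ring
  have e2 : ∑ i, pd i (fun y => q.eval (y 2 * ‖y‖⁻¹)) y * pd i ζ y
      = -q.derivative.eval (y 2 * ‖y‖⁻¹) * y 2 * ‖y‖⁻¹ ^ 3 * n * ζ y := by
    have h3 := hζ.euler y hy
    have h4 := h2 y hy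
    simp only [pd_eval q ht.smooth hy, dt, Fin.sum_univ_three] at h3 ⊢
    simp only [Fin.isValue, Fin.reduceEq, if_true, if_false, zero_mul, one_mul]
    linear_combination -q.derivative.eval (y 2 * ‖y‖⁻¹) * y 2 * ‖y‖⁻¹ ^ 3 * h3
      + q.derivative.eval (y 2 * ‖y‖⁻¹) * ‖y‖⁻¹ * h4
  have lapb : flatLaplacian (fun y => ‖y‖⁻¹) y = 0 := by
    have h3 : ∀ i, pd i (pd i fun y => ‖y‖⁻¹) y = 3 * ‖y‖⁻¹ ^ 5 * (y i * y i) - ‖y‖⁻¹ ^ 3 := by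
      intro i
      have h4 := pd_eval (i := i) (-X ^ 3) smoothOffZero_norm_inv hy
      simp only [eval_neg, eval_pow, eval_X, pd_norm_inv hy,
        derivative_neg, derivative_X_pow, eval_mul,
        eval_C] at h4
      rw [pd_congr (fun z hz => pd_norm_inv hz) hy,
        pd_mul ((smoothOffZero_norm_inv.pow 3).neg) (smoothOffZero_coord i) hy, h4, pd_coord]
      norm_num
      ring
    rw [flatLaplacian, sum_congr rfl fun i _ => h3 i, sum_sub_distrib,
      ← mul_sum, hy2]
    simp only [Finset.sum_const, Finset.card_univ, Fintype.card_fin, nsmul_eq_mul]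
    field_simp
    norm_num
  have e3 : flatLaplacian (fun y => y 2 * ‖y‖⁻¹) y = -2 * y 2 * ‖y‖⁻¹ ^ 3 := by
    rw [flatLaplacian_mul (smoothOffZero_coord 2) smoothOffZero_norm_inv hy, lapb,
      flatLaplacian_coord]
    simp [pd_coord, pd_norm_inv hy]
    ring
  have e4 : ∑ i, pd i (fun y => y 2 * ‖y‖⁻¹) y * pd i (fun y => y 2 * ‖y‖⁻¹) y
      = ‖y‖⁻¹ ^ 2 * (1 - (y 2 * ‖y‖⁻¹) ^ 2) := by
    simp only [dt, Fin.sum_univ_three] at hy2 ⊢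
    simp only [Fin.isValue, Fin.reduceEq, if_true, if_false, zero_mul, one_mul]
    have h5 : ‖y‖⁻¹ * ‖y‖ = 1 := inv_mul_cancel₀ hn0
    generalize ‖y‖⁻¹ = b at *
    linear_combination (y 2 ^ 2 * b ^ 6) * hy2 + (y 2 ^ 2 * b ^ 4 * (b * ‖y‖ + 1)) * h5
  have ode := congrArg (eval (y 2 * ‖y‖⁻¹)) (rodrigues_ode ℓ (ℓ + n))
  rw [Function.iterate_succ_apply', Function.iterate_succ_apply', ← hq] at ode
  simp only [eval_add, eval_mul, eval_sub, eval_pow,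
    eval_X, eval_one, eval_C, eval_zero] at ode
  rw [flatLaplacian_mul hA.smooth hBζ.smooth hy, e1, flatLaplacian_norm_pow _ hy, hcast,
    flatLaplacian_mul hB.smooth hζ.smooth hy, e2, hζ.harmonic y hy,
    flatLaplacian_eval q ht.smooth hy, e4, e3]
  push_cast at ode
  linear_combination -‖y‖ ^ (ℓ - n) * ‖y‖⁻¹ ^ 2 * ζ y * ode

theorem exists_isSolidHarmonic_realSphHarm {ℓ : ℕ} {m : ℤ} (hm : m.natAbs ≤ ℓ) :
    ∃ F : E3 → ℝ, IsSolidHarmonic ℓ F ∧ ∀ x : E3, ‖x‖ = 1 → ∀ I, realSphHarm ℓ m x I = F x := by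
  obtain ⟨-, -, h⟩ := re_im_pow_properties m.natAbs
  by_cases hm0 : 0 ≤ m
  · refine ⟨_, (isSolidHarmonic_legendre hm (isSolidHarmonic_re_im_pow m.natAbs).1
      fun y hy => (h y hy).2.2.1).const_mul (Real.sqrt ((if m = 0 then 1 else 2) * ((2 * ℓ + 1) /
      (4 * Real.pi)) * ((ℓ - m.natAbs).factorial / (ℓ + m.natAbs).factorial))
      / (2 ^ ℓ * ℓ.factorial)), fun x hx I => ?_⟩
    rw [realSphHarm, if_pos hm0, hx, one_pow, inv_one, mul_one, one_mul, ← mul_assoc]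
  · refine ⟨_, (isSolidHarmonic_legendre hm (isSolidHarmonic_re_im_pow m.natAbs).2
      fun y hy => (h y hy).2.2.2).const_mul (Real.sqrt ((if m = 0 then 1 else 2) * ((2 * ℓ + 1) /
      (4 * Real.pi)) * ((ℓ - m.natAbs).factorial / (ℓ + m.natAbs).factorial))
      / (2 ^ ℓ * ℓ.factorial)), fun x hx I => ?_⟩
    rw [realSphHarm, if_neg hm0, hx, one_pow, inv_one, mul_one, one_mul, ← mul_assoc]

/-! ### Tensor harmonics -/

/-- Smooth stf 2-tensor fields which are eigentensors of the Laplacian of the unit sphere, with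
eigenvalue `μ + 2`.  The equation is stated for the flat Laplacian of the extension of degree zero
of the components, and for its tangential part only. -/
structure IsTensorHarmonic (μ : ℝ) (H : SphereTensor 2) : Prop where
  smooth : ∀ I, SmoothOffZero fun y => H (normalize y) I
  stf : IsStf H
  eigen : ∀ x : E3, ‖x‖ = 1 → ∀ A : Fin 3 → Fin 3 → ℝ, (∀ b, ∑ a, x a * A a b = 0) →
    (∀ a, ∑ b, x b * A a b = 0) →
    ∑ a, ∑ b, A a b * flatLaplacian (fun y => H (normalize y) ![a, b]) x
      = μ * ∑ a, ∑ b, A a b * H x ![a, b]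

theorem eta_fin_two (J : Fin 2 → Fin 3) : ![J 0, J 1] = J := by
  ext i; fin_cases i <;> rfl

theorem flatLaplacian_zero (y : E3) : flatLaplacian (fun _ => 0) y = 0 := by
  simp [flatLaplacian, show ∀ i, pd i (fun _ => (0 : ℝ)) = fun _ => 0 from
    fun i => funext fun _ => pd_const 0, pd_const]

namespace IsTensorHarmonic

variable {μ : ℝ} {H K : SphereTensor 2}

theorem zero : IsTensorHarmonic μ 0 where
  smooth I := contDiffOn_const
  stf x _ := by simp
  eigen x _ A _ _ := by simp [flatLaplacian_zero]

theorem add (hH : IsTensorHarmonic μ H) (hK : IsTensorHarmonic μ K) :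
    IsTensorHarmonic μ (H + K) where
  smooth I := (hH.smooth I).add (hK.smooth I)
  stf x hx := by
    obtain ⟨h1, h2, h3⟩ := hH.stf x hx
    obtain ⟨k1, k2, k3⟩ := hK.stf x hx
    simp only [Pi.add_apply, mul_add, sum_add_distrib, h2, h3, k2, k3, add_zero]
    exact ⟨fun i j => by rw [h1, k1], by simp, by simp⟩
  eigen x hx A h1 h2 := by
    simp only [Pi.add_apply, flatLaplacian_add (hH.smooth _) (hK.smooth _) (ne_zero_of_unit hx),
      mul_add, sum_add_distrib, hH.eigen x hx A h1 h2, hK.eigen x hx A h1 h2]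

theorem smul (c : ℝ) (hH : IsTensorHarmonic μ H) : IsTensorHarmonic μ (c • H) where
  smooth I := contDiffOn_const.mul (hH.smooth I)
  stf x hx := by
    obtain ⟨h1, h2, h3⟩ := hH.stf x hx
    simp only [Pi.smul_apply, smul_eq_mul, mul_left_comm _ c, ← mul_sum, h2, h3, mul_zero]
    exact ⟨fun i j => by rw [h1], by simp, by simp⟩
  eigen x hx A h1 h2 := by
    simp only [Pi.smul_apply, smul_eq_mul,
      flatLaplacian_const_mul c (hH.smooth _) (ne_zero_of_unit hx), mul_left_comm _ c,
      ← mul_sum, hH.eigen x hx A h1 h2]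

theorem sum {ι : Type*} (s : Finset ι) {F : ι → SphereTensor 2}
    (h : ∀ i ∈ s, IsTensorHarmonic μ (F i)) : IsTensorHarmonic μ (∑ i ∈ s, F i) := by
  classical
  induction s using Finset.induction_on with
  | empty => simpa using zero
  | insert a s ha ih =>
    rw [sum_insert ha]
    exact (h a (Finset.mem_insert_self a s)).add
      (ih fun i hi => h i (Finset.mem_insert_of_mem hi))

/-- Tensor harmonics from solid harmonics. -/
theorem of_isSolidHarmonic {dU dV dB : ℝ} {U : Fin 3 → Fin 3 → E3 → ℝ} {V : Fin 3 → E3 → ℝ}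
    {B : E3 → ℝ} (hU : ∀ a b, IsSolidHarmonic dU (U a b)) (hV : ∀ a, IsSolidHarmonic dV (V a))
    (hB : IsSolidHarmonic dB B)
    (hH : ∀ x : E3, ‖x‖ = 1 → ∀ a b, H x ![a, b] = U a b x + (x a * V b x + x b * V a x)
      + ((if a = b then 1 else 0) + x a * x b) * B x)
    (hUV : ∀ x : E3, ‖x‖ = 1 → ∀ a b,
      2 * (pd a (V b) x + pd b (V a) x) = (μ + dU * (dU + 1)) * U a b x)
    (hBμ : ∀ x : E3, ‖x‖ = 1 → (2 - dB * (dB + 1)) * B x = μ * B x) (hstf : IsStf H) :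
    IsTensorHarmonic μ H := by
  have hx1 := fun a => smoothOffZero_coord a
  have h1 : ∀ a b, IsHomogeneousOffZero (1 + dV) fun y => y a * V b y := fun a b =>
    (IsHomogeneousOffZero.coord a).mul (hV b).toIsHomogeneousOffZero
  have h2 : ∀ a b : Fin 3, IsHomogeneousOffZero dB fun y => (if a = b then 1 else 0) * B y :=
    fun a b => hB.toIsHomogeneousOffZero.const_mul _
  have h3 : ∀ a b, IsHomogeneousOffZero (1 + 1 + dB) fun y => y a * y b * B y := fun a b =>
    ((IsHomogeneousOffZero.coord a).mul (.coord b)).mul hB.toIsHomogeneousOffZero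
  have hdecomp : ∀ a b, ∀ y : E3, y ≠ 0 → H (normalize y) ![a, b] = U a b (normalize y)
      + ((normalize y a * V b (normalize y) + normalize y b * V a (normalize y))
      + ((if a = b then 1 else 0) * B (normalize y) + normalize y a * normalize y b
        * B (normalize y))) := by
    intro a b y hy
    rw [hH _ (norm_normalize hy)]
    ring
  have sU := fun a b => smoothOffZero_comp_normalize (hU a b).smooth
  have s1 := fun a b => smoothOffZero_comp_normalize (h1 a b).smooth
  have s2 := fun a b => smoothOffZero_comp_normalize (h2 a b).smooth
  have s3 := fun a b => smoothOffZero_comp_normalize (h3 a b).smooth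
  refine ⟨fun I => ?_, hstf, fun x hx A hA hA' => ?_⟩
  · rw [← eta_fin_two I]
    exact ((sU _ _).add (((s1 (I 0) (I 1)).add (s1 (I 1) (I 0))).add
      ((s2 (I 0) (I 1)).add (s3 _ _)))).congr fun y hy => hdecomp _ _ y hy
  have hx0 := ne_zero_of_unit hx
  set w : Fin 3 → ℝ := fun b => -((dV + 1) * (dV + 2) + μ) * V b x + 2 * pd b B x
    - ((dB + 2) * (dB + 3) + μ) / 2 * (x b * B x)
  have lap : ∀ a b, flatLaplacian (fun y => H (normalize y) ![a, b]) x
      = μ * H x ![a, b] + (x a * w b + x b * w a) := by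
    intro a b
    have l1 : ∀ a b, flatLaplacian (fun y => y a * V b y) x = 2 * pd a (V b) x := fun a b => by
      rw [flatLaplacian_mul (hx1 a) (hV b).smooth hx0, flatLaplacian_coord, (hV b).harmonic x hx0]
      simp [pd_coord]
    have l2 : flatLaplacian (fun y => y a * y b * B y) x
        = 2 * (if a = b then 1 else 0) * B x + 2 * (x b * pd a B x + x a * pd b B x) := by
      rw [flatLaplacian_mul ((hx1 a).mul (hx1 b)) hB.smooth hx0,
        flatLaplacian_mul (hx1 a) (hx1 b) hx0, flatLaplacian_coord, flatLaplacian_coord,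
        hB.harmonic x hx0]
      simp only [pd_mul (hx1 a) (hx1 b) hx0, pd_coord]
      simp [add_mul, sum_add_distrib, eq_comm]
    rw [flatLaplacian_congr (hdecomp a b) hx0, flatLaplacian_add (sU a b)
      (((s1 a b).add (s1 b a)).add ((s2 a b).add (s3 a b))) hx0,
      flatLaplacian_add ((s1 a b).add (s1 b a)) ((s2 a b).add (s3 a b)) hx0,
      flatLaplacian_add (s1 a b) (s1 b a) hx0, flatLaplacian_add (s2 a b) (s3 a b) hx0,
      (hU a b).flatLaplacian_comp_normalize hx, (h1 a b).flatLaplacian_comp_normalize hx,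
      (h1 b a).flatLaplacian_comp_normalize hx, (h2 a b).flatLaplacian_comp_normalize hx,
      (h3 a b).flatLaplacian_comp_normalize hx, (hU a b).harmonic x hx0, l1, l1,
      flatLaplacian_const_mul _ hB.smooth hx0, hB.harmonic x hx0, l2, hH x hx]
    linear_combination hUV x hx a b + (if a = b then 1 else 0) * hBμ x hx
  have z1 : ∑ a, ∑ b, A a b * (x a * w b) = 0 := by
    rw [sum_comm]
    refine sum_eq_zero fun b _ => ?_
    rw [← mul_zero (w b), ← hA b, mul_sum]
    exact sum_congr rfl fun _ _ => by ring
  have z2 : ∑ a, ∑ b, A a b * (x b * w a) = 0 := by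
    refine sum_eq_zero fun a _ => ?_
    rw [← mul_zero (w a), ← hA' a, mul_sum]
    exact sum_congr rfl fun _ _ => by ring
  simp only [lap, mul_add, sum_add_distrib, z1, z2, add_zero, mul_sum]
  exact sum_congr rfl fun a _ => sum_congr rfl fun b _ => by ring

end IsTensorHarmonic

theorem covDeriv_scalar {Y : SphereTensor 0} {F : E3 → ℝ} {d : ℝ} (hF : IsHomogeneousOffZero d F)
    (hY : ∀ x : E3, ‖x‖ = 1 → ∀ I, Y x I = F x) {x : E3} (hx : ‖x‖ = 1) (I : Fin 1 → Fin 3) :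
    covDeriv Y x I = pd (I 0) F x - d * (x (I 0) * F x) := by
  have hx0 := ne_zero_of_unit hx
  rw [covDeriv_eq (g := fun _ => F) hx (fun J y hy => hY y hy J)
    (fun _ => hF.smooth.differentiableAt hx0), Fintype.sum_unique, fderiv_tangentVec,
    sum_tangentProj_mul]
  have := hF.euler x hx0
  simp only [pd] at this
  rw [this]
  simp only [Finset.univ_eq_empty, Finset.prod_empty, pd]
  ring

theorem covDeriv_zero {x : E3} (hx : ‖x‖ = 1) (I : Fin 1 → Fin 3) :
    covDeriv (0 : SphereTensor 0) x I = 0 := by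
  rw [covDeriv_scalar (Y := 0) (IsHomogeneousOffZero.const 0) (fun _ _ _ => rfl) hx, pd_const]
  ring

theorem covDeriv_one_form {β : SphereTensor 1} {Z : Fin 3 → E3 → ℝ}
    (hZ : ∀ b, SmoothOffZero (Z b)) (hβ : ∀ x : E3, ‖x‖ = 1 → ∀ I, β x I = Z (I 0) x) {x : E3}
    (hx : ‖x‖ = 1) {D : Fin 3 → Fin 3 → ℝ}
    (hD : ∀ i b, pd i (Z b) x - x i * ∑ k, x k * pd k (Z b) x = D i b) (i j : Fin 3) :
    covDeriv β x ![i, j] = D i j - x j * ∑ b, x b * D i b := by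
  have hx0 := ne_zero_of_unit hx
  rw [covDeriv_eq (g := fun J => Z (J 0)) hx (fun J y hy => hβ y hy J)
    (fun J => (hZ _).differentiableAt hx0), sum_fin_one_pi, ← sum_tangentProj_mul]
  refine sum_congr rfl fun b _ => ?_
  rw [← hD, fderiv_tangentVec, sum_tangentProj_mul]
  simp [pd]

theorem leviCivita_contract (v w : Fin 3 → ℝ) (i : Fin 3) :
    ∑ j, (∑ k, leviCivita k i j * v k) * w j = v (i + 2) * w (i + 1) - v (i + 1) * w (i + 2) := by
  fin_cases i <;>
    simp [leviCivita, Matrix.det_fin_three, Fin.sum_univ_three, Pi.single_apply] <;> ring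

section

variable {ℓ : ℕ} {F : E3 → ℝ}

/-- The components of `x ∧ ∇F` are solid harmonics. -/
theorem isSolidHarmonic_rotate {d : ℝ} (hF : IsSolidHarmonic d F) (a b : Fin 3) :
    IsSolidHarmonic d fun y => y a * pd b F y - y b * pd a F y := by
  have e : (fun y : E3 => y a * pd b F y - y b * pd a F y)
      = fun y => y a * pd b F y + (-1) * (y b * pd a F y) := by ext; ring
  have h1 : ∀ a b, IsHomogeneousOffZero d fun y => y a * pd b F y := fun a b => by
    simpa using (IsHomogeneousOffZero.coord a).mul (hF.pd b).toIsHomogeneousOffZero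
  have h2 : ∀ a b, ∀ y : E3, y ≠ 0 → flatLaplacian (fun y => y a * pd b F y) y
      = 2 * pd a (pd b F) y := fun a b y hy => by
    rw [flatLaplacian_mul (smoothOffZero_coord a) (hF.pd b).smooth hy, flatLaplacian_coord,
      (hF.pd b).harmonic y hy]
    simp [pd_coord]
  rw [e]
  refine ⟨(h1 a b).add ((h1 b a).const_mul (-1)), fun y hy => ?_⟩
  rw [flatLaplacian_add (h1 a b).smooth ((h1 b a).const_mul (-1)).smooth hy,
    flatLaplacian_const_mul _ (h1 b a).smooth hy, h2 a b y hy, h2 b a y hy,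
    pd_pd_comm hF.smooth hy]
  ring

/-- The electric tensor harmonics in terms of the solid harmonic of their potential. -/
theorem adjD2_adjD1_electric (hF : IsSolidHarmonic ℓ F) {Y : SphereTensor 0}
    (hY : ∀ x : E3, ‖x‖ = 1 → ∀ I, Y x I = F x) {x : E3} (hx : ‖x‖ = 1) (i j : Fin 3) :
    adjD2 (adjD1 Y 0) x ![i, j] = pd i (pd j F) x + (x i * (-(ℓ - 1) * pd j F x)
      + x j * (-(ℓ - 1) * pd i F x))
      + ((if i = j then 1 else 0) + x i * x j) * (ℓ * (ℓ - 1) / 2 * F x) := by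
  have hx0 := ne_zero_of_unit hx
  have hn := sum_sq_eq_one hx
  have e0 := hF.euler x hx0
  have e1 := fun i => (hF.pd i).euler x hx0
  have hZ : ∀ b, SmoothOffZero fun y => ℓ * (y b * F y) + (-1) * pd b F y := fun b =>
    (contDiffOn_const.mul ((smoothOffZero_coord b).mul hF.smooth)).add
      (contDiffOn_const.mul (hF.pd b).smooth)
  have hβ : ∀ y : E3, ‖y‖ = 1 → ∀ I : Fin 1 → Fin 3, adjD1 Y 0 y I
      = ℓ * (y (I 0) * F y) + (-1) * pd (I 0) F y := fun y hy I => by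
    have hz : hodge (covDeriv 0) y I = 0 := sum_eq_zero fun j _ => by
      rw [covDeriv_zero hy, mul_zero]
    rw [adjD1, covDeriv_scalar hF.toIsHomogeneousOffZero hY hy, hz]
    ring
  have hpd : ∀ k b, pd k (fun y => ℓ * (y b * F y) + (-1) * pd b F y) x
      = ℓ * ((if k = b then 1 else 0) * F x + x b * pd k F x) - pd k (pd b F) x := by
    intro k b
    rw [pd_add (contDiffOn_const.mul ((smoothOffZero_coord b).mul hF.smooth))
      (contDiffOn_const.mul (hF.pd b).smooth) hx0,
      pd_const_mul _ ((smoothOffZero_coord b).mul hF.smooth) hx0,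
      pd_const_mul _ (hF.pd b).smooth hx0, pd_mul (smoothOffZero_coord b) hF.smooth hx0, pd_coord]
    ring
  set D : Fin 3 → Fin 3 → ℝ := fun i b => ℓ * ((if i = b then 1 else 0) * F x + x b * pd i F x)
    - pd i (pd b F) x - x i * (ℓ * (ℓ + 1) * (x b * F x) - (ℓ - 1) * pd b F x) with hD
  have hcov := covDeriv_one_form hZ hβ hx (D := D) fun i b => by
    have h1 : ∑ k, x k * pd k (fun y => ℓ * (y b * F y) + (-1) * pd b F y) x
        = ℓ * (ℓ + 1) * (x b * F x) - (ℓ - 1) * pd b F x := by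
      rw [← e1 b]
      have h2 : ∑ k, x k * (if k = b then (1 : ℝ) else 0) = x b := by simp
      rw [← h2]
      simp only [hpd, Fin.sum_univ_three] at e0 h2 ⊢
      linear_combination (ℓ * x b) * e0 + (-(ℓ * ℓ * F x)) * h2
    rw [h1, hpd]
  have hs : ∀ i, ∑ b, x b * D i b = pd i F x - ℓ * (x i * F x) := by
    intro i
    have h1 := e1 i
    have h2 : ∑ b, x b * (if i = b then (1 : ℝ) else 0) = x i := by simp
    simp only [pd_pd_comm (j := i) hF.smooth hx0] at h1
    simp only [hD, Fin.sum_univ_three] at e0 hn h1 h2 ⊢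
    linear_combination (ℓ * F x) * h2 + (ℓ * pd i F x - ℓ * (ℓ + 1) * x i * F x) * hn - h1
      + ((ℓ - 1) * x i) * e0
  have htr : ∑ k, covDeriv (adjD1 Y 0) x ![k, k] = ℓ * (ℓ + 1) * F x := by
    have h3 := hF.harmonic x hx0
    simp only [hcov, hs]
    simp only [flatLaplacian, hD, Fin.sum_univ_three, if_true] at e0 hn h3 ⊢
    linear_combination (2 * ℓ - 2 : ℝ) * e0 - h3 - ℓ ^ 2 * F x * hn
  rw [adjD2, stfPart, htr]
  simp only [Matrix.cons_val_zero, Matrix.cons_val_one, hcov, hs]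
  simp only [hD, tangentProj, pd_pd_comm (i := j) (j := i) hF.smooth hx0]
  by_cases hij : i = j
  · subst hij; simp only [if_true]; ring
  · simp only [if_neg hij, if_neg (Ne.symm hij)]; ring

theorem pd_rotate (hF : SmoothOffZero F) {x : E3} (hx : x ≠ 0) (a b k : Fin 3) :
    pd k (fun y => y a * pd b F y - y b * pd a F y) x = (if k = a then 1 else 0) * pd b F x
      - (if k = b then 1 else 0) * pd a F x + x a * pd k (pd b F) x - x b * pd k (pd a F) x := by
  have e : (fun y : E3 => y a * pd b F y - y b * pd a F y)
      = fun y => y a * pd b F y + (-1) * (y b * pd a F y) := by ext; ring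
  have h1 : ∀ a b, SmoothOffZero fun y => y a * pd b F y := fun a b =>
    (smoothOffZero_coord a).mul (smoothOffZero_pd hF b)
  rw [e, pd_add (h1 a b) (contDiffOn_const.mul (h1 b a)) hx, pd_const_mul _ (h1 b a) hx,
    pd_mul (smoothOffZero_coord a) (smoothOffZero_pd hF b) hx,
    pd_mul (smoothOffZero_coord b) (smoothOffZero_pd hF a) hx, pd_coord, pd_coord]
  ring

/-- The magnetic tensor harmonics in terms of the solid harmonic of their potential. -/
theorem adjD2_adjD1_magnetic (hF : IsSolidHarmonic ℓ F) {Y : SphereTensor 0}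
    (hY : ∀ x : E3, ‖x‖ = 1 → ∀ I, Y x I = F x) {X : Fin 3 → E3 → ℝ}
    (hX : X = fun i y => y (i + 2) * pd (i + 1) F y - y (i + 1) * pd (i + 2) F y) {x : E3}
    (hx : ‖x‖ = 1) (i j : Fin 3) :
    adjD2 (adjD1 0 Y) x ![i, j] = -(1 / 2) * (pd i (X j) x + pd j (X i) x)
      + (x i * ((ℓ - 1) / 2 * X j x) + x j * ((ℓ - 1) / 2 * X i x)) := by
  have hx0 := ne_zero_of_unit hx
  have hXs : ∀ b, IsSolidHarmonic ℓ (X b) := fun b => by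
    rw [hX]; exact isSolidHarmonic_rotate hF _ _
  have hβ : ∀ y : E3, ‖y‖ = 1 → ∀ I : Fin 1 → Fin 3, adjD1 0 Y y I = X (I 0) y := fun y hy I => by
    rw [adjD1, covDeriv_zero hy, hodge]
    simp only [covDeriv_scalar hF.toIsHomogeneousOffZero hY hy, leviCivita_contract, hX,
      Matrix.cons_val_zero]
    ring
  have hcov := covDeriv_one_form (fun b => (hXs b).smooth) hβ hx
    (D := fun i b => pd i (X b) x - x i * (ℓ * X b x)) fun i b => by rw [(hXs b).euler x hx0]
  have hxX : ∀ y : E3, ∑ b, y b * X b y = 0 := fun y => by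
    simp only [hX, Fin.sum_univ_three, Fin.isValue, Fin.reduceAdd, zero_add]
    ring
  have hs : ∀ i, ∑ b, x b * (pd i (X b) x - x i * (ℓ * X b x)) = -X i x := by
    intro i
    have h1 := pd_congr (i := i) (fun y _ => hxX y) hx0
    rw [pd_const, pd_sum _ (fun b => (smoothOffZero_coord b).mul (hXs b).smooth) hx0] at h1
    simp only [pd_mul (smoothOffZero_coord _) (hXs _).smooth hx0, pd_coord, ite_mul, one_mul,
      zero_mul, sum_add_distrib, sum_ite_eq, Finset.mem_univ, if_true] at h1
    have h2 := hxX x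
    simp only [Fin.sum_univ_three] at h1 h2 ⊢
    linear_combination h1 - x i * ℓ * h2
  have htr : ∑ k, covDeriv (adjD1 0 Y) x ![k, k] = 0 := by
    have h1 := hxX x
    have h2 : ∑ k, pd k (X k) x = 0 := by
      simp only [hX, pd_rotate hF.smooth hx0, Fin.sum_univ_three, Fin.isValue, Fin.reduceAdd,
        zero_add, Fin.reduceEq, if_false, pd_pd_comm (i := 1) (j := 0) hF.smooth hx0,
        pd_pd_comm (i := 2) (j := 0) hF.smooth hx0, pd_pd_comm (i := 2) (j := 1) hF.smooth hx0]
      simp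
    simp only [hcov, hs]
    simp only [Fin.sum_univ_three] at h1 h2 ⊢
    linear_combination h2 + (1 - ℓ : ℝ) * h1
  rw [adjD2, stfPart, htr]
  simp only [Matrix.cons_val_zero, Matrix.cons_val_one, hcov, hs]
  ring

end

theorem isStf_adjD2 (β : SphereTensor 1) : IsStf (adjD2 β) := by
  intro x hx
  obtain ⟨W, hW⟩ : ∃ W : Fin 3 → Fin 3 → ℝ, ∀ i j, covDeriv β x ![i, j]
      = ∑ a, tangentProj x i a * ∑ b, tangentProj x j b * W a b := by
    refine ⟨fun a b => fderiv ℝ (fun y : E3 => β (‖y‖⁻¹ • y) (Fin.tail ![a, b])) x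
      (EuclideanSpace.single a 1), fun i j => ?_⟩
    rw [covDeriv, sum_fin_two_pi]
    simp [Fin.prod_univ_two, mul_sum, mul_assoc]
  have hc : ∀ G : Fin 3 → ℝ, ∑ i, x i * ∑ a, tangentProj x i a * G a = 0 := fun G => by
    simp only [sum_tangentProj_mul, mul_sub, sum_sub_distrib, ← mul_assoc, ← sum_mul,
      sum_sq_eq_one hx, one_mul, sub_self]
  have h1 : ∀ j, ∑ i, x i * covDeriv β x ![i, j] = 0 := fun j => by
    simp only [hW, hc]
  have h2 : ∀ i, ∑ j, x j * covDeriv β x ![i, j] = 0 := fun i => by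
    simp only [hW]
    calc _ = ∑ a, tangentProj x i a * ∑ j, x j * ∑ b, tangentProj x j b * W a b := by
          refine (sum_congr rfl fun j _ => mul_sum _ _ _).trans
            (Finset.sum_comm.trans (sum_congr rfl fun a _ => ?_))
          rw [mul_sum]
          exact sum_congr rfl fun _ _ => by ring
      _ = 0 := by simp only [hc, mul_zero, Finset.sum_const_zero]
  have h3 : ∑ i, tangentProj x i i = 2 := by
    have := sum_sq_eq_one hx
    simp only [tangentProj, if_true, sum_sub_distrib, this]
    norm_num
  refine ⟨fun i j => ?_, fun j => ?_, ?_⟩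
  · simp only [adjD2, stfPart, Matrix.cons_val_zero, Matrix.cons_val_one, tangentProj_comm x j i]
    ring
  · have h4 := h1 j
    have h5 := h2 j
    have h6 := tangentProj_mul_self hx j
    simp only [adjD2, stfPart, Matrix.cons_val_zero, Matrix.cons_val_one, tangentProj_comm x _ j]
    generalize ∑ i, covDeriv β x ![i, i] = t
    simp only [Fin.sum_univ_three] at h4 h5 h6 ⊢
    linear_combination -(1 / 2) * h4 - (1 / 2) * h5 + t / 2 * h6
  · simp only [adjD2, stfPart, Matrix.cons_val_zero, Matrix.cons_val_one]
    simp only [Fin.sum_univ_three] at h3 ⊢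
    linear_combination (covDeriv β x ![0, 0] + covDeriv β x ![1, 1] + covDeriv β x ![2, 2]) / 2 * h3

/-- The electric and magnetic tensor harmonics are eigentensors with eigenvalue `4 - ℓ(ℓ+1)`. -/
theorem isTensorHarmonic_harm {ℓ : ℕ} {m : ℤ} (hm : m.natAbs ≤ ℓ) :
    IsTensorHarmonic (2 - (ℓ : ℝ) * (ℓ + 1)) (harmE ℓ m) ∧
    IsTensorHarmonic (2 - (ℓ : ℝ) * (ℓ + 1)) (harmH ℓ m) := by
  obtain ⟨F, hF, hY⟩ := exists_isSolidHarmonic_realSphHarm hm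
  refine ⟨.smul _ ?_, .smul _ ?_⟩
  · refine .of_isSolidHarmonic (U := fun a b => pd a (pd b F)) (fun a b => (hF.pd b).pd a)
      (fun a => (hF.pd a).const_mul _) (hF.const_mul _)
      (fun x hx a b => adjD2_adjD1_electric hF hY hx a b) (fun x hx a b => ?_)
      (fun x hx => rfl) (isStf_adjD2 _)
    have hx0 := ne_zero_of_unit hx
    rw [pd_const_mul _ (hF.pd b).smooth hx0, pd_const_mul _ (hF.pd a).smooth hx0,
      pd_pd_comm (i := b) hF.smooth hx0]
    ring
  · have hX := fun a => isSolidHarmonic_rotate hF (a + 2) (a + 1)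
    refine .of_isSolidHarmonic (B := fun _ => 0) (dB := 0) (dU := ℓ - 1) (dV := ℓ)
      (fun a b => (((hX b).pd a).add ((hX a).pd b)).const_mul _)
      (fun a => (hX a).const_mul _) ⟨.const 0, fun y _ => flatLaplacian_zero y⟩
      (fun x hx a b => (adjD2_adjD1_magnetic hF hY rfl hx a b).trans (by rw [mul_zero, add_zero]))
      (fun x hx a b => ?_) (fun x hx => by simp) (isStf_adjD2 _)
    have hx0 := ne_zero_of_unit hx
    rw [pd_const_mul _ (hX b).smooth hx0, pd_const_mul _ (hX a).smooth hx0]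
    ring

/-! ### Self-adjointness of the Laplacian of the sphere -/

instance : IsFiniteMeasure sphereMeasure :=
  inferInstanceAs (IsFiniteMeasure (volume : Measure E3).toSphere)

instance : sphereMeasure.IsOpenPosMeasure :=
  inferInstanceAs ((volume : Measure E3).toSphere.IsOpenPosMeasure)

theorem norm_coe_sphere (x : Metric.sphere (0 : E3) 1) : ‖(x : E3)‖ = 1 := by
  simp

theorem SmoothOffZero.continuous_sphere {f : E3 → ℝ} (hf : SmoothOffZero f) :
    Continuous fun x : Metric.sphere (0 : E3) 1 => f x :=
  hf.continuousOn.comp_continuous continuous_subtype_val fun x =>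
    ne_zero_of_unit (norm_coe_sphere x)

theorem integrable_sphere {f : Metric.sphere (0 : E3) 1 → ℝ} (hf : Continuous f) :
    Integrable f sphereMeasure :=
  hf.integrable_of_hasCompactSupport (HasCompactSupport.of_compactSpace f)

theorem isHomogeneousOffZero_comp_normalize {f : E3 → ℝ}
    (hf : SmoothOffZero fun y => f (normalize y)) :
    IsHomogeneousOffZero 0 fun y => f (normalize y) where
  smooth := hf
  euler y hy := by
    rw [zero_mul, ← fderiv_comp_normalize_self (T := f)
      (hf.differentiableAt hy)]
    conv_rhs => rw [← sum_smul_coordVec y, map_sum]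
    simp [sum_smul_coordVec, pd, normalize]

/-- A radial cutoff function, supported in `[3/2, 5/2]`. -/
noncomputable def cutoff : ContDiffBump (2 : ℝ) := ⟨1 / 4, 1 / 2, by norm_num, by norm_num⟩

theorem cutoff_eq_zero {r : ℝ} (hr : 1 / 2 ≤ |r - 2|) : cutoff r = 0 :=
  cutoff.zero_of_le_dist (by rw [Real.dist_eq]; exact hr)

section

variable {f g : E3 → ℝ}

theorem contDiff_cutoff_mul (hg : SmoothOffZero g) :
    ContDiff ℝ ∞ fun y : E3 => cutoff ‖y‖ * g y := by
  rw [contDiff_iff_contDiffAt]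
  intro y
  by_cases hy : y = 0
  · have : (fun y : E3 => cutoff ‖y‖ * g y) =ᶠ[𝓝 y] fun _ => 0 := by
      rw [hy]
      filter_upwards [Metric.ball_mem_nhds (0 : E3) one_pos] with z hz
      rw [mem_ball_zero_iff] at hz
      rw [cutoff_eq_zero, zero_mul]
      rw [abs_of_nonpos (by linarith)]
      linarith
    exact contDiffAt_const.congr_of_eventuallyEq this
  · exact (cutoff.contDiffAt.comp y (contDiffAt_norm ℝ hy)).mul (hg.contDiffAt hy)

theorem hasCompactSupport_cutoff_mul (g : E3 → ℝ) :
    HasCompactSupport fun y : E3 => cutoff ‖y‖ * g y := by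
  refine HasCompactSupport.intro (isCompact_closedBall (0 : E3) 3) fun y hy => ?_
  rw [mem_closedBall_zero_iff, not_le] at hy
  rw [cutoff_eq_zero, zero_mul]
  rw [abs_of_nonneg (by linarith)]
  linarith

theorem integrable_pd_cutoff_mul (hg : SmoothOffZero g) (i : Fin 3) :
    Integrable (pd i fun y => cutoff ‖y‖ * g y) := by
  refine Continuous.integrable_of_hasCompactSupport ?_ ?_
  · exact ((contDiff_cutoff_mul hg).continuous_fderiv (by simp)).clm_apply continuous_const
  · exact (hasCompactSupport_cutoff_mul g).fderiv_apply ℝ (coordVec i)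

theorem integral_pd_cutoff_mul (hg : SmoothOffZero g) (i : Fin 3) :
    ∫ y, pd i (fun y => cutoff ‖y‖ * g y) y = 0 := by
  have h := integral_mul_fderiv_eq_neg_fderiv_mul_of_integrable (μ := (volume : Measure E3))
    (f := fun _ : E3 => (1 : ℝ)) (g := fun y : E3 => cutoff ‖y‖ * g y) (v := coordVec i)
    (by simp) (by simp only [one_mul]; exact integrable_pd_cutoff_mul hg i)
    (by
      simp only [one_mul]
      exact (contDiff_cutoff_mul hg).continuous.integrable_of_hasCompactSupport
        (hasCompactSupport_cutoff_mul g)) (fun _ _ => differentiableAt_const _)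
    (fun y _ => (contDiff_cutoff_mul hg).differentiable (by simp) y)
  simpa [pd] using h

theorem pd_cutoff {y : E3} (hy : y ≠ 0) (i : Fin 3) :
    pd i (fun y => cutoff ‖y‖) y = deriv cutoff ‖y‖ * (‖y‖⁻¹ * y i) := by
  have h1 : HasDerivAt cutoff (deriv cutoff ‖y‖) ‖y‖ :=
    ((cutoff.contDiff (n := 1)).differentiable (by simp) _).hasDerivAt
  have h2 : HasFDerivAt (fun y : E3 => cutoff ‖y‖) _ y :=
    h1.comp_hasFDerivAt y (smoothOffZero_norm.differentiableAt hy).hasFDerivAt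
  rw [← pd_norm hy, pd, h2.fderiv]
  rfl

/-- Integration in polar coordinates. -/
theorem integral_radial_mul (φ : ℝ → ℝ) (h : E3 → ℝ) :
    ∫ y : E3, φ ‖y‖ * h (normalize y) ∂volume = (∫ x : Metric.sphere (0 : E3) 1, h x ∂sphereMeasure)
      * ∫ r : Ioi (0 : ℝ), φ (r : ℝ) ∂Measure.volumeIoiPow (Module.finrank ℝ E3 - 1) := by
  calc _ = ∫ y : ({0}ᶜ : Set E3), φ ‖y.1‖ * h (normalize y.1) 
        ∂((volume : Measure E3).comap (Subtype.val : ({0}ᶜ : Set E3) → E3)) := by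
        rw [integral_subtype_comap (measurableSet_singleton _).compl
          fun y : E3 => φ ‖y‖ * h (normalize y), restrict_compl_singleton]
    _ = ∫ z, h z.1 * φ z.2 ∂(volume : Measure E3).toSphere.prod
          (Measure.volumeIoiPow (Module.finrank ℝ E3 - 1)) := by
        have := (volume : Measure E3).measurePreserving_homeomorphUnitSphereProd.integral_comp
          (Homeomorph.measurableEmbedding _)
          (fun z : Metric.sphere (0 : E3) 1 × Ioi (0 : ℝ) => h z.1 * φ z.2)
        rw [← this]
        refine integral_congr_ae (ae_of_all _ fun y => ?_)
        simp [normalize, mul_comm]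
    _ = _ := integral_prod_mul (fun x : Metric.sphere (0 : E3) 1 => h x)
      (fun r : Ioi (0 : ℝ) => φ r)

theorem flatLaplacian_normalize (hf : SmoothOffZero fun y => f (normalize y)) {y : E3} (hy : y ≠ 0) :
    flatLaplacian (fun y => f (normalize y)) y
      = ‖y‖⁻¹ ^ 2 * flatLaplacian (fun y => f (normalize y)) (normalize y) := by
  have hF := isHomogeneousOffZero_comp_normalize hf
  have hn : ∀ y : E3, y ≠ 0 → normalize (normalize y) = normalize y := fun y hy =>
    normalize_of_unit (norm_normalize hy)
  set F : E3 → ℝ := fun y => f (normalize y) with hFdef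
  have h1 : ∀ k, ∀ y : E3, y ≠ 0 → pd k F y = ‖y‖⁻¹ * pd k F (normalize y) := fun k y hy => by
    have := hF.pd_comp_normalize k hy
    rw [zero_mul, sub_zero] at this
    rw [← this]
    exact pd_congr (fun z hz => by rw [hFdef]; simp only [hn z hz]) hy
  simp only [flatLaplacian, mul_sum]
  refine sum_congr rfl fun k _ => ?_
  rw [pd_congr (h1 k) hy, pd_mul smoothOffZero_norm_inv
    (smoothOffZero_comp_normalize (smoothOffZero_pd hF.smooth k)) hy, pd_norm_inv hy,
    (hF.pd k).pd_comp_normalize k hy, normalize_apply]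
  ring

/-- The Laplacian of the sphere is symmetric, on the extensions of degree zero of functions on the
sphere.  This is Green's formula in a spherical shell. -/
theorem integral_mul_flatLaplacian_comm (hf : SmoothOffZero fun y => f (normalize y))
    (hg : SmoothOffZero fun y => g (normalize y)) :
    ∫ x : Metric.sphere (0 : E3) 1, f x * flatLaplacian (fun y => g (normalize y)) x ∂sphereMeasure
      = ∫ x : Metric.sphere (0 : E3) 1, g x * flatLaplacian (fun y => f (normalize y)) x
        ∂sphereMeasure := by
  have hF := isHomogeneousOffZero_comp_normalize hf
  have hG := isHomogeneousOffZero_comp_normalize hg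
  have slap : ∀ {h : E3 → ℝ}, SmoothOffZero h → SmoothOffZero (flatLaplacian h) := fun hh =>
    ContDiffOn.sum fun i _ => smoothOffZero_pd (smoothOffZero_pd hh i) i
  set F : E3 → ℝ := fun y => f (normalize y) with hFdef
  set G : E3 → ℝ := fun y => g (normalize y) with hGdef
  set w : Fin 3 → E3 → ℝ := fun i y => F y * pd i G y + (-1) * (G y * pd i F y) with hw
  have hfg : ∀ i, SmoothOffZero fun y => F y * pd i G y := fun i => hF.smooth.mul (hG.pd i).smooth
  have hgf : ∀ i, SmoothOffZero fun y => G y * pd i F y := fun i => hG.smooth.mul (hF.pd i).smooth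
  have hws : ∀ i, SmoothOffZero (w i) := fun i => (hfg i).add (contDiffOn_const.mul (hgf i))
  have hdiv : ∀ y : E3, y ≠ 0 → ∑ i, pd i (fun y => cutoff ‖y‖ * w i y) y
      = cutoff ‖y‖ * (F y * flatLaplacian G y - G y * flatLaplacian F y) := by
    intro y hy
    have hc : SmoothOffZero fun y => cutoff ‖y‖ := by
      simpa using (contDiff_cutoff_mul (g := fun _ => 1) contDiffOn_const).contDiffOn
        (s := ({0}ᶜ : Set E3))
    have h1 := hF.euler y hy
    have h2 := hG.euler y hy
    have h3 : ∀ i, pd i (w i) y = F y * pd i (pd i G) y - G y * pd i (pd i F) y := fun i => by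
      rw [pd_add (hfg i) (contDiffOn_const.mul (hgf i)) hy, pd_const_mul _ (hgf i) hy,
        pd_mul hF.smooth (hG.pd i).smooth hy, pd_mul hG.smooth (hF.pd i).smooth hy]
      ring
    simp only [pd_mul hc (hws _) hy, pd_cutoff hy, h3, flatLaplacian]
    simp only [hw, Fin.sum_univ_three] at h1 h2 ⊢
    linear_combination deriv cutoff ‖y‖ * ‖y‖⁻¹ * (F y * h2 - G y * h1)
  have hint : ∫ y : E3, cutoff ‖y‖ * (F y * flatLaplacian G y - G y * flatLaplacian F y) = 0 := by
    rw [← integral_congr_ae (f := fun y => ∑ i, pd i (fun y => cutoff ‖y‖ * w i y) y)]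
    · rw [integral_finsetSum _ fun i _ => integrable_pd_cutoff_mul (hws i) i]
      exact sum_eq_zero fun i _ => integral_pd_cutoff_mul (hws i) i
    · filter_upwards [compl_mem_ae_iff.2 (measure_singleton (0 : E3))] with y hy using hdiv y hy
  set φ : ℝ → ℝ := fun r => cutoff r * r⁻¹ ^ 2 with hφ
  have hpolar : ∀ h : E3 → ℝ, (∀ y : E3, y ≠ 0 → h y = ‖y‖⁻¹ ^ 2 * h (normalize y)) →
      ∫ y : E3, cutoff ‖y‖ * h y = (∫ x : Metric.sphere (0 : E3) 1, h x ∂sphereMeasure)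
        * ∫ r : Ioi (0 : ℝ), φ (r : ℝ) ∂Measure.volumeIoiPow (Module.finrank ℝ E3 - 1) := fun h hh => by
    rw [← integral_radial_mul φ h]
    refine integral_congr_ae ?_
    filter_upwards [compl_mem_ae_iff.2 (measure_singleton (0 : E3))] with y hy
    rw [hh y hy, hφ]
    ring
  have hpos : ∫ r : Ioi (0 : ℝ), φ (r : ℝ) ∂Measure.volumeIoiPow (Module.finrank ℝ E3 - 1) ≠ 0 := by
    intro h0
    have h1 := hpolar (fun y => ‖y‖⁻¹ ^ 2) fun y hy => by rw [norm_normalize hy]; ring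
    rw [h0, mul_zero] at h1
    refine (Continuous.integral_pos_of_hasCompactSupport_nonneg_nonzero
      (contDiff_cutoff_mul (smoothOffZero_norm_inv.pow 2)).continuous
      (hasCompactSupport_cutoff_mul _) (x := (2 : ℝ) • coordVec 0) (fun y => ?_) ?_).ne' h1
    · exact mul_nonneg cutoff.nonneg (by positivity)
    · have h2 : ‖(2 : ℝ) • coordVec 0‖ = 2 := by simp [norm_smul]
      rw [h2, cutoff.one_of_mem_closedBall (by simp [cutoff])]
      norm_num
  have hn : ∀ y : E3, y ≠ 0 → normalize (normalize y) = normalize y := fun y hy =>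
    normalize_of_unit (norm_normalize hy)
  rw [hpolar _ fun y hy => by
    rw [hFdef, hGdef, flatLaplacian_normalize hg hy, flatLaplacian_normalize hf hy]
    simp only [hn y hy]
    ring] at hint
  have key := (mul_eq_zero.1 hint).resolve_right hpos
  have c1 := SmoothOffZero.continuous_sphere (hF.smooth.mul (slap hG.smooth))
  have c2 := SmoothOffZero.continuous_sphere (hG.smooth.mul (slap hF.smooth))
  rw [integral_sub (integrable_sphere c1) (integrable_sphere c2), sub_eq_zero] at key
  simpa only [hFdef, hGdef, normalize_of_unit (norm_coe_sphere _)] using key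

end

/-- Smooth tensor fields on the unit sphere. -/
abbrev IsSmoothTensor (T : SphereTensor 2) : Prop := ∀ I, SmoothOffZero fun y => T (normalize y) I

theorem IsSmoothTensor.continuous {T : SphereTensor 2} (hT : IsSmoothTensor T)
    (I : Fin 2 → Fin 3) : Continuous fun x : Metric.sphere (0 : E3) 1 => T x I := by
  simpa only [normalize_of_unit (norm_coe_sphere _)] using (hT I).continuous_sphere

theorem l2Inner_comm (S T : SphereTensor 2) : l2Inner S T = l2Inner T S := by
  simp only [l2Inner, mul_comm]

section

variable {S T K L : SphereTensor 2}

theorem l2Inner_eq_sum (hS : IsSmoothTensor S) (hT : IsSmoothTensor T) :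
    l2Inner S T = ∑ I : Fin 2 → Fin 3,
      ∫ x : Metric.sphere (0 : E3) 1, S x I * T x I ∂sphereMeasure :=
  integral_finsetSum _ fun I _ => integrable_sphere ((hS.continuous I).mul (hT.continuous I))

theorem l2Inner_add_right (hS : IsSmoothTensor S) (hK : IsSmoothTensor K) (hL : IsSmoothTensor L) :
    l2Inner S (K + L) = l2Inner S K + l2Inner S L := by
  rw [l2Inner_eq_sum hS hK, l2Inner_eq_sum hS hL,
    l2Inner_eq_sum hS fun I => (hK I).add (hL I), ← sum_add_distrib]
  refine sum_congr rfl fun I _ => ?_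
  simp only [Pi.add_apply, mul_add]
  exact integral_add (integrable_sphere ((hS.continuous I).mul (hK.continuous I)))
    (integrable_sphere ((hS.continuous I).mul (hL.continuous I)))

theorem l2Inner_smul_right (c : ℝ) (S K : SphereTensor 2) :
    l2Inner S (c • K) = c * l2Inner S K := by
  simp only [l2Inner, Pi.smul_apply, smul_eq_mul, mul_left_comm _ c, ← mul_sum,
    integral_const_mul]

theorem l2Inner_congr_left (h : ∀ x : E3, ‖x‖ = 1 → ∀ I, S x I = T x I) (K : SphereTensor 2) :
    l2Inner S K = l2Inner T K := by
  simp only [l2Inner, h _ (norm_coe_sphere _)]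

theorem l2Inner_sum_right {ι : Type*} (s : Finset ι) {F : ι → SphereTensor 2}
    (hS : IsSmoothTensor S) (hF : ∀ i ∈ s, IsSmoothTensor (F i)) :
    l2Inner S (∑ i ∈ s, F i) = ∑ i ∈ s, l2Inner S (F i) := by
  classical
  induction s using Finset.induction_on with
  | empty => simp [l2Inner]
  | insert a s ha ih =>
    have h1 : IsSmoothTensor (∑ i ∈ s, F i) := fun I => by
      simp only [Finset.sum_apply]
      exact ContDiffOn.sum fun i hi => hF i (Finset.mem_insert_of_mem hi) I
    rw [sum_insert ha, sum_insert ha,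
      l2Inner_add_right hS (hF a (Finset.mem_insert_self a s)) h1,
      ih fun i hi => hF i (Finset.mem_insert_of_mem hi)]

theorem sum_sq_nonneg' (x : E3) : 0 ≤ ∑ I, S x I * S x I :=
  Finset.sum_nonneg fun _ _ => mul_self_nonneg _

theorem l2Inner_self_nonneg : 0 ≤ l2Inner S S :=
  integral_nonneg fun x => sum_sq_nonneg' (S := S) x

theorem l2Inner_self_pos (hS : IsSmoothTensor S) {x : E3} (hx : ‖x‖ = 1) {I : Fin 2 → Fin 3}
    (h : S x I ≠ 0) : 0 < l2Inner S S := by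
  have hc : Continuous fun x : Metric.sphere (0 : E3) 1 => ∑ I, S x I * S x I :=
    continuous_finsetSum _ fun I _ => (hS.continuous I).mul (hS.continuous I)
  refine hc.integral_pos_of_hasCompactSupport_nonneg_nonzero
    (x := ⟨x, by simpa using hx⟩) (HasCompactSupport.of_compactSpace _)
    (fun x => sum_sq_nonneg' (S := S) x) (ne_of_gt ?_)
  exact (mul_self_pos.2 h).trans_le (Finset.single_le_sum (f := fun I => S x I * S x I)
    (fun _ _ => mul_self_nonneg _) (Finset.mem_univ I))

/-- The Cauchy–Schwarz inequality. -/
theorem l2Inner_sq_le (hS : IsSmoothTensor S) (hK : IsSmoothTensor K) :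
    l2Inner S K ^ 2 ≤ l2Inner S S * l2Inner K K := by
  have h : ∀ t : ℝ, 0 ≤ l2Inner S S * (t * t) + 2 * l2Inner S K * t + l2Inner K K := by
    intro t
    have h1 : IsSmoothTensor (t • S) := fun I => contDiffOn_const.mul (hS I)
    have h2 : IsSmoothTensor (t • S + K) := fun I => (h1 I).add (hK I)
    have h3 := l2Inner_self_nonneg (S := t • S + K)
    rw [l2Inner_add_right h2 h1 hK, l2Inner_comm _ (t • S), l2Inner_comm _ K,
      l2Inner_add_right h1 h1 hK, l2Inner_add_right hK h1 hK, l2Inner_comm (t • S) K,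
      l2Inner_smul_right, l2Inner_smul_right, l2Inner_comm (t • S) S, l2Inner_smul_right,
      l2Inner_comm K S] at h3
    linarith
  have := discrim_le_zero h
  rw [discrim] at this
  linarith

end

/-- Projecting to the tangent space does not affect the product with a tangential tensor. -/
theorem sum_tangentProj_contract {K : SphereTensor 2} (hK : IsStf K) {x : E3} (hx : ‖x‖ = 1)
    (B : Fin 3 → Fin 3 → ℝ) : ∑ I : Fin 2 → Fin 3, (∑ c, tangentProj x (I 0) c
      * ∑ d, tangentProj x (I 1) d * B c d) * K x I = ∑ a, ∑ b, K x ![a, b] * B a b := by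
  obtain ⟨h1, h2, -⟩ := hK x hx
  have h3 : ∀ i, ∑ j, x j * K x ![i, j] = 0 := fun i => by simpa only [h1 _ i] using h2 i
  simp only [sum_fin_two_pi, Matrix.cons_val_zero, Matrix.cons_val_one, sum_tangentProj_mul]
  have e0 := h2 0
  have e1 := h2 1
  have e2 := h2 2
  have f0 := h3 0
  have f1 := h3 1
  have f2 := h3 2
  simp only [Fin.sum_univ_three] at *
  linear_combination (-(x 0 * B 0 0 + x 1 * B 1 0 + x 2 * B 2 0)
      + x 0 * (x 0 * (x 0 * B 0 0 + x 1 * B 0 1 + x 2 * B 0 2)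
      + x 1 * (x 0 * B 1 0 + x 1 * B 1 1 + x 2 * B 1 2)
      + x 2 * (x 0 * B 2 0 + x 1 * B 2 1 + x 2 * B 2 2))) * e0
    + (-(x 0 * B 0 1 + x 1 * B 1 1 + x 2 * B 2 1)
      + x 1 * (x 0 * (x 0 * B 0 0 + x 1 * B 0 1 + x 2 * B 0 2)
      + x 1 * (x 0 * B 1 0 + x 1 * B 1 1 + x 2 * B 1 2)
      + x 2 * (x 0 * B 2 0 + x 1 * B 2 1 + x 2 * B 2 2))) * e1
    + (-(x 0 * B 0 2 + x 1 * B 1 2 + x 2 * B 2 2)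
      + x 2 * (x 0 * (x 0 * B 0 0 + x 1 * B 0 1 + x 2 * B 0 2)
      + x 1 * (x 0 * B 1 0 + x 1 * B 1 1 + x 2 * B 1 2)
      + x 2 * (x 0 * B 2 0 + x 1 * B 2 1 + x 2 * B 2 2))) * e2
    - (x 0 * B 0 0 + x 1 * B 0 1 + x 2 * B 0 2) * f0
    - (x 0 * B 1 0 + x 1 * B 1 1 + x 2 * B 1 2) * f1
    - (x 0 * B 2 0 + x 1 * B 2 1 + x 2 * B 2 2) * f2

/-- The Laplacian on stf 2-tensors, in terms of the Laplacian of the components of the extension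
which is homogeneous of degree zero. -/
theorem sphereLaplacian_eq_of_isStf {T : SphereTensor 2} (hT : IsSmoothTensor T) (hs : IsStf T)
    {x : E3} (hx : ‖x‖ = 1) (I : Fin 2 → Fin 3) :
    sphereLaplacian T x I = (∑ c, tangentProj x (I 0) c * ∑ d, tangentProj x (I 1) d
      * flatLaplacian (fun y => T (normalize y) ![c, d]) x) + 2 * T x I := by
  set g : Fin 3 → Fin 3 → E3 → ℝ := fun a b y => T (normalize y) ![a, b] with hg
  have hx0 := ne_zero_of_unit hx
  have sg : ∀ a b, SmoothOffZero (g a b) := fun a b => hT _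
  have hom : ∀ a b, IsHomogeneousOffZero 0 (g a b) := fun a b =>
    isHomogeneousOffZero_comp_normalize (f := fun y => T y ![a, b]) (hT _)
  have g_unit : ∀ a b, ∀ y : E3, ‖y‖ = 1 → g a b y = T y ![a, b] := fun a b y hy => by
    simp only [hg, normalize_of_unit hy]
  have symm : ∀ a b, ∀ y : E3, y ≠ 0 → g a b y = g b a y := fun a b y hy =>
    (hs _ (norm_normalize hy)).1 a b
  have tang : ∀ b, ∀ y : E3, y ≠ 0 → ∑ a, y a * g a b y = 0 := fun b y hy => by
    have h1 := (hs _ (norm_normalize hy)).2.1 b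
    simp only [normalize_apply, mul_assoc, ← mul_sum] at h1
    exact (mul_eq_zero.1 h1).resolve_left (inv_ne_zero (norm_ne_zero_iff.2 hy))
  have tang' : ∀ a, ∀ y : E3, y ≠ 0 → ∑ b, y b * g a b y = 0 := fun a y hy => by
    simpa only [symm a _ y hy] using tang a y hy
  have dtang : ∀ b k, ∀ y : E3, y ≠ 0 → ∑ a, y a * pd k (g a b) y = -g k b y := fun b k y hy => by
    have h1 := pd_congr (i := k) (tang b) hy
    rw [pd_sum _ (fun a => (smoothOffZero_coord a).mul (sg a b)) hy, pd_const] at h1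
    simp only [pd_mul (smoothOffZero_coord _) (sg _ b) hy, pd_coord, ite_mul, one_mul, zero_mul,
      sum_add_distrib, sum_ite_eq, Finset.mem_univ, if_true] at h1
    linarith
  have dtang' : ∀ a k, ∀ y : E3, y ≠ 0 → ∑ b, y b * pd k (g a b) y = -g a k y := fun a k y hy => by
    rw [symm a k y hy, ← dtang a k y hy]
    exact sum_congr rfl fun b _ => by rw [pd_congr (symm a b) hy]
  have euler : ∀ a b, ∀ y : E3, y ≠ 0 → ∑ k, y k * pd k (g a b) y = 0 := fun a b y hy => by
    simpa using (hom a b).euler y hy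
  have fderiv_tang : ∀ (f : E3 → ℝ) (y : E3) (k : Fin 3), fderiv ℝ f y (tangentVec y k)
      = pd k f y - y k * ∑ j, y j * pd j f y := fun f y k => by
    rw [fderiv_tangentVec, sum_tangentProj_mul]; rfl
  -- the first covariant derivative
  set h : (Fin 3 → Fin 3) → E3 → ℝ := fun J y => pd (J 0) (g (J 1) (J 2)) y
    + (y (J 1) * g (J 0) (J 2) y + y (J 2) * g (J 1) (J 0) y) with hh
  have first : ∀ J, ∀ y : E3, ‖y‖ = 1 → covDeriv T y J = h J y := by
    intro J y hy
    have hy0 := ne_zero_of_unit hy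
    rw [covDeriv_eq (g := fun J y => g (J 0) (J 1) y) hy
      (fun J z hz => by rw [g_unit _ _ z hz, eta_fin_two]) (fun J => (sg _ _).differentiableAt hy0),
      sum_fin_two_pi]
    have e1 : ∀ c d, (∏ a : Fin 2, tangentProj y (J a.succ) (![c, d] a))
        * fderiv ℝ (fun y => g (![c, d] 0) (![c, d] 1) y) y (tangentVec y (J 0))
        = tangentProj y (J 1) c * (tangentProj y (J 2) d * pd (J 0) (g c d) y) := by
      intro c d
      rw [fderiv_tang, Fin.prod_univ_two, mul_assoc]
      change tangentProj y (J 1) c * (tangentProj y (J 2) d * (pd (J 0) (g c d) y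
        - y (J 0) * ∑ j, y j * pd j (g c d) y)) = _
      rw [euler c d y hy0, mul_zero, sub_zero]
    have e3 : ∑ c, y c * (y (J 2) * -g c (J 0) y) = 0 := by
      simp only [mul_neg, mul_left_comm _ (y (J 2)), Finset.sum_neg_distrib, ← mul_sum,
        tang _ y hy0, mul_zero, neg_zero]
    simp only [e1, ← mul_sum, sum_tangentProj_mul, dtang' _ _ y hy0, mul_sub,
      sum_sub_distrib, dtang _ _ y hy0, e3, hh]
    ring
  have s1 : ∀ a b c, SmoothOffZero fun y => y c * g a b y := fun a b c =>
    (smoothOffZero_coord c).mul (sg a b)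
  have spd : ∀ a b c, SmoothOffZero (pd c (g a b)) := fun a b c => smoothOffZero_pd (sg a b) c
  have hdiff : ∀ J, DifferentiableAt ℝ (h J) x := fun J => SmoothOffZero.differentiableAt
    ((spd _ _ _).add ((s1 _ _ _).add (s1 _ _ _))) hx0
  have hpd : ∀ k c d j, pd j (h ![k, c, d]) x = pd j (pd k (g c d)) x
      + ((if j = c then 1 else 0) * g k d x + x c * pd j (g k d) x
        + ((if j = d then 1 else 0) * g c k x + x d * pd j (g c k) x)) := by
    intro k c d j
    refine (pd_add (spd c d k) ((s1 k d c).add (s1 c k d)) hx0).trans ?_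
    rw [pd_add (s1 k d c) (s1 c k d) hx0, pd_mul (smoothOffZero_coord c) (sg k d) hx0,
      pd_mul (smoothOffZero_coord d) (sg c k) hx0, pd_coord, pd_coord]
  have e1 : ∀ i, covDeriv (covDeriv T) x (Fin.cons i (Fin.cons i I))
      = ∑ k, tangentProj x i k * (∑ c, tangentProj x (I 0) c • ∑ d, tangentProj x (I 1) d •
        fderiv ℝ (h ![k, c, d]) x) (tangentVec x i) := by
    intro i
    rw [covDeriv_eq hx first hdiff, sum_fin_three_pi]
    simp only [sum_apply, smul_apply, smul_eq_mul, mul_sum]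
    refine sum_congr rfl fun k _ => sum_congr rfl fun c _ => sum_congr rfl fun d _ => ?_
    rw [Fin.prod_univ_three, mul_assoc, mul_assoc]
    rfl
  -- the trace over the two derivative indices
  have e2 : ∀ (L : Fin 3 → E3 →L[ℝ] ℝ), ∑ i, ∑ k, tangentProj x i k * L k (tangentVec x i)
      = ∑ k, L k (tangentVec x k) := by
    intro L
    rw [sum_comm]
    refine sum_congr rfl fun k _ => ?_
    have h1 : ∑ i, tangentProj x i k • tangentVec x i = tangentVec x k := by
      have h2 : ∀ i, tangentProj x i k • tangentVec x i
          = tangentProj x k i • coordVec i - (tangentProj x k i * x i) • x := fun i => by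
        rw [tangentVec, smul_sub, smul_smul, tangentProj_comm]
      simp only [h2, sum_sub_distrib, ← sum_smul]
      rw [sum_tangentProj_smul, tangentProj_mul_self hx, zero_smul, sub_zero]
    rw [← h1, map_sum]
    simp
  rw [sphereLaplacian, sum_congr rfl fun i _ => e1 i, e2 fun k => ∑ c, tangentProj x (I 0) c •
    ∑ d, tangentProj x (I 1) d • fderiv ℝ (h ![k, c, d]) x]
  have e4 : ∀ c d, ∑ k, fderiv ℝ (h ![k, c, d]) x (tangentVec x k) = flatLaplacian (g c d) x
      + (2 * T x ![c, d] + (x c * (∑ k, pd k (g k d) x) + x d * ∑ k, pd k (g c k) x)) := by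
    intro c d
    have r : ∀ k, ∑ j, x j * pd j (h ![k, c, d]) x
        = -pd k (g c d) x + x c * g k d x + x d * g c k x := fun k => by
      have h1 := ((hom c d).pd k).euler x hx0
      simp only [hpd, mul_add, sum_add_distrib, h1, mul_left_comm (x _) (x _), ← mul_sum,
        euler _ _ x hx0]
      simp
      ring
    have r0 : ∑ k, x k * (-pd k (g c d) x + x c * g k d x + x d * g c k x) = 0 := by
      simp only [mul_add, mul_neg, sum_add_distrib, Finset.sum_neg_distrib, mul_left_comm (x _) (x _),
        ← mul_sum, euler _ _ x hx0, tang _ x hx0, tang' _ x hx0]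
      ring
    simp only [fderiv_tang, r, sum_sub_distrib, r0]
    simp only [hpd, sum_add_distrib, ← mul_sum, ite_mul, one_mul, zero_mul, Finset.sum_ite_eq',
      Finset.mem_univ, if_true, ← g_unit c d x hx]
    rw [flatLaplacian]
    ring
  have e5 : ∑ k, (∑ c, tangentProj x (I 0) c • ∑ d, tangentProj x (I 1) d •
      fderiv ℝ (h ![k, c, d]) x) (tangentVec x k) = ∑ c, tangentProj x (I 0) c *
      ∑ d, tangentProj x (I 1) d * ∑ k, fderiv ℝ (h ![k, c, d]) x (tangentVec x k) := by
    simp only [sum_apply, smul_apply, smul_eq_mul, mul_sum]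
    rw [sum_comm]
    exact sum_congr rfl fun c _ => sum_comm
  -- the normal components are projected away
  have p0 : ∀ q : Fin 3 → ℝ, ∑ c, tangentProj x (I 0) c * ∑ d, tangentProj x (I 1) d
      * (x c * q d) = 0 := fun q => by
    have h1 : ∀ c, tangentProj x (I 0) c * ∑ d, tangentProj x (I 1) d * (x c * q d)
        = tangentProj x (I 0) c * x c * ∑ d, tangentProj x (I 1) d * q d := fun c => by
      simp only [mul_left_comm _ (x c), ← mul_sum]; ring
    simp only [h1, ← sum_mul, tangentProj_mul_self hx, zero_mul]
  have p1 : ∀ q : Fin 3 → ℝ, ∑ c, tangentProj x (I 0) c * ∑ d, tangentProj x (I 1) d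
      * (x d * q c) = 0 := fun q => by
    simp only [← mul_assoc, ← sum_mul, tangentProj_mul_self hx, zero_mul, mul_zero,
      Finset.sum_const_zero]
  have p2 : ∑ c, tangentProj x (I 0) c * ∑ d, tangentProj x (I 1) d * (2 * T x ![c, d])
      = 2 * T x I := by
    simp only [← g_unit _ _ x hx, mul_left_comm _ (2 : ℝ), ← mul_sum, sum_tangentProj_mul,
      tang' _ x hx0, tang _ x hx0, mul_zero, sub_zero]
    rw [g_unit _ _ x hx, eta_fin_two]
  rw [e5]
  simp only [e4, mul_add, sum_add_distrib, p0, p1, p2, add_zero]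
  rfl

section

variable {μ : ℝ} {H T : SphereTensor 2}

/-- Tensor harmonics are eigentensors of the Laplacian. -/
theorem IsTensorHarmonic.sphereLaplacian_eq (hH : IsTensorHarmonic μ H) {x : E3} (hx : ‖x‖ = 1)
    (I : Fin 2 → Fin 3) : sphereLaplacian H x I = (μ + 2) * H x I := by
  obtain ⟨h1, h2, -⟩ := hH.stf x hx
  have h3 : ∀ i, ∑ j, x j * H x ![i, j] = 0 := fun i => by simpa only [h1 _ i] using h2 i
  have hP : ∀ i, ∑ a, x a * tangentProj x i a = 0 := fun i => by
    simpa only [mul_comm] using tangentProj_mul_self hx i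
  have h4 := hH.eigen x hx (fun c d => tangentProj x (I 0) c * tangentProj x (I 1) d)
    (fun b => by simp only [← mul_assoc, ← sum_mul, hP, zero_mul])
    (fun a => by simp only [mul_left_comm (x _), ← mul_sum, hP, mul_zero])
  have h5 : ∑ c, ∑ d, tangentProj x (I 0) c * tangentProj x (I 1) d * H x ![c, d] = H x I := by
    simp only [mul_assoc, ← mul_sum, sum_tangentProj_mul, h3, mul_zero, sub_zero, h2,
      eta_fin_two]
  rw [sphereLaplacian_eq_of_isStf hH.smooth hH.stf hx]
  rw [h5] at h4
  simp only [mul_assoc, ← mul_sum] at h4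
  rw [h4]
  ring

/-- The Laplacian is symmetric, when tested with a tensor harmonic. -/
theorem IsTensorHarmonic.l2Inner_sphereLaplacian (hH : IsTensorHarmonic μ H)
    (hT : IsSmoothTensor T) (hs : IsStf T) :
    l2Inner (sphereLaplacian T) H = (μ + 2) * l2Inner T H := by
  have slap : ∀ {h : E3 → ℝ}, SmoothOffZero h → Continuous fun x : Metric.sphere (0 : E3) 1 =>
      flatLaplacian h x := fun hh => SmoothOffZero.continuous_sphere
    (ContDiffOn.sum fun i _ => smoothOffZero_pd (smoothOffZero_pd hh i) i)
  have hc : ∀ S K : SphereTensor 2, IsSmoothTensor S → IsSmoothTensor K → ∀ a b, Integrable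
      (fun x : Metric.sphere (0 : E3) 1 =>
        S x ![a, b] * flatLaplacian (fun y => K (normalize y) ![a, b]) x) sphereMeasure :=
    fun S K hS hK a b => integrable_sphere ((hS.continuous _).mul (slap (hK _)))
  have hi : ∀ S K : SphereTensor 2, IsSmoothTensor S → IsSmoothTensor K →
      ∫ x : Metric.sphere (0 : E3) 1, ∑ a, ∑ b, S x ![a, b]
        * flatLaplacian (fun y => K (normalize y) ![a, b]) x ∂sphereMeasure
      = ∑ a, ∑ b, ∫ x : Metric.sphere (0 : E3) 1, S x ![a, b]
        * flatLaplacian (fun y => K (normalize y) ![a, b]) x ∂sphereMeasure := fun S K hS hK => by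
    rw [integral_finsetSum _ fun a _ => integrable_finsetSum _ fun b _ => hc S K hS hK a b]
    exact sum_congr rfl fun a _ => integral_finsetSum _ fun b _ => hc S K hS hK a b
  have hTH : Integrable (fun x : Metric.sphere (0 : E3) 1 => ∑ I, T x I * H x I) sphereMeasure :=
    integrable_sphere (continuous_finsetSum _ fun I _ => (hT.continuous I).mul
      (IsSmoothTensor.continuous hH.smooth I))
  have e1 : ∀ x : Metric.sphere (0 : E3) 1, ∑ I, sphereLaplacian T x I * H x I
      = (∑ a, ∑ b, H x ![a, b] * flatLaplacian (fun y => T (normalize y) ![a, b]) x)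
        + 2 * ∑ I, T x I * H x I := fun x => by
    simp only [sphereLaplacian_eq_of_isStf hT hs (norm_coe_sphere x), add_mul,
      sum_add_distrib, mul_assoc (2 : ℝ)]
    rw [sum_tangentProj_contract hH.stf (norm_coe_sphere x) fun c d =>
      flatLaplacian (fun y => T (normalize y) ![c, d]) x, mul_sum]
  have e2 : ∀ x : Metric.sphere (0 : E3) 1, ∑ a, ∑ b, T x ![a, b]
      * flatLaplacian (fun y => H (normalize y) ![a, b]) x = μ * ∑ I, T x I * H x I := fun x => by
    obtain ⟨h1, h2, -⟩ := hs x (norm_coe_sphere x)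
    rw [hH.eigen x (norm_coe_sphere x) (fun a b => T x ![a, b]) h2
      (fun a => by simpa only [h1 _ a] using h2 a), sum_fin_two_pi]
  have e3 : ∫ x : Metric.sphere (0 : E3) 1, ∑ a, ∑ b, H x ![a, b]
      * flatLaplacian (fun y => T (normalize y) ![a, b]) x ∂sphereMeasure = μ * l2Inner T H := by
    rw [hi H T hH.smooth hT, l2Inner, ← integral_const_mul, ← integral_congr_ae
      (ae_of_all _ e2), hi T H hT hH.smooth]
    exact sum_congr rfl fun a _ => sum_congr rfl fun b _ =>
      integral_mul_flatLaplacian_comm (f := fun y => H y ![a, b]) (g := fun y => T y ![a, b])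
        (hH.smooth _) (hT _)
  have hint : Integrable (fun x : Metric.sphere (0 : E3) 1 => ∑ a, ∑ b, H x ![a, b]
      * flatLaplacian (fun y => T (normalize y) ![a, b]) x) sphereMeasure :=
    integrable_finsetSum _ fun a _ => integrable_finsetSum _ fun b _ => hc H T hH.smooth hT a b
  rw [l2Inner, integral_congr_ae (ae_of_all _ e1), integral_add hint (hTH.const_mul 2), e3,
    integral_const_mul]
  change μ * l2Inner T H + 2 * l2Inner T H = _
  ring

end

/-! ### Smooth tensor fields on the spheres of a double null foliation -/

/-- Differentiation under the integral over a compact space, along a closed convex set of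
parameters. -/
theorem hasDerivWithinAt_integral_of_compactSpace {X : Type*} [TopologicalSpace X] [CompactSpace X]
    [SecondCountableTopologyEither X ℝ] [MeasurableSpace X] [OpensMeasurableSpace X]
    {ν : Measure X} [IsFiniteMeasure ν] {J : Set ℝ} (hJ : Convex ℝ J) (hJc : IsClosed J)
    {g g' : ℝ → X → ℝ} (hg : ∀ t ∈ J, ∀ x, HasDerivWithinAt (fun t => g t x) (g' t x) J t)
    (hc : ∀ t ∈ J, Continuous (g t)) (hc' : ContinuousOn (Function.uncurry g') (J ×ˢ univ))
    {t₀ : ℝ} (ht₀ : t₀ ∈ J) :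
    HasDerivWithinAt (fun t => ∫ x, g t x ∂ν) (∫ x, g' t₀ x ∂ν) J t₀ := by
  have hint : ∀ t ∈ J, Integrable (g t) ν := fun t ht =>
    (hc t ht).integrable_of_hasCompactSupport (HasCompactSupport.of_compactSpace _)
  obtain ⟨C, hC⟩ := ((isCompact_Icc (a := t₀ - 1) (b := t₀ + 1)).inter_left hJc |>.prod
    (isCompact_univ (X := X))).exists_bound_of_continuousOn
    (hc'.mono (prod_mono inter_subset_left subset_rfl))
  rw [hasDerivWithinAt_iff_tendsto_slope]
  have hmem : ∀ᶠ t in 𝓝[J \ {t₀}] t₀, t ∈ J ∩ Icc (t₀ - 1) (t₀ + 1) := by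
    filter_upwards [self_mem_nhdsWithin, mem_nhdsWithin_of_mem_nhds
      (Icc_mem_nhds (show t₀ - 1 < t₀ by linarith) (show t₀ < t₀ + 1 by linarith))] with t h1 h2
    exact ⟨h1.1, h2⟩
  have key : Tendsto (fun t => ∫ x, slope (fun t => g t x) t₀ t ∂ν) (𝓝[J \ {t₀}] t₀)
      (𝓝 (∫ x, g' t₀ x ∂ν)) := by
    refine tendsto_integral_filter_of_dominated_convergence (fun _ => C) ?_ ?_
      (integrable_const C) (ae_of_all _ fun x => hasDerivWithinAt_iff_tendsto_slope.1 (hg t₀ ht₀ x))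
    · filter_upwards [hmem] with t ht
      simp only [slope_def_field]
      exact (((hc t ht.1).sub (hc t₀ ht₀)).div_const _).aestronglyMeasurable
    · filter_upwards [hmem] with t ht
      refine ae_of_all _ fun x => ?_
      have h0 : t₀ ∈ J ∩ Icc (t₀ - 1) (t₀ + 1) := ⟨ht₀, by constructor <;> linarith⟩
      have h1 := (hJ.inter (convex_Icc (t₀ - 1) (t₀ + 1))).norm_image_sub_le_of_norm_hasDerivWithin_le
        (f := fun t => g t x) (f' := fun t => g' t x) (C := C)
        (fun s hs => (hg s hs.1 x).mono inter_subset_left)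
        (fun s hs => hC (s, x) ⟨hs, mem_univ x⟩) h0 ht
      rw [slope_def_field, norm_div]
      rcases eq_or_ne t t₀ with rfl | hne
      · simpa using (norm_nonneg _).trans (hC (t, x) ⟨h0, mem_univ x⟩)
      · rwa [div_le_iff₀ (norm_pos_iff.2 (sub_ne_zero.2 hne))]
  refine key.congr' ?_
  filter_upwards [hmem] with t ht
  simp only [slope_def_field]
  rw [integral_div, integral_sub (hint t ht.1) (hint t₀ ht₀)]

/-- Smooth tensor fields on the region `u ≤ u₀`, `v ≥ v₁`. -/
def IsSmoothField (u₀ v₁ : ℝ) (F : Field) : Prop := ∀ I, ContDiffOn ℝ ∞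
  (fun p : ℝ × ℝ × E3 => F p.1 p.2.1 (normalize p.2.2) I) (Iic u₀ ×ˢ Ici v₁ ×ˢ {0}ᶜ)

namespace IsSmoothField

variable {u₀ v₁ u v : ℝ} {F : Field} {K : SphereTensor 2}

theorem uniqueDiffOn_domain (u₀ v₁ : ℝ) :
    UniqueDiffOn ℝ (Iic u₀ ×ˢ Ici v₁ ×ˢ ({0}ᶜ : Set E3)) :=
  (uniqueDiffOn_Iic u₀).prod ((uniqueDiffOn_Ici v₁).prod isOpen_compl_singleton.uniqueDiffOn)

theorem smoothTensor (hF : IsSmoothField u₀ v₁ F) (hu : u ≤ u₀) (hv : v₁ ≤ v) :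
    IsSmoothTensor (F u v) := fun I =>
  (hF I).comp (f := fun y : E3 => (u, v, y)) (by fun_prop) fun _ hy => ⟨hu, hv, hy⟩

theorem hasDerivWithinAt_comp_u {G : ℝ × ℝ × E3 → ℝ}
    (hG : ContDiffOn ℝ ∞ G (Iic u₀ ×ˢ Ici v₁ ×ˢ {0}ᶜ)) (hu : u ≤ u₀) (hv : v₁ ≤ v) {y : E3}
    (hy : y ≠ 0) : HasDerivWithinAt (fun u' => G (u', v, y))
      (fderivWithin ℝ G (Iic u₀ ×ˢ Ici v₁ ×ˢ {0}ᶜ) (u, v, y) (1, 0, 0)) (Iic u₀) u := by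
  have h1 : HasDerivWithinAt (fun u' : ℝ => (u', v, y)) ((1 : ℝ), (0 : ℝ), (0 : E3)) (Iic u₀) u :=
    ((hasDerivAt_id' u).prodMk ((hasDerivAt_const u v).prodMk
      (hasDerivAt_const u y))).hasDerivWithinAt
  exact HasFDerivWithinAt.comp_hasDerivWithinAt (f := fun u' : ℝ => (u', v, y)) u
    ((hG.differentiableOn (by simp)) (u, v, y) ⟨hu, hv, hy⟩).hasFDerivWithinAt h1
    fun u' hu' => ⟨hu', hv, hy⟩

theorem hasDerivWithinAt_comp_v {G : ℝ × ℝ × E3 → ℝ}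
    (hG : ContDiffOn ℝ ∞ G (Iic u₀ ×ˢ Ici v₁ ×ˢ {0}ᶜ)) (hu : u ≤ u₀) (hv : v₁ ≤ v) {y : E3}
    (hy : y ≠ 0) : HasDerivWithinAt (fun v' => G (u, v', y))
      (fderivWithin ℝ G (Iic u₀ ×ˢ Ici v₁ ×ˢ {0}ᶜ) (u, v, y) (0, 1, 0)) (Ici v₁) v := by
  have h1 : HasDerivWithinAt (fun v' : ℝ => (u, v', y)) ((0 : ℝ), (1 : ℝ), (0 : E3)) (Ici v₁) v :=
    ((hasDerivAt_const v u).prodMk ((hasDerivAt_id' v).prodMk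
      (hasDerivAt_const v y))).hasDerivWithinAt
  exact HasFDerivWithinAt.comp_hasDerivWithinAt (f := fun v' : ℝ => (u, v', y)) v
    ((hG.differentiableOn (by simp)) (u, v, y) ⟨hu, hv, hy⟩).hasFDerivWithinAt h1
    fun v' hv' => ⟨hu, hv', hy⟩

/-- On the domain, `∇_u` is a component of the full derivative. -/
theorem nablaU_eq (hF : IsSmoothField u₀ v₁ F) (I : Fin 2 → Fin 3) (hu : u ≤ u₀) (hv : v₁ ≤ v)
    {y : E3} (hy : y ≠ 0) : nablaU u₀ F u v (normalize y) I = fderivWithin ℝ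
      (fun p : ℝ × ℝ × E3 => F p.1 p.2.1 (normalize p.2.2) I) (Iic u₀ ×ˢ Ici v₁ ×ˢ {0}ᶜ)
      (u, v, y) (1, 0, 0) :=
  (hasDerivWithinAt_comp_u (hF I) hu hv hy).derivWithin (uniqueDiffOn_Iic u₀ u hu)

theorem nablaV_eq (hF : IsSmoothField u₀ v₁ F) (I : Fin 2 → Fin 3) (hu : u ≤ u₀) (hv : v₁ ≤ v)
    {y : E3} (hy : y ≠ 0) : nablaV v₁ F u v (normalize y) I = fderivWithin ℝ
      (fun p : ℝ × ℝ × E3 => F p.1 p.2.1 (normalize p.2.2) I) (Iic u₀ ×ˢ Ici v₁ ×ˢ {0}ᶜ)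
      (u, v, y) (0, 1, 0) :=
  (hasDerivWithinAt_comp_v (hF I) hu hv hy).derivWithin (uniqueDiffOn_Ici v₁ v hv)

theorem hasDerivWithinAt_u (hF : IsSmoothField u₀ v₁ F) (hu : u ≤ u₀) (hv : v₁ ≤ v) {x : E3}
    (hx : ‖x‖ = 1) (I : Fin 2 → Fin 3) :
    HasDerivWithinAt (fun u' => F u' v x I) (nablaU u₀ F u v x I) (Iic u₀) u := by
  have h := hasDerivWithinAt_comp_u (hF I) hu hv (ne_zero_of_unit hx)
  rw [← hF.nablaU_eq I hu hv (ne_zero_of_unit hx)] at h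
  simpa only [normalize_of_unit hx] using h

theorem hasDerivWithinAt_v (hF : IsSmoothField u₀ v₁ F) (hu : u ≤ u₀) (hv : v₁ ≤ v) {x : E3}
    (hx : ‖x‖ = 1) (I : Fin 2 → Fin 3) :
    HasDerivWithinAt (fun v' => F u v' x I) (nablaV v₁ F u v x I) (Ici v₁) v := by
  have h := hasDerivWithinAt_comp_v (hF I) hu hv (ne_zero_of_unit hx)
  rw [← hF.nablaV_eq I hu hv (ne_zero_of_unit hx)] at h
  simpa only [normalize_of_unit hx] using h

theorem nablaU (hF : IsSmoothField u₀ v₁ F) : IsSmoothField u₀ v₁ (nablaU u₀ F) := fun I =>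
  (((hF I).fderivWithin (uniqueDiffOn_domain u₀ v₁) (m := ∞) (by norm_num)).clm_apply
    (contDiffOn_const (c := ((1 : ℝ), (0 : ℝ), (0 : E3))))).congr
    fun _ hp => hF.nablaU_eq I hp.1 hp.2.1 hp.2.2

theorem nablaV (hF : IsSmoothField u₀ v₁ F) : IsSmoothField u₀ v₁ (nablaV v₁ F) := fun I =>
  (((hF I).fderivWithin (uniqueDiffOn_domain u₀ v₁) (m := ∞) (by norm_num)).clm_apply
    (contDiffOn_const (c := ((0 : ℝ), (1 : ℝ), (0 : E3))))).congr
    fun _ hp => hF.nablaV_eq I hp.1 hp.2.1 hp.2.2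

theorem mul (hF : IsSmoothField u₀ v₁ F) {c : ℝ → ℝ → ℝ}
    (hc : ContDiffOn ℝ ∞ (Function.uncurry c) (Iic u₀ ×ˢ Ici v₁)) :
    IsSmoothField u₀ v₁ fun u v x I => c u v * F u v x I := fun I =>
  (hc.comp (f := fun p : ℝ × ℝ × E3 => (p.1, p.2.1)) (by fun_prop)
    fun _ hp => ⟨hp.1, hp.2.1⟩).mul (hF I)

theorem nablaU_nablaV_comm (hF : IsSmoothField u₀ v₁ F) (hu : u ≤ u₀) (hv : v₁ ≤ v) {x : E3}
    (hx : ‖x‖ = 1) (I : Fin 2 → Fin 3) :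
    TeukolskyScattering.nablaU u₀ (TeukolskyScattering.nablaV v₁ F) u v x I
      = TeukolskyScattering.nablaV v₁ (TeukolskyScattering.nablaU u₀ F) u v x I := by
  set D : Set (ℝ × ℝ × E3) := Iic u₀ ×ˢ Ici v₁ ×ˢ {0}ᶜ with hD
  set G : ℝ × ℝ × E3 → ℝ := fun p => F p.1 p.2.1 (normalize p.2.2) I with hG
  have hx0 := ne_zero_of_unit hx
  have hp : (u, v, x) ∈ D := ⟨hu, hv, hx0⟩
  have hU := uniqueDiffOn_domain u₀ v₁
  have h1 : DifferentiableWithinAt ℝ (fderivWithin ℝ G D) D (u, v, x) :=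
    ((hF I).fderivWithin hU (m := ∞) (by norm_num)).differentiableOn (by simp) _ hp
  have h2 : ∀ e e' : ℝ × ℝ × E3, fderivWithin ℝ (fun p => fderivWithin ℝ G D p e) D (u, v, x) e'
      = fderivWithin ℝ (fderivWithin ℝ G D) D (u, v, x) e' e := by
    intro e e'
    have h3 : HasFDerivWithinAt (fun p => fderivWithin ℝ G D p e) _ D (u, v, x) :=
      h1.hasFDerivWithinAt.clm_apply (hasFDerivWithinAt_const e (u, v, x) D)
    rw [h3.fderivWithin (hU _ hp)]
    simp
  have h4 := hF.nablaV.nablaU_eq I hu hv hx0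
  have h5 := hF.nablaU.nablaV_eq I hu hv hx0
  rw [normalize_of_unit hx] at h4 h5
  have hcl : (u, v, x) ∈ closure (interior D) := by
    rw [hD, interior_prod_eq, interior_prod_eq, closure_prod_eq, closure_prod_eq, interior_Iic,
      interior_Ici, closure_Iio, closure_Ioi, isOpen_compl_singleton.interior_eq]
    exact ⟨hu, hv, subset_closure hx0⟩
  have h6 : fderivWithin ℝ (fun p : ℝ × ℝ × E3 =>
      TeukolskyScattering.nablaV v₁ F p.1 p.2.1 (normalize p.2.2) I) D (u, v, x)
      = fderivWithin ℝ (fun p => fderivWithin ℝ G D p (0, 1, 0)) D (u, v, x) :=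
    fderivWithin_congr' (fun p hp => hF.nablaV_eq I hp.1 hp.2.1 hp.2.2) hp
  have h7 : fderivWithin ℝ (fun p : ℝ × ℝ × E3 =>
      TeukolskyScattering.nablaU u₀ F p.1 p.2.1 (normalize p.2.2) I) D (u, v, x)
      = fderivWithin ℝ (fun p => fderivWithin ℝ G D p (1, 0, 0)) D (u, v, x) :=
    fderivWithin_congr' (fun p hp => hF.nablaU_eq I hp.1 hp.2.1 hp.2.2) hp
  rw [h4, h5, h6, h7, h2, h2]
  exact ((hF I).contDiffWithinAt hp).isSymmSndFDerivWithinAt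
    (by simpa using WithTop.coe_le_coe.2 (le_top (a := (2 : ℕ∞)))) hU hcl hp _ _

theorem continuousOn_comp (hF : IsSmoothField u₀ v₁ F) (I : Fin 2 → Fin 3) :
    ContinuousOn (fun p : (ℝ × ℝ) × Metric.sphere (0 : E3) 1 => F p.1.1 p.1.2 p.2 I)
      ((Iic u₀ ×ˢ Ici v₁) ×ˢ univ) := by
  refine ((hF I).continuousOn.comp (f := fun p : (ℝ × ℝ) × Metric.sphere (0 : E3) 1 =>
    (p.1.1, p.1.2, (p.2 : E3))) (by fun_prop) fun p hp =>
    ⟨hp.1.1, hp.1.2, ne_zero_of_unit (norm_coe_sphere p.2)⟩).congr fun p _ => ?_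
  simp [normalize_of_unit (norm_coe_sphere p.2)]

theorem const (hK : IsSmoothTensor K) : IsSmoothField u₀ v₁ fun _ _ => K := fun I =>
  (hK I).comp (f := fun p : ℝ × ℝ × E3 => p.2.2) (by fun_prop) fun _ hp => hp.2.2

theorem continuousOn_integrand {G : Field} (hF : IsSmoothField u₀ v₁ F)
    (hG : IsSmoothField u₀ v₁ G) :
    ContinuousOn (fun p : (ℝ × ℝ) × Metric.sphere (0 : E3) 1 =>
      ∑ I, F p.1.1 p.1.2 p.2 I * G p.1.1 p.1.2 p.2 I) ((Iic u₀ ×ˢ Ici v₁) ×ˢ univ) :=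
  continuousOn_finsetSum _ fun I _ => (hF.continuousOn_comp I).mul (hG.continuousOn_comp I)

theorem continuousOn_l2Inner {G : Field} (hF : IsSmoothField u₀ v₁ F)
    (hG : IsSmoothField u₀ v₁ G) :
    ContinuousOn (Function.uncurry fun u v => l2Inner (F u v) (G u v)) (Iic u₀ ×ˢ Ici v₁) :=
  continuousOn_integral_of_compact_support
    (f := fun (p : ℝ × ℝ) (x : Metric.sphere (0 : E3) 1) => ∑ I, F p.1 p.2 x I * G p.1 p.2 x I)
    isCompact_univ (hF.continuousOn_integrand hG) fun _ x _ hx => (hx (mem_univ x)).elim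

theorem hasDerivWithinAt_l2Inner_u (hF : IsSmoothField u₀ v₁ F) (hK : IsSmoothTensor K)
    (hu : u ≤ u₀) (hv : v₁ ≤ v) : HasDerivWithinAt (fun u' => l2Inner (F u' v) K)
      (l2Inner (TeukolskyScattering.nablaU u₀ F u v) K) (Iic u₀) u :=
  hasDerivWithinAt_integral_of_compactSpace (convex_Iic u₀) isClosed_Iic
    (g := fun u' (x : Metric.sphere (0 : E3) 1) => ∑ I, F u' v x I * K x I)
    (g' := fun u' x => ∑ I, TeukolskyScattering.nablaU u₀ F u' v x I * K x I)
    (fun u' hu' x => HasDerivWithinAt.fun_sum fun I _ =>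
      (hF.hasDerivWithinAt_u hu' hv (norm_coe_sphere x) I).mul_const _)
    (fun u' hu' => continuous_finsetSum _ fun I _ =>
      ((hF.smoothTensor hu' hv).continuous I).mul (hK.continuous I))
    ((hF.nablaU.continuousOn_integrand (const hK)).comp
      (f := fun p : ℝ × Metric.sphere (0 : E3) 1 => ((p.1, v), p.2)) (by fun_prop)
      fun p hp => ⟨⟨hp.1, hv⟩, hp.2⟩) hu

theorem hasDerivWithinAt_l2Inner_v (hF : IsSmoothField u₀ v₁ F) (hK : IsSmoothTensor K)
    (hu : u ≤ u₀) (hv : v₁ ≤ v) : HasDerivWithinAt (fun v' => l2Inner (F u v') K)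
      (l2Inner (TeukolskyScattering.nablaV v₁ F u v) K) (Ici v₁) v :=
  hasDerivWithinAt_integral_of_compactSpace (convex_Ici v₁) isClosed_Ici
    (g := fun v' (x : Metric.sphere (0 : E3) 1) => ∑ I, F u v' x I * K x I)
    (g' := fun v' x => ∑ I, TeukolskyScattering.nablaV v₁ F u v' x I * K x I)
    (fun v' hv' x => HasDerivWithinAt.fun_sum fun I _ =>
      (hF.hasDerivWithinAt_v hu hv' (norm_coe_sphere x) I).mul_const _)
    (fun v' hv' => continuous_finsetSum _ fun I _ =>
      ((hF.smoothTensor hu hv').continuous I).mul (hK.continuous I))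
    ((hF.nablaV.continuousOn_integrand (const hK)).comp
      (f := fun p : ℝ × Metric.sphere (0 : E3) 1 => ((u, p.1), p.2)) (by fun_prop)
      fun p hp => ⟨⟨hu, hp.1⟩, hp.2⟩) hv

end IsSmoothField

/-! ### The modes of a solution of the Teukolsky equation -/

section

variable {M u₀ v₁ : ℝ} {F : Field}

theorem contDiffOn_areaRadius (hM : 0 ≤ M) (hd : M = 0 → u₀ < v₁) :
    ContDiffOn ℝ ∞ (Function.uncurry (areaRadius M)) (Iic u₀ ×ˢ Ici v₁) :=
  (contDiffOn_radius hM).comp (f := fun p : ℝ × ℝ => p.2 - p.1) (by fun_prop) fun p hp h0 => by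
    have h1 : p.1 ≤ u₀ := hp.1
    have h2 : v₁ ≤ p.2 := hp.2
    linarith [hd h0]

theorem isRadius_radius_of_region (hM : 0 ≤ M) (hd : M = 0 → u₀ < v₁) :
    IsRadius M (v₁ - u₀) (radius M) := isRadius_radius hM fun h => sub_pos.2 (hd h)

theorem lapseSq_eq (M u v : ℝ) : lapseSq M u v = 1 - 2 * M * (radius M (v - u))⁻¹ := by
  rw [lapseSq, areaRadius_eq, div_eq_mul_inv]

theorem lapseSq_pos (hM : 0 ≤ M) (hd : M = 0 → u₀ < v₁) {u v : ℝ} (hu : u ≤ u₀) (hv : v₁ ≤ v) :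
    0 < lapseSq M u v := by
  rw [lapseSq_eq]
  exact (isRadius_radius_of_region hM hd).lapse_inv_pos (by linarith)

theorem areaRadius_pos (hM : 0 ≤ M) (hd : M = 0 → u₀ < v₁) {u v : ℝ} (hu : u ≤ u₀) (hv : v₁ ≤ v) :
    0 < areaRadius M u v := (isRadius_radius_of_region hM hd).pos (by linarith)

theorem contDiffOn_lapseSq (hM : 0 ≤ M) (hd : M = 0 → u₀ < v₁) :
    ContDiffOn ℝ ∞ (Function.uncurry (lapseSq M)) (Iic u₀ ×ˢ Ici v₁) :=
  contDiffOn_const.sub (contDiffOn_const.div (contDiffOn_areaRadius hM hd)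
    fun _ hp => (areaRadius_pos hM hd hp.1 hp.2).ne')

theorem IsSmoothField.weighted (hM : 0 ≤ M) (hd : M = 0 → u₀ < v₁) (hF : IsSmoothField u₀ v₁ F) :
    IsSmoothField u₀ v₁ (weighted M F) :=
  hF.mul ((contDiffOn_areaRadius hM hd).mul (contDiffOn_lapseSq hM hd))

theorem IsSmoothField.scaledNablaV (hM : 0 ≤ M) (hd : M = 0 → u₀ < v₁)
    (hF : IsSmoothField u₀ v₁ F) : IsSmoothField u₀ v₁ (scaledNablaV M v₁ F) :=
  hF.nablaV.mul (((contDiffOn_areaRadius hM hd).pow 2).div (contDiffOn_lapseSq hM hd)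
    fun _ hp => (lapseSq_pos hM hd hp.1 hp.2).ne')

theorem IsTeukolskySolution.isSmoothField (h : IsTeukolskySolution M u₀ v₁ F) :
    IsSmoothField u₀ v₁ F := fun I => (contDiffOn_pi.1 h.smooth) I

theorem l2Inner_mul_left (c : ℝ) (S K : SphereTensor 2) :
    l2Inner (fun x I => c * S x I) K = c * l2Inner S K := by
  rw [l2Inner_comm, show (fun x I => c * S x I) = c • S from rfl, l2Inner_smul_right, l2Inner_comm]

/-- `∇_v` in terms of `(r² / Ω²) ∇_v`, after projection. -/
theorem l2Inner_nablaV_eq (hM : 0 ≤ M) (hd : M = 0 → u₀ < v₁) (K : SphereTensor 2) {u v : ℝ}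
    (hu : u ≤ u₀) (hv : v₁ ≤ v) : l2Inner (nablaV v₁ F u v) K
      = (1 - 2 * M * (radius M (v - u))⁻¹) * (radius M (v - u))⁻¹ ^ 2
        * l2Inner (scaledNablaV M v₁ F u v) K := by
  have h1 := (lapseSq_pos hM hd hu hv).ne'
  have h2 := (areaRadius_pos hM hd hu hv).ne'
  have h3 : l2Inner (scaledNablaV M v₁ F u v) K
      = areaRadius M u v ^ 2 / lapseSq M u v * l2Inner (nablaV v₁ F u v) K :=
    l2Inner_mul_left _ _ _
  rw [h3, ← lapseSq_eq, ← areaRadius_eq]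
  field_simp

/-- The projections of a solution of the Teukolsky equation to tensor harmonics are modes. -/
theorem IsTeukolskySolution.isMode {lam : ℝ} {α : Field} {K : SphereTensor 2} (hM : 0 ≤ M)
    (hd : M = 0 → u₀ < v₁) (h : IsTeukolskySolution M u₀ v₁ α)
    (hK : IsTensorHarmonic (2 - lam) K) :
    IsMode M lam u₀ v₁ (radius M) (fun u v => l2Inner (weighted M α u v) K)
      (fun u v => l2Inner (psiBar M v₁ α u v) K) (fun u v => l2Inner (PsiBar M v₁ α u v) K)
      (fun u v => l2Inner (nablaV v₁ (PsiBar M v₁ α) u v) K) := by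
  have hR := isRadius_radius_of_region hM hd
  have sα := h.isSmoothField
  have sw := sα.weighted hM hd
  have sψ : IsSmoothField u₀ v₁ (psiBar M v₁ α) := sw.scaledNablaV hM hd
  have sΨ : IsSmoothField u₀ v₁ (PsiBar M v₁ α) := sψ.scaledNablaV hM hd
  have hρ : ∀ u ≤ u₀, ∀ v ≥ v₁, 0 < (radius M (v - u))⁻¹ := fun u hu v hv =>
    hR.inv_pos (by linarith)
  have hΩ : ∀ u ≤ u₀, ∀ v ≥ v₁, 0 < 1 - 2 * M * (radius M (v - u))⁻¹ := fun u hu v hv =>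
    hR.lapse_inv_pos (by linarith)
  have f_v : ∀ u ≤ u₀, ∀ v ≥ v₁, HasDerivWithinAt (fun v' => l2Inner (weighted M α u v') K)
      ((1 - 2 * M * (radius M (v - u))⁻¹) * (radius M (v - u))⁻¹ ^ 2
        * l2Inner (psiBar M v₁ α u v) K) (Ici v₁) v := fun u hu v hv => by
    rw [psiBar, ← l2Inner_nablaV_eq hM hd K hu hv]
    exact sw.hasDerivWithinAt_l2Inner_v hK.smooth hu hv
  have ψ_v : ∀ u ≤ u₀, ∀ v ≥ v₁, HasDerivWithinAt (fun v' => l2Inner (psiBar M v₁ α u v') K)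
      ((1 - 2 * M * (radius M (v - u))⁻¹) * (radius M (v - u))⁻¹ ^ 2
        * l2Inner (PsiBar M v₁ α u v) K) (Ici v₁) v := fun u hu v hv => by
    rw [PsiBar, ← l2Inner_nablaV_eq hM hd K hu hv]
    exact sψ.hasDerivWithinAt_l2Inner_v hK.smooth hu hv
  -- the weight `Ω² / r²` and its derivative
  have hweight : ∀ u ≤ u₀, ∀ v ≥ v₁, HasDerivAt (fun u' => (1 - 2 * M * (radius M (v - u'))⁻¹)
      * (radius M (v - u'))⁻¹ ^ 2) ((2 * (radius M (v - u))⁻¹ - 6 * M * (radius M (v - u))⁻¹ ^ 2)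
      * ((1 - 2 * M * (radius M (v - u))⁻¹) * (radius M (v - u))⁻¹ ^ 2)) u := fun u hu v hv => by
    have h1 := hR.hasDerivAt_inv_u hu hv
    refine (((h1.const_mul (2 * M)).const_sub 1).mul (h1.fun_pow 2)).congr_deriv ?_
    norm_num
    ring
  have ψ_u : ∀ u ≤ u₀, ∀ v ≥ v₁, HasDerivWithinAt (fun u' => l2Inner (psiBar M v₁ α u' v) K)
      ((2 * (radius M (v - u))⁻¹ - 6 * M * (radius M (v - u))⁻¹ ^ 2)
        * l2Inner (psiBar M v₁ α u v) K - (lam - 2 + 6 * M * (radius M (v - u))⁻¹)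
        * l2Inner (weighted M α u v) K) (Iic u₀) u := fun u hu v hv => by
    set θ : Field := fun u v x I => areaRadius M u v ^ 4 / lapseSq M u v ^ 2
      * nablaV v₁ (weighted M α) u v x I with hθ
    have sθ : IsSmoothField u₀ v₁ θ := sw.nablaV.mul
      (((contDiffOn_areaRadius hM hd).pow 4).div ((contDiffOn_lapseSq hM hd).pow 2)
        fun _ hp => (pow_pos (lapseSq_pos hM hd hp.1 hp.2) 2).ne')
    have d1 := sθ.hasDerivWithinAt_l2Inner_u hK.smooth hu hv
    have e1 : l2Inner (nablaU u₀ θ u v) K = -(areaRadius M u v ^ 3 * (lam - 2)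
        + 6 * M * areaRadius M u v ^ 2) * l2Inner (α u v) K := by
      have h1 := hK.l2Inner_sphereLaplacian (sα.smoothTensor hu hv) (h.stf u hu v hv)
      have h2 : IsSmoothTensor fun x I => areaRadius M u v ^ 3 * sphereLaplacian (α u v) x I
          + -(2 * areaRadius M u v ^ 3 + 6 * M * areaRadius M u v ^ 2) * α u v x I := fun I => by
        refine (sθ.nablaU.smoothTensor hu hv I).congr fun y hy => ?_
        have := h.teukolsky u hu v hv _ (norm_normalize hy) I
        rw [hθ, this]
        ring
      have s2 : IsSmoothTensor fun x I =>
          -(2 * areaRadius M u v ^ 3 + 6 * M * areaRadius M u v ^ 2) * α u v x I := fun I =>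
        contDiffOn_const.mul (sα.smoothTensor hu hv I)
      have s1 : IsSmoothTensor fun x I => areaRadius M u v ^ 3 * sphereLaplacian (α u v) x I :=
        fun I => ((h2 I).sub (s2 I)).congr fun y _ => by ring
      rw [l2Inner_congr_left (T := (fun x I => areaRadius M u v ^ 3 * sphereLaplacian (α u v) x I)
        + fun x I => -(2 * areaRadius M u v ^ 3 + 6 * M * areaRadius M u v ^ 2) * α u v x I)
        (fun x hx I => (h.teukolsky u hu v hv x hx I).trans (by
          simp only [Pi.add_apply]; ring)), l2Inner_comm, l2Inner_add_right hK.smooth s1 s2,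
        l2Inner_comm K, l2Inner_comm K, l2Inner_mul_left, l2Inner_mul_left, h1]
      ring
    rw [e1] at d1
    have e2 : ∀ u ≤ u₀, l2Inner (psiBar M v₁ α u v) K = (1 - 2 * M * (radius M (v - u))⁻¹)
        * (radius M (v - u))⁻¹ ^ 2 * l2Inner (θ u v) K := fun u hu => by
      have h1 := (lapseSq_pos hM hd hu hv).ne'
      have h2 := (areaRadius_pos hM hd hu hv).ne'
      rw [show l2Inner (θ u v) K = areaRadius M u v ^ 4 / lapseSq M u v ^ 2
        * l2Inner (nablaV v₁ (weighted M α) u v) K from l2Inner_mul_left _ _ _,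
        show l2Inner (psiBar M v₁ α u v) K = areaRadius M u v ^ 2 / lapseSq M u v
        * l2Inner (nablaV v₁ (weighted M α) u v) K from l2Inner_mul_left _ _ _,
        ← lapseSq_eq, ← areaRadius_eq]
      field_simp
    refine (((hweight u hu v hv).hasDerivWithinAt.mul d1).congr_deriv ?_).congr
      (fun u' hu' => e2 u' hu') (e2 u hu)
    have h1 := (lapseSq_pos hM hd hu hv).ne'
    have h2 := (areaRadius_pos hM hd hu hv).ne'
    rw [e2 u hu, show l2Inner (weighted M α u v) K = areaRadius M u v * lapseSq M u v
      * l2Inner (α u v) K from l2Inner_mul_left _ _ _, ← lapseSq_eq, ← areaRadius_eq]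
    field_simp
    ring
  have Ψ_u : ∀ u ≤ u₀, ∀ v ≥ v₁, HasDerivWithinAt (fun u' => l2Inner (PsiBar M v₁ α u' v) K)
      (-(lam - 6 * M * (radius M (v - u))⁻¹) * l2Inner (psiBar M v₁ α u v) K
        + 6 * M * l2Inner (weighted M α u v) K) (Iic u₀) u := fun u hu v hv => by
    have d1 := sψ.nablaV.hasDerivWithinAt_l2Inner_u hK.smooth hu hv
    rw [l2Inner_congr_left fun x hx I => sψ.nablaU_nablaV_comm hu hv hx I] at d1
    have d2 := sψ.nablaU.hasDerivWithinAt_l2Inner_v hK.smooth hu hv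
    have e1 : ∀ v ≥ v₁, l2Inner (nablaU u₀ (psiBar M v₁ α) u v) K = _ := fun v hv =>
      (uniqueDiffOn_Iic u₀ u hu).eq_deriv _ (sψ.hasDerivWithinAt_l2Inner_u hK.smooth hu hv)
        (ψ_u u hu v hv)
    have hi := hR.hasDerivAt_inv_v hu hv
    have d3 := ((((hi.const_mul 2).sub ((hi.fun_pow 2).const_mul (6 * M))).hasDerivWithinAt
      (s := Ici v₁)).mul (ψ_v u hu v hv)).sub ((((hi.const_mul (6 * M)).const_add
      (lam - 2)).hasDerivWithinAt (s := Ici v₁)).mul (f_v u hu v hv))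
    have e2 := (uniqueDiffOn_Ici v₁ v hv).eq_deriv _ d2 (d3.congr e1 (e1 v hv))
    rw [e2] at d1
    have hw0 := fun u hu => (mul_pos (hΩ u hu v hv) (pow_pos (hρ u hu v hv) 2)).ne'
    have e3 : ∀ u ≤ u₀, l2Inner (PsiBar M v₁ α u v) K = l2Inner (nablaV v₁ (psiBar M v₁ α) u v) K
        / ((1 - 2 * M * (radius M (v - u))⁻¹) * (radius M (v - u))⁻¹ ^ 2) := fun u hu => by
      rw [l2Inner_nablaV_eq hM hd K hu hv, mul_div_cancel_left₀ _ (hw0 u hu)]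
      rfl
    refine ((d1.div (hweight u hu v hv).hasDerivWithinAt (hw0 u hu)).congr_deriv ?_).congr
      (fun u' hu' => e3 u' hu') (e3 u hu)
    rw [l2Inner_nablaV_eq hM hd K hu hv]
    change _ = -(lam - 6 * M * (radius M (v - u))⁻¹)
      * l2Inner (scaledNablaV M v₁ (weighted M α) u v) K + _
    have q1 := hΩ u hu v hv
    have q2 := hρ u hu v hv
    simp only [PsiBar, psiBar, Pi.sub_apply]
    generalize (radius M (v - u))⁻¹ = ρ at *
    field_simp
    ring
  refine ⟨f_v, ψ_v, fun u hu v hv => sΨ.hasDerivWithinAt_l2Inner_v hK.smooth hu hv, ψ_u, Ψ_u,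
    fun u hu v hv => ?_, sw.continuousOn_l2Inner (.const hK.smooth),
    sψ.continuousOn_l2Inner (.const hK.smooth),
    sΨ.continuousOn_l2Inner (.const hK.smooth), sΨ.nablaV.continuousOn_l2Inner (.const hK.smooth)⟩
  have d1 := sΨ.nablaV.hasDerivWithinAt_l2Inner_u hK.smooth hu hv
  rw [l2Inner_congr_left fun x hx I => sΨ.nablaU_nablaV_comm hu hv hx I] at d1
  have d2 := sΨ.nablaU.hasDerivWithinAt_l2Inner_v hK.smooth hu hv
  have e1 : ∀ v ≥ v₁, l2Inner (nablaU u₀ (PsiBar M v₁ α) u v) K = _ := fun v hv =>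
    (uniqueDiffOn_Iic u₀ u hu).eq_deriv _ (sΨ.hasDerivWithinAt_l2Inner_u hK.smooth hu hv)
      (Ψ_u u hu v hv)
  have hi := hR.hasDerivAt_inv_v hu hv
  have d3 := ((((hi.const_mul (6 * M)).const_sub lam).fun_neg.hasDerivWithinAt
    (s := Ici v₁)).mul (ψ_v u hu v hv)).add ((f_v u hu v hv).const_mul (6 * M))
  have e2 := (uniqueDiffOn_Ici v₁ v hv).eq_deriv _ d2 (d3.congr e1 (e1 v hv))
  rw [e2] at d1
  refine d1.congr_deriv ?_
  rw [potential]
  ring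

end

/-! ### The projection to an angular frequency, and interpolation -/

/-- The integral kernel of the projection to the angular frequency `ℓ`. -/
noncomputable def harmKernel (ℓ : ℕ) (x : E3) (I : Fin 2 → Fin 3) : SphereTensor 2 :=
  ∑ m ∈ Finset.Icc (-(ℓ : ℤ)) ℓ, (harmE ℓ m x I • harmE ℓ m + harmH ℓ m x I • harmH ℓ m)

theorem natAbs_le_of_mem_Icc {ℓ : ℕ} {m : ℤ} (hm : m ∈ Finset.Icc (-(ℓ : ℤ)) ℓ) :
    m.natAbs ≤ ℓ := by
  have := Finset.mem_Icc.1 hm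
  omega

theorem isTensorHarmonic_harmKernel (ℓ : ℕ) (x : E3) (I : Fin 2 → Fin 3) :
    IsTensorHarmonic (2 - (ℓ : ℝ) * (ℓ + 1)) (harmKernel ℓ x I) :=
  .sum _ fun _ hm => have h := isTensorHarmonic_harm (natAbs_le_of_mem_Icc hm)
    (h.1.smul _).add (h.2.smul _)

theorem angularMode_eq_l2Inner (ℓ : ℕ) {T : SphereTensor 2} (hT : IsSmoothTensor T) (x : E3)
    (I : Fin 2 → Fin 3) : angularMode ℓ T x I = l2Inner T (harmKernel ℓ x I) := by
  have h := fun m (hm : m ∈ Finset.Icc (-(ℓ : ℤ)) ℓ) =>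
    isTensorHarmonic_harm (natAbs_le_of_mem_Icc hm)
  rw [harmKernel, l2Inner_sum_right _ hT fun m hm =>
    (((h m hm).1.smul (harmE ℓ m x I)).add ((h m hm).2.smul (harmH ℓ m x I))).smooth]
  simp only [angularMode, Finset.sum_apply]
  refine sum_congr rfl fun m hm => ?_
  rw [l2Inner_add_right hT ((h m hm).1.smul _).smooth ((h m hm).2.smul _).smooth,
    l2Inner_smul_right, l2Inner_smul_right]
  simp only [Pi.add_apply, Pi.smul_apply, smul_eq_mul]
  ring

theorem IsSmoothTensor.exists_bound {T : SphereTensor 2} (hT : IsSmoothTensor T) :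
    ∃ B, ∀ x : E3, ‖x‖ = 1 → ∀ I, |T x I| ≤ B := by
  choose B hB using fun I => isCompact_univ.exists_bound_of_continuousOn
    (hT.continuous I).continuousOn
  refine ⟨∑ I, |B I|, fun x hx I => (hB I ⟨x, by simpa using hx⟩ (mem_univ _)).trans
    ((le_abs_self _).trans ?_)⟩
  exact Finset.single_le_sum (f := fun I => |B I|) (fun _ _ => abs_nonneg _) (Finset.mem_univ I)

/-- The tensor fields `S` which are recovered from their values at the nodes `z k` by the
interpolation formula `S = ∑ k, S (z k) φ k` on the unit sphere. -/
def interpolated {n : ℕ} (z : Fin n → E3 × (Fin 2 → Fin 3)) (φ : Fin n → SphereTensor 2) :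
    Submodule ℝ (SphereTensor 2) where
  carrier := {S | ∀ x : E3, ‖x‖ = 1 → ∀ I, S x I = ∑ k, S (z k).1 (z k).2 * φ k x I}
  add_mem' hS hT x hx I := by
    simp only [Pi.add_apply, add_mul, sum_add_distrib, ← hS x hx, ← hT x hx]
  zero_mem' x _ I := by simp
  smul_mem' c S hS x hx I := by
    simp only [Pi.smul_apply, smul_eq_mul, mul_assoc, ← mul_sum, ← hS x hx]

/-- A finite family of bounded tensor fields can be interpolated by bounded tensor fields. -/
theorem exists_interpolated (s : Finset (SphereTensor 2))
    (hs : ∀ S ∈ s, ∃ B, ∀ x : E3, ‖x‖ = 1 → ∀ I, |S x I| ≤ B) :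
    ∃ (n : ℕ) (z : Fin n → E3 × (Fin 2 → Fin 3)) (φ : Fin n → SphereTensor 2),
      (∀ k, ‖(z k).1‖ = 1) ∧ (∀ k, ∃ B, ∀ x : E3, ‖x‖ = 1 → ∀ I, |φ k x I| ≤ B) ∧
      ∀ S ∈ s, S ∈ interpolated z φ := by
  classical
  induction s using Finset.induction_on with
  | empty => exact ⟨0, Fin.elim0, Fin.elim0, fun k => k.elim0, fun k => k.elim0, by simp⟩
  | insert T s hT ih =>
    obtain ⟨n, z, φ, hz, hφ, h⟩ := ih fun S hS => hs S (Finset.mem_insert_of_mem hS)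
    -- the interpolation error of the new tensor field
    obtain ⟨g, hg⟩ : ∃ g : SphereTensor 2, g = fun x I =>
      T x I - ∑ k, T (z k).1 (z k).2 * φ k x I := ⟨_, rfl⟩
    by_cases h0 : ∀ x : E3, ‖x‖ = 1 → ∀ I, g x I = 0
    · refine ⟨n, z, φ, hz, hφ, fun S hS => ?_⟩
      rcases Finset.mem_insert.1 hS with rfl | hS
      · intro x hx I
        have := h0 x hx I
        rw [hg] at this
        exact sub_eq_zero.1 this
      · exact h S hS
    · push Not at h0
      obtain ⟨x₀, hx₀, I₀, h0⟩ := h0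
      choose B hB using hφ
      obtain ⟨BT, hBT⟩ := hs T (Finset.mem_insert_self T s)
      have hgb : ∀ x : E3, ‖x‖ = 1 → ∀ I,
          |g x I / g x₀ I₀| ≤ (BT + ∑ k, |T (z k).1 (z k).2| * B k) / |g x₀ I₀| := fun x hx I => by
        rw [abs_div, hg]
        refine div_le_div_of_nonneg_right ((abs_sub _ _).trans (add_le_add (hBT x hx I)
          ((abs_sum_le_sum_abs _ _).trans (sum_le_sum fun k _ => ?_))))
          (abs_nonneg _)
        rw [abs_mul]
        exact mul_le_mul_of_nonneg_left (hB k x hx I) (abs_nonneg _)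
      have key : ∀ S : SphereTensor 2, (∀ x : E3, ‖x‖ = 1 → ∀ I, S x I
          = (∑ k, S (z k).1 (z k).2 * φ k x I)
            + (S x₀ I₀ - ∑ k, S (z k).1 (z k).2 * φ k x₀ I₀) * (g x I / g x₀ I₀)) →
          S ∈ interpolated (Fin.cons (x₀, I₀) z) (Fin.cons (fun x I => g x I / g x₀ I₀)
            fun k x I => φ k x I - φ k x₀ I₀ * (g x I / g x₀ I₀)) := fun S hS x hx I => by
        rw [hS x hx I, Fin.sum_univ_succ]
        simp only [Fin.cons_zero, Fin.cons_succ, mul_sub, sum_sub_distrib, ← mul_assoc,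
          ← sum_mul]
        ring
      refine ⟨n + 1, _, _, fun k => ?_, fun k => ?_, fun S hS => key S fun x hx I => ?_⟩
      · refine Fin.cases ?_ (fun k => ?_) k
        · simpa using hx₀
        · simpa using hz k
      · refine Fin.cases ⟨_, hgb⟩ (fun k => ⟨B k + |φ k x₀ I₀|
          * ((BT + ∑ k, |T (z k).1 (z k).2| * B k) / |g x₀ I₀|), fun x hx I => ?_⟩) k
        simp only [Fin.cons_succ]
        refine (abs_sub _ _).trans (add_le_add (hB k x hx I) ?_)
        rw [abs_mul]
        exact mul_le_mul_of_nonneg_left (hgb x hx I) (abs_nonneg _)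
      · rcases Finset.mem_insert.1 hS with rfl | hS
        · have : S x₀ I₀ - ∑ k, S (z k).1 (z k).2 * φ k x₀ I₀ = g x₀ I₀ := by rw [hg]
          rw [this, mul_div_cancel₀ _ h0, hg]
          ring
        · rw [← h S hS x hx I, ← h S hS x₀ hx₀ I₀]
          ring

/-- The components of angular frequency `ℓ` can be interpolated by bounded tensor fields. -/
theorem exists_angularMode_mem_interpolated (ℓ : ℕ) :
    ∃ (n : ℕ) (z : Fin n → E3 × (Fin 2 → Fin 3)) (φ : Fin n → SphereTensor 2),
      (∀ k, ‖(z k).1‖ = 1) ∧ (∀ k, ∃ B, ∀ x : E3, ‖x‖ = 1 → ∀ I, |φ k x I| ≤ B) ∧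
      ∀ T, angularMode ℓ T ∈ interpolated z φ := by
  classical
  obtain ⟨n, z, φ, hz, hφ, h⟩ := exists_interpolated
    ((Finset.Icc (-(ℓ : ℤ)) ℓ).image (harmE ℓ) ∪ (Finset.Icc (-(ℓ : ℤ)) ℓ).image (harmH ℓ))
    fun S hS => by
      rcases Finset.mem_union.1 hS with hS | hS <;> obtain ⟨m, hm, rfl⟩ := Finset.mem_image.1 hS
      exacts [IsSmoothTensor.exists_bound (isTensorHarmonic_harm (natAbs_le_of_mem_Icc hm)).1.smooth,
        IsSmoothTensor.exists_bound (isTensorHarmonic_harm (natAbs_le_of_mem_Icc hm)).2.smooth]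
  exact ⟨n, z, φ, hz, hφ, fun T => sum_mem fun m hm => add_mem
    (Submodule.smul_mem _ _ (h _ (Finset.mem_union_left _ (Finset.mem_image_of_mem _ hm))))
    (Submodule.smul_mem _ _ (h _ (Finset.mem_union_right _ (Finset.mem_image_of_mem _ hm))))⟩

section

variable {n : ℕ} {z : Fin n → E3 × (Fin 2 → Fin 3)} {φ : Fin n → SphereTensor 2}

theorem mem_interpolated_of_tendsto {ι : Type*} {l : Filter ι} [l.NeBot] {F : ι → SphereTensor 2}
    {S : SphereTensor 2} (hz : ∀ k, ‖(z k).1‖ = 1) (hF : ∀ i, F i ∈ interpolated z φ)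
    (h : ∀ x : E3, ‖x‖ = 1 → ∀ I, Tendsto (fun i => F i x I) l (𝓝 (S x I))) :
    S ∈ interpolated z φ := fun x hx I =>
  tendsto_nhds_unique (h x hx I) ((tendsto_finsetSum Finset.univ fun k _ =>
    (h _ (hz k) (z k).2).mul_const (φ k x I)).congr fun i => (hF i x hx I).symm)

/-- Estimates for interpolated tensor fields only have to be proved at the nodes. -/
theorem exists_norm_le_of_interpolation {u₀ : ℝ} {b : ℝ → ℝ} {F : ℝ → SphereTensor 2}
    {e : ℝ → Fin n → ℝ} (hφ : ∀ k, ∃ B, ∀ x : E3, ‖x‖ = 1 → ∀ I, |φ k x I| ≤ B)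
    (hb : ∀ u ≤ u₀, 0 ≤ b u)
    (hF : ∀ u ≤ u₀, ∀ x : E3, ‖x‖ = 1 → ∀ I, F u x I = ∑ k, e u k * φ k x I)
    (h : ∀ k, ∃ C, ∀ u ≤ u₀, |e u k| ≤ C * b u) :
    ∃ C, ∀ u ≤ u₀, ∀ x : E3, ‖x‖ = 1 → ‖F u x‖ ≤ C * b u := by
  choose B hB using hφ
  choose C hC using h
  refine ⟨∑ k, |C k| * |B k|, fun u hu x hx => ?_⟩
  refine (pi_norm_le_iff_of_nonneg (mul_nonneg (by positivity) (hb u hu))).2 fun I => ?_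
  rw [hF u hu x hx I, Real.norm_eq_abs, sum_mul]
  refine (abs_sum_le_sum_abs _ _).trans (sum_le_sum fun k _ => ?_)
  rw [abs_mul, mul_right_comm]
  exact mul_le_mul ((hC k u hu).trans (mul_le_mul_of_nonneg_right (le_abs_self _) (hb u hu)))
    ((hB k x hx I).trans (le_abs_self _)) (abs_nonneg _)
    (mul_nonneg (abs_nonneg _) (hb u hu))

end

/-! ### From the modes to tensor fields -/

theorem zpow_eq_inv_pow {r : ℝ} {k : ℤ} {m : ℕ} (h : k = -m) : r ^ k = r⁻¹ ^ m := by
  rw [h, zpow_neg, zpow_natCast, inv_pow]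

theorem l2Inner_weighted_harmKernel {M u v : ℝ} {α : Field} (ℓ : ℕ) (hα : IsSmoothTensor (α u v))
    (x : E3) (I : Fin 2 → Fin 3) : l2Inner (weighted M α u v) (harmKernel ℓ x I)
      = lapseSq M u v * (areaRadius M u v * angularMode ℓ (α u v) x I) := by
  rw [angularMode_eq_l2Inner ℓ hα, ← mul_assoc, mul_comm (lapseSq M u v)]
  exact l2Inner_mul_left _ _ _

/-- The incoming radiation of the modes of a tensor field. -/
theorem HasIncomingRadiation.tendsto_integral_l2Inner {M u₀ v₁ : ℝ} {α : Field}
    {P : ℝ → SphereTensor 2} (h : HasIncomingRadiation M v₁ α P) (hM : 0 ≤ M)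
    (hd : M = 0 → u₀ < v₁) (hα : IsSmoothField u₀ v₁ α) (hP : IsSmoothField u₀ v₁ fun _ => P)
    {K : SphereTensor 2} (hK : IsSmoothTensor K) {V : ℝ} (hV : v₁ ≤ V) :
    Tendsto (fun u => ∫ v in v₁..V, (l2Inner (nablaV v₁ (PsiBar M v₁ α) u v) K
      - l2Inner (P v) K) ^ 2) atBot (𝓝 0) := by
  have sχ : IsSmoothField u₀ v₁ (nablaV v₁ (PsiBar M v₁ α)) :=
    (((hα.weighted hM hd).scaledNablaV hM hd).scaledNablaV hM hd).nablaV
  obtain ⟨F, hF⟩ : ∃ F : Field, F = fun u v => nablaV v₁ (PsiBar M v₁ α) u v - P v := ⟨_, rfl⟩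
  have sF : IsSmoothField u₀ v₁ F := by
    rw [hF]
    exact fun I => (sχ I).sub (hP I)
  have h1 : ∀ u ≤ u₀, ∀ v ≥ v₁, l2Inner (nablaV v₁ (PsiBar M v₁ α) u v) K - l2Inner (P v) K
      = l2Inner (F u v) K := fun u hu v hv => by
    have e := l2Inner_add_right (hK) (sF.smoothTensor hu hv) (hP.smoothTensor hu hv)
    rw [l2Inner_comm K (F u v), l2Inner_comm K (P v), ← sub_eq_iff_eq_add] at e
    rw [← e, l2Inner_comm _ K, hF, sub_add_cancel]
  have h2 := (h V hV).mul_const (l2Inner K K)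
  rw [zero_mul] at h2
  refine squeeze_zero' (Eventually.of_forall fun u =>
    intervalIntegral.integral_nonneg hV fun v _ => sq_nonneg _) ?_ h2
  filter_upwards [eventually_le_atBot u₀] with u hu
  have hc : ∀ {g : ℝ → ℝ → ℝ}, ContinuousOn (Function.uncurry g) (Iic u₀ ×ˢ Ici v₁) →
      ContinuousOn (g u) (Icc v₁ V) := fun hg =>
    hg.comp (f := fun v => (u, v)) (by fun_prop) fun _ hv => ⟨hu, hv.1⟩
  rw [← intervalIntegral.integral_mul_const, integral_congr
    (g := fun v => l2Inner (F u v) K ^ 2) fun v hv => by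
      rw [uIcc_of_le hV] at hv
      simp only [h1 u hu v hv.1]]
  simp only [← congrFun (congrFun hF u) _]
  exact integral_mono_on hV
    (((hc (sF.continuousOn_l2Inner (.const hK))).pow 2).intervalIntegrable_of_Icc hV)
    (((hc (sF.continuousOn_l2Inner sF)).mul continuousOn_const).intervalIntegrable_of_Icc hV)
    fun v hv => l2Inner_sq_le (sF.smoothTensor hu hv.1) hK

section

variable {M u₀ v₁ : ℝ} {α : Field} {E : ℕ → ℕ → SphereTensor 2} {A : ℕ → SphereTensor 2}
  {ℓ n : ℕ} {z : Fin n → E3 × (Fin 2 → Fin 3)} {φ : Fin n → SphereTensor 2}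

theorem DescribesExterior.abs_sub_le (h : DescribesExterior M u₀ v₁ α E A) (hℓ : 2 ≤ ℓ) {N : ℕ}
    (hN : 2 ≤ N) : ∃ C, ∀ u ≤ u₀, ∀ x : E3, ‖x‖ = 1 → ∀ I,
      |areaRadius M u v₁ * angularMode ℓ (α u v₁) x I
        - ∑ p ∈ Finset.Icc 2 N, (areaRadius M u v₁)⁻¹ ^ (p + 2) * E ℓ p x I|
      ≤ C * (areaRadius M u v₁)⁻¹ ^ (N + 3) := by
  obtain ⟨C, hC⟩ := h.expansion ℓ hℓ N hN
  refine ⟨C, fun u hu x hx I => ?_⟩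
  have h1 := (norm_le_pi_norm _ I).trans (hC u hu x hx)
  rw [zpow_eq_inv_pow (m := N + 3) (by push_cast; ring)] at h1
  simpa only [Pi.sub_apply, Pi.smul_apply, Finset.sum_apply, smul_eq_mul, Real.norm_eq_abs,
    fun p : ℕ => zpow_eq_inv_pow (r := areaRadius M u v₁) (k := -2 - (p : ℤ)) (m := p + 2)
      (by push_cast; ring)] using h1

theorem DescribesExterior.mem_interpolated (h : DescribesExterior M u₀ v₁ α E A) (hM : 0 ≤ M)
    (hd : M = 0 → u₀ < v₁) (hℓ : 2 ≤ ℓ) (hz : ∀ k, ‖(z k).1‖ = 1)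
    (hang : ∀ T, angularMode ℓ T ∈ interpolated z φ) :
    A ℓ ∈ interpolated z φ ∧ ∀ p : ℕ, 2 ≤ p → E ℓ p ∈ interpolated z φ := by
  have hR := isRadius_radius_of_region hM hd
  constructor
  · refine mem_interpolated_of_tendsto (l := atBot)
      (F := fun u => (2 : ℝ)⁻¹ • angularMode ℓ (PsiBar M v₁ α u v₁)) hz
      (fun u => Submodule.smul_mem _ _ (hang _)) fun x hx I => ?_
    simpa using ((tendsto_pi_nhds.1 (h.limit ℓ hℓ x hx)) I).const_mul 2⁻¹
  intro p
  induction p using Nat.strong_induction_on with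
  | _ p ih =>
    intro hp
    obtain ⟨C, hC⟩ := h.abs_sub_le hℓ hp
    -- the coefficient is the limit of the normalised remainder of the preceding expansion
    refine mem_interpolated_of_tendsto (l := atBot) (F := fun u => (areaRadius M u v₁ ^ (p + 2)) •
      (areaRadius M u v₁ • angularMode ℓ (α u v₁)
        - ∑ q ∈ Finset.Ico 2 p, (areaRadius M u v₁)⁻¹ ^ (q + 2) • E ℓ q)) hz
      (fun u => Submodule.smul_mem _ _ (sub_mem (Submodule.smul_mem _ _ (hang _))
        (sum_mem fun q hq => Submodule.smul_mem _ _
          (ih q (Finset.mem_Ico.1 hq).2 (Finset.mem_Ico.1 hq).1)))) fun x hx I => ?_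
    have h0 : Tendsto (fun u => C * (areaRadius M u v₁)⁻¹) atBot (𝓝 0) := by
      simpa [areaRadius_eq] using (hR.tendsto_inv_atBot v₁).const_mul C
    rw [← tendsto_sub_nhds_zero_iff]
    refine squeeze_zero_norm' ?_ h0
    filter_upwards [eventually_le_atBot u₀] with u hu
    have hr := areaRadius_pos hM hd hu (le_refl v₁)
    have h1 := hC u hu x hx I
    rw [← Finset.Ico_insert_right hp, sum_insert (by simp)] at h1
    simp only [Pi.smul_apply, Pi.sub_apply, Finset.sum_apply, smul_eq_mul, Real.norm_eq_abs]
    generalize areaRadius M u v₁ = r at *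
    generalize ∑ q ∈ Finset.Ico 2 p, r⁻¹ ^ (q + 2) * E ℓ q x I = S at *
    have h3 : r ^ (p + 2) * r⁻¹ ^ (p + 2) = 1 := by
      rw [← mul_pow, mul_inv_cancel₀ hr.ne', one_pow]
    have h2 : r ^ (p + 2) * (r * angularMode ℓ (α u v₁) x I - S) - E ℓ p x I
        = r ^ (p + 2) * (r * angularMode ℓ (α u v₁) x I - (r⁻¹ ^ (p + 2) * E ℓ p x I + S)) := by
      linear_combination E ℓ p x I * h3
    rw [h2, abs_mul, abs_of_pos (pow_pos hr _)]
    refine (mul_le_mul_of_nonneg_left h1 (pow_pos hr _).le).trans_eq ?_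
    linear_combination C * r⁻¹ * h3

/-- If the components of `r α̲_ℓ` have radiation fields with given expansions, then so does the
tensor field `r α̲_ℓ`, uniformly on the sphere. -/
theorem exists_field_of_components (hz : ∀ k, ‖(z k).1‖ = 1)
    (hφ : ∀ k, ∃ B, ∀ x : E3, ‖x‖ = 1 → ∀ I, |φ k x I| ≤ B)
    (hang : ∀ T, angularMode ℓ T ∈ interpolated z φ) {G : ℕ → ℝ → SphereTensor 2}
    {b : ℕ → ℝ → ℝ} (hb : ∀ N, ∀ u ≤ u₀, 0 ≤ b N u) (hG : ∀ N u, G N u ∈ interpolated z φ)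
    (h : ∀ x : E3, ‖x‖ = 1 → ∀ I, ∃ L : ℝ → ℝ, (∀ u ≤ u₀, Tendsto
      (fun v => areaRadius M u v * angularMode ℓ (α u v) x I) atTop (𝓝 (L u))) ∧
      ∀ N : ℕ, 2 ≤ N → ∃ C, ∀ u ≤ u₀, |L u - G N u x I| ≤ C * b N u) :
    ∃ L : ℝ → SphereTensor 2,
      (∀ u ≤ u₀, ∀ x : E3, ‖x‖ = 1 →
        Tendsto (fun v => areaRadius M u v • angularMode ℓ (α u v) x) atTop (𝓝 (L u x))) ∧
      ∀ N : ℕ, 2 ≤ N → ∃ C, ∀ u ≤ u₀, ∀ x : E3, ‖x‖ = 1 → ‖L u x - G N u x‖ ≤ C * b N u := by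
  choose! L hL using h
  refine ⟨fun u x I => L x I u, fun u hu x hx => tendsto_pi_nhds.2 fun I => (hL x hx I).1 u hu,
    fun N hN => exists_norm_le_of_interpolation (F := fun u => (fun x I => L x I u) - G N u)
      (e := fun u k => ((fun x I => L x I u) - G N u) (z k).1 (z k).2) hφ (hb N)
      (fun u hu => sub_mem ?_ (hG N u)) fun k => (hL _ (hz k) _).2 N hN⟩
  exact mem_interpolated_of_tendsto (l := atTop)
    (F := fun v => areaRadius M u v • angularMode ℓ (α u v)) hz
    (fun v => Submodule.smul_mem _ _ (hang _)) fun x hx I => (hL x hx I).1 u hu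

/-- The mode equations and the data of a component of `r α̲_ℓ`. -/
theorem DescribesExterior.tendsto_component (h : DescribesExterior M u₀ v₁ α E A) (hM : 0 ≤ M)
    (hd : M = 0 → u₀ < v₁) (hℓ : 2 ≤ ℓ) {x : E3} (hx : ‖x‖ = 1) (I : Fin 2 → Fin 3) :
    Tendsto (fun u => l2Inner (PsiBar M v₁ α u v₁) (harmKernel ℓ x I)) atBot (𝓝 (2 * A ℓ x I)) ∧
    ∀ V ≥ v₁, Tendsto (fun u => ∫ v in v₁..V, l2Inner (nablaV v₁ (PsiBar M v₁ α) u v)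
      (harmKernel ℓ x I) ^ 2) atBot (𝓝 0) := by
  have sα := h.solution.isSmoothField
  constructor
  · refine ((tendsto_pi_nhds.1 (h.limit ℓ hℓ x hx)) I).congr' ?_
    filter_upwards [eventually_le_atBot u₀] with u hu
    exact angularMode_eq_l2Inner ℓ ((((sα.weighted hM hd).scaledNablaV hM hd).scaledNablaV
      hM hd).smoothTensor hu le_rfl) x I
  · intro V hV
    have := h.noIncoming.tendsto_integral_l2Inner hM hd sα
      (IsSmoothField.const fun I => contDiffOn_const)
      (isTensorHarmonic_harmKernel ℓ x I).smooth hV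
    simpa [l2Inner] using this

/-- The radiation field on Minkowski space. -/
theorem DescribesExterior.exists_limit_minkowski (h : DescribesExterior 0 u₀ v₁ α E A)
    (hd : u₀ < v₁) (hℓ : 2 ≤ ℓ) :
    ∃ L : ℝ → SphereTensor 2,
      (∀ u ≤ u₀, ∀ x : E3, ‖x‖ = 1 →
        Tendsto (fun v => areaRadius 0 u v • angularMode ℓ (α u v) x) atTop (𝓝 (L u x))) ∧
      (∀ N : ℕ, 2 ≤ N → ∃ C : ℝ, ∀ u ≤ u₀, ∀ x : E3, ‖x‖ = 1 →
        ‖L u x - ∑ p ∈ Finset.Icc 2 N,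
            (coeffS ℓ p (ℓ + 2) 0 (-2) * areaRadius 0 u v₁ ^ (-2 - (p : ℤ))) • E ℓ p x‖
          ≤ C * areaRadius 0 u v₁ ^ (-3 - (N : ℤ))) := by
  have hd' : (0 : ℝ) = 0 → u₀ < v₁ := fun _ => hd
  have sα := h.solution.isSmoothField
  obtain ⟨n, z, φ, hz, hφ, hang⟩ := exists_angularMode_mem_interpolated ℓ
  obtain ⟨-, hE⟩ := h.mem_interpolated le_rfl hd' hℓ hz hang
  have hf : ∀ (x : E3) I, ∀ u ≤ u₀, ∀ v ≥ v₁, l2Inner (weighted 0 α u v) (harmKernel ℓ x I)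
      = areaRadius 0 u v * angularMode ℓ (α u v) x I := fun x I u hu v hv => by
    rw [l2Inner_weighted_harmKernel ℓ (sα.smoothTensor hu hv), lapseSq]
    simp
  obtain ⟨L, hL, hN⟩ := exists_field_of_components (M := 0) (α := α) (G := fun N u =>
      ∑ p ∈ Finset.Icc 2 N, (coeffS ℓ p (ℓ + 2) 0 (-2) * areaRadius 0 u v₁ ^ (-2 - (p : ℤ)))
        • E ℓ p) (b := fun N u => areaRadius 0 u v₁ ^ (-3 - (N : ℤ))) hz hφ hang
    (fun N u hu => zpow_nonneg (areaRadius_pos le_rfl hd' hu le_rfl).le _)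
    (fun N u => sum_mem fun p hp => Submodule.smul_mem _ _ (hE p (Finset.mem_Icc.1 hp).1))
    fun x hx I => by
      obtain ⟨hΨ, hχ⟩ := h.tendsto_component le_rfl hd' hℓ hx I
      obtain ⟨L, hL, hN⟩ := IsMode.exists_radiation_expansion
        (isRadius_radius_of_region le_rfl hd') hℓ
        (h.solution.isMode le_rfl hd' (isTensorHarmonic_harmKernel ℓ x I))
        (E := fun p => E ℓ p x I) (fun N hN => by
          obtain ⟨C, hC⟩ := h.abs_sub_le hℓ hN
          refine ⟨C, fun u hu => ?_⟩
          rw [hf x I u hu v₁ le_rfl]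
          exact hC u hu x hx I) hΨ hχ
      refine ⟨L, fun u hu => (hL u hu).congr' ?_, fun N hN' => ?_⟩
      · filter_upwards [eventually_ge_atTop v₁] with v hv
        exact hf x I u hu v hv
      · obtain ⟨C, hC⟩ := hN N hN'
        refine ⟨C, fun u hu => ?_⟩
        rw [zpow_eq_inv_pow (m := N + 3) (by push_cast; ring)]
        simpa only [Finset.sum_apply, Pi.smul_apply, smul_eq_mul, areaRadius_eq, fun p : ℕ =>
          zpow_eq_inv_pow (r := radius 0 (v₁ - u)) (k := -2 - (p : ℤ)) (m := p + 2)
          (by push_cast; ring)] using hC u hu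
  refine ⟨L, hL, fun N hN' => ?_⟩
  simpa only [Finset.sum_apply, Pi.smul_apply] using hN N hN'

/-- The radiation field on a Schwarzschild spacetime. -/
theorem DescribesExterior.exists_limit_schwarzschild (h : DescribesExterior M u₀ v₁ α E A)
    (hM : 0 < M) (hℓ : 2 ≤ ℓ) :
    ∃ L : ℝ → SphereTensor 2,
      (∀ u ≤ u₀, ∀ x : E3, ‖x‖ = 1 →
        Tendsto (fun v => areaRadius M u v • angularMode ℓ (α u v) x) atTop (𝓝 (L u x))) ∧
      (∃ C : ℝ, ∀ u ≤ u₀, ∀ x : E3, ‖x‖ = 1 →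
        ‖L u x - ((-1) ^ (ℓ + 1) * ((ℓ - 2).factorial / (ℓ + 2).factorial : ℝ) * (4 * M)
            * areaRadius M u v₁ ^ (-3 : ℤ)) • A ℓ x‖
          ≤ C * areaRadius M u v₁ ^ (-4 : ℤ)) := by
  have hd : M = 0 → u₀ < v₁ := fun h => (hM.ne' h).elim
  have hR := isRadius_radius_of_region hM.le hd
  have sα := h.solution.isSmoothField
  obtain ⟨n, z, φ, hz, hφ, hang⟩ := exists_angularMode_mem_interpolated ℓ
  obtain ⟨hA, -⟩ := h.mem_interpolated hM.le hd hℓ hz hang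
  have hfac : ((ℓ - 2).factorial / (ℓ + 2).factorial : ℝ)
      = (((ℓ : ℝ) * (ℓ + 1) - 2) * (ℓ * (ℓ + 1)))⁻¹ := by
    obtain ⟨m, rfl⟩ := Nat.exists_eq_add_of_le' hℓ
    have h0 : ((m.factorial : ℕ) : ℝ) ≠ 0 := by positivity
    have h1 : (((m + 2 : ℕ) : ℝ) * ((m + 2 : ℕ) + 1) - 2) = (m + 1) * (m + 4) := by push_cast; ring
    rw [h1, Nat.add_sub_cancel]
    simp only [Nat.factorial_succ]
    push_cast
    field_simp
    ring
  obtain ⟨L, hL, hN⟩ := exists_field_of_components (M := M) (α := α) (G := fun _ u =>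
      ((-1) ^ (ℓ + 1) * ((ℓ - 2).factorial / (ℓ + 2).factorial : ℝ) * (4 * M)
        * areaRadius M u v₁ ^ (-3 : ℤ)) • A ℓ) (b := fun _ u => areaRadius M u v₁ ^ (-4 : ℤ))
    hz hφ hang (fun N u hu => zpow_nonneg (areaRadius_pos hM.le hd hu le_rfl).le _)
    (fun N u => Submodule.smul_mem _ _ hA)
    fun x hx I => by
      obtain ⟨hΨ, hχ⟩ := h.tendsto_component hM.le hd hℓ hx I
      obtain ⟨C, hC⟩ := h.abs_sub_le hℓ le_rfl
      have hℓ' : (2 : ℝ) ≤ ℓ := by exact_mod_cast hℓ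
      have hf : ∀ u ≤ u₀, |l2Inner (weighted M α u v₁) (harmKernel ℓ x I)|
          ≤ (|E ℓ 2 x I| + |C| * (radius M (v₁ - u₀))⁻¹) * (radius M (v₁ - u))⁻¹ ^ (0 + 4) := by
        intro u hu
        have h1 := hC u hu x hx I
        have p1 := hR.inv_pos (t := v₁ - u) (by linarith)
        have p2 := hR.inv_anti (t := v₁ - u₀) (t' := v₁ - u) le_rfl (by linarith)
        have p3 := (lapseSq_pos hM.le hd hu (le_refl v₁))
        have p4 : lapseSq M u v₁ ≤ 1 := by
          rw [lapseSq_eq]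
          nlinarith
        rw [l2Inner_weighted_harmKernel ℓ (sα.smoothTensor hu le_rfl), abs_mul, abs_of_pos p3]
        rw [Finset.Icc_self, sum_singleton, areaRadius_eq] at h1
        rw [areaRadius_eq]
        generalize (radius M (v₁ - u))⁻¹ = a at *
        generalize radius M (v₁ - u) * angularMode ℓ (α u v₁) x I = y at *
        have h2 : |y| ≤ |E ℓ 2 x I| * a ^ 4 + C * a ^ 5 := by
          have h3 := abs_sub_abs_le_abs_sub y (a ^ (2 + 2) * E ℓ 2 x I)
          rw [abs_mul, abs_of_pos (pow_pos p1 _)] at h3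
          norm_num at h1 h3
          linarith
        have h3 : C * a ^ 5 ≤ |C| * (radius M (v₁ - u₀))⁻¹ * a ^ 4 := by
          rw [pow_succ', ← mul_assoc]
          gcongr
          exact le_abs_self C
        have h4 := mul_le_of_le_one_left (abs_nonneg y) p4
        norm_num
        linarith
      obtain ⟨L, K, hL⟩ := (h.solution.isMode hM.le hd
        (isTensorHarmonic_harmKernel ℓ x I)).exists_radiation_field hR (by nlinarith) (k := 0)
        (Or.inr rfl) hf hΨ hχ fun k' => exists_isProfile M (A ℓ x I) k' hℓ
      refine ⟨L, fun u hu => ?_, fun N _ => ⟨K, fun u hu => ?_⟩⟩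
      · have h1 : Tendsto (fun v => lapseSq M u v) atTop (𝓝 1) := by
          have := ((hR.tendsto_inv.comp (tendsto_atTop_add_const_right atTop (-u)
            tendsto_id)).const_mul (2 * M)).const_sub 1
          simpa [lapseSq_eq, sub_eq_add_neg, Function.comp_def] using this
        have h2 := (hL u hu).1.div h1 one_ne_zero
        rw [div_one] at h2
        refine h2.congr' ?_
        filter_upwards [eventually_ge_atTop v₁] with v hv
        simp only [Pi.div_apply]
        rw [l2Inner_weighted_harmKernel ℓ (sα.smoothTensor hu hv),
          mul_div_cancel_left₀ _ (lapseSq_pos hM.le hd hu hv).ne']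
      · have h1 := (hL u hu).2
        simp only [Pi.smul_apply, smul_eq_mul]
        rw [hfac, zpow_eq_inv_pow (k := -3) (m := 3) rfl, zpow_eq_inv_pow (k := -4) (m := 4) rfl,
          areaRadius_eq]
        rw [zero_add] at h1
        refine (le_of_eq ?_).trans h1
        congr 2
        rw [div_eq_mul_inv]
        ring
  obtain ⟨C, hC⟩ := hN 2 le_rfl
  exact ⟨L, hL, C, hC⟩

end

/-! ### Compactly supported incoming radiation -/

section

variable {M u₀ v₁ v₂ : ℝ} {α F G : Field} {P : ℝ → SphereTensor 2}

/-- The one-sided derivatives with respect to `v` do not depend on the region. -/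
theorem IsSmoothField.nablaV_eq_of_le (hF : IsSmoothField u₀ v₁ F) (hv : v₁ ≤ v₂)
    (hFG : ∀ u ≤ u₀, ∀ v ≥ v₂, ∀ x : E3, ‖x‖ = 1 → ∀ I, G u v x I = F u v x I) {u v : ℝ}
    (hu : u ≤ u₀) (hv' : v₂ ≤ v) {x : E3} (hx : ‖x‖ = 1) (I : Fin 2 → Fin 3) :
    TeukolskyScattering.nablaV v₂ G u v x I = TeukolskyScattering.nablaV v₁ F u v x I :=
  (((hF.hasDerivWithinAt_v hu (hv.trans hv') hx I).mono (Ici_subset_Ici.2 hv)).congr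
    (fun v hv => hFG u hu v hv x hx I) (hFG u hu v hv' x hx I)).derivWithin
    (uniqueDiffOn_Ici v₂ v hv')

theorem IsTeukolskySolution.restrict (h : IsTeukolskySolution M u₀ v₁ α) (hM : 0 ≤ M)
    (hd : M = 0 → u₀ < v₁) (hv : v₁ ≤ v₂) : IsTeukolskySolution M u₀ v₂ α where
  smooth := h.smooth.mono (prod_mono subset_rfl (prod_mono (Ici_subset_Ici.2 hv) subset_rfl))
  stf u hu v hv' := h.stf u hu v (hv.trans hv')
  teukolsky u hu v hv' x hx I := by
    have h1 := fun u' (hu' : u' ≤ u₀) => (h.isSmoothField.weighted hM hd).nablaV_eq_of_le hv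
      (fun _ _ _ _ _ _ _ => rfl) hu' hv' hx I
    rw [← h.teukolsky u hu v (hv.trans hv') x hx I]
    exact derivWithin_congr (fun u' hu' => by simp only [h1 u' hu']) (by simp only [h1 u hu])

theorem IsTeukolskySolution.PsiBar_eq_of_le (h : IsTeukolskySolution M u₀ v₁ α) (hM : 0 ≤ M)
    (hd : M = 0 → u₀ < v₁) (hv : v₁ ≤ v₂) : ∀ u ≤ u₀, ∀ v ≥ v₂, ∀ x : E3, ‖x‖ = 1 → ∀ I,
      PsiBar M v₂ α u v x I = PsiBar M v₁ α u v x I := by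
  have sw := h.isSmoothField.weighted hM hd
  intro u hu v hv' x hx I
  refine congrArg (_ * ·) ((sw.scaledNablaV hM hd).nablaV_eq_of_le hv ?_ hu hv' hx I)
  intro u hu v hv' x hx I
  exact congrArg (_ * ·) (sw.nablaV_eq_of_le hv (fun _ _ _ _ _ _ _ => rfl) hu hv' hx I)

theorem HasIncomingRadiation.restrict (h : HasIncomingRadiation M v₁ α P) (hM : 0 ≤ M)
    (hd : M = 0 → u₀ < v₁) (hα : IsTeukolskySolution M u₀ v₁ α)
    (hP : IsSmoothField u₀ v₁ fun _ => P) (hv : v₁ ≤ v₂)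
    (hP0 : ∀ v ≥ v₂, ∀ x : E3, ‖x‖ = 1 → P v x = 0) : HasIncomingRadiation M v₂ α 0 := by
  have sΨ : IsSmoothField u₀ v₁ (PsiBar M v₁ α) :=
    ((hα.isSmoothField.weighted hM hd).scaledNablaV hM hd).scaledNablaV hM hd
  have sF : IsSmoothField u₀ v₁ fun u v => nablaV v₁ (PsiBar M v₁ α) u v - P v :=
    fun I => (sΨ.nablaV I).sub (hP I)
  intro V hV
  have hc : ∀ u ≤ u₀, ∀ a ≥ v₁, ContinuousOn (fun v => l2Inner
      (nablaV v₁ (PsiBar M v₁ α) u v - P v) (nablaV v₁ (PsiBar M v₁ α) u v - P v)) (Icc a V) :=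
    fun u hu a ha => (sF.continuousOn_l2Inner sF).comp (f := fun v => (u, v)) (by fun_prop)
      fun v hv => ⟨hu, ha.trans hv.1⟩
  refine squeeze_zero' (Eventually.of_forall fun u =>
    intervalIntegral.integral_nonneg hV fun v _ => l2Inner_self_nonneg) ?_ (h V (hv.trans hV))
  filter_upwards [eventually_le_atBot u₀] with u hu
  rw [← intervalIntegral.integral_add_adjacent_intervals (b := v₂)
    (((hc u hu v₁ le_rfl).mono (Icc_subset_Icc_right hV)).intervalIntegrable_of_Icc hv)
    ((hc u hu v₂ hv).intervalIntegrable_of_Icc hV)]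
  refine le_add_of_nonneg_of_le
    (intervalIntegral.integral_nonneg hv fun v _ => l2Inner_self_nonneg) (le_of_eq ?_)
  refine integral_congr fun v hv' => ?_
  rw [uIcc_of_le hV] at hv'
  have h1 : ∀ x : E3, ‖x‖ = 1 → (nablaV v₂ (PsiBar M v₂ α) u v - (0 : ℝ → SphereTensor 2) v) x
      = (nablaV v₁ (PsiBar M v₁ α) u v - P v) x := fun x hx => by
    ext I
    simp [hP0 v hv'.1 x hx, sΨ.nablaV_eq_of_le hv (hα.PsiBar_eq_of_le hM hd hv) hu hv'.1 hx I]
  simp only [l2Inner, h1 _ (norm_coe_sphere _)]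

theorem l2Inner_eq_zero {S : SphereTensor 2} (h : ∀ x : E3, ‖x‖ = 1 → S x = 0)
    (K : SphereTensor 2) : l2Inner S K = 0 := by
  simp [l2Inner, h _ (norm_coe_sphere _)]

/-- The component of degree `ℓ` of a solution which arises from incoming radiation: the limit of
`Ψ̲` on the cone `v = v₂`, and the asymptotic expansion of `r α̲` there. -/
theorem ArisesFromCompactRadiation.component (h : ArisesFromCompactRadiation M u₀ v₁ v₂ α P)
    (hM : 0 ≤ M) (hd : M = 0 → u₀ < v₁) (hv : v₁ ≤ v₂) (hP : IsSmoothField u₀ v₁ fun _ => P)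
    (ℓ : ℕ) (x : E3) (I : Fin 2 → Fin 3) :
    Tendsto (fun u => l2Inner (PsiBar M v₁ α u v₂) (harmKernel ℓ x I)) atBot
      (𝓝 (∫ v in v₁..v₂, l2Inner (P v) (harmKernel ℓ x I))) ∧
    ∃ E : ℕ → ℝ, ∀ N : ℕ, 2 ≤ N → ∃ C, ∀ u ≤ u₀,
      |areaRadius M u v₂ * angularMode ℓ (α u v₂) x I
        - ∑ p ∈ Finset.Icc 2 N, (areaRadius M u v₂)⁻¹ ^ (p + 2) * E p|
      ≤ C * (areaRadius M u v₂)⁻¹ ^ (N + 3) := by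
  have sα := h.solution.isSmoothField
  have hK := isTensorHarmonic_harmKernel ℓ x I
  obtain ⟨h1, E, hE⟩ := (h.solution.isMode hM hd hK).exists_expansion_of_trivial
    (isRadius_radius_of_region hM hd) hv
    (fun u hu => l2Inner_eq_zero (fun x hx => by
      ext I; simp [weighted, h.trivial u hu x hx]) _)
    (l2Inner_eq_zero h.trivial_psi _) (l2Inner_eq_zero h.trivial_Psi _)
    (P := fun v => l2Inner (P v) (harmKernel ℓ x I))
    ((hP.continuousOn_l2Inner (.const hK.smooth)).comp (f := fun v => (u₀, v)) (by fun_prop)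
      fun v hv => ⟨le_refl u₀, hv⟩)
    (h.radiation.tendsto_integral_l2Inner hM hd sα hP hK.smooth hv)
  refine ⟨h1, E, fun N hN => ?_⟩
  obtain ⟨C, hC⟩ := hE N hN
  refine ⟨C, fun u hu => ?_⟩
  have h2 := hC u hu
  rwa [l2Inner_weighted_harmKernel ℓ (sα.smoothTensor hu hv), ← lapseSq_eq,
    inv_mul_cancel_left₀ (lapseSq_pos hM hd hu hv).ne'] at h2

/-- Incoming radiation supported in `v₁ ≤ v ≤ v₂` produces the exterior of a compactly supported
perturbation. -/
theorem ArisesFromCompactRadiation.describesExterior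
    (h : ArisesFromCompactRadiation M u₀ v₁ v₂ α P) (hM : 0 ≤ M) (hd : M = 0 → u₀ < v₁)
    (hv : v₁ ≤ v₂) : ∃ E : ℕ → ℕ → SphereTensor 2, DescribesExterior M u₀ v₂ α E
      (fun ℓ x => (1 / 2 : ℝ) • ∫ v in v₁..v₂, angularMode ℓ (P v) x) := by
  have hd₂ : M = 0 → u₀ < v₂ := fun h => (hd h).trans_le hv
  have sP : IsSmoothField u₀ v₁ fun _ => P := fun I => (contDiffOn_pi.1 h.smooth I).comp
    (f := fun p : ℝ × ℝ × E3 => (p.2.1, p.2.2)) (by fun_prop) fun p hp => ⟨hp.2.1, hp.2.2⟩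
  have hα := h.solution
  have hα₂ := hα.restrict hM hd hv
  have hexp : ∀ ℓ : ℕ, ∃ E : ℕ → SphereTensor 2, ∀ N : ℕ, 2 ≤ N → ∃ C : ℝ, ∀ u ≤ u₀, ∀ x : E3,
      ‖x‖ = 1 → ‖areaRadius M u v₂ • angularMode ℓ (α u v₂) x
        - ∑ p ∈ Finset.Icc 2 N, areaRadius M u v₂ ^ (-2 - (p : ℤ)) • E p x‖
      ≤ C * areaRadius M u v₂ ^ (-3 - (N : ℤ)) := fun ℓ => by
    obtain ⟨n, z, φ, hz, hφ, hang⟩ := exists_angularMode_mem_interpolated ℓ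
    choose E hE using fun k => (h.component hM hd hv sP ℓ (z k).1 (z k).2).2
    refine ⟨fun p x I => ∑ k, E k p * φ k x I, fun N hN => exists_norm_le_of_interpolation
      (F := fun u x => areaRadius M u v₂ • angularMode ℓ (α u v₂) x - ∑ p ∈ Finset.Icc 2 N,
        areaRadius M u v₂ ^ (-2 - (p : ℤ)) • fun I => ∑ k, E k p * φ k x I)
      (e := fun u k => areaRadius M u v₂ * angularMode ℓ (α u v₂) (z k).1 (z k).2
        - ∑ p ∈ Finset.Icc 2 N, (areaRadius M u v₂)⁻¹ ^ (p + 2) * E k p) hφ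
      (fun u hu => zpow_nonneg (areaRadius_pos hM hd hu hv).le _) (fun u hu x hx I => ?_)
      fun k => ?_⟩
    · simp only [Pi.sub_apply, Pi.smul_apply, Finset.sum_apply, smul_eq_mul, sub_mul,
        sum_sub_distrib, hang (α u v₂) x hx I, mul_sum, sum_mul, mul_assoc,
        fun p : ℕ => zpow_eq_inv_pow (r := areaRadius M u v₂) (k := -2 - (p : ℤ)) (m := p + 2)
          (by push_cast; ring)]
      rw [sum_comm]
    · obtain ⟨C, hC⟩ := hE k N hN
      refine ⟨C, fun u hu => ?_⟩
      rw [zpow_eq_inv_pow (m := N + 3) (by push_cast; ring)]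
      exact hC u hu
  choose E hE using hexp
  refine ⟨E, hα₂, h.radiation.restrict hM hd hα sP hv h.support, fun ℓ _ => hE ℓ,
    fun ℓ _ x hx => tendsto_pi_nhds.2 fun I => ?_⟩
  have hPK : ∀ v ≥ v₁, ∀ I, angularMode ℓ (P v) x I = l2Inner (P v) (harmKernel ℓ x I) :=
    fun v hv I => angularMode_eq_l2Inner ℓ (sP.smoothTensor le_rfl hv) x I
  have hint : IntervalIntegrable (fun v => angularMode ℓ (P v) x) volume v₁ v₂ := by
    refine ContinuousOn.intervalIntegrable_of_Icc hv (continuousOn_pi.2 fun I => ?_)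
    exact ((sP.continuousOn_l2Inner (.const (isTensorHarmonic_harmKernel ℓ x I).smooth)).comp
      (f := fun v => (u₀, v)) (by fun_prop) fun v hv => ⟨le_refl u₀, hv.1⟩).congr
      fun v hv => hPK v hv.1 I
  have h1 : (∫ v in v₁..v₂, angularMode ℓ (P v) x) I
      = ∫ v in v₁..v₂, l2Inner (P v) (harmKernel ℓ x I) := by
    rw [← integral_congr fun v hv' => hPK v (by
      rw [uIcc_of_le hv] at hv'; exact hv'.1) I]
    exact ((ContinuousLinearMap.proj (R := ℝ) (φ := fun _ : Fin 2 → Fin 3 => ℝ)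
      I).intervalIntegral_comp_comm hint).symm
  simp only [Pi.smul_apply, smul_smul, h1]
  norm_num
  refine (h.component hM hd hv sP ℓ x I).1.congr' ?_
  filter_upwards [eventually_le_atBot u₀] with u hu
  have sΨ : IsSmoothField u₀ v₂ (PsiBar M v₂ α) :=
    ((hα₂.isSmoothField.weighted hM hd₂).scaledNablaV hM hd₂).scaledNablaV hM hd₂
  rw [angularMode_eq_l2Inner ℓ (sΨ.smoothTensor hu le_rfl)]
  exact l2Inner_congr_left (fun x hx I =>
    (hα.PsiBar_eq_of_le hM hd hv u hu v₂ le_rfl x hx I).symm) _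

end

/-! ### A solution with prescribed expansion coefficients -/

theorem derivative_iterate_rodrigues (ℓ : ℕ) (t : ℝ) : (derivative^[ℓ + ℓ]
    (((X : ℝ[X]) ^ 2 - 1) ^ ℓ)).eval t = (ℓ + ℓ).factorial := by
  have hm : ((X : ℝ[X]) ^ 2 - 1).Monic := by
    simpa using monic_X_pow_sub_C (1 : ℝ) two_ne_zero
  have hdeg : (((X : ℝ[X]) ^ 2 - 1) ^ ℓ).natDegree = ℓ + ℓ := by
    have h : ((X : ℝ[X]) ^ 2 - 1).natDegree = 2 := by
      simpa using natDegree_X_pow_sub_C (n := 2) (r := (1 : ℝ))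
    rw [hm.natDegree_pow, h, mul_two]
  have h1 := natDegree_iterate_derivative
    (((X : ℝ[X]) ^ 2 - 1) ^ ℓ) (ℓ + ℓ)
  rw [hdeg, Nat.sub_self] at h1
  have h2 := (hm.pow ℓ).coeff_natDegree
  rw [hdeg] at h2
  rw [eq_C_of_natDegree_le_zero h1, eval_C,
    coeff_iterate_derivative, zero_add, h2, Nat.descFactorial_self]
  simp

/-- For `m = ℓ` the potential is a multiple of `Re (x₀ + i x₁)^ℓ`. -/
theorem harmE_self_ne_zero {ℓ : ℕ} (hℓ : 2 ≤ ℓ) :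
    harmE ℓ ℓ (EuclideanSpace.single 0 1) ![2, 2] ≠ 0 := by
  obtain ⟨c, hc0, hc⟩ : ∃ c : ℝ, c ≠ 0 ∧ ∀ x : E3, ∀ I : Fin 0 → Fin 3,
      realSphHarm ℓ ℓ x I = c * ((⟨x 0, x 1⟩ : ℂ) ^ ℓ).re := by
    refine ⟨_, ?_, fun x I => by
      rw [realSphHarm, if_pos (Int.natCast_nonneg ℓ), Int.natAbs_natCast,
        derivative_iterate_rodrigues]⟩
    have h1 : (if (ℓ : ℤ) = 0 then 1 else 2 : ℝ) ≠ 0 := by split_ifs <;> norm_num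
    have h2 : 0 < Real.sqrt ((if (ℓ : ℤ) = 0 then 1 else 2) * ((2 * ℓ + 1) / (4 * Real.pi))
        * ((ℓ - ℓ).factorial / (ℓ + ℓ).factorial)) := by
      rw [Real.sqrt_pos, if_neg (by omega)]
      have := Real.pi_pos
      positivity
    have h3 : ((ℓ + ℓ).factorial : ℝ) ≠ 0 := by positivity
    have h4 : (2 ^ ℓ * ℓ.factorial : ℝ) ≠ 0 := by positivity
    exact mul_ne_zero (div_ne_zero h2.ne' h4) h3
  have hx : ‖(EuclideanSpace.single 0 1 : E3)‖ = 1 := by simp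
  have h2 := fun y (hy : y ≠ 0) => ((re_im_pow_properties ℓ).2.2 y hy).2.2.1
  have hs := (isSolidHarmonic_re_im_pow ℓ).1
  have h3 : ∀ y : E3, y ≠ 0 → pd 2 (fun y => c * ((⟨y 0, y 1⟩ : ℂ) ^ ℓ).re) y = 0 := fun y hy => by
    rw [pd_const_mul c hs.smooth hy, h2 y hy, mul_zero]
  have h4 := adjD2_adjD1_electric (hs.const_mul c) (fun x _ I => hc x I) hx 2 2
  rw [h3 _ (ne_zero_of_unit hx), pd_congr h3 (ne_zero_of_unit hx), pd_const] at h4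
  have hℓ' : (2 : ℝ) ≤ ℓ := by exact_mod_cast hℓ
  have h5 : harmNorm ℓ ≠ 0 := mul_ne_zero
    (inv_ne_zero (Real.sqrt_pos.2 (by nlinarith)).ne')
    (inv_ne_zero (Real.sqrt_pos.2 (by nlinarith)).ne')
  simp only [harmE, Pi.smul_apply, smul_eq_mul, h4]
  refine mul_ne_zero h5 ?_
  have h6 : (⟨1, 0⟩ : ℂ) = 1 := rfl
  have h7 : (ℓ : ℝ) - 1 ≠ 0 := by linarith
  have h8 : (ℓ : ℝ) ≠ 0 := by linarith
  simp [h6, hc0, h7, h8]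

theorem angularMode_mul (ℓ : ℕ) (c : ℝ) (S : SphereTensor 2) :
    angularMode ℓ (fun x I => c * S x I) = c • angularMode ℓ S := by
  simp only [angularMode, l2Inner_mul_left, Finset.smul_sum, smul_add, smul_smul]

theorem exists_angularMode_harmE_ne_zero {ℓ : ℕ} (hℓ : 2 ≤ ℓ) :
    ∃ x : E3, ‖x‖ = 1 ∧ angularMode ℓ (harmE ℓ ℓ) x ≠ 0 := by
  by_contra! hc
  have hs := fun m (hm : m ∈ Finset.Icc (-(ℓ : ℤ)) ℓ) =>
    isTensorHarmonic_harm (natAbs_le_of_mem_Icc hm)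
  have hmem : (ℓ : ℤ) ∈ Finset.Icc (-(ℓ : ℤ)) ℓ := Finset.mem_Icc.2 ⟨by omega, le_rfl⟩
  have hH : IsSmoothTensor (harmE ℓ ℓ) := (hs _ hmem).1.smooth
  have h0 := l2Inner_eq_zero hc (harmE ℓ ℓ)
  rw [l2Inner_comm, angularMode, l2Inner_sum_right _ hH fun m hm =>
    (((hs m hm).1.smul _).add ((hs m hm).2.smul _)).smooth] at h0
  rw [sum_congr rfl fun m hm => by rw [l2Inner_add_right hH
    ((hs m hm).1.smul _).smooth ((hs m hm).2.smul _).smooth, l2Inner_smul_right,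
    l2Inner_smul_right]] at h0
  have h1 := (Finset.sum_eq_zero_iff_of_nonneg fun m _ =>
    add_nonneg (mul_self_nonneg _) (mul_self_nonneg _)).1 h0 _ hmem
  have h2 := l2Inner_self_pos hH (x := EuclideanSpace.single 0 1) (by simp)
    (harmE_self_ne_zero hℓ)
  nlinarith [mul_self_nonneg (l2Inner (harmE ℓ ℓ) (harmH ℓ ℓ))]

section

variable {u₀ v₁ : ℝ}

theorem areaRadius_zero_eq (hd : u₀ < v₁) {u v : ℝ} (hu : u ≤ u₀) (hv : v₁ ≤ v) :
    areaRadius 0 u v = v - u := by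
  rw [areaRadius_eq, radius_zero (by linarith)]

/-- `∇_v` of a multiple of a fixed tensor field. -/
theorem nablaV_mul {F : Field} {H : SphereTensor 2} {c d : ℝ → ℝ → ℝ}
    (hF : ∀ u ≤ u₀, ∀ v ≥ v₁, ∀ x I, F u v x I = c u v * H x I)
    (hc : ∀ u ≤ u₀, ∀ v ≥ v₁, HasDerivWithinAt (fun v => c u v) (d u v) (Ici v₁) v) :
    ∀ u ≤ u₀, ∀ v ≥ v₁, ∀ x I, nablaV v₁ F u v x I = d u v * H x I := fun u hu v hv x I =>
  (((hc u hu v hv).mul_const (H x I)).congr (fun v hv => hF u hu v hv x I)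
    (hF u hu v hv x I)).derivWithin (uniqueDiffOn_Ici v₁ v hv)

theorem scaledNablaV_zero_mul (hd : u₀ < v₁) {F : Field} {H : SphereTensor 2} {c d : ℝ → ℝ → ℝ}
    (hF : ∀ u ≤ u₀, ∀ v ≥ v₁, ∀ x I, F u v x I = c u v * H x I)
    (hc : ∀ u ≤ u₀, ∀ v ≥ v₁, HasDerivWithinAt (fun v => c u v)
      ((1 - 2 * 0 * (radius 0 (v - u))⁻¹) * (radius 0 (v - u))⁻¹ ^ 2 * d u v) (Ici v₁) v) :
    ∀ u ≤ u₀, ∀ v ≥ v₁, ∀ x I, scaledNablaV 0 v₁ F u v x I = d u v * H x I :=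
  fun u hu v hv x I => by
    have h := (areaRadius_pos le_rfl (fun _ => hd) hu hv).ne'
    rw [scaledNablaV, nablaV_mul hF hc u hu v hv, lapseSq, ← areaRadius_eq]
    generalize areaRadius 0 u v = r at *
    simp only [mul_zero, zero_mul, zero_div, sub_zero, one_mul, div_one]
    field_simp

/-- The exact modes on Minkowski space satisfy the conditions which are imposed on the modes of the
exterior of a compactly supported perturbation. -/
theorem exists_isMode_zero (hd : u₀ < v₁) (ℓ : ℕ) {p : ℕ} (hp : 2 ≤ p) :
    ∃ f ψ Ψ χ : ℝ → ℝ → ℝ, IsMode 0 (ℓ * (ℓ + 1)) u₀ v₁ (radius 0) f ψ Ψ χ ∧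
      ContDiffOn ℝ ∞ (Function.uncurry f) (Iic u₀ ×ˢ Ici v₁) ∧
      (∀ u ≤ u₀, f u v₁ = (areaRadius 0 u v₁)⁻¹ ^ (p + 2)) ∧
      Tendsto (fun u => Ψ u v₁) atBot (𝓝 0) ∧
      ∀ V ≥ v₁, Tendsto (fun u => ∫ v in v₁..V, χ u v ^ 2) atBot (𝓝 0) := by
  have hd' : (0 : ℝ) = 0 → u₀ < v₁ := fun _ => hd
  have hR := isRadius_radius_of_region le_rfl hd'
  have hm := hR.isMode_scatPoly ℓ hp
  obtain ⟨B, hB⟩ := hR.exists_abs_chi_scatPoly_le ℓ hp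
  have hpos : ∀ u ≤ u₀, ∀ v ≥ v₁, 0 < areaRadius 0 u v := fun u hu v hv =>
    areaRadius_pos le_rfl hd' hu hv
  have hdiv : ∀ u ≤ u₀, 1 - (radius 0 (v₁ - u))⁻¹ / (radius 0 (v₁ - u))⁻¹ = 0 := fun u hu => by
    have h1 := (inv_pos.2 (hpos u hu v₁ le_rfl)).ne'
    rw [areaRadius_eq] at h1
    rw [div_self h1, sub_self]
  refine ⟨_, _, _, _, hm, ?_, fun u hu => ?_, ?_, fun V hV => ?_⟩
  · have h1 : ContDiffOn ℝ ∞ (fun q : ℝ × ℝ => (areaRadius 0 q.1 q.2)⁻¹) (Iic u₀ ×ˢ Ici v₁) :=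
      (contDiffOn_areaRadius le_rfl hd').inv fun q hq => (hpos _ hq.1 _ hq.2).ne'
    have h2 : ContDiffOn ℝ ∞ (fun q : ℝ × ℝ => (areaRadius 0 q.1 v₁)⁻¹) (Iic u₀ ×ˢ Ici v₁) :=
      h1.comp (f := fun q : ℝ × ℝ => (q.1, v₁)) (by fun_prop) fun q hq => ⟨hq.1, le_refl v₁⟩
    have h3 : ContDiff ℝ ∞ fun t : ℝ => (scatPoly ℓ p).eval t := by
      simpa [coe_aeval_eq_eval] using (scatPoly ℓ p).contDiff_aeval (𝕜 := ℝ) ∞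
    exact (h2.pow (p + 2)).mul (h3.comp_contDiffOn (contDiffOn_const.sub
      (h1.div h2 fun q hq => (inv_pos.2 (hpos _ hq.1 _ le_rfl)).ne')))
  · simp only [hdiv u hu, eval_zero_scatPoly, mul_one, areaRadius_eq]
  · have h1 := ((hR.tendsto_inv_atBot v₁).pow p).mul_const
      ((derivative (derivative (scatPoly ℓ p))).eval 0)
    rw [zero_pow (by omega), zero_mul] at h1
    refine h1.congr' ?_
    filter_upwards [eventually_le_atBot u₀] with u hu
    simp only [hdiv u hu]
  · exact hR.tendsto_integral_sq_of_sub (χ := fun _ _ => 0) hV continuousOn_const hm.cont_χ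
      (fun u hu v hv => by rw [zero_sub, abs_neg]; exact hB u hu v hv) (by simp)

/-- On Minkowski space, every coefficient of the expansion is nonzero for some solution: a
multiple of a tensor harmonic with data `r₀^(-2-p)`. -/
theorem exists_describesExterior (hd : u₀ < v₁) {ℓ p : ℕ} (hℓ : 2 ≤ ℓ) (hp : 2 ≤ p) :
    ∃ (α : Field) (E : ℕ → ℕ → SphereTensor 2) (A : ℕ → SphereTensor 2),
      DescribesExterior 0 u₀ v₁ α E A ∧ ∃ x : E3, ‖x‖ = 1 ∧ E ℓ p x ≠ 0 := by
  have hd' : (0 : ℝ) = 0 → u₀ < v₁ := fun _ => hd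
  obtain ⟨f, ψ, Ψ, χ, hm, hf_cont, hfv, hΨ, hχ⟩ := exists_isMode_zero hd ℓ hp
  have hH : IsTensorHarmonic (2 - (ℓ : ℝ) * (ℓ + 1)) (harmE ℓ ℓ) :=
    (isTensorHarmonic_harm (by simp)).1
  have hH0 := exists_angularMode_harmE_ne_zero hℓ
  have hpos : ∀ u ≤ u₀, ∀ v ≥ v₁, 0 < areaRadius 0 u v := fun u hu v hv =>
    areaRadius_pos le_rfl hd' hu hv
  generalize harmE ℓ ℓ = H at *
  obtain ⟨α, hα⟩ : ∃ α : Field, α = fun u v x I => f u v / areaRadius 0 u v * H x I := ⟨_, rfl⟩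
  have hw : ∀ u ≤ u₀, ∀ v ≥ v₁, ∀ x I, weighted 0 α u v x I = f u v * H x I := by
    intro u hu v hv x I
    have h1 := (hpos u hu v hv).ne'
    simp only [weighted, hα, lapseSq, mul_zero, zero_div, sub_zero, mul_one]
    field_simp
  have hψH := scaledNablaV_zero_mul hd hw hm.f_v
  have hΨH := scaledNablaV_zero_mul hd hψH hm.ψ_v
  have hχH := nablaV_mul hΨH hm.Ψ_v
  refine ⟨α, fun ℓ' q => if q = p then angularMode ℓ' H else 0, fun _ => 0, ⟨⟨?_, ?_, ?_⟩, ?_, ?_,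
    ?_⟩, ?_⟩
  · rw [hα]
    exact contDiffOn_pi.2 fun I => (IsSmoothField.const hH.smooth).mul
      (c := fun u v => f u v / areaRadius 0 u v) (hf_cont.div
      (contDiffOn_areaRadius le_rfl hd') fun q hq => (hpos _ hq.1 _ hq.2).ne') I
  · intro u _ v _
    rw [hα]
    exact (hH.smul _).stf
  · intro u hu v hv x hx I
    have h1 : ∀ u ≤ u₀, areaRadius 0 u v ^ 4 / lapseSq 0 u v ^ 2 * nablaV v₁ (weighted 0 α) u v x I
        = (v - u) ^ 2 * ψ u v * H x I := fun u hu => by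
      have h2 := (hpos u hu v hv).ne'
      rw [nablaV_mul hw hm.f_v u hu v hv, lapseSq, ← areaRadius_eq,
        ← areaRadius_zero_eq hd hu hv]
      generalize areaRadius 0 u v = r at *
      simp only [mul_zero, zero_mul, zero_div, sub_zero, one_mul, div_one, one_pow]
      field_simp
    have h3 := (((((hasDerivAt_id' u).const_sub v).fun_pow 2).hasDerivWithinAt (s := Iic u₀)).mul
      (hm.ψ_u u hu v hv)).mul_const (H x I)
    have h4 := (h3.congr h1 (h1 u hu)).derivWithin (uniqueDiffOn_Iic u₀ u hu)
    have h5 : sphereLaplacian (α u v) x I = (2 - (ℓ : ℝ) * (ℓ + 1) + 2)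
        * (f u v / areaRadius 0 u v * H x I) := by
      rw [hα]
      exact (hH.smul (f u v / areaRadius 0 u v)).sphereLaplacian_eq hx I
    rw [nablaU, h4, h5, hα]
    beta_reduce
    have h2 := (hpos u hu v hv).ne'
    rw [← areaRadius_eq, ← areaRadius_zero_eq hd hu hv]
    generalize areaRadius 0 u v = r at *
    simp only [mul_zero, zero_mul, sub_zero, add_zero]
    field_simp
    norm_num
    ring
  · intro V hV
    have h1 := (hχ V hV).mul_const (l2Inner H H)
    rw [zero_mul] at h1
    refine h1.congr' ?_
    filter_upwards [eventually_le_atBot u₀] with u hu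
    rw [← intervalIntegral.integral_mul_const]
    refine integral_congr fun v hv => ?_
    rw [uIcc_of_le hV] at hv
    have h2 : nablaV v₁ (PsiBar 0 v₁ α) u v - (0 : ℝ → SphereTensor 2) v
        = fun x I => χ u v * H x I := by
      ext x I
      exact (sub_zero _).trans (hχH u hu v hv.1 x I)
    simp only [h2]
    rw [l2Inner_mul_left, l2Inner_comm H fun x I => χ u v * H x I, l2Inner_mul_left]
    ring
  · intro ℓ' hℓ' N hN
    have hα' : ∀ u ≤ u₀, ∀ x, areaRadius 0 u v₁ • angularMode ℓ' (α u v₁) x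
        = (areaRadius 0 u v₁)⁻¹ ^ (p + 2) • angularMode ℓ' H x := fun u hu x => by
      have h2 := (hpos u hu v₁ le_rfl).ne'
      rw [hα, angularMode_mul, Pi.smul_apply, smul_smul, mul_div_cancel₀ _ h2, hfv u hu]
    have hE : ∀ u (x : E3), ∑ q ∈ Finset.Icc 2 N, areaRadius 0 u v₁ ^ (-2 - (q : ℤ))
        • (if q = p then angularMode ℓ' H else 0) x
        = if p ≤ N then (areaRadius 0 u v₁)⁻¹ ^ (p + 2) • angularMode ℓ' H x else 0 :=
      fun u x => by
        simp only [ite_apply, Pi.zero_apply, smul_ite, smul_zero, Finset.sum_ite_eq',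
          Finset.mem_Icc, hp, true_and, zpow_eq_inv_pow (r := areaRadius 0 u v₁)
          (k := -2 - (p : ℤ)) (m := p + 2) (by push_cast; ring)]
    by_cases hpN : p ≤ N
    · refine ⟨0, fun u hu x hx => ?_⟩
      rw [hα' u hu, hE, if_pos hpN, sub_self, norm_zero, zero_mul]
    · obtain ⟨n, rfl⟩ : ∃ n, p = N + 1 + n := ⟨p - (N + 1), by omega⟩
      obtain ⟨B, hB⟩ := IsSmoothTensor.exists_bound (T := angularMode ℓ' H)
        (IsTensorHarmonic.sum _ fun m hm =>
          ((isTensorHarmonic_harm (natAbs_le_of_mem_Icc hm)).1.smul _).add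
            ((isTensorHarmonic_harm (natAbs_le_of_mem_Icc hm)).2.smul _)).smooth
      refine ⟨(areaRadius 0 u₀ v₁)⁻¹ ^ n * |B|, fun u hu x hx => ?_⟩
      have h1 := hpos u hu v₁ le_rfl
      have h2 : (areaRadius 0 u v₁)⁻¹ ≤ (areaRadius 0 u₀ v₁)⁻¹ :=
        inv_anti₀ (hpos u₀ le_rfl v₁ le_rfl) (by
          rw [areaRadius_zero_eq hd hu le_rfl, areaRadius_zero_eq hd le_rfl le_rfl]; linarith)
      have h3 : ‖angularMode ℓ' H x‖ ≤ |B| := (pi_norm_le_iff_of_nonneg (abs_nonneg B)).2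
        fun I => (hB x hx I).trans (le_abs_self B)
      rw [hα' u hu, hE, if_neg hpN, sub_zero, norm_smul, Real.norm_eq_abs,
        abs_of_pos (pow_pos (inv_pos.2 h1) _), zpow_eq_inv_pow (m := N + 3) (by push_cast; ring)]
      calc (areaRadius 0 u v₁)⁻¹ ^ (N + 1 + n + 2) * ‖angularMode ℓ' H x‖
          ≤ (areaRadius 0 u v₁)⁻¹ ^ (N + 1 + n + 2) * |B| := by gcongr
        _ = (areaRadius 0 u v₁)⁻¹ ^ n * |B| * (areaRadius 0 u v₁)⁻¹ ^ (N + 3) := by ring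
        _ ≤ _ := by gcongr
  · intro ℓ' _ x _
    have h1 := hΨ.smul_const (angularMode ℓ' H x)
    rw [zero_smul] at h1
    simp only [Pi.zero_apply, smul_zero]
    refine h1.congr' ?_
    filter_upwards [eventually_le_atBot u₀] with u hu
    rw [show PsiBar 0 v₁ α u v₁ = fun x I => Ψ u v₁ * H x I from
      funext fun x => funext fun I => hΨH u hu v₁ le_rfl x I, angularMode_mul, Pi.smul_apply]
  · simpa using hH0

end

end TeukolskyScattering

open TeukolskyScattering in
theorem mainTheorem11 :
    -- Minkowski
    (∀ (u₀ v₁ : ℝ), u₀ < v₁ → ∀ (α : Field) (E : ℕ → ℕ → SphereTensor 2)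
        (A : ℕ → SphereTensor 2), DescribesExterior 0 u₀ v₁ α E A → ∀ ℓ : ℕ, 2 ≤ ℓ →
      ∃ L : ℝ → SphereTensor 2,
        (∀ u ≤ u₀, ∀ x : E3, ‖x‖ = 1 →
          Tendsto (fun v => areaRadius 0 u v • angularMode ℓ (α u v) x) atTop (𝓝 (L u x))) ∧
        (∀ N : ℕ, 2 ≤ N → ∃ C : ℝ, ∀ u ≤ u₀, ∀ x : E3, ‖x‖ = 1 →
          ‖L u x - ∑ p ∈ Finset.Icc 2 N,
              (coeffS ℓ p (ℓ + 2) 0 (-2) * areaRadius 0 u v₁ ^ (-2 - (p : ℤ))) • E ℓ p x‖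
            ≤ C * areaRadius 0 u v₁ ^ (-3 - (N : ℤ))) ∧
        (∃ C : ℝ, ∀ u ≤ u₀, ∀ x : E3, ‖x‖ = 1 →
          ‖L u x - (coeffS ℓ (ℓ + 1) (ℓ + 2) 0 (-2) * areaRadius 0 u v₁ ^ (-3 - (ℓ : ℤ)))
              • E ℓ (ℓ + 1) x‖
            ≤ C * areaRadius 0 u v₁ ^ (-4 - (ℓ : ℤ)))) ∧
    -- vanishing of the constants
    (∀ ℓ p : ℕ, 2 ≤ ℓ → 2 ≤ p → (coeffS ℓ p (ℓ + 2) 0 (-2) = 0 ↔ p ≤ ℓ)) ∧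
    -- the coefficients are generically nonvanishing
    (∀ (u₀ v₁ : ℝ), u₀ < v₁ → ∀ ℓ p : ℕ, 2 ≤ ℓ → 2 ≤ p →
      ∃ (α : Field) (E : ℕ → ℕ → SphereTensor 2) (A : ℕ → SphereTensor 2),
        DescribesExterior 0 u₀ v₁ α E A ∧ ∃ x : E3, ‖x‖ = 1 ∧ E ℓ p x ≠ 0) ∧
    -- Schwarzschild with positive mass
    (∀ (M u₀ v₁ : ℝ), 0 < M → ∀ (α : Field) (E : ℕ → ℕ → SphereTensor 2)
        (A : ℕ → SphereTensor 2), DescribesExterior M u₀ v₁ α E A → ∀ ℓ : ℕ, 2 ≤ ℓ →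
      ∃ L : ℝ → SphereTensor 2,
        (∀ u ≤ u₀, ∀ x : E3, ‖x‖ = 1 →
          Tendsto (fun v => areaRadius M u v • angularMode ℓ (α u v) x) atTop (𝓝 (L u x))) ∧
        (∃ C : ℝ, ∀ u ≤ u₀, ∀ x : E3, ‖x‖ = 1 →
          ‖L u x - ((-1) ^ (ℓ + 1) * ((ℓ - 2).factorial / (ℓ + 2).factorial : ℝ) * (4 * M)
              * areaRadius M u v₁ ^ (-3 : ℤ)) • A ℓ x‖
            ≤ C * areaRadius M u v₁ ^ (-4 : ℤ))) ∧
    -- compactly supported incoming radiation gives such exterior data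
    (∀ (M u₀ v₁ v₂ : ℝ), 0 ≤ M → (M = 0 → u₀ < v₁) → v₁ ≤ v₂ →
      ∀ (α : Field) (P : ℝ → SphereTensor 2), ArisesFromCompactRadiation M u₀ v₁ v₂ α P →
        ∃ E : ℕ → ℕ → SphereTensor 2, DescribesExterior M u₀ v₂ α E
          (fun ℓ x => (1 / 2 : ℝ) • ∫ v in v₁..v₂, angularMode ℓ (P v) x)) := by
  refine ⟨fun u₀ v₁ hd α E A h ℓ hℓ => ?_, fun ℓ p hℓ hp => coeffS_eq_zero_iff hℓ hp,
    fun u₀ v₁ hd ℓ p hℓ hp => exists_describesExterior hd hℓ hp,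
    fun M u₀ v₁ hM α E A h ℓ hℓ => h.exists_limit_schwarzschild hM hℓ,
    fun M u₀ v₁ v₂ hM hd hv α P h => h.describesExterior hM hd hv⟩
  obtain ⟨L, hL, hN⟩ := h.exists_limit_minkowski hd hℓ
  refine ⟨L, hL, hN, ?_⟩
  -- in the expansion with `N = ℓ + 1`, only the last coefficient does not vanish
  obtain ⟨C, hC⟩ := hN (ℓ + 1) (by omega)
  refine ⟨C, fun u hu x hx => ?_⟩
  have h1 := hC u hu x hx
  rw [Finset.sum_eq_single_of_mem (ℓ + 1) (Finset.mem_Icc.2 ⟨by omega, le_rfl⟩) fun p hp hne => by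
    rw [(coeffS_eq_zero_iff hℓ (Finset.mem_Icc.1 hp).1).2
      (by have := (Finset.mem_Icc.1 hp).2; omega), zero_mul, zero_smul],
    show -2 - ((ℓ + 1 : ℕ) : ℤ) = -3 - ℓ by push_cast; ring,
    show -3 - ((ℓ + 1 : ℕ) : ℤ) = -4 - ℓ by push_cast; ring] at h1
  exact_mod_cast h1
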